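/- **Conventions.** $(M,\Omega)$ is a connected (Hausdorff, second countable) symplectic two-manifold. A symplectic connection is a smooth torsion-free affine connection $\nabla$ with $\nabla\Omega=0$. Indices are raised and lowered by $X^i=\Omega^{ip}X_p$, $X_i=X^p\Omega_{pi}$, where $\Omega^{ip}\Omega_{pj}=-\delta_j{}^i$; parentheses denote complete symmetrization. The curvature is given by $2\nabla_{[i}\nabla_{j]}X^k=R_{ijp}{}^kX^p$, $R_{ijkl}=R_{ijk}{}^p\Omega_{pl}$, and $\mathrm{Ric}(\nabla)_{ij}=R_{ij}=R_{pij}{}^p$. Put $\rho(\nabla)_i=2\nabla^pR_{ip}$ and $K(\nabla)=\nabla^i\nabla^jR_{ij}-\tfrac12R^{ij}R_{ij}+\tfrac14R^{ijkl}R_{ijkl}$. For a function $f$ let $H_f^i=-df^i$ and $\mathcal H_\nabla(f)_{ijk}=(\mathcal L_{H_f}\nabla)_{ijk}$, where $(\mathcal L_X\nabla)_{ij}{}^k=\nabla_i\nabla_jX^k+X^pR_{pij}{}^k$. Let $\mathcal H_\nabla^*$ be the formal adjoint, $\int\mathcal H_\nabla(f)_{ijk}\alpha^{ijk}\,\Omega=\int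 f\,\mathcal H_\nabla^*(\alpha)\,\Omega$ for compactly supported $f$, and $\mathrm{Jac}_\nabla(\alpha)=\mathcal H_\nabla\mathcal H_\nabla^*(\alpha)+\mathcal L_{H_{K(\nabla)}}\alpha$ for completely symmetric cubic tensors $\alpha$. Let $(\delta_\nabla^*\alpha)_{i_1\dots i_{k+1}}=-\nabla_{(i_1}\alpha_{i_2\dots i_{k+1})}$. The connection $\nabla$ is *critical* if it is a critical point of $\int K(\nabla)^2\,\Omega$ with respect to compactly supported variations $\nabla+s\Pi_{ij}{}^k$, $\Pi_{ijk}=\Pi_{(ijk)}$, and *preferred* if $\nabla_{(i}R_{jk)}=0$. **Theorem.** Let $D$ be a symplectic connection on $(M,\Omega)$ whose Ricci tensor $S_{ij}$ is parallel, $D_iS_{jk}=0$, and let $Z_i$ be a smooth one-form with $D_{(i}Z_{j)}=0$. Put $\gamma=D_pZ^p$. Then $$\nu=\gamma^2+4Z^aZ^bS_{ab}$$ is constant. On the open set $\hat M=\{\gamma^2\neq\nu\}$ put $\Gamma_{ijk}=(\nu-\gamma^2)^{-1}Z_iZ_jZ_k$. For every $t\in\mathbb R$, $\nabla(t)=D+t\Gamma_{ij}{}^k$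 is a symplectic connection on $\hat M$, and on $\hat M$, with $R(t)=\mathrm{Ric}(\nabla(t))$, 1. $R(t)_{ij}=S_{ij}+t\gamma(\nu-\gamma^2)^{-1}Z_iZ_j$; 2. $-(\delta^*_{\nabla(t)}R(t))_{ijk}=\nabla(t)_{(i}R(t)_{jk)}=-4t\nu(\nu-\gamma^2)^{-2}Z_{(i}Z_jS_{k)p}Z^p$; 3. $\rho(\nabla(t))_i=\tfrac12t(\nu-3\gamma^2)(\nu-\gamma^2)^{-1}Z_i$; 4. $K(\nabla(t))=-\tfrac34t\gamma$; 5. with $K=K(\nabla(t))$ and $\rho=\rho(\nabla(t))$, the function $\tau=K^2+\rho^p\,dK_p$ is the constant $\tfrac{3t^2}{16}\nu$; 6. $\mathcal H_{\nabla(t)}(\gamma)=0$, and $\nabla(t)$ is critical; 7. if $t\neq0$ and $4\nu(\nu-\gamma^2)^{-2}Z_{(i}Z_jS_{k)p}Z^p$ is nonzero somewhere on $\hat M$, then $\nabla(t)$ is not preferred; 8. $\mathrm{Jac}_{\nabla(t)}(\Gamma)=0$. Moreover, let $S^2\subset\mathbb R^3$ be the round unit sphere with its area form (outward orientation), $D$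 its Levi-Civita connection, and $Z$ the one-form metrically dual to the rotation field $x\mapsto e_3\times x$. Then $D$ and $Z$ satisfy the hypotheses above, $\nu=4$, and $\hat M=S^2\setminus\{\pm e_3\}$. For $t\neq0$ the critical connection $\nabla(t)$ on $S^2\setminus\{\pm e_3\}$ is not preferred, $K(\nabla(t))$ is not identically zero, and the difference tensor $t\Gamma_{ijk}$ extends continuously to $S^2$, but no extension of it is differentiable at either pole $\pm e_3$. -/

import Mathlib

open scoped Manifold ContDiff Bundle Topology
open MeasureTheory

noncomputable section

namespace SympSurface

/-- The model space of a surface. -/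
abbrev Plane : Type := EuclideanSpace ℝ (Fin 2)

section General

variable {M : Type*} [TopologicalSpace M] [ChartedSpace Plane M]

variable (M) in
/-- Vector fields (arbitrary sections of the tangent bundle). -/
abbrev VField : Type _ := Π x : M, TangentSpace (𝓡 2) x

variable (M) in
/-- Operators of the type of an affine connection; `D Y x v` is `(∇_v Y)(x)`. -/
abbrev Conn : Type _ :=
  (Π x : M, TangentSpace (𝓡 2) x) →
    (Π x : M, TangentSpace (𝓡 2) x →L[ℝ] TangentSpace (𝓡 2) x)

variable (M) in
/-- Covariant `k`-tensor fields as functions of `k` tangent vectors. Multilinearity and smoothness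
are imposed by `IsSmoothTensor`. `T x ![u, v, w]` is `T_{ijk} u^i v^j w^k`. -/
abbrev Tensor (k : ℕ) : Type _ := (x : M) → (Fin k → TangentSpace (𝓡 2) x) → ℝ

variable [IsManifold (𝓡 2) ∞ M]

/-- Smooth vector fields on `M`. -/
def IsSmoothVField (X : VField M) : Prop :=
  ContMDiff (𝓡 2) ((𝓡 2).prod 𝓘(ℝ, Plane)) ∞ (fun x => (⟨x, X x⟩ : TangentBundle (𝓡 2) M))

/-- `T` is pointwise multilinear on `U`. -/
def IsTensor {k : ℕ} (U : Set M) (T : Tensor M k) : Prop :=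
  ∀ x ∈ U, ∃ f : MultilinearMap ℝ (fun _ : Fin k => TangentSpace (𝓡 2) x) ℝ, ∀ v, T x v = f v

/-- `T` is a smooth covariant tensor field on `U`: it is multilinear at the points of `U` and its
evaluation on smooth vector fields is smooth on `U`. -/
structure IsSmoothTensor {k : ℕ} (U : Set M) (T : Tensor M k) : Prop where
  multilinear : IsTensor U T
  smooth : ∀ X : Fin k → VField M, (∀ i, IsSmoothVField (X i)) →
    ContMDiffOn (𝓡 2) 𝓘(ℝ, ℝ) ∞ (fun x => T x (fun i => X i x)) U

/-- `T` is a continuous covariant tensor field on `M`. -/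
structure IsContinuousTensor {k : ℕ} (T : Tensor M k) : Prop where
  multilinear : IsTensor Set.univ T
  continuous : ∀ X : Fin k → VField M, (∀ i, IsSmoothVField (X i)) →
    Continuous (fun x => T x (fun i => X i x))

/-- The tensor field `T` is differentiable at the point `p`. -/
def TensorDifferentiableAt {k : ℕ} (T : Tensor M k) (p : M) : Prop :=
  ∀ X : Fin k → VField M, (∀ i, IsSmoothVField (X i)) →
    MDifferentiableAt (𝓡 2) 𝓘(ℝ, ℝ) (fun x => T x (fun i => X i x)) p

/-- `T` is completely symmetric on `U`. -/
def IsSymmetricTensor {k : ℕ} (U : Set M) (T : Tensor M k) : Prop :=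
  ∀ x ∈ U, ∀ v, ∀ s : Equiv.Perm (Fin k), T x (fun i => v (s i)) = T x v

/-- Complete symmetrization `T_{(i_1 … i_k)}`. -/
def symmetrize {k : ℕ} (T : Tensor M k) : Tensor M k := fun x v =>
  ((k.factorial : ℝ))⁻¹ * ∑ s : Equiv.Perm (Fin k), T x (fun i => v (s i))

/-! ### Symplectic forms and index conventions -/

/-- A symplectic form on a surface: a smooth nondegenerate alternating `2`-tensor.
(Closedness is automatic in dimension two.) -/
structure IsSymplecticForm (Om : Tensor M 2) : Prop where
  smooth : IsSmoothTensor Set.univ Om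
  alternating : ∀ x v, Om x ![v, v] = 0
  nondegenerate : ∀ x v, v ≠ 0 → ∃ w, Om x ![v, w] ≠ 0

/-- The frame of `T_x M` used to write traces and contractions as sums over indices. -/
def frame (x : M) (i : Fin 2) : TangentSpace (𝓡 2) x :=
  (EuclideanSpace.single i (1 : ℝ) : Plane)

/-- The `i`-th component of a tangent vector in `frame x`. -/
def coframe (x : M) (i : Fin 2) : TangentSpace (𝓡 2) x →L[ℝ] ℝ :=
  (EuclideanSpace.proj i : Plane →L[ℝ] ℝ)

/-- The dual bivector `Ω^{ij}`, normalized by `Ω^{ip} Ω_{pj} = -δ_j^i`. -/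
def bivector (Om : Tensor M 2) (x : M) : Matrix (Fin 2) (Fin 2) ℝ :=
  -(Matrix.of fun i j => Om x ![frame x i, frame x j])⁻¹

/-- Raising the index of a one-form: `α^i = Ω^{ip} α_p`. -/
def sharp (Om : Tensor M 2) (a : Tensor M 1) : VField M := fun x =>
  ∑ i, (∑ p, bivector Om x i p * a x ![frame x p]) • frame x i

/-- The complete contraction `α_{i_1 … i_k} β^{i_1 … i_k}`. -/
def contract (Om : Tensor M 2) {k : ℕ} (a b : Tensor M k) (x : M) : ℝ :=
  ∑ I : Fin k → Fin 2, ∑ J : Fin k → Fin 2,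
    (∏ r, bivector Om x (I r) (J r)) * a x (fun r => frame x (I r)) * b x (fun r => frame x (J r))

/-- The differential of a function. -/
def diffl (f : M → ℝ) : Tensor M 1 := fun x v => mvfderiv (𝓡 2) f x (v 0)

/-- The Hamiltonian vector field `H_f^i = -df^i`. -/
def ham (Om : Tensor M 2) (f : M → ℝ) : VField M := fun x => -sharp Om (diffl f) x

/-- A local vector field, smooth near `x`, with the value `v` at `x`. The tensorial expressions
below do not depend on its choice. -/
def extVec {x : M} (v : TangentSpace (𝓡 2) x) : VField M :=
  FiberBundle.extend Plane (E := fun y : M => TangentSpace (𝓡 2) y) v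

/-- The covariant derivative `∇_i T_{i_1 … i_k}` of a covariant tensor field; the index of
differentiation comes first. -/
def covD (D : Conn M) {k : ℕ} (T : Tensor M k) : Tensor M (k + 1) := fun x v =>
  mvfderiv (𝓡 2) (fun y => T y (fun i => extVec (v i.succ) y)) x (v 0)
    - ∑ i : Fin k, T x (Function.update (fun j => v j.succ) i (D (extVec (v i.succ)) x (v 0)))

/-- The Lie derivative `L_X T` of a covariant tensor field. -/
def lieD (X : VField M) {k : ℕ} (T : Tensor M k) : Tensor M k := fun x v =>
  mvfderiv (𝓡 2) (fun y => T y (fun i => extVec (v i) y)) x (X x)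
    - ∑ i : Fin k, T x (Function.update v i (VectorField.mlieBracket (𝓡 2) X (extVec (v i)) x))

/-- `D` is a (torsion-free, smooth) symplectic connection on `U`. -/
structure IsSymplecticConnection (Om : Tensor M 2) (D : Conn M) (U : Set M) : Prop where
  isCov : IsCovariantDerivativeOn Plane D U
  smooth : ContMDiffCovariantDerivativeOn Plane ∞ D U
  torsionFree : ∀ x ∈ U, ∀ X Y : VField M,
    MDifferentiableAt (𝓡 2) ((𝓡 2).prod 𝓘(ℝ, Plane))
      (fun y => (⟨y, X y⟩ : TangentBundle (𝓡 2) M)) x →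
    MDifferentiableAt (𝓡 2) ((𝓡 2).prod 𝓘(ℝ, Plane))
      (fun y => (⟨y, Y y⟩ : TangentBundle (𝓡 2) M)) x →
    D Y x (X x) - D X x (Y x) = VectorField.mlieBracket (𝓡 2) X Y x
  parallel : ∀ x ∈ U, ∀ v, covD D Om x v = 0

/-- The connection `D + Π_{ij}^k`, with `Π_{ij}^k = Ω^{kp} Π_{ijp}`:
`v^i Y^j Π_{ij}^k` is added to `∇_v Y`. -/
def addCubic (Om : Tensor M 2) (D : Conn M) (P : Tensor M 3) : Conn M := fun Y x =>
  D Y x + ∑ i : Fin 2, (coframe x i).smulRight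
    (∑ k, (∑ p, bivector Om x k p * P x ![frame x i, Y x, frame x p]) • frame x k)

/-! ### Curvature -/

/-- The curvature `R_{ijk}^l u^i v^j w^k`, where `2 ∇_{[i} ∇_{j]} X^k = R_{ijp}^k X^p`. -/
def curv (D : Conn M) (x : M) (u v w : TangentSpace (𝓡 2) x) : TangentSpace (𝓡 2) x :=
  D (fun y => D (extVec w) y (extVec v y)) x u - D (fun y => D (extVec w) y (extVec u y)) x v
    - D (extVec w) x (VectorField.mlieBracket (𝓡 2) (extVec u) (extVec v) x)

/-- The Ricci tensor `R_{ij} = R_{pij}^p`. -/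
def ric (D : Conn M) : Tensor M 2 := fun x v =>
  ∑ p, coframe x p (curv D x (frame x p) (v 0) (v 1))

/-- The covariant curvature tensor `R_{ijkl} = R_{ijk}^p Ω_{pl}`. -/
def riem (Om : Tensor M 2) (D : Conn M) : Tensor M 4 := fun x v =>
  Om x ![curv D x (v 0) (v 1) (v 2), v 3]

/-- The curvature one-form `ρ_i = 2 ∇^p R_{ip}`. -/
def rho (Om : Tensor M 2) (D : Conn M) : Tensor M 1 := fun x v =>
  2 * ∑ p, ∑ q, bivector Om x p q * covD D (ric D) x ![frame x q, v 0, frame x p]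

/-- The moment map
`K(∇) = ∇^i ∇^j R_{ij} - (1/2) R^{ij} R_{ij} + (1/4) R^{ijkl} R_{ijkl}`. -/
def moment (Om : Tensor M 2) (D : Conn M) (x : M) : ℝ :=
  (∑ i, ∑ j, ∑ p, ∑ q, bivector Om x i p * bivector Om x j q *
      covD D (covD D (ric D)) x ![frame x p, frame x q, frame x i, frame x j])
    - 1 / 2 * contract Om (ric D) (ric D) x
    + 1 / 4 * contract Om (riem Om D) (riem Om D) x

/-- The divergence `D_p X^p`. -/
def divergence (D : Conn M) (X : VField M) (x : M) : ℝ := ∑ p, coframe x p (D X x (frame x p))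

/-- The operator `(δ* α)_{i_1 … i_{k+1}} = -∇_{(i_1} α_{i_2 … i_{k+1})}`. -/
def deltaStar (D : Conn M) {k : ℕ} (a : Tensor M k) : Tensor M (k + 1) := fun x v =>
  -symmetrize (covD D a) x v

/-- `D` is preferred on `U`: `∇_{(i} R_{jk)} = 0`. -/
def IsPreferred (D : Conn M) (U : Set M) : Prop :=
  ∀ x ∈ U, ∀ v, symmetrize (covD D (ric D)) x v = 0

/-- The Lie derivative of a connection,
`(L_X ∇)_{ij}^k = ∇_i ∇_j X^k + X^p R_{pij}^k`, evaluated on `u^i v^j`. -/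
def lieConn (D : Conn M) (X : VField M) (x : M) (u v : TangentSpace (𝓡 2) x) :
    TangentSpace (𝓡 2) x :=
  D (fun y => D X y (extVec v y)) x u - D X x (D (extVec v) x u) + curv D x (X x) u v

/-- The operator `H(f)_{ijk} = (L_{H_f} ∇)_{ij}^p Ω_{pk}`. -/
def hop (Om : Tensor M 2) (D : Conn M) (f : M → ℝ) : Tensor M 3 := fun x v =>
  Om x ![lieConn D (ham Om f) x (v 0) (v 1), v 2]

/-! ### Integration, critical connections, the Jacobi operator -/

section Measure

variable [MeasurableSpace M]

/-- The measure on `M` given by the area form `Ω`: in every chart of the atlas it has the density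
`|Ω(∂₁, ∂₂)|` with respect to Lebesgue measure. These local measures agree on overlaps; their
supremum is the measure glued from them. -/
def area (Om : Tensor M 2) : Measure M :=
  ⨆ e ∈ atlas Plane M,
    Measure.map e.symm
      ((volume.withDensity fun y : Plane => ENNReal.ofReal
        |Om (e.symm y)
          ![mfderiv 𝓘(ℝ, Plane) (𝓡 2) e.symm y (EuclideanSpace.single 0 (1 : ℝ) : Plane),
            mfderiv 𝓘(ℝ, Plane) (𝓡 2) e.symm y (EuclideanSpace.single 1 (1 : ℝ) : Plane)]|).restrict
        e.target)

/-- `D` is critical on the open set `U` for the functional `E(∇) = ∫ K(∇)² Ω` with respect to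
compactly supported variations: for every smooth completely symmetric cubic tensor field `P` on `U`
vanishing outside a compact set `C ⊆ U`, the derivative at `s = 0` of the part over `C` of
`E(D + s P)` vanishes (the rest of the integral does not depend on `s`). -/
def IsCritical (Om : Tensor M 2) (D : Conn M) (U : Set M) : Prop :=
  ∀ (P : Tensor M 3) (C : Set M), IsSmoothTensor U P → IsSymmetricTensor U P →
    IsCompact C → C ⊆ U → (∀ x, x ∉ C → ∀ v, P x v = 0) →
    HasDerivAt
      (fun s : ℝ => ∫ x in C, (moment Om (addCubic Om D (fun y v => s * P y v)) x) ^ 2 ∂(area Om))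
      0 0

/-- `h = H*(a)` on the open set `U`, where `H*` is the formal adjoint of `H`: the function `h` is
smooth on `U` and `∫_U H(f)_{ijk} a^{ijk} Ω = ∫_U f h Ω` for all smooth functions `f` with compact
support in `U`. -/
def IsAdjointValue (Om : Tensor M 2) (D : Conn M) (U : Set M) (a : Tensor M 3) (h : M → ℝ) :
    Prop :=
  ContMDiffOn (𝓡 2) 𝓘(ℝ, ℝ) ∞ h U ∧
    ∀ f : M → ℝ, ContMDiff (𝓡 2) 𝓘(ℝ, ℝ) ∞ f → HasCompactSupport f → tsupport f ⊆ U →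
      ∫ x in U, contract Om (hop Om D f) a x ∂(area Om) = ∫ x in U, f x * h x ∂(area Om)

/-- `a` lies in the kernel of the Jacobi operator `J(a) = H H*(a) + L_{H_K} a` on `U`. (The value
`h = H*(a)` on `U` is unique.) -/
def IsJacobi (Om : Tensor M 2) (D : Conn M) (U : Set M) (a : Tensor M 3) : Prop :=
  ∃ h : M → ℝ, IsAdjointValue Om D U a h ∧
    ∀ x ∈ U, ∀ v, hop Om D h x v + lieD (ham Om (moment Om D)) a x v = 0

end Measure

/-! ### The family of connections -/

/-- `γ = D_p Z^p`. -/
def gam (Om : Tensor M 2) (D : Conn M) (Z : Tensor M 1) : M → ℝ := divergence D (sharp Om Z)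

/-- The set on which `γ² ≠ ν`. -/
def hatM (Om : Tensor M 2) (D : Conn M) (Z : Tensor M 1) (nu : ℝ) : Set M :=
  {x | gam Om D Z x ^ 2 ≠ nu}

/-- `Γ_{ijk} = (ν - γ²)⁻¹ Z_i Z_j Z_k`. -/
def Gam (Om : Tensor M 2) (D : Conn M) (Z : Tensor M 1) (nu : ℝ) : Tensor M 3 := fun x v =>
  (nu - gam Om D Z x ^ 2)⁻¹ * Z x ![v 0] * Z x ![v 1] * Z x ![v 2]

/-- `∇(t) = D + t Γ_{ij}^k`. -/
def nab (Om : Tensor M 2) (D : Conn M) (Z : Tensor M 1) (nu t : ℝ) : Conn M :=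
  addCubic Om D (fun x v => t * Gam Om D Z nu x v)

/-- `Z_{(i} Z_j R_{k)p} Z^p`, with `R` the Ricci tensor of `D`. -/
def cubicZR (Om : Tensor M 2) (D : Conn M) (Z : Tensor M 1) : Tensor M 3 :=
  symmetrize fun x v => Z x ![v 0] * Z x ![v 1] * ric D x ![v 2, sharp Om Z x]

end General

/-! ### The round sphere -/

/-- The ambient space of the sphere. -/
abbrev Space : Type := EuclideanSpace ℝ (Fin (2 + 1))

/-- The unit sphere. -/
abbrev S2 : Type := Metric.sphere (0 : Space) 1

/-- The image in the ambient space of a vector tangent to the sphere. -/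
def incl (x : S2) (v : TangentSpace (𝓡 2) x) : Space :=
  mvfderiv (𝓡 2) (Subtype.val : S2 → Space) x v

/-- The determinant of three vectors. -/
def det3 (u v w : Space) : ℝ := Matrix.det ![u.ofLp, v.ofLp, w.ofLp]

/-- The vector `e_3`. -/
def e3 : Space := EuclideanSpace.single 2 1

/-- The round metric. -/
def roundMetric : Tensor S2 2 := fun x v => inner ℝ (incl x (v 0)) (incl x (v 1))

/-- The area form of the round metric (with the outward orientation). -/
def roundArea : Tensor S2 2 := fun x v => det3 x (incl x (v 0)) (incl x (v 1))

/-- The one-form metrically dual to the rotation field `x ↦ e_3 × x`. -/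
def rotForm : Tensor S2 1 := fun x v => det3 e3 x (incl x (v 0))

/-- The two poles of the rotation axis. -/
def poles : Set S2 := {x | (x : Space) = e3 ∨ (x : Space) = -e3}

end SympSurface

end

open SympSurface

open scoped Manifold ContDiff Bundle Topology
open MeasureTheory

noncomputable section

namespace SympSurface

set_option linter.unusedSectionVars false

/-! Apart from one integration by parts, the statements about `∇(t)` are pointwise identities. In a
local frame with `Ω(e₀, e₁) = 1` a symplectic connection amounts to two derivations of the ring of
smooth functions together with trace-free coefficients, and torsion-freeness is the commutation rule
of the derivations. This is `FrameConn`. Curvature, `ρ`, `K` and `H` become differential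
polynomials, and the identities are checked over an arbitrary commutative ring carrying such data.
`frameConn` and the lemmas whose names end in `_frame` carry them back to tensor fields.

Put `g = γ/2`. The Killing equation says `D_i Z_j = g Ω_ij`. Commuting derivatives of `Z` gives
`dg_i = -S_ip Z^p`, and since `S` is parallel, `d(S(Z,Z))_i = 2g S_ip Z^p`. Hence `ν = 4g² +
4S(Z,Z)` is constant and `ν - γ² = 4S(Z,Z)`; write `w` for its inverse. Because `Z_p Z^p = 0`, the
part of the Ricci tensor quadratic in `Γ` vanishes, so `Ric` changes by `t D_p Γ_ij^p = 2tgw Z_i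
Z_j`. In dimension two the terms of `K` quadratic in the curvature cancel, so `2K = -∇_p ρ^p`, and
`ρ` and `K` follow from the derivatives of `g`, `w` and `Z`.

The Hamiltonian field of `γ` preserves `D`, `Z` and `γ`, hence `Γ` and every `∇(t)`. This is why
`H(γ) = 0` (`hop_g`) and why `Γ` has zero Lie derivative (`lie_gamma`).

The analytic input is a Green identity: `f δK - H(f)·Π` is half a divergence (`div_flux`), so the
first variation of `K` is `H*` (`integral_green`). Therefore the derivative of `∫K²` along `Π` is
`2∫H(K)·Π`, which vanishes because `K` is a constant multiple of `γ`. Since `K(∇ + sΠ)` is a cubic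
polynomial in `s`, nothing is differentiated under the integral sign. From `∇(t) + sΓ = ∇(t+s)` one
reads off `H*(Γ) = -(3/4)γ`, and both terms of the Jacobi operator vanish on `Γ`.

On the sphere `Ric` is the metric, `Z^♯` is minus the gradient of the height and `γ` is twice the
height. Near a pole `Γ` behaves like a cubic form divided by a quadratic one: it is homogeneous of
degree one but not linear, so it is continuous and not differentiable there. -/

section

/-! ### Calculus of a symplectic connection in a symplectic frame -/

/-- The data of a symplectic connection in a frame `e₀, e₁` with `Ω(e₀, e₁) = 1`, over a ring `A` of
functions: the derivations `d i` given by the frame and the coefficients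
`∇_{e i} (e j) = ∑ k, G i j k • e k`. -/
structure FrameConn (A : Type*) [CommRing A] [Algebra ℝ A] where
  d : Fin 2 → Derivation ℝ A A
  G : Fin 2 → Fin 2 → Fin 2 → A
  tr : ∀ i, G i 1 1 = -G i 0 0
  comm : ∀ f, d 1 (d 0 f) =
    d 0 (d 1 f) - (G 0 1 0 - G 1 0 0) * d 0 f - (G 0 1 1 - G 1 0 1) * d 1 f

namespace FrameConn

set_option linter.unusedSimpArgs false

variable {A : Type*} [CommRing A] [Algebra ℝ A] (C : FrameConn A)

/-- The covariant derivative of a vector field, `∇_i X^k`. -/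
def covV (X : Fin 2 → A) (i k : Fin 2) : A := C.d i (X k) + ∑ p, C.G i p k * X p

/-- The covariant derivative `∇_i T_j`. -/
def cov1 (T : Fin 2 → A) (i j : Fin 2) : A := C.d i (T j) - ∑ p, C.G i j p * T p

/-- The covariant derivative `∇_i T_{jk}`. -/
def cov2 (T : Fin 2 → Fin 2 → A) (i j k : Fin 2) : A :=
  C.d i (T j k) - ∑ p, C.G i j p * T p k - ∑ p, C.G i k p * T j p

/-- The covariant derivative `∇_i T_{jkl}`. -/
def cov3 (T : Fin 2 → Fin 2 → Fin 2 → A) (i j k l : Fin 2) : A :=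
  C.d i (T j k l) - ∑ p, C.G i j p * T p k l - ∑ p, C.G i k p * T j p l
    - ∑ p, C.G i l p * T j k p

/-- The curvature `R_{ijk}^l`. -/
def curv (i j k l : Fin 2) : A :=
  C.d i (C.G j k l) - C.d j (C.G i k l) + ∑ p, C.G j k p * C.G i p l - ∑ p, C.G i k p * C.G j p l
    - ∑ p, (C.G i j p - C.G j i p) * C.G p k l

/-- The Ricci tensor `R_{jk}`. -/
def ric (j k : Fin 2) : A := ∑ p, C.curv p j k p

/-- The components `X_l` of a vector `X^l`. -/
def lower (X : Fin 2 → A) : Fin 2 → A := ![-X 1, X 0]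

/-- The components `α^k` of a one-form `α_k`. -/
def raise (a : Fin 2 → A) : Fin 2 → A := ![a 1, -a 0]

/-- The covariant curvature tensor `R_{ijkl}`. -/
def riem (i j k l : Fin 2) : A := lower (fun p => C.curv i j k p) l

/-- The contraction `2 ∇^p T_{ip}` of a two-tensor. -/
def rhoOf (T : Fin 2 → Fin 2 → A) (i : Fin 2) : A := 2 * (C.cov2 T 1 i 0 - C.cov2 T 0 i 1)

/-- The divergence of a vector field. -/
def div (X : Fin 2 → A) : A := ∑ p, C.covV X p p

/-- The full contraction of two two-tensors. -/
def contr2 (a b : Fin 2 → Fin 2 → A) : A :=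
  a 0 0 * b 1 1 - a 0 1 * b 1 0 - a 1 0 * b 0 1 + a 1 1 * b 0 0

/-- The full contraction of two three-tensors. -/
def contr3 (a b : Fin 2 → Fin 2 → Fin 2 → A) : A :=
  contr2 (a 0) (b 1) - contr2 (a 1) (b 0)

/-- The full contraction of two four-tensors. -/
def contr4 (a b : Fin 2 → Fin 2 → Fin 2 → Fin 2 → A) : A :=
  contr3 (a 0) (b 1) - contr3 (a 1) (b 0)

/-- The double divergence `∇^i ∇^j T_{ij}`. -/
def divdiv (T : Fin 2 → Fin 2 → A) : A :=
  C.cov3 (C.cov2 T) 1 1 0 0 - C.cov3 (C.cov2 T) 1 0 0 1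
    - C.cov3 (C.cov2 T) 0 1 1 0 + C.cov3 (C.cov2 T) 0 0 1 1

/-- The Hamiltonian vector field of a function. -/
def ham (f : A) : Fin 2 → A := fun k => -raise (fun i => C.d i f) k

/-- The Lie derivative of the connection. -/
def lieConn (X : Fin 2 → A) (i j k : Fin 2) : A :=
  C.d i (C.covV X j k) - ∑ p, C.G i j p * C.covV X p k + ∑ p, C.G i p k * C.covV X j p
    + ∑ p, X p * C.curv p i j k

/-- The operator `H(f)_{ijk}`. -/
def hop (f : A) (i j k : Fin 2) : A := lower (fun p => C.lieConn (C.ham f) i j p) k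

/-- The Lie derivative of a three-tensor. -/
def lie3 (X : Fin 2 → A) (T : Fin 2 → Fin 2 → Fin 2 → A) (i j k : Fin 2) : A :=
  ∑ p, (X p * C.cov3 T p i j k + C.covV X i p * T p j k + C.covV X j p * T i p k
    + C.covV X k p * T i j p)

/-- The symmetric three-tensor with components `p 0, p 1, p 2, p 3`. -/
def sym3 (p : ℕ → A) (i j k : Fin 2) : A := p (i.val + j.val + k.val)

/-- The connection `∇ + Π_{ij}^k`. -/
def add (p : ℕ → A) : FrameConn A where
  d := C.d
  G i j k := C.G i j k + raise (fun l => sym3 p i j l) k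
  -- Complete symmetry of `Π_{ijk}` makes the trace `Π_{ik}^k` zero and leaves the torsion
  -- unchanged.
  tr i := by
    have := C.tr i
    fin_cases i <;> simp [sym3, raise] at * <;> rw [this] <;> ring
  comm f := by
    rw [C.comm]
    simp [sym3, raise]

@[simp] lemma add_d (p : ℕ → A) : (C.add p).d = C.d := rfl

lemma add_G (p : ℕ → A) (i j k : Fin 2) :
    (C.add p).G i j k = C.G i j k + raise (fun l => sym3 p i j l) k := rfl

@[simp] lemma raise_zero (a : Fin 2 → A) : raise a 0 = a 1 := rfl
@[simp] lemma raise_one (a : Fin 2 → A) : raise a 1 = -a 0 := rfl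
@[simp] lemma lower_zero (a : Fin 2 → A) : lower a 0 = -a 1 := rfl
@[simp] lemma lower_one (a : Fin 2 → A) : lower a 1 = a 0 := rfl

/-- The skew part of the Ricci tensor is the trace of the curvature endomorphism `R_{01}`, which
vanishes because the connection preserves `Ω`. -/
lemma ric_symm : C.ric 1 0 = C.ric 0 1 := by
  simp only [ric, curv, Fin.sum_univ_two, C.tr, map_neg]
  ring

/-- The curvature in terms of the Ricci tensor. -/
lemma curv_eq (i j k l : Fin 2) :
    C.curv i j k l = (if i = l then C.ric j k else 0) - if j = l then C.ric i k else 0 := by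
  -- Skewness in `i, j` on a two-dimensional frame leaves only the components `R_{01k}^l`, and these
  -- are Ricci components up to sign.
  fin_cases i <;> fin_cases j <;> fin_cases k <;> fin_cases l <;>
  · simp [ric, curv, Fin.sum_univ_two, C.tr]
    try ring

/-- The reason why `K` is a pure double divergence: its two quadratic terms cancel, since `-1/2 + 2
· 1/4 = 0`. -/
lemma curv_contr : contr4 C.riem C.riem = 2 * contr2 C.ric C.ric := by
  simp [contr4, contr3, contr2, riem, curv_eq]
  ring

/-- The double divergence is half the divergence of `2 ∇^p T_{ip}`. -/
lemma two_mul_divdiv (T : Fin 2 → Fin 2 → A) (hT : T 1 0 = T 0 1) :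
    2 * C.divdiv T = -C.div (raise (C.rhoOf T)) := by
  simp only [divdiv, div, rhoOf, covV, cov3, cov2, Fin.sum_univ_two, raise_zero, raise_one, C.tr,
    map_sub, map_neg, map_add, hT, Derivation.leibniz, smul_eq_mul, two_mul, C.comm]
  ring

/-- The correction is the trace `Π_{pi}^p`, which is zero: all symplectic connections share one
divergence, that of the area form. -/
lemma div_add (p : ℕ → A) (X : Fin 2 → A) : (C.add p).div X = C.div X := by
  simp only [div, covV, Fin.sum_univ_two, add_d, add_G, sym3, raise_zero, raise_one]
  norm_num
  ring

/-- The contraction `∇_p Π_{ij}^p`. -/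
def divOf (P : Fin 2 → Fin 2 → Fin 2 → A) (i j : Fin 2) : A := C.cov3 P 0 i j 1 - C.cov3 P 1 i j 0

lemma sym3_simps (p : ℕ → A) : sym3 p 0 0 0 = p 0 ∧ sym3 p 0 0 1 = p 1 ∧ sym3 p 0 1 0 = p 1 ∧
    sym3 p 1 0 0 = p 1 ∧ sym3 p 0 1 1 = p 2 ∧ sym3 p 1 0 1 = p 2 ∧ sym3 p 1 1 0 = p 2 ∧
    sym3 p 1 1 1 = p 3 := ⟨rfl, rfl, rfl, rfl, rfl, rfl, rfl, rfl⟩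

/-- The quadratic part of the variation of the Ricci tensor. -/
def quad (p : ℕ → A) (i j : Fin 2) : A :=
  -∑ a, ∑ b, raise (fun l => sym3 p a i l) b * raise (fun l => sym3 p b j l) a

/-- The variation of the Ricci tensor. -/
lemma ric_add (p : ℕ → A) (i j : Fin 2) :
    (C.add p).ric i j = C.ric i j + C.divOf (sym3 p) i j + quad p i j := by
  fin_cases i <;> fin_cases j <;>
  · simp only [Fin.zero_eta, Fin.mk_one, ric, curv, quad, divOf, cov3, add_d, add_G,
      Fin.sum_univ_two, raise_zero, raise_one, C.tr, map_add, map_neg, sym3_simps]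
    ring

/-- The term `-2 (Π^p_i^q T_{pq})` appearing in the variation of `2 ∇^p T_{ip}`. -/
def twist (p : ℕ → A) (T : Fin 2 → Fin 2 → A) (i : Fin 2) : A :=
  2 * ∑ a, (raise (fun l => sym3 p 0 i l) a * T a 1 - raise (fun l => sym3 p 1 i l) a * T a 0)

/-- Only the free index contributes. The correction on the contracted index pairs the symmetric `Π`
with the skew `Ω` and drops out. -/
lemma rhoOf_add (p : ℕ → A) (T : Fin 2 → Fin 2 → A) (i : Fin 2) :
    (C.add p).rhoOf T i = C.rhoOf T i + twist p T i := by
  fin_cases i <;>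
  · simp only [Fin.zero_eta, Fin.mk_one, rhoOf, cov2, twist, add_d, add_G,
      Fin.sum_univ_two, raise_zero, raise_one, sym3_simps]
    ring

/-- Twice the divergence `∇^i Θ_i`, where `Θ` is the first variation of `2 ∇^p R_{ip}` in the
direction `Π`; it is `-2` times the first variation of the moment map. -/
def momentVar (p : ℕ → A) : A :=
  C.div (raise (fun i => C.rhoOf (C.divOf (sym3 p)) i + twist p C.ric i))

/-- The flux in the Green identity for `H` and the first variation of the moment map. -/
def flux (f : A) (p : ℕ → A) (k : Fin 2) : A :=
  -f * raise (fun i => C.rhoOf (C.divOf (sym3 p)) i + twist p C.ric i) k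
    + 2 * ![C.divOf (sym3 p) 0 1 * C.d 1 f - C.divOf (sym3 p) 1 1 * C.d 0 f
        + contr2 (sym3 p 1) (C.cov1 fun i => C.d i f),
      C.divOf (sym3 p) 0 1 * C.d 0 f - C.divOf (sym3 p) 0 0 * C.d 1 f
        - contr2 (sym3 p 0) (C.cov1 fun i => C.d i f)] k

/-- The first variation of the moment map is the formal adjoint of `H`. -/
lemma div_flux (f : A) (p : ℕ → A) :
    C.div (C.flux f p) = -f * C.momentVar p - 2 * contr3 (C.hop f) (sym3 p) := by
  symm
  have hs := C.ric_symm
  unfold flux momentVar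
  have h2 (i : Fin 2) : C.d i (2 : A) = 0 := by exact_mod_cast (C.d i).map_natCast 2
  have hA : C.divOf (sym3 p) 1 0 = C.divOf (sym3 p) 0 1 := by
    simp only [divOf, cov3, Fin.sum_univ_two, sym3_simps]
    ring
  have e0 : C.divOf (sym3 p) 0 0 = C.cov3 (sym3 p) 0 0 0 1 - C.cov3 (sym3 p) 1 0 0 0 := rfl
  have e1 : C.divOf (sym3 p) 0 1 = C.cov3 (sym3 p) 0 0 1 1 - C.cov3 (sym3 p) 1 0 1 0 := rfl
  have e2 : C.divOf (sym3 p) 1 1 = C.cov3 (sym3 p) 0 1 1 1 - C.cov3 (sym3 p) 1 1 1 0 := rfl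
  generalize C.divOf (sym3 p) = B at *
  -- `H(f)` is minus the covariant derivative of the Hessian of `f` plus a curvature term. Only the
  -- Hessian `F` and `df` are then visible.
  have hf : C.hop f = fun i j k => -C.cov2 (C.cov1 fun i => C.d i f) i j k
      + lower (fun k => ∑ q, C.ham f q * C.curv q i j k) k := by
    funext i j k
    fin_cases k <;>
    · simp only [Fin.zero_eta, Fin.mk_one, hop, lieConn, cov2, cov1, covV, ham, raise_zero,
        raise_one, lower_zero, lower_one, map_add, map_neg, map_sub, Fin.sum_univ_two, neg_neg,
        Derivation.leibniz, smul_eq_mul, C.tr]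
      ring
  have hF : C.cov1 (fun i => C.d i f) 1 0 = C.cov1 (fun i => C.d i f) 0 1 := by
    simp only [cov1, Fin.sum_univ_two, C.comm, C.tr]
    ring
  -- Second derivatives are traded for the Hessian, so that `F` and the divergence `B` of `Π` can be
  -- treated as opaque symmetric two-tensors and the final identity stays small.
  have f0 (i : Fin 2) : C.d i (C.d 0 f) = C.cov1 (fun i => C.d i f) i 0 +
      C.G i 0 0 * C.d 0 f + C.G i 0 1 * C.d 1 f := by simp [cov1]; ring
  have f1 (i : Fin 2) : C.d i (C.d 1 f) = C.cov1 (fun i => C.d i f) i 1 +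
      C.G i 1 0 * C.d 0 f - C.G i 0 0 * C.d 1 f := by simp [cov1, C.tr]; ring
  rw [hf]
  generalize C.cov1 (fun i => C.d i f) = F at *
  simp only [div, covV, contr3, contr2, cov2, Fin.sum_univ_two, raise_zero, raise_one, map_add,
    map_neg, map_sub, Derivation.leibniz, smul_eq_mul, h2, sym3_simps, ham, lower_zero, lower_one,
    curv_eq, twist, rhoOf, C.tr, hs, hF, hA, f0, f1, Matrix.cons_val_zero, Matrix.cons_val_one]
  simp only [cov3, sym3_simps, Fin.sum_univ_two, C.tr] at e0 e1 e2
  simp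
  -- What remains is twice the full contraction of `F` with the definition of `B`; the mixed
  -- component occurs twice in it.
  linear_combination 2 * F 0 0 * e2 - 4 * F 0 1 * e1 + 2 * F 1 1 * e0

/-! ### Killing fields and parallel Ricci tensor -/

section Killing

variable {z : Fin 2 → A} {g w t : A}

/-- The contraction `S_{ip} Z^p`. -/
def sz (z : Fin 2 → A) (i : Fin 2) : A := C.ric i 0 * z 1 - C.ric i 1 * z 0

/-- The contraction `S_{ij} Z^i Z^j`. -/
def szz (z : Fin 2 → A) : A := C.sz z 0 * z 1 - C.sz z 1 * z 0

/-- Derivatives of the components of a Killing one-form with `∇_0 Z_1 = g`, for a connection with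
parallel Ricci tensor. -/
structure IsKilling (z : Fin 2 → A) (g : A) : Prop where
  d00 : C.d 0 (z 0) = C.G 0 0 0 * z 0 + C.G 0 0 1 * z 1
  d01 : C.d 0 (z 1) = C.G 0 1 0 * z 0 - C.G 0 0 0 * z 1 + g
  d10 : C.d 1 (z 0) = C.G 1 0 0 * z 0 + C.G 1 0 1 * z 1 - g
  d11 : C.d 1 (z 1) = C.G 1 1 0 * z 0 - C.G 1 0 0 * z 1
  par : ∀ i j k, C.d i (C.ric j k) =
    ∑ p, C.G i j p * C.ric p k + ∑ p, C.G i k p * C.ric j p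

namespace IsKilling

variable {C}

/-- Integrability condition of the Killing equation: the commutator of `d 0` and `d 1` on `z 0`
gives `d 0 g`, on `z 1` it gives `d 1 g`, and the terms without derivatives of `g` assemble into
curvature. -/
lemma d_g (h : C.IsKilling z g) (i : Fin 2) : C.d i g = -C.sz z i := by
  have h0 := C.comm (z 0)
  have h1 := C.comm (z 1)
  simp only [h.d00, h.d01, h.d10, h.d11, map_add, map_sub, Derivation.leibniz, smul_eq_mul,
    C.tr] at h0 h1
  fin_cases i
  · simp only [Fin.zero_eta, sz, ric, curv, Fin.sum_univ_two, C.tr, map_neg]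
    linear_combination h0
  · simp only [Fin.mk_one, sz, ric, curv, Fin.sum_univ_two, C.tr, map_neg]
    linear_combination h1

/-- As `S` is parallel only the two factors `Z` are differentiated, and `D_i Z^p` is `g` times the
identity. -/
lemma d_szz (h : C.IsKilling z g) (i : Fin 2) : C.d i (C.szz z) = 2 * g * C.sz z i := by
  have hs := C.ric_symm
  fin_cases i <;>
  · simp only [Fin.zero_eta, Fin.mk_one, szz, sz, map_sub, Derivation.leibniz, smul_eq_mul, h.d00,
      h.d01, h.d10, h.d11, h.par, Fin.sum_univ_two, C.tr, hs]
    ring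

/-- With `γ = 2g` this is the constancy of `ν`: the contributions `-8g S_ip Z^p` and `8g S_ip Z^p`
cancel. -/
lemma d_nu (h : C.IsKilling z g) (i : Fin 2) : C.d i (4 * g ^ 2 + 4 * C.szz z) = 0 := by
  have h4 : C.d i (4 : A) = 0 := by exact_mod_cast (C.d i).map_natCast 4
  simp only [map_add, Derivation.leibniz, Derivation.leibniz_pow, h.d_g, h.d_szz, h4, smul_eq_mul,
    nsmul_eq_mul]
  push_cast
  ring

lemma d_w (h : C.IsKilling z g) (hw : w * (4 * C.szz z) = 1) (i : Fin 2) :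
    C.d i w = -8 * w ^ 2 * g * C.sz z i := by
  have h4 : C.d i (4 : A) = 0 := by exact_mod_cast (C.d i).map_natCast 4
  have h1 := congrArg (C.d i) hw
  simp only [h4, Derivation.leibniz, h.d_szz, smul_eq_mul, Derivation.map_one_eq_zero] at h1
  -- The inverse is known only through the equation `hw`; its derivative is multiplied by `w` to
  -- isolate `d w`.
  linear_combination w * h1 - C.d i w * hw

end IsKilling

/-- The components of `t Γ_{ijk}`. -/
def gamma (z : Fin 2 → A) (w t : A) (n : ℕ) : A := t * w * z 0 ^ (3 - n) * z 1 ^ n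

lemma gamma_simps : gamma z w t 0 = t * w * z 0 ^ 3 ∧ gamma z w t 1 = t * w * z 0 ^ 2 * z 1 ∧
    gamma z w t 2 = t * w * z 0 * z 1 ^ 2 ∧ gamma z w t 3 = t * w * z 1 ^ 3 := by
  simp [gamma]

/-- Every summand contains the contraction `Z_p Z^p = 0`. Hence the Ricci tensor is affine in `t`.
-/
lemma quad_gamma (i j : Fin 2) : quad (gamma z w t) i j = 0 := by
  fin_cases i <;> fin_cases j <;>
  · simp only [Fin.zero_eta, Fin.mk_one, quad, Fin.sum_univ_two, raise_zero, raise_one, sym3_simps,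
      gamma_simps]
    ring

namespace IsKilling

variable {C}

/-- In `D_p(w Z_i Z_j Z^p)` the divergence of `Z` contributes `2g`, each of the factors `Z_i` and
`Z_j` contributes `g`, and `dw(Z) = -8w²g S(Z,Z) = -2gw` by `hw`. The total is `2g`. -/
lemma divOf_gamma (h : C.IsKilling z g) (hw : w * (4 * C.szz z) = 1)
    (ht : ∀ i, C.d i t = 0) (i j : Fin 2) :
    C.divOf (sym3 (gamma z w t)) i j = 2 * t * g * w * z i * z j := by
  have hs := C.ric_symm
  fin_cases i <;> fin_cases j <;>
  · simp only [Fin.zero_eta, Fin.mk_one, divOf, cov3, sym3_simps, gamma_simps, Derivation.leibniz,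
      Derivation.leibniz_pow, h.d_w hw, ht, h.d00, h.d01, h.d10, h.d11, smul_eq_mul, nsmul_eq_mul,
      Fin.sum_univ_two, C.tr, sz, hs]
    simp only [szz, sz, hs] at hw
    push_cast
    first
    | linear_combination -2 * t * g * w * z 0 * z 0 * hw
    | linear_combination -2 * t * g * w * z 0 * z 1 * hw
    | linear_combination -2 * t * g * w * z 1 * z 1 * hw

lemma ric_add_gamma (h : C.IsKilling z g) (hw : w * (4 * C.szz z) = 1)
    (ht : ∀ i, C.d i t = 0) (i j : Fin 2) :
    (C.add (gamma z w t)).ric i j = C.ric i j + 2 * t * g * w * z i * z j := by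
  rw [ric_add, quad_gamma, h.divOf_gamma hw ht, add_zero]

/-- The covariant derivative of the Ricci tensor of `∇ + t Γ`. -/
lemma cov_ric (h : C.IsKilling z g) (hw : w * (4 * C.szz z) = 1)
    (ht : ∀ i, C.d i t = 0) (i j k : Fin 2) :
    (C.add (gamma z w t)).cov2 (C.add (gamma z w t)).ric i j k =
      -2 * t * w * C.sz z i * z j * z k - 16 * t * g ^ 2 * w ^ 2 * C.sz z i * z j * z k
      + 2 * t * g ^ 2 * w * ((![![0, 1], ![-1, 0]] i j) * z k + (![![0, 1], ![-1, 0]] i k) * z j)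
      - t * w * z i * (z j * C.sz z k + z k * C.sz z j) := by
  have h2 (i : Fin 2) : C.d i (2 : A) = 0 := by exact_mod_cast (C.d i).map_natCast 2
  have hs := C.ric_symm
  have hr : (C.add (gamma z w t)).ric = fun i j => C.ric i j + 2 * t * g * w * z i * z j := by
    funext i j; exact h.ric_add_gamma hw ht i j
  rw [hr]
  -- The four groups of terms come from `dg`, from `dw`, from `D_i Z_j = g Ω_ij` (the constant
  -- matrix is `Ω`) and from the action of `Γ` on `S`. On `Z_j Z_k` the tensor `Γ` acts by zero
  -- because `Z_p Z^p = 0`.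
  fin_cases i <;> fin_cases j <;> fin_cases k <;>
  · simp only [Fin.zero_eta, Fin.mk_one, cov2, add_d, add_G, Fin.sum_univ_two, raise_zero,
      raise_one, sym3_simps, gamma_simps, map_add, h.par, Derivation.leibniz, h2, ht, h.d_g,
      h.d_w hw, h.d00, h.d01, h.d10, h.d11, smul_eq_mul, C.tr, hs, sz]
    simp
    ring

lemma rhoOf_ric (h : C.IsKilling z g) (hw : w * (4 * C.szz z) = 1)
    (ht : ∀ i, C.d i t = 0) (i : Fin 2) :
    (C.add (gamma z w t)).rhoOf (C.add (gamma z w t)).ric i =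
      2 * t * (C.szz z - 2 * g ^ 2) * w * z i := by
  rw [rhoOf, h.cov_ric hw ht, h.cov_ric hw ht]
  fin_cases i <;>
  · simp [szz] at hw ⊢
    first
    | linear_combination 8 * t * g ^ 2 * w * z 0 * hw
    | linear_combination 8 * t * g ^ 2 * w * z 1 * hw

lemma divdiv_ric (h : C.IsKilling z g) (hw : w * (4 * C.szz z) = 1)
    (ht : ∀ i, C.d i t = 0) :
    2 * (C.add (gamma z w t)).divdiv (C.add (gamma z w t)).ric = -3 * t * g := by
  have h2 (i : Fin 2) : C.d i (2 : A) = 0 := by exact_mod_cast (C.d i).map_natCast 2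
  rw [two_mul_divdiv _ _ (ric_symm _), div_add]
  have hr : (C.add (gamma z w t)).rhoOf (C.add (gamma z w t)).ric =
      fun i => 2 * t * (C.szz z - 2 * g ^ 2) * w * z i := by
    funext i; exact h.rhoOf_ric hw ht i
  rw [hr]
  simp only [div, covV, Fin.sum_univ_two, raise_zero, raise_one, map_neg, map_sub,
    Derivation.leibniz, Derivation.leibniz_pow, h2, ht, h.d_g, h.d_szz,
      h.d_w hw, h.d00, h.d01, h.d10, h.d11, smul_eq_mul, C.tr, nsmul_eq_mul]
  simp only [szz] at hw ⊢
  push_cast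
  -- With `φ = 2t(S(Z,Z) - 2g²)w` the divergence is `dφ(Z) + 2gφ`. It contains `(w S(Z,Z))²`, so
  -- `hw` is needed with a multiplier that itself involves `w S(Z,Z)`.
  linear_combination (t * g * (4 * w * (C.sz z 0 * z 1 - C.sz z 1 * z 0) - 3)
    - 8 * t * g ^ 3 * w) * hw

set_option maxHeartbeats 1000000 in
-- Geometrically, the Hamiltonian field of `g` preserves `D` (the case `t = 0`) as well as `Γ`,
-- hence also `D + tΓ`. The proof verifies this in components.
lemma hop_g (h : C.IsKilling z g) (hw : w * (4 * C.szz z) = 1)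
    (ht : ∀ i, C.d i t = 0) (i j k : Fin 2) :
    (C.add (gamma z w t)).hop g i j k = 0 := by
  have hs := C.ric_symm
  -- After expansion the component of `H(g)` is exactly this multiple of the relation `hw`.
  have e : 2 * t * g * w * C.sz z i * z j * z k * (w * (4 * C.szz z) - 1) = 0 := by
    rw [hw]; ring
  fin_cases i <;> fin_cases j <;> fin_cases k <;>
  · simp only [szz, sz, hs, Fin.zero_eta, Fin.mk_one] at e
    simp only [Fin.zero_eta, Fin.mk_one, hop, lieConn, covV, ham, curv_eq, add_d, add_G,
      h.ric_add_gamma hw ht, Fin.sum_univ_two, raise_zero, raise_one, lower_zero, lower_one,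
      sym3_simps, gamma_simps, map_add, map_neg, map_sub, h.par, Derivation.leibniz,
      Derivation.leibniz_pow, ht, h.d_g, h.d_w hw, h.d00, h.d01, h.d10, h.d11, smul_eq_mul,
      C.tr, hs, sz, nsmul_eq_mul]
    simp
    linear_combination e

/-- Symmetrization kills the terms with `Ω`. The others combine to the factor `-4tw - 16tg²w²`,
which equals `-4tνw²` because `w = 4w² S(Z,Z)`. -/
lemma symm_cov_ric (h : C.IsKilling z g) (hw : w * (4 * C.szz z) = 1)
    (ht : ∀ i, C.d i t = 0) (i j k : Fin 2) :
    letI T := (C.add (gamma z w t)).cov2 (C.add (gamma z w t)).ric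
    T i j k + T i k j + T j i k + T j k i + T k i j + T k j i =
      -4 * t * (4 * g ^ 2 + 4 * C.szz z) * w ^ 2 * (z i * z j * C.sz z k + z i * z k * C.sz z j
        + z j * z i * C.sz z k + z j * z k * C.sz z i + z k * z i * C.sz z j
        + z k * z j * C.sz z i) := by
  simp only [h.cov_ric hw ht]
  have e : 4 * t * w * (2 * z j * z k * C.sz z i + 2 * z i * z k * C.sz z j
      + 2 * z i * z j * C.sz z k) * (w * (4 * C.szz z) - 1) = 0 := by
    rw [hw]; ring
  have ha (i j : Fin 2) : (![![0, 1], ![-1, 0]] : Fin 2 → Fin 2 → A) j i =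
      -(![![0, 1], ![-1, 0]] : Fin 2 → Fin 2 → A) i j := by
    fin_cases i <;> fin_cases j <;> simp
  rw [ha i j, ha i k, ha j k]
  linear_combination e

/-- The Hamiltonian field of `g` preserves `Γ`. -/
lemma lie_gamma (h : C.IsKilling z g) (hw : w * (4 * C.szz z) = 1) {c : A}
    (ht : ∀ i, C.d i t = 0) (hc : ∀ i, C.d i c = 0) (i j k : Fin 2) :
    C.lie3 (C.ham (c * g)) (sym3 (gamma z w t)) i j k = 0 := by
  -- For `X = H_g` one has `X g = 0`, hence `X w = 0`. Moreover `L_X Z = ι_X dZ + d(Z(X)) = 0`,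
  -- since `dS(Z,Z) = -2g dg` balances `dZ = 2gΩ`.
  have hs := C.ric_symm
  fin_cases i <;> fin_cases j <;> fin_cases k <;>
  · simp only [Fin.zero_eta, Fin.mk_one, lie3, cov3, covV, ham,
      Fin.sum_univ_two, raise_zero, raise_one,
      sym3_simps, gamma_simps, map_add, map_neg, map_sub, map_zero, h.par, Derivation.leibniz,
      Derivation.leibniz_pow, ht, hc, h.d_g, h.d_w hw, h.d00, h.d01, h.d10, h.d11, smul_eq_mul,
      C.tr, hs, sz, nsmul_eq_mul]
    push_cast
    ring

end IsKilling
end Killing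

end FrameConn

end

/-! ### Derivatives along vector fields and the Lie bracket as a commutator. -/

section

variable {M : Type*} [TopologicalSpace M] [ChartedSpace Plane M] [IsManifold (𝓡 2) ∞ M]

/-- `X` is smooth on `V`. -/
abbrev SmoothVF (X : VField M) (V : Set M) : Prop :=
  ContMDiffOn (𝓡 2) ((𝓡 2).prod 𝓘(ℝ, Plane)) ∞ (fun x => (⟨x, X x⟩ : TangentBundle (𝓡 2) M)) V

/-- `f` is smooth on `V`. -/
abbrev SmoothFn (f : M → ℝ) (V : Set M) : Prop := ContMDiffOn (𝓡 2) 𝓘(ℝ, ℝ) ∞ f V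

lemma smooth_mvfderiv {F : Type*} [NormedAddCommGroup F] [NormedSpace ℝ F] {f : M → F}
    {X : VField M} {V : Set M} (hV : IsOpen V)
    (hf : ContMDiffOn (𝓡 2) 𝓘(ℝ, F) ∞ f V) (hX : SmoothVF X V) :
    ContMDiffOn (𝓡 2) 𝓘(ℝ, F) ∞ (fun y => mvfderiv (𝓡 2) f y (X y)) V := by
  have h1 := hf.contMDiffOn_tangentMapWithin (m := ∞) (by simp) hV.uniqueMDiffOn
  have h2 := h1.comp hX (fun y hy => hy)
  have h3 := (contMDiff_snd_tangentBundle_modelSpace F 𝓘(ℝ, F) (n := ∞)).comp_contMDiffOn h2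
  refine h3.congr fun y hy => ?_
  change _ = mfderivWithin (𝓡 2) 𝓘(ℝ, F) f V y (X y)
  rw [mfderivWithin_of_mem_nhds (hV.mem_nhds hy)]
  rfl

/-- In the chart at `x` all fields are pulled back to the plane, where the formula is the symmetry
of the second derivative. The target is a general normed space because the inclusion of the sphere
is used later. -/
lemma mvfderiv_mlieBracket {F : Type*} [NormedAddCommGroup F] [NormedSpace ℝ F] {f : M → F}
    {X Y : VField M} {V : Set M} (hV : IsOpen V)
    (hf : ContMDiffOn (𝓡 2) 𝓘(ℝ, F) ∞ f V) (hX : SmoothVF X V) (hY : SmoothVF Y V)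
    {x : M} (hx : x ∈ V) :
    mvfderiv (𝓡 2) f x (VectorField.mlieBracket (𝓡 2) X Y x) =
      mvfderiv (𝓡 2) (fun y => mvfderiv (𝓡 2) f y (Y y)) x (X x)
        - mvfderiv (𝓡 2) (fun y => mvfderiv (𝓡 2) f y (X y)) x (Y x) := by
  have hVx := hV.mem_nhds hx
  have h2 : IsManifold (𝓡 2) 1 M := IsManifold.of_le (n := ∞) (by simp)
  set φ := extChartAt (𝓡 2) x with hφ
  have hr : Set.range (𝓡 2) = Set.univ := (𝓡 2).range_eq_univ
  have hsymm : ∀ z ∈ φ.target, MDifferentiableAt 𝓘(ℝ, Plane) (𝓡 2) φ.symm z := fun z hz => by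
    have := mdifferentiableWithinAt_extChartAt_symm (I := 𝓡 2) hz
    rwa [hr, mdifferentiableWithinAt_univ] at this
  have hinv : ∀ z ∈ φ.target, (mfderiv 𝓘(ℝ, Plane) (𝓡 2) φ.symm z).IsInvertible := fun z hz => by
    have := isInvertible_mfderivWithin_extChartAt_symm (I := 𝓡 2) hz
    rwa [hr, mfderivWithin_univ] at this
  have ht : IsOpen φ.target := isOpen_extChartAt_target x
  have hxt : φ x ∈ φ.target := mem_extChartAt_target x
  have hxx : φ.symm (φ x) = x := extChartAt_to_inv x
  have hloc : ∀ᶠ z in 𝓝 (φ x), z ∈ φ.target ∧ φ.symm z ∈ V := by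
    refine (ht.eventually_mem hxt).and ?_
    have : ContinuousAt φ.symm (φ x) := continuousAt_extChartAt_symm x
    refine this.eventually_mem ?_
    rw [hxx]; exact hVx
  have hpush (g : M → F) (Z : VField M) (hg : ContMDiffOn (𝓡 2) 𝓘(ℝ, F) ∞ g V) :
      ∀ z, z ∈ φ.target ∧ φ.symm z ∈ V →
      mvfderiv (𝓡 2) g (φ.symm z) (Z (φ.symm z)) = fderiv ℝ (g ∘ φ.symm) z
        (VectorField.mpullbackWithin 𝓘(ℝ, Plane) (𝓡 2) φ.symm Z (Set.range (𝓡 2)) z) := by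
    rintro z ⟨hz, hzV⟩
    have hgd : MDifferentiableAt (𝓡 2) 𝓘(ℝ, F) g (φ.symm z) :=
      (hg.contMDiffAt (hV.mem_nhds hzV)).mdifferentiableAt (by simp)
    rw [← mfderiv_eq_fderiv, mfderiv_comp z hgd (hsymm z hz), hr,
      VectorField.mpullbackWithin_univ, VectorField.mpullback_apply]
    have := (hinv z hz).self_apply_inverse (Z (φ.symm z))
    change _ = mfderiv (𝓡 2) 𝓘(ℝ, F) g (φ.symm z) (mfderiv 𝓘(ℝ, Plane) (𝓡 2) φ.symm z
      ((mfderiv 𝓘(ℝ, Plane) (𝓡 2) φ.symm z).inverse (Z (φ.symm z))))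
    rw [this]
    rfl
  have hd (g : M → F) (Z : VField M) (hg : ContMDiffOn (𝓡 2) 𝓘(ℝ, F) ∞ g V) :
      mvfderiv (𝓡 2) g x (Z x) = fderiv ℝ (g ∘ φ.symm) (φ x)
        (VectorField.mpullbackWithin 𝓘(ℝ, Plane) (𝓡 2) φ.symm Z (Set.range (𝓡 2)) (φ x)) := by
    have := hpush g Z hg (φ x) ⟨hxt, by rwa [hxx]⟩
    rwa [hxx] at this
  have hfs (Z : VField M) : (fun y => mvfderiv (𝓡 2) f y (Z y)) ∘ φ.symm =ᶠ[𝓝 (φ x)]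
      fun z => fderiv ℝ (f ∘ φ.symm) z
        (VectorField.mpullbackWithin 𝓘(ℝ, Plane) (𝓡 2) φ.symm Z (Set.range (𝓡 2)) z) :=
    hloc.mono fun z hz => hpush f Z hf z hz
  have hfc : ContDiffAt ℝ ∞ (f ∘ φ.symm) (φ x) := by
    rw [← contMDiffAt_iff_contDiffAt]
    have h3 : ContMDiffAt (𝓡 2) 𝓘(ℝ, F) ∞ f (φ.symm (φ x)) := by
      rw [hxx]; exact hf.contMDiffAt hVx
    refine h3.comp (φ x) ?_
    have := contMDiffOn_extChartAt_symm (I := 𝓡 2) (n := ∞) x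
    exact this.contMDiffAt (ht.mem_nhds hxt)
  have hVF (Z : VField M) (hZ : SmoothVF Z V) : DifferentiableAt ℝ
      (VectorField.mpullbackWithin 𝓘(ℝ, Plane) (𝓡 2) φ.symm Z (Set.range (𝓡 2))) (φ x) := by
    have h4 : MDifferentiableWithinAt (𝓡 2) ((𝓡 2).prod 𝓘(ℝ, Plane))
        (fun x => (⟨x, Z x⟩ : TangentBundle (𝓡 2) M)) Set.univ x :=
      ((hZ.contMDiffAt hVx).mdifferentiableAt (by simp)).mdifferentiableWithinAt
    have := h4.differentiableWithinAt_mpullbackWithin_vectorField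
    rw [Set.preimage_univ, Set.univ_inter, hr] at this
    rw [hr]
    exact differentiableWithinAt_univ.mp this
  have hfd : MDifferentiableAt 𝓘(ℝ, Plane) 𝓘(ℝ, F) (f ∘ φ.symm) (φ x) :=
    (hfc.differentiableAt (by simp)).mdifferentiableAt
  have hφd : MDifferentiableAt (𝓡 2) 𝓘(ℝ, Plane) φ x :=
    mdifferentiableAt_extChartAt (mem_chart_source _ x)
  have hfe : f =ᶠ[𝓝 x] (f ∘ φ.symm) ∘ φ := by
    filter_upwards [extChartAt_source_mem_nhds (I := 𝓡 2) x] with y hy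
    simp only [Function.comp_apply]
    rw [φ.left_inv hy]
  have hpull (u : Plane) : mvfderiv (𝓡 2) f x ((mfderiv (𝓡 2) 𝓘(ℝ, Plane) φ x).inverse u) =
      fderiv ℝ (f ∘ φ.symm) (φ x) u := by
    change mfderiv (𝓡 2) 𝓘(ℝ, F) f x _ = _
    rw [hfe.mfderiv_eq, mfderiv_comp x hfd hφd, ← mfderiv_eq_fderiv]
    have := (isInvertible_mfderiv_extChartAt (I := 𝓡 2)
      (mem_extChartAt_source x)).self_apply_inverse u
    change mfderiv 𝓘(ℝ, Plane) 𝓘(ℝ, F) (f ∘ φ.symm) (φ x) (mfderiv (𝓡 2) 𝓘(ℝ, Plane) φ x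
      ((mfderiv (𝓡 2) 𝓘(ℝ, Plane) φ x).inverse u)) = _
    rw [this]
    rfl
  rw [hd _ X (smooth_mvfderiv hV hf hY), hd _ Y (smooth_mvfderiv hV hf hX),
    (hfs Y).fderiv_eq, (hfs X).fderiv_eq,
    ← VectorField.fderiv_apply_lieBracket (hfc.of_le (m := 2) (by exact WithTop.coe_le_coe.mpr (le_top : (2 : ℕ∞) ≤ ⊤)))
      (by simp) (hVF Y hY) (hVF X hX),
    VectorField.mlieBracket, VectorField.mlieBracketWithin_apply, hpull, Set.preimage_univ,
    Set.univ_inter, hr]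
  exact congrArg _ (congrFun (VectorField.lieBracketWithin_univ (𝕜 := ℝ)) _)

end

/-! ### Germs of smooth functions and fields, and tensoriality. -/

section

variable {M : Type*} [TopologicalSpace M] [ChartedSpace Plane M] [IsManifold (𝓡 2) ∞ M]

/-- `X` is smooth near `x`. -/
def SmoothVFAt (X : VField M) (x : M) : Prop :=
  ∀ᶠ y in 𝓝 x, ContMDiffAt (𝓡 2) ((𝓡 2).prod 𝓘(ℝ, Plane)) ∞
    (fun z => (⟨z, X z⟩ : TangentBundle (𝓡 2) M)) y

/-- `f` is smooth near `x`. -/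
def SmoothFnAt (f : M → ℝ) (x : M) : Prop :=
  ∀ᶠ y in 𝓝 x, ContMDiffAt (𝓡 2) 𝓘(ℝ, ℝ) ∞ f y

section closure

variable {X Y : VField M} {f g : M → ℝ} {x : M} {V : Set M}

lemma SmoothVF.at (hX : SmoothVF X V) (hV : IsOpen V) (hx : x ∈ V) : SmoothVFAt X x :=
  (hV.eventually_mem hx).mono fun _ hy => hX.contMDiffAt (hV.mem_nhds hy)

lemma SmoothFn.at (hf : SmoothFn f V) (hV : IsOpen V) (hx : x ∈ V) : SmoothFnAt f x :=
  (hV.eventually_mem hx).mono fun _ hy => hf.contMDiffAt (hV.mem_nhds hy)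

lemma smoothVF_of_at (h : ∀ x ∈ V, SmoothVFAt X x) : SmoothVF X V :=
  fun x hx => (h x hx).self_of_nhds.contMDiffWithinAt

lemma smoothFn_of_at (h : ∀ x ∈ V, SmoothFnAt f x) : SmoothFn f V :=
  fun x hx => (h x hx).self_of_nhds.contMDiffWithinAt

lemma IsSmoothVField.at (hX : IsSmoothVField X) (x : M) : SmoothVFAt X x :=
  Filter.Eventually.of_forall fun y => hX y

lemma SmoothVFAt.eventually (h : SmoothVFAt X x) : ∀ᶠ y in 𝓝 x, SmoothVFAt X y :=
  eventually_eventually_nhds.mpr h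

lemma SmoothFnAt.eventually (h : SmoothFnAt f x) : ∀ᶠ y in 𝓝 x, SmoothFnAt f y :=
  eventually_eventually_nhds.mpr h

lemma SmoothVFAt.mdiff (h : SmoothVFAt X x) :
    MDifferentiableAt (𝓡 2) ((𝓡 2).prod 𝓘(ℝ, Plane))
      (fun z => (⟨z, X z⟩ : TangentBundle (𝓡 2) M)) x :=
  h.self_of_nhds.mdifferentiableAt (by simp)

lemma SmoothFnAt.mdiff (h : SmoothFnAt f x) : MDifferentiableAt (𝓡 2) 𝓘(ℝ, ℝ) f x :=
  h.self_of_nhds.mdifferentiableAt (by simp)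

lemma SmoothVFAt.exists_open (h : SmoothVFAt X x) : ∃ V, IsOpen V ∧ x ∈ V ∧ SmoothVF X V := by
  obtain ⟨V, hV, ho, hx⟩ := eventually_nhds_iff.mp h
  exact ⟨V, ho, hx, fun y hy => (hV y hy).contMDiffWithinAt⟩

lemma SmoothFnAt.exists_open (h : SmoothFnAt f x) : ∃ V, IsOpen V ∧ x ∈ V ∧ SmoothFn f V := by
  obtain ⟨V, hV, ho, hx⟩ := eventually_nhds_iff.mp h
  exact ⟨V, ho, hx, fun y hy => (hV y hy).contMDiffWithinAt⟩

lemma SmoothVFAt.congr (h : SmoothVFAt X x) (he : ∀ᶠ y in 𝓝 x, Y y = X y) : SmoothVFAt Y x := by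
  filter_upwards [h, eventually_eventually_nhds.mpr he] with y h1 h2
  exact h1.congr_of_eventuallyEq (h2.mono fun z hz => by simp [hz])

lemma SmoothFnAt.congr (h : SmoothFnAt f x) (he : ∀ᶠ y in 𝓝 x, g y = f y) : SmoothFnAt g x := by
  filter_upwards [h, eventually_eventually_nhds.mpr he] with y h1 h2
  exact h1.congr_of_eventuallyEq h2

lemma SmoothVFAt.add (hX : SmoothVFAt X x) (hY : SmoothVFAt Y x) :
    SmoothVFAt (fun y => X y + Y y) x := by
  filter_upwards [hX, hY] with y h1 h2 using h1.add_section h2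

lemma SmoothVFAt.sub (hX : SmoothVFAt X x) (hY : SmoothVFAt Y x) :
    SmoothVFAt (fun y => X y - Y y) x := by
  filter_upwards [hX, hY] with y h1 h2 using h1.sub_section h2

lemma SmoothVFAt.neg (hX : SmoothVFAt X x) : SmoothVFAt (fun y => -X y) x := by
  filter_upwards [hX] with y h1 using h1.neg_section

lemma SmoothVFAt.smul (hf : SmoothFnAt f x) (hX : SmoothVFAt X x) :
    SmoothVFAt (fun y => f y • X y) x := by
  filter_upwards [hf, hX] with y h1 h2 using h1.smul_section h2

lemma smoothFnAt_const (c : ℝ) : SmoothFnAt (fun _ : M => c) x :=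
  Filter.Eventually.of_forall fun _ => contMDiffAt_const

lemma SmoothFnAt.sub (hf : SmoothFnAt f x) (hg : SmoothFnAt g x) :
    SmoothFnAt (fun y => f y - g y) x := by
  filter_upwards [hf, hg] with y h1 h2 using ContMDiffAt.sub h1 h2

lemma SmoothFnAt.mul (hf : SmoothFnAt f x) (hg : SmoothFnAt g x) :
    SmoothFnAt (fun y => f y * g y) x := by
  filter_upwards [hf, hg] with y h1 h2 using ContMDiffAt.mul h1 h2

lemma SmoothFnAt.pow (hf : SmoothFnAt f x) (n : ℕ) : SmoothFnAt (fun y => f y ^ n) x := by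
  filter_upwards [hf] with y h1 using ContMDiffAt.pow h1 n

lemma SmoothFnAt.inv (hf : SmoothFnAt f x) (h0 : f x ≠ 0) : SmoothFnAt (fun y => (f y)⁻¹) x := by
  filter_upwards [hf, hf.self_of_nhds.continuousAt.eventually_ne h0] with y h1 h2
  exact ContMDiffAt.inv₀ h1 h2

lemma SmoothFnAt.sum {ι : Type*} (s : Finset ι) {f : ι → M → ℝ}
    (hf : ∀ i ∈ s, SmoothFnAt (f i) x) : SmoothFnAt (fun y => ∑ i ∈ s, f i y) x := by
  filter_upwards [(Finset.eventually_all s).mpr hf] with y h using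
    ContMDiffAt.sum h

lemma SmoothFnAt.mvfderiv (hf : SmoothFnAt f x) (hX : SmoothVFAt X x) :
    SmoothFnAt (fun y => mvfderiv (𝓡 2) f y (X y)) x := by
  obtain ⟨V, hV, hxV, h1⟩ := hf.exists_open
  obtain ⟨W, hW, hxW, h2⟩ := hX.exists_open
  exact SmoothFn.at (smooth_mvfderiv (hV.inter hW) (h1.mono Set.inter_subset_left)
    (h2.mono Set.inter_subset_right)) (hV.inter hW) ⟨hxV, hxW⟩

lemma commutator_apply (hf : SmoothFnAt f x) (hX : SmoothVFAt X x) (hY : SmoothVFAt Y x) :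
    mvfderiv (𝓡 2) f x (VectorField.mlieBracket (𝓡 2) X Y x) =
      mvfderiv (𝓡 2) (fun y => mvfderiv (𝓡 2) f y (Y y)) x (X x)
        - mvfderiv (𝓡 2) (fun y => mvfderiv (𝓡 2) f y (X y)) x (Y x) := by
  obtain ⟨U, hU, hxU, h0⟩ := hf.exists_open
  obtain ⟨V, hV, hxV, h1⟩ := hX.exists_open
  obtain ⟨W, hW, hxW, h2⟩ := hY.exists_open
  exact mvfderiv_mlieBracket (V := U ∩ V ∩ W) ((hU.inter hV).inter hW)
    (h0.mono fun _ h => h.1.1) (h1.mono fun _ h => h.1.2) (h2.mono fun _ h => h.2)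
    ⟨⟨hxU, hxV⟩, hxW⟩

lemma smoothVFAt_extVec (v : TangentSpace (𝓡 2) x) : SmoothVFAt (extVec v) x := by
  obtain ⟨u, hu, h⟩ := FiberBundle.exists_contMDiffOn_extend (𝓡 2) Plane (k := ∞)
    (V := fun y : M => TangentSpace (𝓡 2) y) v
  exact SmoothVF.at (h.mono interior_subset) isOpen_interior (mem_interior_iff_mem_nhds.mpr hu)

@[simp] lemma extVec_self (v : TangentSpace (𝓡 2) x) : extVec v x = v :=
  FiberBundle.extend_apply_self ..

/-- A vector field that is smooth near a point agrees there with a global smooth vector field. -/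
lemma SmoothVFAt.exists_global [T2Space M] (h : SmoothVFAt X x) :
    ∃ Y : VField M, IsSmoothVField Y ∧ ∀ᶠ y in 𝓝 x, Y y = X y := by
  obtain ⟨V, hV, hx, hs⟩ := h.exists_open
  obtain ⟨χ, -, hχ⟩ := (SmoothBumpFunction.nhds_basis_tsupport (I := 𝓡 2) x).mem_iff.mp
    (hV.mem_nhds hx)
  refine ⟨fun y => χ y • X y, fun y => ?_, χ.eventuallyEq_one.mono fun y hy => by simp [hy]⟩
  by_cases hy : y ∈ tsupport χ
  · exact (χ.contMDiff y).smul_section (hs.contMDiffAt (hV.mem_nhds (hχ hy)))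
  · have h0 : ContMDiffAt (𝓡 2) ((𝓡 2).prod 𝓘(ℝ, Plane)) ∞
        (fun z => (⟨z, 0⟩ : TangentBundle (𝓡 2) M)) y :=
      Bundle.contMDiff_zeroSection ℝ (fun z : M => TangentSpace (𝓡 2) z) y
    refine h0.congr_of_eventuallyEq ?_
    filter_upwards [(isClosed_tsupport χ).isOpen_compl.mem_nhds hy] with z hz
    simp [image_eq_zero_of_notMem_tsupport hz]

/-- A local smooth frame near every point. -/
lemma exists_coord (x : M) : ∃ (E : Fin 2 → VField M) (c : Fin 2 → Π y : M,
    TangentSpace (𝓡 2) y →ₗ[ℝ] ℝ), (∀ i, SmoothVFAt (E i) x) ∧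
    (∀ᶠ y in 𝓝 x, ∀ v, v = ∑ i, c i y v • E i y) ∧
    ∀ X, SmoothVFAt X x → ∀ i, SmoothFnAt (fun y => c i y (X y)) x := by
  let e := trivializationAt Plane (fun y : M => TangentSpace (𝓡 2) y) x
  let b := (EuclideanSpace.basisFun (Fin 2) ℝ).toBasis
  have ho : IsOpen e.baseSet := e.open_baseSet
  have hx : x ∈ e.baseSet := FiberBundle.mem_baseSet_trivializationAt' x
  refine ⟨e.localFrame b, e.localFrameCoeff (𝓡 2) b, fun i => ?_, ?_, fun X hX i => ?_⟩
  · exact SmoothVF.at (e.contMDiffOn_localFrame_baseSet ∞ b i) ho hx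
  · filter_upwards [ho.mem_nhds hx] with y hy v
    have := e.eq_sum_localFrameCoeff_smul (I := 𝓡 2) (b := b) (s := extVec v) hy
    simpa using this
  · filter_upwards [hX, ho.mem_nhds hx] with y h1 h2
    exact contMDiffAt_localFrameCoeff (e := e) b h2 h1 i

end closure
/-- An operation on vector fields that is linear over the functions smooth near `x` depends only on
the values at `x`. -/
lemma eq_of_linear {A : Type*} [AddCommGroup A] [Module ℝ A] {x : M} {Φ : VField M → A}
    (hadd : ∀ X Y, SmoothVFAt X x → SmoothVFAt Y x → Φ (fun y => X y + Y y) = Φ X + Φ Y)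
    (hsmul : ∀ f X, SmoothFnAt f x → SmoothVFAt X x → Φ (fun y => f y • X y) = f x • Φ X)
    {X Y : VField M} (hX : SmoothVFAt X x) (hY : SmoothVFAt Y x) (h : X x = Y x) : Φ X = Φ Y := by
  classical
  have hlocal : ∀ X Y, SmoothVFAt X x → SmoothVFAt Y x → (∀ᶠ y in 𝓝 x, X y = Y y) → Φ X = Φ Y := by
    intro X Y hX hY he
    -- The indicator of the coincidence set is constantly `1` near `x`, so it is an admissible
    -- factor although it may be discontinuous elsewhere. Since `ψX = ψY` everywhere, linearity
    -- forces locality.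
    let ψ : M → ℝ := fun y => if X y = Y y then 1 else 0
    have hψ : SmoothFnAt ψ x := (smoothFnAt_const 1).congr (he.mono fun y hy => by simp [ψ, hy])
    have hx : ψ x = 1 := by simp [ψ, he.self_of_nhds]
    have e1 := hsmul ψ X hψ hX
    have e2 := hsmul ψ Y hψ hY
    rw [hx, one_smul] at e1 e2
    rw [← e1, ← e2]
    congr 1
    funext y
    by_cases hy : X y = Y y <;> simp [ψ, hy]
  have hsum : ∀ X Y, SmoothVFAt X x → SmoothVFAt Y x →
      ∀ f g, SmoothFnAt f x → SmoothFnAt g x →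
      Φ (fun y => f y • X y + g y • Y y) = f x • Φ X + g x • Φ Y := by
    intro X Y hX hY f g hf hg
    rw [hadd _ _ (SmoothVFAt.smul hf hX) (SmoothVFAt.smul hg hY), hsmul _ _ hf hX, hsmul _ _ hg hY]
  obtain ⟨E, c, hE, hc, hs⟩ := exists_coord x
  have key : ∀ X, SmoothVFAt X x → Φ X = c 0 x (X x) • Φ (E 0) + c 1 x (X x) • Φ (E 1) := by
    intro X hX
    rw [← hsum _ _ (hE 0) (hE 1) (fun y => c 0 y (X y)) (fun y => c 1 y (X y)) (hs X hX 0)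
      (hs X hX 1)]
    refine hlocal _ _ hX ?_ ?_
    · exact (SmoothVFAt.smul (hs X hX 0) (hE 0)).add (SmoothVFAt.smul (hs X hX 1) (hE 1))
    · filter_upwards [hc] with y hy
      simpa using hy (X y)
  rw [key X hX, key Y hY, h]

section tensors

variable {x : M} {k : ℕ} {U : Set M} {T : Tensor M k}

lemma IsSmoothTensor.smoothAt [T2Space M] (hT : IsSmoothTensor U T) (hU : U ∈ 𝓝 x)
    {X : Fin k → VField M} (hX : ∀ i, SmoothVFAt (X i) x) :
    SmoothFnAt (fun y => T y (fun i => X i y)) x := by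
  choose Y hY hYX using fun i => (hX i).exists_global
  have h1 : SmoothFnAt (fun y => T y (fun i => Y i y)) x :=
    SmoothFn.at ((hT.smooth Y hY).mono interior_subset) isOpen_interior
      (mem_interior_iff_mem_nhds.mpr hU)
  refine h1.congr ?_
  filter_upwards [Filter.eventually_all.mpr hYX] with y hy
  simp [hy]

lemma isSmoothTensor_of_at (h1 : IsTensor U T) (h2 : ∀ x ∈ U, ∀ X : Fin k → VField M,
    (∀ i, SmoothVFAt (X i) x) → SmoothFnAt (fun y => T y (fun i => X i y)) x) :
    IsSmoothTensor U T :=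
  ⟨h1, fun X hX => smoothFn_of_at fun x hx => h2 x hx X fun i => (hX i).at x⟩

lemma IsTensor.update_add (hT : IsTensor U T) (hx : x ∈ U) (v : Fin k → TangentSpace (𝓡 2) x)
    (i : Fin k) (a b : TangentSpace (𝓡 2) x) :
    T x (Function.update v i (a + b)) = T x (Function.update v i a) + T x (Function.update v i b) := by
  obtain ⟨f, hf⟩ := hT x hx
  simp only [hf]
  exact f.map_update_add v i a b

lemma IsTensor.update_smul (hT : IsTensor U T) (hx : x ∈ U) (v : Fin k → TangentSpace (𝓡 2) x)
    (i : Fin k) (c : ℝ) (a : TangentSpace (𝓡 2) x) :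
    T x (Function.update v i (c • a)) = c * T x (Function.update v i a) := by
  obtain ⟨f, hf⟩ := hT x hx
  simp only [hf]
  exact f.map_update_smul v i c a

/-- Symplectic connections act locally. -/
lemma IsSymplecticConnection.congr {Om : Tensor M 2} {D : Conn M}
    (hD : IsSymplecticConnection Om D U) (hU : U ∈ 𝓝 x) {X Y : VField M} (hX : SmoothVFAt X x)
    (hY : SmoothVFAt Y x) (h : ∀ᶠ y in 𝓝 x, X y = Y y) : D X x = D Y x :=
  hD.isCov.congr_of_eventuallyEq hX.mdiff hY.mdiff hU h

lemma IsSymplecticConnection.add {Om : Tensor M 2} {D : Conn M}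
    (hD : IsSymplecticConnection Om D U) (hx : x ∈ U) {X Y : VField M} (hX : SmoothVFAt X x)
    (hY : SmoothVFAt Y x) : D (fun y => X y + Y y) x = D X x + D Y x :=
  hD.isCov.add hX.mdiff hY.mdiff hx

lemma IsSymplecticConnection.smul {Om : Tensor M 2} {D : Conn M}
    (hD : IsSymplecticConnection Om D U) (hx : x ∈ U) {X : VField M} {f : M → ℝ}
    (hf : SmoothFnAt f x) (hX : SmoothVFAt X x) (v : TangentSpace (𝓡 2) x) :
    D (fun y => f y • X y) x v = f x • D X x v + mvfderiv (𝓡 2) f x v • X x := by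
  have := hD.isCov.leibniz hX.mdiff hf.mdiff hx
  exact congrArg (fun L => L v) this

/-- Smoothness of a connection is tested on sections smooth on all of `U`. A germ is first extended
by a bump function, and locality of the connection identifies the results near `x`. -/
lemma IsSymplecticConnection.smoothAt [T2Space M] {Om : Tensor M 2} {D : Conn M}
    (hD : IsSymplecticConnection Om D U) (hU : U ∈ 𝓝 x) {X Y : VField M} (hX : SmoothVFAt X x)
    (hY : SmoothVFAt Y x) : SmoothVFAt (fun y => D Y y (X y)) x := by
  obtain ⟨Y', hY', he⟩ := hY.exists_global
  have h1 : SmoothVF (fun y => D Y' y (X y)) (U ∩ {y | SmoothVFAt X y}) := by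
    have h := (hD.smooth.contMDiff (σ := Y') (by exact hY'.contMDiffOn)).mono
      (Set.inter_subset_left (t := {y | SmoothVFAt X y}))
    have h2 : SmoothVF X (U ∩ {y | SmoothVFAt X y}) := smoothVF_of_at fun y hy => hy.2
    exact h.clm_bundle_apply h2
  have h3 : SmoothVFAt (fun y => D Y' y (X y)) x :=
    SmoothVF.at (h1.mono interior_subset) isOpen_interior (mem_interior_iff_mem_nhds.mpr
      (Filter.inter_mem hU hX.eventually))
  refine h3.congr ?_
  filter_upwards [eventually_eventually_nhds.mpr he, hY.eventually,
    eventually_eventually_nhds.mpr hU] with y h1 h2 h3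
  rw [hD.congr h3 h2 (hY'.at y) (h1.mono fun z hz => hz.symm)]

end tensors

end

/-! ### The covariant derivative of a tensor field is a tensor field. -/

section

variable {M : Type*} [TopologicalSpace M] [ChartedSpace Plane M] [IsManifold (𝓡 2) ∞ M]

variable {x : M} {k : ℕ} {U : Set M} {T : Tensor M k} {Om : Tensor M 2} {D : Conn M}

lemma mvfderiv_congr {f g : M → ℝ} (h : ∀ᶠ y in 𝓝 x, f y = g y) :
    mvfderiv (𝓡 2) f x = mvfderiv (𝓡 2) g x :=
  Filter.EventuallyEq.mfderiv_eq h

lemma isTensor_of_linear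
    (h1 : ∀ x ∈ U, ∀ v i a b, T x (Function.update v i (a + b)) =
      T x (Function.update v i a) + T x (Function.update v i b))
    (h2 : ∀ x ∈ U, ∀ v i (c : ℝ) a, T x (Function.update v i (c • a)) =
      c * T x (Function.update v i a)) : IsTensor U T := fun x hx =>
  ⟨{ toFun := T x
     map_update_add' := by
      intro inst v i a b
      -- The axioms of a multilinear map quantify over the decidability instance hidden in
      -- `Function.update`.
      obtain rfl : inst = instDecidableEqFin k := Subsingleton.elim _ _
      exact h1 x hx v i a b
     map_update_smul' := by
      intro inst v i c a
      obtain rfl : inst = instDecidableEqFin k := Subsingleton.elim _ _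
      exact h2 x hx v i c a }, fun _ => rfl⟩

lemma update_field_apply (Y : Fin k → VField M) (r : Fin k) (Z : VField M) (y : M) :
    (fun i => Function.update Y r Z i y) = Function.update (fun i => Y i y) r (Z y) := by
  funext i
  by_cases h : i = r
  · subst h; simp
  · simp [h]

/-- The covariant derivative of a tensor field, evaluated on vector fields. -/
def covE (D : Conn M) (T : Tensor M k) (x : M) (v : TangentSpace (𝓡 2) x) (Y : Fin k → VField M) :
    ℝ :=
  mvfderiv (𝓡 2) (fun y => T y (fun i => Y i y)) x v
    - ∑ i : Fin k, T x (Function.update (fun j => Y j x) i (D (Y i) x v))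

/-- Isolates the dependence on the field in slot `r`: the derivative, the term where `D` hits that
field, and the terms in which it enters only through its value. -/
lemma covE_update (v : TangentSpace (𝓡 2) x) (Y : Fin k → VField M) (r : Fin k) (Z : VField M) :
    covE D T x v (Function.update Y r Z) =
      mvfderiv (𝓡 2) (fun y => T y (Function.update (fun i => Y i y) r (Z y))) x v
      - T x (Function.update (fun j => Y j x) r (D Z x v))
      - ∑ i ∈ {r}ᶜ, T x (Function.update (Function.update (fun j => Y j x) i (D (Y i) x v)) r
          (Z x)) := by
  rw [covE, Fintype.sum_eq_add_sum_compl r, sub_sub]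
  simp only [update_field_apply, Function.update_idem, Function.update_self]
  congr 2
  refine Finset.sum_congr rfl fun i hi => ?_
  have hi : i ≠ r := by simpa using hi
  rw [Function.update_of_ne hi, Function.update_comm hi.symm]

variable [T2Space M]

lemma covE_update_add (hD : IsSymplecticConnection Om D U) (hU : IsOpen U) (hx : x ∈ U)
    (hT : IsSmoothTensor U T) (v : TangentSpace (𝓡 2) x) {Y : Fin k → VField M}
    (hY : ∀ i, SmoothVFAt (Y i) x) (r : Fin k) {Z W : VField M} (hZ : SmoothVFAt Z x)
    (hW : SmoothVFAt W x) :
    covE D T x v (Function.update Y r (fun y => Z y + W y)) =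
      covE D T x v (Function.update Y r Z) + covE D T x v (Function.update Y r W) := by
  have hs : ∀ {Z : VField M}, SmoothVFAt Z x →
      SmoothFnAt (fun y => T y (Function.update (fun i => Y i y) r (Z y))) x := fun {Z} hZ => by
    simp only [← update_field_apply]
    refine hT.smoothAt (hU.mem_nhds hx) fun i => ?_
    by_cases h : i = r
    · subst h; simpa using hZ
    · simpa [h] using hY i
  have h1 : mvfderiv (𝓡 2) (fun y => T y (Function.update (fun i => Y i y) r (Z y + W y))) x v =
      mvfderiv (𝓡 2) (fun y => T y (Function.update (fun i => Y i y) r (Z y))) x v +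
      mvfderiv (𝓡 2) (fun y => T y (Function.update (fun i => Y i y) r (W y))) x v := by
    rw [mvfderiv_congr ((hU.eventually_mem hx).mono fun y hy =>
      hT.multilinear.update_add hy (fun i => Y i y) r (Z y) (W y))]
    exact congrArg (fun L => L v) (mvfderiv_add (hs hZ).mdiff (hs hW).mdiff)
  simp only [covE_update, h1, hD.add hx hZ hW, add_apply,
    hT.multilinear.update_add hx, Finset.sum_add_distrib]
  ring

/-- The derivative of `f` appears once from the product rule for functions and once from the Leibniz
rule of `D`, with opposite signs. -/
lemma covE_update_smul (hD : IsSymplecticConnection Om D U) (hU : IsOpen U) (hx : x ∈ U)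
    (hT : IsSmoothTensor U T) (v : TangentSpace (𝓡 2) x) {Y : Fin k → VField M}
    (hY : ∀ i, SmoothVFAt (Y i) x) (r : Fin k) {Z : VField M} (hZ : SmoothVFAt Z x)
    {f : M → ℝ} (hf : SmoothFnAt f x) :
    covE D T x v (Function.update Y r (fun y => f y • Z y)) =
      f x * covE D T x v (Function.update Y r Z) := by
  have hs : SmoothFnAt (fun y => T y (Function.update (fun i => Y i y) r (Z y))) x := by
    simp only [← update_field_apply]
    refine hT.smoothAt (hU.mem_nhds hx) fun i => ?_
    by_cases h : i = r
    · subst h; simpa using hZ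
    · simpa [h] using hY i
  have h1 : mvfderiv (𝓡 2) (fun y => T y (Function.update (fun i => Y i y) r (f y • Z y))) x v =
      f x * mvfderiv (𝓡 2) (fun y => T y (Function.update (fun i => Y i y) r (Z y))) x v +
      mvfderiv (𝓡 2) f x v * T x (Function.update (fun i => Y i x) r (Z x)) := by
    rw [mvfderiv_congr ((hU.eventually_mem hx).mono fun y hy =>
      hT.multilinear.update_smul hy (fun i => Y i y) r (f y) (Z y))]
    have := congrArg (fun L => L v) (mvfderiv_mul hf.mdiff hs.mdiff)
    exact Eq.trans this (congrArg₂ _ rfl (mul_comm _ _))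
  simp only [covE_update, h1, hD.smul hx hf hZ, hT.multilinear.update_add hx,
    hT.multilinear.update_smul hx, ← Finset.mul_sum]
  ring

lemma covE_congr (hD : IsSymplecticConnection Om D U) (hU : IsOpen U) (hx : x ∈ U)
    (hT : IsSmoothTensor U T) (v : TangentSpace (𝓡 2) x) {Y Y' : Fin k → VField M}
    (hY : ∀ i, SmoothVFAt (Y i) x) (hY' : ∀ i, SmoothVFAt (Y' i) x) (h : ∀ i, Y i x = Y' i x) :
    covE D T x v Y = covE D T x v Y' := by
  -- The fields are exchanged one slot at a time; each exchange is an instance of `eq_of_linear`.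
  have key : ∀ s : Finset (Fin k), covE D T x v (s.piecewise Y' Y) = covE D T x v Y := by
    intro s
    induction s using Finset.induction_on with
    | empty => simp
    | insert r s hr ih =>
      have hs : ∀ i, SmoothVFAt (s.piecewise Y' Y i) x := fun i => by
        by_cases hi : i ∈ s <;> simp [hi, hY, hY']
      rw [Finset.piecewise_insert, ← ih]
      have := eq_of_linear (Φ := fun Z => covE D T x v (Function.update (s.piecewise Y' Y) r Z))
        (fun Z W hZ hW => covE_update_add hD hU hx hT v hs r hZ hW)
        (fun f Z hf hZ => covE_update_smul hD hU hx hT v hs r hZ hf) (hY' r) (hY r) (h r).symm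
      refine this.trans ?_
      congr 1
      conv_rhs => rw [← Function.update_eq_self r (s.piecewise Y' Y)]
      simp [hr]
  simpa using (key Finset.univ).symm

omit [T2Space M] in
lemma covD_eq_covE (v : Fin (k + 1) → TangentSpace (𝓡 2) x) :
    covD D T x v = covE D T x (v 0) (fun i => extVec (v i.succ)) := by
  simp [covD, covE]

/-- Frees `covD` from the particular extensions `extVec` in its definition, so that it may be
evaluated on a frame. -/
lemma covD_apply (hD : IsSymplecticConnection Om D U) (hU : IsOpen U) (hx : x ∈ U)
    (hT : IsSmoothTensor U T) {X : Fin (k + 1) → VField M} (hX : ∀ i, SmoothVFAt (X i) x) :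
    covD D T x (fun i => X i x) = covE D T x (X 0 x) (fun i => X i.succ) := by
  rw [covD_eq_covE]
  exact covE_congr hD hU hx hT _ (fun i => smoothVFAt_extVec _) (fun i => hX _) (by simp)

lemma isTensor_covD (hD : IsSymplecticConnection Om D U) (hU : IsOpen U)
    (hT : IsSmoothTensor U T) : IsTensor U (covD D T) := by
  have hsucc : ∀ (x : M) (v : Fin (k + 1) → TangentSpace (𝓡 2) x) (i : Fin k) a,
      (fun j : Fin k => (extVec (Function.update v i.succ a j.succ) : VField M)) =
      Function.update (fun j : Fin k => (extVec (v j.succ) : VField M)) i (extVec a) := by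
    intro x v i a
    funext j
    by_cases h : j = i
    · subst h; simp
    · rw [Function.update_of_ne h, Function.update_of_ne (by simpa using h)]
  refine isTensor_of_linear ?_ ?_
  · intro x hx v i a b
    refine Fin.cases ?_ (fun i => ?_) i
    · simp only [covD, Function.update_self, ne_eq, Fin.succ_ne_zero, not_false_eq_true,
        Function.update_of_ne, map_add, hT.multilinear.update_add hx, Finset.sum_add_distrib]
      ring
    · simp only [covD_eq_covE, hsucc, Function.update_of_ne (Fin.succ_ne_zero i).symm]
      rw [← covE_update_add hD hU hx hT (v 0) (Y := fun j : Fin k => extVec (v j.succ)) (fun _ => smoothVFAt_extVec _) i (smoothVFAt_extVec a)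
        (smoothVFAt_extVec b)]
      -- The extension of `a + b` need not be compared with the sum of the extensions as fields;
      -- their values at `x` agree, and that suffices.
      refine covE_congr hD hU hx hT _ (fun j => ?_) (fun j => ?_) (fun j => ?_)
      all_goals
        by_cases h : j = i
        · subst h
          simp [smoothVFAt_extVec, SmoothVFAt.add]
        · simp [h, smoothVFAt_extVec]
  · intro x hx v i c a
    refine Fin.cases ?_ (fun i => ?_) i
    · simp only [covD, Function.update_self, ne_eq, Fin.succ_ne_zero, not_false_eq_true,
        Function.update_of_ne, map_smul, hT.multilinear.update_smul hx, ← Finset.mul_sum,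
        smul_eq_mul]
      ring
    · simp only [covD_eq_covE, hsucc, Function.update_of_ne (Fin.succ_ne_zero i).symm]
      have := covE_update_smul hD hU hx hT (v 0) (Y := fun j : Fin k => extVec (v j.succ))
        (fun _ => smoothVFAt_extVec _) i (smoothVFAt_extVec a) (smoothFnAt_const c)
      rw [← this]
      refine covE_congr hD hU hx hT _ (fun j => ?_) (fun j => ?_) (fun j => ?_)
      all_goals
        by_cases h : j = i
        · subst h
          simp [smoothVFAt_extVec, SmoothVFAt.smul, smoothFnAt_const]
        · simp [h, smoothVFAt_extVec]

lemma IsSmoothTensor.covD (hT : IsSmoothTensor U T) (hD : IsSymplecticConnection Om D U)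
    (hU : IsOpen U) : IsSmoothTensor U (covD D T) := by
  refine isSmoothTensor_of_at (isTensor_covD hD hU hT) fun x hx X hX => ?_
  have hUx := hU.mem_nhds hx
  have h1 : SmoothFnAt (fun y => covE D T y (X 0 y) (fun i => X i.succ)) x := by
    refine SmoothFnAt.sub ((hT.smoothAt hUx fun i => hX i.succ).mvfderiv (hX 0))
      (SmoothFnAt.sum _ fun i _ => ?_)
    have := hT.smoothAt hUx (X := Function.update (fun j : Fin k => X j.succ) i
      (fun y => D (X i.succ) y (X 0 y))) (fun j => ?_)
    · simpa only [update_field_apply] using this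
    · by_cases h : j = i
      · subst h; simpa using hD.smoothAt hUx (hX 0) (hX _)
      · simpa [h] using hX _
  refine h1.congr ?_
  filter_upwards [hU.eventually_mem hx, Filter.eventually_all.mpr fun i => (hX i).eventually]
    with y hy hXy
  exact covD_apply hD hU hy hT hXy

end

/-! ### Tensoriality of the curvature and smoothness of the Ricci tensor. -/

section

variable {M : Type*} [TopologicalSpace M] [ChartedSpace Plane M] [IsManifold (𝓡 2) ∞ M] [T2Space M]

variable {x : M} {U : Set M} {Om : Tensor M 2} {D : Conn M}

/-- The curvature of a torsion-free connection, evaluated on vector fields. -/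
def curvE (D : Conn M) (x : M) (X Y W : VField M) : TangentSpace (𝓡 2) x :=
  D (fun y => D W y (Y y)) x (X x) - D (fun y => D W y (X y)) x (Y x)
    - D W x (D Y x (X x) - D X x (Y x))

lemma curvE_swap (X Y W : VField M) : curvE D x X Y W = -curvE D x Y X W := by
  simp only [curvE, map_sub]; abel

namespace IsSymplecticConnection

variable (hD : IsSymplecticConnection Om D U) (hU : IsOpen U) (hx : x ∈ U)
include hD hU hx

omit hU in
lemma bracket {X Y : VField M} (hX : SmoothVFAt X x) (hY : SmoothVFAt Y x) :
    VectorField.mlieBracket (𝓡 2) X Y x = D Y x (X x) - D X x (Y x) :=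
  (hD.torsionFree x hx X Y hX.mdiff hY.mdiff).symm

omit hU in
lemma curv_eq_curvE (u v w : TangentSpace (𝓡 2) x) :
    curv D x u v w = curvE D x (extVec u) (extVec v) (extVec w) := by
  simp [curv, curvE, hD.bracket hx (smoothVFAt_extVec u) (smoothVFAt_extVec v)]

lemma curvE_add {X X' Y W : VField M} (hX : SmoothVFAt X x) (hX' : SmoothVFAt X' x)
    (hW : SmoothVFAt W x) :
    curvE D x (fun y => X y + X' y) Y W = curvE D x X Y W + curvE D x X' Y W := by
  have hUx := hU.mem_nhds hx
  simp only [curvE, hD.add hx hX hX', map_add, map_sub, add_apply,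
    hD.add hx (hD.smoothAt hUx hX hW) (hD.smoothAt hUx hX' hW)]
  abel

lemma curvE_smul {X Y W : VField M} {f : M → ℝ} (hf : SmoothFnAt f x) (hX : SmoothVFAt X x)
    (hW : SmoothVFAt W x) :
    curvE D x (fun y => f y • X y) Y W = f x • curvE D x X Y W := by
  have hUx := hU.mem_nhds hx
  simp only [curvE, hD.smul hx hf hX, map_smul, map_sub, map_add,
    hD.smul hx hf (hD.smoothAt hUx hX hW)]
  module

lemma curvE_add_right {X Y W W' : VField M} (hX : SmoothVFAt X x) (hY : SmoothVFAt Y x)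
    (hW : SmoothVFAt W x) (hW' : SmoothVFAt W' x) :
    curvE D x X Y (fun y => W y + W' y) = curvE D x X Y W + curvE D x X Y W' := by
  have hUx := hU.mem_nhds hx
  have h1 : ∀ {Z : VField M}, SmoothVFAt Z x → ∀ v, D (fun y => D (fun y => W y + W' y) y (Z y)) x v =
      D (fun y => D W y (Z y)) x v + D (fun y => D W' y (Z y)) x v := by
    intro Z hZ v
    rw [← add_apply, ← hD.add hx (hD.smoothAt hUx hZ hW) (hD.smoothAt hUx hZ hW')]
    rw [hD.congr hUx (hD.smoothAt hUx hZ (hW.add hW'))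
      ((hD.smoothAt hUx hZ hW).add (hD.smoothAt hUx hZ hW'))]
    filter_upwards [hW.eventually, hW'.eventually, hU.eventually_mem hx] with y h1 h2 h3
    rw [hD.add h3 h1 h2, add_apply]
  simp only [curvE, h1 hX, h1 hY, hD.add hx hW hW', add_apply]
  abel

/-- First derivatives of `f` cancel by skewness in `X, Y`. The second derivatives form the
commutator `[X,Y]f`, which cancels against the bracket term. -/
lemma curvE_smul_right {X Y W : VField M} {f : M → ℝ} (hf : SmoothFnAt f x)
    (hX : SmoothVFAt X x) (hY : SmoothVFAt Y x) (hW : SmoothVFAt W x) :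
    curvE D x X Y (fun y => f y • W y) = f x • curvE D x X Y W := by
  have hUx := hU.mem_nhds hx
  have h1 : ∀ {Z : VField M}, SmoothVFAt Z x → ∀ v, D (fun y => D (fun y => f y • W y) y (Z y)) x v =
      f x • D (fun y => D W y (Z y)) x v + mvfderiv (𝓡 2) f x v • D W x (Z x) +
      (mvfderiv (𝓡 2) f x (Z x) • D W x v +
        mvfderiv (𝓡 2) (fun y => mvfderiv (𝓡 2) f y (Z y)) x v • W x) := by
    intro Z hZ v
    rw [← hD.smul hx hf (hD.smoothAt hUx hZ hW), ← hD.smul hx (hf.mvfderiv hZ) hW, ← add_apply,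
      ← hD.add hx (SmoothVFAt.smul hf (hD.smoothAt hUx hZ hW))
        (SmoothVFAt.smul (hf.mvfderiv hZ) hW),
      hD.congr hUx (hD.smoothAt hUx hZ (SmoothVFAt.smul hf hW))
        ((SmoothVFAt.smul hf (hD.smoothAt hUx hZ hW)).add
        (SmoothVFAt.smul (hf.mvfderiv hZ) hW))]
    filter_upwards [hW.eventually, hf.eventually, hU.eventually_mem hx] with y h1 h2 h3
    rw [hD.smul h3 h2 h1]
  have h2 := commutator_apply hf hX hY
  rw [hD.bracket hx hX hY] at h2
  simp only [curvE, h1 hX, h1 hY, hD.smul hx hf hW, h2]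
  module

lemma curvE_congr {X X' Y Y' W W' : VField M} (hX : SmoothVFAt X x) (hX' : SmoothVFAt X' x)
    (hY : SmoothVFAt Y x) (hY' : SmoothVFAt Y' x) (hW : SmoothVFAt W x) (hW' : SmoothVFAt W' x)
    (h1 : X x = X' x) (h2 : Y x = Y' x) (h3 : W x = W' x) :
    curvE D x X Y W = curvE D x X' Y' W' := by
  have hleft : ∀ {X X' Y W : VField M}, SmoothVFAt X x → SmoothVFAt X' x → SmoothVFAt W x →
      X x = X' x → curvE D x X Y W = curvE D x X' Y W := fun {X X' Y W} hX hX' hW h =>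
    eq_of_linear (Φ := fun X => curvE D x X Y W)
      (fun _ _ h1 h2 => hD.curvE_add hU hx h1 h2 hW)
      (fun _ _ h1 h2 => hD.curvE_smul hU hx h1 h2 hW) hX hX' h
  rw [hleft hX hX' hW h1, curvE_swap, hleft hY hY' hW h2, ← curvE_swap]
  exact eq_of_linear (Φ := fun W => curvE D x X' Y' W)
      (fun _ _ h1 h2 => hD.curvE_add_right hU hx hX' hY' h1 h2)
      (fun _ _ h1 h2 => hD.curvE_smul_right hU hx h1 hX' hY' h2) hW hW' h3

lemma curv_apply {X Y W : VField M} (hX : SmoothVFAt X x) (hY : SmoothVFAt Y x)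
    (hW : SmoothVFAt W x) : curv D x (X x) (Y x) (W x) = curvE D x X Y W := by
  rw [hD.curv_eq_curvE hx]
  exact hD.curvE_congr hU hx (smoothVFAt_extVec _) hX (smoothVFAt_extVec _) hY
    (smoothVFAt_extVec _) hW (extVec_self _) (extVec_self _) (extVec_self _)

lemma curv_add (u u' v w : TangentSpace (𝓡 2) x) :
    curv D x (u + u') v w = curv D x u v w + curv D x u' v w := by
  have h := hD.curv_apply hU hx ((smoothVFAt_extVec u).add (smoothVFAt_extVec u'))
    (smoothVFAt_extVec v) (smoothVFAt_extVec w)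
  rw [hD.curvE_add hU hx (smoothVFAt_extVec u) (smoothVFAt_extVec u') (smoothVFAt_extVec w),
    ← hD.curv_eq_curvE hx, ← hD.curv_eq_curvE hx] at h
  simpa using h

lemma curv_smul (c : ℝ) (u v w : TangentSpace (𝓡 2) x) :
    curv D x (c • u) v w = c • curv D x u v w := by
  have h := hD.curv_apply hU hx (SmoothVFAt.smul (smoothFnAt_const c) (smoothVFAt_extVec u))
    (smoothVFAt_extVec v) (smoothVFAt_extVec w)
  rw [hD.curvE_smul hU hx (smoothFnAt_const c) (smoothVFAt_extVec u) (smoothVFAt_extVec w),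
    ← hD.curv_eq_curvE hx] at h
  simpa using h

omit hU in
lemma curv_swap (u v w : TangentSpace (𝓡 2) x) : curv D x u v w = -curv D x v u w := by
  rw [hD.curv_eq_curvE hx, hD.curv_eq_curvE hx, curvE_swap]

lemma curv_add_right (u v w w' : TangentSpace (𝓡 2) x) :
    curv D x u v (w + w') = curv D x u v w + curv D x u v w' := by
  have h := hD.curv_apply hU hx (smoothVFAt_extVec u) (smoothVFAt_extVec v)
    ((smoothVFAt_extVec w).add (smoothVFAt_extVec w'))
  rw [hD.curvE_add_right hU hx (smoothVFAt_extVec u) (smoothVFAt_extVec v) (smoothVFAt_extVec w)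
    (smoothVFAt_extVec w'), ← hD.curv_eq_curvE hx, ← hD.curv_eq_curvE hx] at h
  simpa using h

lemma curv_smul_right (c : ℝ) (u v w : TangentSpace (𝓡 2) x) :
    curv D x u v (c • w) = c • curv D x u v w := by
  have h := hD.curv_apply hU hx (smoothVFAt_extVec u) (smoothVFAt_extVec v)
    (SmoothVFAt.smul (smoothFnAt_const c) (smoothVFAt_extVec w))
  rw [hD.curvE_smul_right hU hx (smoothFnAt_const c) (smoothVFAt_extVec u) (smoothVFAt_extVec v)
    (smoothVFAt_extVec w), ← hD.curv_eq_curvE hx] at h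
  simpa using h

/-- The endomorphism `u ↦ R(u, v) w`. -/
def curvLin (v w : TangentSpace (𝓡 2) x) : TangentSpace (𝓡 2) x →ₗ[ℝ] TangentSpace (𝓡 2) x where
  toFun u := curv D x u v w
  map_add' u u' := hD.curv_add hU hx u u' v w
  map_smul' c u := hD.curv_smul hU hx c u v w

lemma curv_add_mid (u v v' w : TangentSpace (𝓡 2) x) :
    curv D x u (v + v') w = curv D x u v w + curv D x u v' w := by
  rw [hD.curv_swap hx, hD.curv_add hU hx, neg_add, ← hD.curv_swap hx, ← hD.curv_swap hx]

lemma curv_smul_mid (c : ℝ) (u v w : TangentSpace (𝓡 2) x) :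
    curv D x u (c • v) w = c • curv D x u v w := by
  rw [hD.curv_swap hx, hD.curv_smul hU hx, ← smul_neg, ← hD.curv_swap hx]

end IsSymplecticConnection

lemma vec_eq_sum (x : M) (v : TangentSpace (𝓡 2) x) : v = ∑ p, coframe x p v • frame x p := by
  have h : ∀ w : Plane, w = ∑ p, w p • (EuclideanSpace.single p (1 : ℝ) : Plane) := fun w => by
    ext i
    fin_cases i <;> simp
  exact h v

/-- The trace of an endomorphism of a tangent space may be computed in any basis. -/
lemma trace_eq (L : TangentSpace (𝓡 2) x →ₗ[ℝ] TangentSpace (𝓡 2) x)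
    (e : Fin 2 → TangentSpace (𝓡 2) x) (c : Fin 2 → TangentSpace (𝓡 2) x →ₗ[ℝ] ℝ)
    (h : ∀ v, v = ∑ i, c i v • e i) :
    ∑ p, coframe x p (L (frame x p)) = ∑ i, c i (L (e i)) := by
  calc ∑ p, coframe x p (L (frame x p))
      = ∑ p, coframe x p (∑ i, c i (L (frame x p)) • e i) := by
        refine Finset.sum_congr rfl fun p _ => ?_
        rw [← h]
    _ = ∑ i, ∑ p, c i (L (frame x p)) * coframe x p (e i) := by
        simp only [map_sum, map_smul, smul_eq_mul]
        exact Finset.sum_comm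
    _ = ∑ i, c i (L (∑ p, coframe x p (e i) • frame x p)) := by
        refine Finset.sum_congr rfl fun i _ => ?_
        simp [mul_comm]
    _ = ∑ i, c i (L (e i)) := by simp only [← vec_eq_sum]

/-- The vectors `frame x` refer to the preferred chart at `x` and need not vary continuously.
Smoothness is therefore seen only after rewriting the trace, by `trace_eq`, in a local smooth frame.
-/
lemma IsSymplecticConnection.smooth_ric (hD : IsSymplecticConnection Om D U) (hU : IsOpen U) :
    IsSmoothTensor U (ric D) := by
  refine isSmoothTensor_of_at (isTensor_of_linear ?_ ?_) ?_
  · intro x hx v i a b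
    fin_cases i <;> simp [ric, hD.curv_add_mid hU hx, hD.curv_add_right hU hx] <;> ring
  · intro x hx v i c a
    fin_cases i <;> simp [ric, hD.curv_smul_mid hU hx, hD.curv_smul_right hU hx] <;> ring
  · intro x hx X hX
    have hUx := hU.mem_nhds hx
    obtain ⟨E, c, hE, hc, hs⟩ := exists_coord x
    have h1 : SmoothFnAt (fun y => ∑ i, c i y (curvE D y (E i) (X 0) (X 1))) x := by
      refine SmoothFnAt.sum _ fun i _ => hs _ ?_ i
      refine SmoothVFAt.sub (SmoothVFAt.sub ?_ ?_) ?_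
      · exact hD.smoothAt hUx (hE i) (hD.smoothAt hUx (hX 0) (hX 1))
      · exact hD.smoothAt hUx (hX 0) (hD.smoothAt hUx (hE i) (hX 1))
      · exact hD.smoothAt hUx ((hD.smoothAt hUx (hE i) (hX 0)).sub
          (hD.smoothAt hUx (hX 0) (hE i))) (hX 1)
    refine h1.congr ?_
    filter_upwards [hU.eventually_mem hx, hc, (hX 0).eventually, (hX 1).eventually,
      (hE 0).eventually, (hE 1).eventually] with y hy hcy h0 h1 h2 h3
    have := trace_eq (hD.curvLin hU hy (X 0 y) (X 1 y)) (fun i => E i y) (fun i => c i y) hcy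
    refine this.trans ?_
    simp [Fin.sum_univ_two, curvLin, hD.curv_apply hU hy h2 h0 h1, hD.curv_apply hU hy h3 h0 h1]

end

/-! ### The ring of smooth functions on an open set, and its derivations. -/

section

variable {M : Type*} [TopologicalSpace M] [ChartedSpace Plane M] [IsManifold (𝓡 2) ∞ M]

section update

variable {α : Type*} (a b c d w : α)

lemma update_one : Function.update ![a] 0 w = ![w] := by
  funext i; fin_cases i; rfl

lemma update_two_zero : Function.update ![a, b] 0 w = ![w, b] := by
  funext i; fin_cases i <;> rfl

lemma update_two_one : Function.update ![a, b] 1 w = ![a, w] := by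
  funext i; fin_cases i <;> rfl

lemma update_three_zero : Function.update ![a, b, c] 0 w = ![w, b, c] := by
  funext i; fin_cases i <;> rfl

lemma update_three_one : Function.update ![a, b, c] 1 w = ![a, w, c] := by
  funext i; fin_cases i <;> rfl

lemma update_three_two : Function.update ![a, b, c] 2 w = ![a, b, w] := by
  funext i; fin_cases i <;> rfl

end update

section ring

/-- The algebra of functions on `V` that are restrictions of functions smooth on `V`. -/
def smoothRing (V : Set M) : Subalgebra ℝ (V → ℝ) where
  carrier := {f | ∃ F : M → ℝ, SmoothFn F V ∧ ∀ y : V, F y = f y}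
  mul_mem' := by
    rintro f g ⟨F, hF, h⟩ ⟨G, hG, h'⟩
    exact ⟨fun y => F y * G y, ContMDiffOn.mul hF hG, fun y => by simp [h, h']⟩
  add_mem' := by
    rintro f g ⟨F, hF, h⟩ ⟨G, hG, h'⟩
    exact ⟨fun y => F y + G y, ContMDiffOn.add hF hG, fun y => by simp [h, h']⟩
  algebraMap_mem' c := ⟨fun _ => c, contMDiffOn_const, fun _ => rfl⟩

variable {V : Set M} {x : M} {F G : M → ℝ} {X : VField M}

/-- A function that extends `a`. -/
def fn (a : smoothRing V) : M → ℝ := a.2.choose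

lemma smooth_fn (a : smoothRing V) : SmoothFn (fn a) V := a.2.choose_spec.1

/-- Evaluation at a point. -/
def ev (hx : x ∈ V) : smoothRing V →ₐ[ℝ] ℝ :=
  (Pi.evalAlgHom ℝ (fun _ : V => ℝ) ⟨x, hx⟩).comp (smoothRing V).val

lemma fn_apply (hx : x ∈ V) (a : smoothRing V) : fn a x = ev hx a := a.2.choose_spec.2 ⟨x, hx⟩

lemma ring_ext {a b : smoothRing V} (h : ∀ x (hx : x ∈ V), ev hx a = ev hx b) : a = b :=
  Subtype.ext (funext fun y => h y.1 y.2)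

open Classical in
/-- The restriction to `V` of a function smooth on `V`. -/
def toR (V : Set M) (F : M → ℝ) : smoothRing V :=
  -- The value `0` is a default; the evaluation lemma `ev_toR` requires smoothness.
  if h : SmoothFn F V then ⟨fun y => F y, F, h, fun _ => rfl⟩ else 0

lemma ev_toR (hF : SmoothFn F V) (hx : x ∈ V) : ev hx (toR V F) = F x := by
  rw [toR, dif_pos hF]; rfl

lemma fn_toR (hF : SmoothFn F V) (hx : x ∈ V) : fn (toR V F) x = F x := by
  rw [fn_apply hx, ev_toR hF]

lemma smoothFn_fn_mvfderiv (hV : IsOpen V) (hX : SmoothVF X V) (a : smoothRing V) :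
    SmoothFn (fun y => mvfderiv (𝓡 2) (fn a) y (X y)) V := smooth_mvfderiv hV (smooth_fn a) hX

/-- The derivation of the ring of smooth functions given by a vector field. -/
def der (hV : IsOpen V) (hX : SmoothVF X V) : Derivation ℝ (smoothRing V) (smoothRing V) :=
  Derivation.mk'
    { toFun := fun a => toR V fun y => mvfderiv (𝓡 2) (fn a) y (X y)
      map_add' := fun a b => ring_ext fun x hx => by
        rw [map_add, ev_toR (smoothFn_fn_mvfderiv hV hX _), ev_toR (smoothFn_fn_mvfderiv hV hX _),
          ev_toR (smoothFn_fn_mvfderiv hV hX _)]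
        -- The chosen representatives are tied to the ring only on `V`, so identities between them
        -- hold locally and pass to derivatives because `V` is open.
        rw [mvfderiv_congr (g := fun y => fn a y + fn b y)]
        · exact congrArg (fun L => L (X x)) (mvfderiv_add (SmoothFn.at (smooth_fn a) hV hx).mdiff
            (SmoothFn.at (smooth_fn b) hV hx).mdiff)
        · filter_upwards [hV.eventually_mem hx] with y hy
          simp [fn_apply hy]
      map_smul' := fun c a => ring_ext fun x hx => by
        rw [RingHom.id_apply, map_smul, ev_toR (smoothFn_fn_mvfderiv hV hX _),
          ev_toR (smoothFn_fn_mvfderiv hV hX _)]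
        rw [mvfderiv_congr (g := fun y => (fun _ => c) y * fn a y)]
        · refine (congrArg (fun L => L (X x)) (mvfderiv_mul mdifferentiableAt_const
            (SmoothFn.at (smooth_fn a) hV hx).mdiff)).trans ?_
          simp [mvfderiv_const]
        · filter_upwards [hV.eventually_mem hx] with y hy
          simp [fn_apply hy] }
    (fun a b => ring_ext fun x hx => by
      simp only [LinearMap.coe_mk, AddHom.coe_mk, smul_eq_mul, map_add, map_mul]
      rw [ev_toR (smoothFn_fn_mvfderiv hV hX _), ev_toR (smoothFn_fn_mvfderiv hV hX _),
          ev_toR (smoothFn_fn_mvfderiv hV hX _)]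
      rw [mvfderiv_congr (g := fun y => fn a y * fn b y)]
      · refine (congrArg (fun L => L (X x)) (mvfderiv_mul (SmoothFn.at (smooth_fn a) hV hx).mdiff
            (SmoothFn.at (smooth_fn b) hV hx).mdiff)).trans ?_
        rw [← fn_apply hx, ← fn_apply hx]
        rfl
      · filter_upwards [hV.eventually_mem hx] with y hy
        simp [fn_apply hy])

lemma ev_der (hV : IsOpen V) (hX : SmoothVF X V) (hx : x ∈ V) (a : smoothRing V) :
    ev hx (der hV hX a) = mvfderiv (𝓡 2) (fn a) x (X x) :=
  ev_toR (smoothFn_fn_mvfderiv hV hX a) hx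

lemma ev_der_toR (hV : IsOpen V) (hX : SmoothVF X V) (hx : x ∈ V) (hF : SmoothFn F V) :
    ev hx (der hV hX (toR V F)) = mvfderiv (𝓡 2) F x (X x) := by
  rw [ev_der, mvfderiv_congr]
  filter_upwards [hV.eventually_mem hx] with y hy using fn_toR hF hy

end ring

/-! ### Symplectic frames -/

/-- `e` is a smooth frame on `V` with `Ω(e₀, e₁) = 1`. -/
structure IsFrame (Om : Tensor M 2) (e : Fin 2 → VField M) (V : Set M) : Prop where
  isOpen : IsOpen V
  smooth : ∀ i, SmoothVF (e i) V
  unit : ∀ y ∈ V, Om y ![e 0 y, e 1 y] = 1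

section form

variable {Om : Tensor M 2} (hOm : IsSymplecticForm Om) {x : M}
include hOm

lemma IsSymplecticForm.add_left (u u' v : TangentSpace (𝓡 2) x) :
    Om x ![u + u', v] = Om x ![u, v] + Om x ![u', v] := by
  simpa only [update_two_zero, update_two_one] using
    hOm.smooth.multilinear.update_add (Set.mem_univ x) ![u, v] 0 u u'

lemma IsSymplecticForm.add_right (u v v' : TangentSpace (𝓡 2) x) :
    Om x ![u, v + v'] = Om x ![u, v] + Om x ![u, v'] := by
  simpa only [update_two_zero, update_two_one] using
    hOm.smooth.multilinear.update_add (Set.mem_univ x) ![u, v] 1 v v'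

lemma IsSymplecticForm.smul_left (c : ℝ) (u v : TangentSpace (𝓡 2) x) :
    Om x ![c • u, v] = c * Om x ![u, v] := by
  simpa only [update_two_zero, update_two_one] using
    hOm.smooth.multilinear.update_smul (Set.mem_univ x) ![u, v] 0 c u

lemma IsSymplecticForm.smul_right (c : ℝ) (u v : TangentSpace (𝓡 2) x) :
    Om x ![u, c • v] = c * Om x ![u, v] := by
  simpa only [update_two_zero, update_two_one] using
    hOm.smooth.multilinear.update_smul (Set.mem_univ x) ![u, v] 1 c v

lemma IsSymplecticForm.swap (u v : TangentSpace (𝓡 2) x) : Om x ![u, v] = -Om x ![v, u] := by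
  have := hOm.alternating x (u + v)
  simp only [hOm.add_left, hOm.add_right, hOm.alternating] at this
  linarith

lemma IsSymplecticForm.neg_left (u v : TangentSpace (𝓡 2) x) : Om x ![-u, v] = -Om x ![u, v] := by
  simpa using hOm.smul_left (-1) u v

end form

/-- The coefficients of a vector in a symplectic frame. -/
def fco {Om : Tensor M 2} (hOm : IsSymplecticForm Om) (e : Fin 2 → VField M) (i : Fin 2) (y : M) :
    TangentSpace (𝓡 2) y →ₗ[ℝ] ℝ where
  toFun v := if i = 0 then Om y ![v, e 1 y] else Om y ![e 0 y, v]
  map_add' u v := by split_ifs <;> simp [hOm.add_left, hOm.add_right]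
  map_smul' c v := by split_ifs <;> simp [hOm.smul_left, hOm.smul_right]

section frame

variable {Om : Tensor M 2} (hOm : IsSymplecticForm Om) {x : M} {V : Set M} {e : Fin 2 → VField M}

lemma fco_zero (v : TangentSpace (𝓡 2) x) : fco hOm e 0 x v = Om x ![v, e 1 x] := rfl

lemma fco_one (v : TangentSpace (𝓡 2) x) : fco hOm e 1 x v = Om x ![e 0 x, v] := rfl

variable (he : IsFrame Om e V)

include he in
lemma fco_frame (hx : x ∈ V) (i j : Fin 2) : fco hOm e i x (e j x) = if j = i then 1 else 0 := by
  have := he.unit x hx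
  fin_cases i <;> fin_cases j <;> simp [fco_zero, fco_one, this, hOm.alternating]

include hOm he in
lemma frame_indep (hx : x ∈ V) : LinearIndependent ℝ (fun i => e i x) := by
  rw [Fintype.linearIndependent_iff]
  intro g hg i
  have := congrArg (fco hOm e i x) hg
  rw [map_sum, map_zero] at this
  simpa [fco_frame hOm he hx] using this

/-- The basis of the tangent space given by a frame. -/
def frameBasis (hx : x ∈ V) : Module.Basis (Fin 2) ℝ (TangentSpace (𝓡 2) x) :=
  basisOfLinearIndependentOfCardEqFinrank (frame_indep hOm he hx)
    (by
      have : Module.finrank ℝ (TangentSpace (𝓡 2) x) = Module.finrank ℝ Plane := rfl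
      simp [this])

lemma frameBasis_apply (hx : x ∈ V) (i : Fin 2) : frameBasis hOm he hx i = e i x := by
  simp [frameBasis]

include he in
lemma eq_sum_fco (hx : x ∈ V) (v : TangentSpace (𝓡 2) x) : v = ∑ i, fco hOm e i x v • e i x := by
  have h := (frameBasis hOm he hx).sum_repr v
  simp only [frameBasis_apply] at h
  have h2 : ∀ i, fco hOm e i x v = (frameBasis hOm he hx).repr v i := fun i => by
    conv_lhs => rw [← h]
    rw [map_sum]
    simp [fco_frame hOm he hx]
  simp only [h2, h]

include hOm he in
/-- Tensors that agree on the frame are equal. -/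
lemma tensor_ext {k : ℕ} {U : Set M} {S T : Tensor M k} (hS : IsTensor U S) (hT : IsTensor U T)
    (hx : x ∈ V) (hU : x ∈ U)
    (h : ∀ I : Fin k → Fin 2, S x (fun r => e (I r) x) = T x (fun r => e (I r) x))
    (v : Fin k → TangentSpace (𝓡 2) x) : S x v = T x v := by
  obtain ⟨f, hf⟩ := hS x hU
  obtain ⟨g, hg⟩ := hT x hU
  have : f = g := Module.Basis.ext_multilinear (fun _ => frameBasis hOm he hx) fun I => by
    simp only [frameBasis_apply, ← hf, ← hg, h]
  rw [hf, hg, this]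

include he in
lemma IsTensor.update_frame {k : ℕ} {U : Set M} {T : Tensor M k} (hT : IsTensor U T)
    (hx : x ∈ V) (hU : x ∈ U) (v : Fin k → TangentSpace (𝓡 2) x) (i : Fin k)
    (w : TangentSpace (𝓡 2) x) : T x (Function.update v i w) =
      fco hOm e 0 x w * T x (Function.update v i (e 0 x)) +
      fco hOm e 1 x w * T x (Function.update v i (e 1 x)) := by
  conv_lhs => rw [eq_sum_fco hOm he hx w]
  rw [Fin.sum_univ_two, hT.update_add hU, hT.update_smul hU, hT.update_smul hU]

lemma smooth_fco [T2Space M] (he : IsFrame Om e V) (hx : x ∈ V) {X : VField M}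
    (hX : SmoothVFAt X x) (i : Fin 2) : SmoothFnAt (fun y => fco hOm e i y (X y)) x := by
  have key : ∀ A B : VField M, SmoothVFAt A x → SmoothVFAt B x →
      SmoothFnAt (fun y => Om y ![A y, B y]) x := fun A B hA hB => by
    have := hOm.smooth.smoothAt Filter.univ_mem (X := ![A, B])
      (by intro i; fin_cases i; exacts [hA, hB])
    refine this.congr (Filter.Eventually.of_forall fun y => ?_)
    congr 1
    funext i
    fin_cases i <;> rfl
  fin_cases i
  · exact key _ _ hX (SmoothVF.at (he.smooth 1) he.isOpen hx)
  · exact key _ _ (SmoothVF.at (he.smooth 0) he.isOpen hx) hX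

end frame

end

/-! ### Coordinate frames and the components of a connection. -/

section

variable {M : Type*} [TopologicalSpace M] [ChartedSpace Plane M] [IsManifold (𝓡 2) ∞ M] [T2Space M]

/-- The coordinate vector fields of the chart at `x`. -/
def coordVF (x : M) (i : Fin 2) : VField M := extVec (frame x i)

/-- The extension of a vector at `x` is constant in the trivialization at `x`, whose coordinate
change at `x` is the identity. Hence `coordVF` really consists of coordinate fields. -/
lemma coordVF_eq_symmL {x y : M} (hy : y ∈ (chartAt Plane x).source) (i : Fin 2) :
    coordVF x i y = (trivializationAt Plane (fun z : M => TangentSpace (𝓡 2) z) x).symmL ℝ y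
      (EuclideanSpace.single i (1 : ℝ) : Plane) := by
  have h1 : IsManifold (𝓡 2) 1 M := IsManifold.of_le (n := ∞) (by simp)
  have hx := mem_chart_source Plane x
  rw [coordVF, extVec, FiberBundle.extend, Bundle.Trivialization.symmL_apply _ hy]
  congr 1
  rw [← Bundle.Trivialization.continuousLinearMapAt_apply_of_mem (R := ℝ) _ hx,
    TangentBundle.continuousLinearMapAt_trivializationAt_eq_core hx]
  exact (tangentBundleCore (𝓡 2) M).coordChange_self (achart Plane x) x hx _

/-- This is the shape in which the coordinate fields enter the definition of `area`. -/
lemma coordVF_apply {x y : M} (hy : y ∈ (chartAt Plane x).source) (i : Fin 2) :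
    coordVF x i y = mfderiv 𝓘(ℝ, Plane) (𝓡 2) (chartAt Plane x).symm (chartAt Plane x y)
      (EuclideanSpace.single i (1 : ℝ) : Plane) := by
  have h1 : IsManifold (𝓡 2) 1 M := IsManifold.of_le (n := ∞) (by simp)
  have h := TangentBundle.symmL_trivializationAt (I := 𝓡 2) hy
  have hr : Set.range (𝓡 2) = Set.univ := (𝓡 2).range_eq_univ
  rw [hr, mfderivWithin_univ] at h
  exact (coordVF_eq_symmL hy i).trans
    (congrArg (fun L => L (EuclideanSpace.single i (1 : ℝ) : Plane)) h)

lemma coordVF_smooth (x : M) (i : Fin 2) :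
    SmoothVF (coordVF x i) (chartAt Plane x).source := by
  let e := trivializationAt Plane (fun y : M => TangentSpace (𝓡 2) y) x
  have h := e.contMDiffOn_localFrame_baseSet (I := 𝓡 2) ∞ (EuclideanSpace.basisFun (Fin 2) ℝ).toBasis i
  refine h.congr fun y hy => ?_
  rw [coordVF_eq_symmL hy, Bundle.Trivialization.localFrame_apply_of_mem_baseSet _ _ hy,
    Bundle.Trivialization.symmL_apply _ hy]
  simp [Bundle.Trivialization.basisAt, e]

lemma coordVF_indep {x y : M} (hy : y ∈ (chartAt Plane x).source) :
    LinearIndependent ℝ (fun i => coordVF x i y) := by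
  let e := trivializationAt Plane (fun y : M => TangentSpace (𝓡 2) y) x
  rw [Fintype.linearIndependent_iff]
  intro g hg i
  have h1 := congrArg (e.continuousLinearMapAt ℝ y) hg
  simp only [coordVF_eq_symmL hy, map_sum, map_smul, map_zero] at h1
  have h2 : ∀ j, e.continuousLinearMapAt ℝ y (e.symmL ℝ y (EuclideanSpace.single j (1 : ℝ))) =
    EuclideanSpace.single j (1 : ℝ) := fun j => e.continuousLinearMapAt_symmL hy _
  have h3 : ∑ j, g j • (EuclideanSpace.single j (1 : ℝ) : Plane) = 0 := by
    rw [← h1]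
    exact Finset.sum_congr rfl fun j _ => by rw [h2]
  have h4 := congrArg (fun v : Plane => v i) h3
  fin_cases i <;> simpa using h4

variable {Om : Tensor M 2} {D : Conn M} {U V : Set M} {e : Fin 2 → VField M}

/-- The density of `Ω` in the chart at `x`. -/
def dens (Om : Tensor M 2) (x y : M) : ℝ := Om y ![coordVF x 0 y, coordVF x 1 y]

lemma dens_ne_zero (hOm : IsSymplecticForm Om) {x y : M} (hy : y ∈ (chartAt Plane x).source) :
    dens Om x y ≠ 0 := by
  intro h0
  have hi := coordVF_indep hy
  have h1 : coordVF x 0 y ≠ 0 := hi.ne_zero 0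
  obtain ⟨w, hw⟩ := hOm.nondegenerate y _ h1
  apply hw
  have hfr : Module.finrank ℝ (TangentSpace (𝓡 2) y) = Module.finrank ℝ Plane := rfl
  let b := basisOfLinearIndependentOfCardEqFinrank hi (by simp [hfr])
  have h2 := b.sum_repr w
  simp only [b, Fin.sum_univ_two, coe_basisOfLinearIndependentOfCardEqFinrank] at h2
  rw [← h2, hOm.add_right, hOm.smul_right, hOm.smul_right, hOm.alternating]
  rw [dens] at h0
  rw [h0]; ring

lemma smooth_dens (hOm : IsSymplecticForm Om) (x : M) :
    SmoothFn (dens Om x) (chartAt Plane x).source := by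
  refine smoothFn_of_at fun y hy => ?_
  have hs : ∀ i, SmoothVFAt (coordVF x i) y := fun i =>
    SmoothVF.at (coordVF_smooth x i) (chartAt Plane x).open_source hy
  have := hOm.smooth.smoothAt Filter.univ_mem (x := y) (X := ![coordVF x 0, coordVF x 1])
    (by intro i; fin_cases i; exacts [hs 0, hs 1])
  refine this.congr (Filter.Eventually.of_forall fun y => ?_)
  unfold dens
  congr 1
  funext i
  fin_cases i <;> rfl

/-- The symplectic frame `∂₀, ω⁻¹ ∂₁` of the chart at `x`. -/
def chartFrame (Om : Tensor M 2) (x : M) : Fin 2 → VField M :=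
  ![coordVF x 0, fun y => (dens Om x y)⁻¹ • coordVF x 1 y]

lemma isFrame_chartFrame (hOm : IsSymplecticForm Om) (x : M) (hV : IsOpen V)
    (hVx : V ⊆ (chartAt Plane x).source) : IsFrame Om (chartFrame Om x) V where
  isOpen := hV
  smooth i := by
    refine smoothVF_of_at fun y hy => ?_
    have hs : ∀ i, SmoothVFAt (coordVF x i) y := fun i =>
      SmoothVF.at (coordVF_smooth x i) (chartAt Plane x).open_source (hVx hy)
    fin_cases i
    · exact hs 0
    · exact SmoothVFAt.smul (SmoothFnAt.inv (SmoothFn.at (smooth_dens hOm x)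
        (chartAt Plane x).open_source (hVx hy)) (dens_ne_zero hOm (hVx hy))) (hs 1)
  unit y hy := by
    have h := dens_ne_zero hOm (hVx hy)
    change Om y ![coordVF x 0 y, (dens Om x y)⁻¹ • coordVF x 1 y] = 1
    rw [hOm.smul_right]
    exact inv_mul_cancel₀ h

/-! ### The components of a symplectic connection -/

section conn

variable (hOm : IsSymplecticForm Om) (hD : IsSymplecticConnection Om D U) (hU : IsOpen U)
  (he : IsFrame Om e V) (hVU : V ⊆ U) {x : M}

lemma IsFrame.at (he : IsFrame Om e V) (hx : x ∈ V) (i : Fin 2) : SmoothVFAt (e i) x :=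
  SmoothVF.at (he.smooth i) he.isOpen hx

/-- The components of a vector field. -/
def compV (V : Set M) (e : Fin 2 → VField M) (X : VField M) (k : Fin 2) : smoothRing V :=
  toR V fun y => fco hOm e k y (X y)

lemma smoothFn_fco (he : IsFrame Om e V) {X : VField M} (hX : SmoothVF X V) (k : Fin 2) :
    SmoothFn (fun y => fco hOm e k y (X y)) V :=
  smoothFn_of_at fun _ hy => smooth_fco hOm he hy (SmoothVF.at hX he.isOpen hy) k

lemma ev_compV (he : IsFrame Om e V) (hx : x ∈ V) {X : VField M} (hX : SmoothVF X V) (k : Fin 2) :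
    ev hx (compV hOm V e X k) = fco hOm e k x (X x) :=
  ev_toR (smoothFn_fco hOm he hX k) hx

include hD hU hVU he in
lemma smooth_nabla {X Y : VField M} (hX : SmoothVF X V) (hY : SmoothVF Y V) :
    SmoothVF (fun y => D Y y (X y)) V :=
  smoothVF_of_at fun _ hy => hD.smoothAt (hU.mem_nhds (hVU hy))
    (SmoothVF.at hX he.isOpen hy) (SmoothVF.at hY he.isOpen hy)

include hOm hD hU hVU he in
-- Differentiate `Ω(e₀, e₁) = 1` along `v` and use that `Ω` is parallel.
lemma fco_trace (hx : x ∈ V) (v : TangentSpace (𝓡 2) x) :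
    fco hOm e 1 x (D (e 1) x v) = -fco hOm e 0 x (D (e 0) x v) := by
  have h := covD_apply (Om := Om) (T := Om) (X := ![extVec v, e 0, e 1]) hD hU (hVU hx)
    ⟨fun x _ => hOm.smooth.multilinear x trivial, fun X hX => (hOm.smooth.smooth X hX).mono
      (Set.subset_univ _)⟩
      (by intro i; fin_cases i; exacts [smoothVFAt_extVec v, he.at hx 0, he.at hx 1])
  have h1 : mvfderiv (𝓡 2) (fun y => Om y (fun i => ![extVec v, e 0, e 1] (Fin.succ i) y)) x = 0 := by
    rw [mvfderiv_congr (g := fun _ => (1 : ℝ)), mvfderiv_const]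
    filter_upwards [he.isOpen.eventually_mem hx] with y hy
    rw [← he.unit y hy]
    congr 1
    funext i
    fin_cases i <;> rfl
  have h2 : (fun i => (![extVec v, e 0, e 1] : Fin 3 → VField M) (Fin.succ i) x) =
      ![e 0 x, e 1 x] := by
    funext i
    fin_cases i <;> rfl
  rw [hD.parallel x (hVU hx), covE, h1, h2, Fin.sum_univ_two, update_two_zero, update_two_one] at h
  simp only [Matrix.cons_val_zero, extVec_self] at h
  rw [fco_zero, fco_one]
  have h3 : (0 : ℝ) = 0 - (Om x ![D (e 0) x v, e 1 x] + Om x ![e 0 x, D (e 1) x v]) := h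
  linarith

/-- The components of a symplectic connection in a symplectic frame. -/
def frameConn : FrameConn (smoothRing V) where
  d i := der he.isOpen (he.smooth i)
  G i j k := compV hOm V e (fun y => D (e j) y (e i y)) k
  tr i := ring_ext fun x hx => by
    rw [map_neg, ev_compV hOm he hx (smooth_nabla hD hU he hVU (he.smooth i) (he.smooth 1)),
      ev_compV hOm he hx (smooth_nabla hD hU he hVU (he.smooth i) (he.smooth 0)),
      fco_trace hOm hD hU he hVU hx]
  comm f := ring_ext fun x hx => by
    have hs := fun i j => smooth_nabla hD hU he hVU (he.smooth i) (he.smooth j)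
    have hf : SmoothFnAt (fn f) x := SmoothFn.at (smooth_fn f) he.isOpen hx
    -- By torsion-freeness the bracket of the frame fields is `∇₀e₁ - ∇₁e₀`, whose frame
    -- coefficients are the ones in the commutation rule.
    have h := commutator_apply hf (he.at hx 0) (he.at hx 1)
    rw [hD.bracket (hVU hx) (he.at hx 0) (he.at hx 1), eq_sum_fco hOm he hx (_ - _)] at h
    simp only [map_sub, map_mul, ev_compV hOm he hx (hs _ _)]
    have hd : ∀ i j, ev hx (der he.isOpen (he.smooth i) (der he.isOpen (he.smooth j) f)) =
        mvfderiv (𝓡 2) (fun y => mvfderiv (𝓡 2) (fn f) y (e j y)) x (e i x) := fun i j =>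
      ev_der_toR he.isOpen (he.smooth i) hx (smoothFn_fn_mvfderiv he.isOpen (he.smooth j) f)
    rw [hd, hd, ev_der, ev_der]
    simp only [Fin.sum_univ_two, map_add, map_smul, map_sub, smul_eq_mul] at h
    linarith

lemma ev_G (hx : x ∈ V) (i j k : Fin 2) :
    ev hx ((frameConn hOm hD hU he hVU).G i j k) = fco hOm e k x (D (e j) x (e i x)) :=
  ev_compV hOm he hx (smooth_nabla hD hU he hVU (he.smooth i) (he.smooth j)) k

lemma ev_d (hx : x ∈ V) {F : M → ℝ} (hF : SmoothFn F V) (i : Fin 2) :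
    ev hx ((frameConn hOm hD hU he hVU).d i (toR V F)) = mvfderiv (𝓡 2) F x (e i x) :=
  ev_der_toR he.isOpen (he.smooth i) hx hF

lemma compV_nabla {X : VField M} (hX : SmoothVF X V) (i k : Fin 2) :
    compV hOm V e (fun y => D X y (e i y)) k =
      (frameConn hOm hD hU he hVU).covV (compV hOm V e X) i k := by
  refine ring_ext fun x hx => ?_
  have hc := fun j => SmoothFn.at (smoothFn_fco hOm he hX j) he.isOpen hx
  rw [ev_compV hOm he hx (smooth_nabla hD hU he hVU (he.smooth i) hX), FrameConn.covV,
    Fin.sum_univ_two, map_add, map_add, map_mul, map_mul, ev_G, ev_G, ev_compV hOm he hx hX,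
    ev_compV hOm he hx hX, compV, ev_d hOm hD hU he hVU hx (smoothFn_fco hOm he hX k)]
  rw [hD.congr (hU.mem_nhds (hVU hx)) (SmoothVF.at hX he.isOpen hx)
    (Y := fun y => fco hOm e 0 y (X y) • e 0 y + fco hOm e 1 y (X y) • e 1 y)
    ((SmoothVFAt.smul (hc 0) (he.at hx 0)).add (SmoothVFAt.smul (hc 1) (he.at hx 1))),
    hD.add (hVU hx) (SmoothVFAt.smul (hc 0) (he.at hx 0)) (SmoothVFAt.smul (hc 1) (he.at hx 1)),
    add_apply, hD.smul (hVU hx) (hc 0) (he.at hx 0), hD.smul (hVU hx) (hc 1) (he.at hx 1)]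
  · simp only [map_add, map_smul, fco_frame hOm he hx, smul_eq_mul]
    fin_cases k <;> simp <;> ring
  · filter_upwards [he.isOpen.eventually_mem hx] with y hy
    rw [← Fin.sum_univ_two (fun i => fco hOm e i y (X y) • e i y)]
    exact eq_sum_fco hOm he hy (X y)

end conn

end

/-! ### Frame components of tensors, curvature and the Ricci tensor. -/

section

variable {M : Type*} [TopologicalSpace M] [ChartedSpace Plane M] [IsManifold (𝓡 2) ∞ M] [T2Space M]

variable {Om : Tensor M 2} {D : Conn M} {U V : Set M} {e : Fin 2 → VField M} {x : M} {k : ℕ}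
  {T : Tensor M k}

/-- The components of a tensor field. -/
def comp (V : Set M) (e : Fin 2 → VField M) (T : Tensor M k) (I : Fin k → Fin 2) : smoothRing V :=
  toR V fun y => T y (fun r => e (I r) y)

lemma smoothFn_comp (he : IsFrame Om e V) (hVU : V ⊆ U) (hU : IsOpen U) (hT : IsSmoothTensor U T)
    (I : Fin k → Fin 2) : SmoothFn (fun y => T y (fun r => e (I r) y)) V :=
  smoothFn_of_at fun _ hy => hT.smoothAt (hU.mem_nhds (hVU hy)) fun r => he.at hy (I r)

lemma ev_comp (he : IsFrame Om e V) (hVU : V ⊆ U) (hU : IsOpen U) (hT : IsSmoothTensor U T)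
    (I : Fin k → Fin 2) (hx : x ∈ V) : ev hx (comp V e T I) = T x (fun r => e (I r) x) :=
  ev_toR (smoothFn_comp he hVU hU hT I) hx

variable (hOm : IsSymplecticForm Om) (hD : IsSymplecticConnection Om D U) (hU : IsOpen U)
  (he : IsFrame Om e V) (hVU : V ⊆ U)

lemma comp_covD (hT : IsSmoothTensor U T) (J : Fin (k + 1) → Fin 2) :
    comp V e (covD D T) J = (frameConn hOm hD hU he hVU).d (J 0) (comp V e T fun r => J r.succ)
      - ∑ r, ∑ p, (frameConn hOm hD hU he hVU).G (J 0) (J r.succ) p *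
        comp V e T (Function.update (fun r => J r.succ) r p) := by
  refine ring_ext fun x hx => ?_
  rw [ev_comp he hVU hU (hT.covD hD hU) _ hx,
    covD_apply (X := fun r => e (J r)) hD hU (hVU hx) hT (fun r => he.at hx _), covE]
  simp only [map_sub, map_sum, map_mul, ev_G]
  rw [comp, ev_d hOm hD hU he hVU hx (smoothFn_comp he hVU hU hT _)]
  congr 1
  refine Finset.sum_congr rfl fun r _ => ?_
  rw [hT.multilinear.update_frame hOm he hx (hVU hx), Fin.sum_univ_two]
  have hupd : ∀ p, Function.update (fun j : Fin k => e (J j.succ) x) r (e p x) =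
      fun j => e (Function.update (fun r : Fin k => J r.succ) r p j) x := fun p => by
    funext j
    by_cases h : j = r
    · subst h; simp
    · simp [h]
  rw [hupd, hupd, ev_comp he hVU hU hT, ev_comp he hVU hU hT]

/-- The components of a one-form. -/
def comp1 (V : Set M) (e : Fin 2 → VField M) (T : Tensor M 1) (i : Fin 2) : smoothRing V :=
  comp V e T ![i]

/-- The components of a two-tensor. -/
def comp2 (V : Set M) (e : Fin 2 → VField M) (T : Tensor M 2) (i j : Fin 2) : smoothRing V :=
  comp V e T ![i, j]

/-- The components of a three-tensor. -/
def comp3 (V : Set M) (e : Fin 2 → VField M) (T : Tensor M 3) (i j k : Fin 2) : smoothRing V :=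
  comp V e T ![i, j, k]

/-- The components of a four-tensor. -/
def comp4 (V : Set M) (e : Fin 2 → VField M) (T : Tensor M 4) (i j k l : Fin 2) : smoothRing V :=
  comp V e T ![i, j, k, l]

lemma succ_one (i j : Fin 2) : (fun r : Fin 1 => ![i, j] r.succ) = ![j] := by
  funext r; fin_cases r; rfl

lemma succ_two (i j k : Fin 2) : (fun r : Fin 2 => ![i, j, k] r.succ) = ![j, k] := by
  funext r; fin_cases r <;> rfl

lemma succ_three (i j k l : Fin 2) : (fun r : Fin 3 => ![i, j, k, l] r.succ) = ![j, k, l] := by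
  funext r; fin_cases r <;> rfl

lemma comp2_covD {T : Tensor M 1} (hT : IsSmoothTensor U T) (i j : Fin 2) :
    comp2 V e (covD D T) i j = (frameConn hOm hD hU he hVU).cov1 (comp1 V e T) i j := by
  rw [comp2, comp_covD hOm hD hU he hVU hT]
  simp only [succ_one, Fin.sum_univ_one, update_one, FrameConn.cov1, comp1]
  rfl

lemma comp3_covD {T : Tensor M 2} (hT : IsSmoothTensor U T) (i j k : Fin 2) :
    comp3 V e (covD D T) i j k = (frameConn hOm hD hU he hVU).cov2 (comp2 V e T) i j k := by
  rw [comp3, comp_covD hOm hD hU he hVU hT, FrameConn.cov2, sub_sub]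
  simp only [succ_two]
  rw [Fin.sum_univ_two]
  simp only [update_two_zero, update_two_one, comp2]
  rfl

lemma comp4_covD {T : Tensor M 3} (hT : IsSmoothTensor U T) (i j k l : Fin 2) :
    comp4 V e (covD D T) i j k l =
      (frameConn hOm hD hU he hVU).cov3 (comp3 V e T) i j k l := by
  rw [comp4, comp_covD hOm hD hU he hVU hT, FrameConn.cov3, sub_sub, sub_sub]
  simp only [succ_three]
  rw [Fin.sum_univ_three]
  simp only [update_three_zero, update_three_one, update_three_two, comp3]
  rw [add_assoc]
  rfl

lemma frame_vec1 (i : Fin 2) (y : M) : (fun r => e (![i] r) y) = ![e i y] := by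
  funext r; fin_cases r; rfl

lemma frame_vec2 (i j : Fin 2) (y : M) : (fun r => e (![i, j] r) y) = ![e i y, e j y] := by
  funext r; fin_cases r <;> rfl

lemma frame_vec3 (i j k : Fin 2) (y : M) :
    (fun r => e (![i, j, k] r) y) = ![e i y, e j y, e k y] := by
  funext r; fin_cases r <;> rfl

lemma frame_vec4 (i j k l : Fin 2) (y : M) :
    (fun r => e (![i, j, k, l] r) y) = ![e i y, e j y, e k y, e l y] := by
  funext r; fin_cases r <;> rfl

section evComp

include he hVU hU

lemma ev_comp1 {T : Tensor M 1} (hT : IsSmoothTensor U T) (hx : x ∈ V) (i : Fin 2) :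
    ev hx (comp1 V e T i) = T x ![e i x] := by
  rw [comp1, ev_comp he hVU hU hT, frame_vec1]

lemma ev_comp2 {T : Tensor M 2} (hT : IsSmoothTensor U T) (hx : x ∈ V) (i j : Fin 2) :
    ev hx (comp2 V e T i j) = T x ![e i x, e j x] := by
  rw [comp2, ev_comp he hVU hU hT, frame_vec2]

lemma ev_comp3 {T : Tensor M 3} (hT : IsSmoothTensor U T) (hx : x ∈ V) (i j k : Fin 2) :
    ev hx (comp3 V e T i j k) = T x ![e i x, e j x, e k x] := by
  rw [comp3, ev_comp he hVU hU hT, frame_vec3]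

lemma ev_comp4 {T : Tensor M 4} (hT : IsSmoothTensor U T) (hx : x ∈ V) (i j k l : Fin 2) :
    ev hx (comp4 V e T i j k l) = T x ![e i x, e j x, e k x, e l x] := by
  rw [comp4, ev_comp he hVU hU hT, frame_vec4]

end evComp

lemma ev_covV (hx : x ∈ V) {X : VField M} (hX : SmoothVF X V) (i k : Fin 2) :
    ev hx ((frameConn hOm hD hU he hVU).covV (compV hOm V e X) i k) =
      fco hOm e k x (D X x (e i x)) := by
  rw [← compV_nabla hOm hD hU he hVU hX,
    ev_compV hOm he hx (smooth_nabla hD hU he hVU (he.smooth i) hX)]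

lemma fco_curv (hx : x ∈ V) (i j k l : Fin 2) :
    fco hOm e l x (curv D x (e i x) (e j x) (e k x)) =
      ev hx ((frameConn hOm hD hU he hVU).curv i j k l) := by
  have hs := fun i j => smooth_nabla hD hU he hVU (he.smooth i) (he.smooth j)
  have hG : ∀ i j, (frameConn hOm hD hU he hVU).G i j =
    compV hOm V e (fun y => D (e j) y (e i y)) := fun i j => rfl
  have h1 : ∀ i j k l, fco hOm e l x (D (fun y => D (e k) y (e j y)) x (e i x)) =
      ev hx ((frameConn hOm hD hU he hVU).d i ((frameConn hOm hD hU he hVU).G j k l)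
        + ∑ p, (frameConn hOm hD hU he hVU).G i p l * (frameConn hOm hD hU he hVU).G j k p) := by
    intro i j k l
    rw [← ev_covV hOm hD hU he hVU hx (hs j k), ← hG]
    rfl
  rw [hD.curv_apply hU (hVU hx) (he.at hx i) (he.at hx j) (he.at hx k), curvE, map_sub, map_sub,
    h1, h1, eq_sum_fco hOm he hx (D (e j) x (e i x) - D (e i) x (e j x)), FrameConn.curv]
  simp only [Fin.sum_univ_two, map_add, map_sub, map_smul, map_mul, smul_eq_mul, ev_G]
  ring

lemma ric_frame (hx : x ∈ V) (j k : Fin 2) :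
    ric D x ![e j x, e k x] = ev hx ((frameConn hOm hD hU he hVU).ric j k) := by
  have := trace_eq (hD.curvLin hU (hVU hx) (e j x) (e k x)) (fun i => e i x)
    (fun i => fco hOm e i x) (fun v => eq_sum_fco hOm he hx v)
  refine this.trans ?_
  simp only [FrameConn.ric, map_sum, ← fco_curv hOm hD hU he hVU hx]
  rfl

lemma comp2_ric : comp2 V e (ric D) = (frameConn hOm hD hU he hVU).ric := by
  funext j k
  refine ring_ext fun x hx => ?_
  rw [ev_comp2 hU he hVU (hD.smooth_ric hU), ric_frame hOm hD hU he hVU hx]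

section bivector

include hOm he

/-- The bivector `Ω^{ij}` is `e₀ ∧ e₁`. -/
lemma bivector_sum (hx : x ∈ V) (B : TangentSpace (𝓡 2) x → TangentSpace (𝓡 2) x → ℝ)
    (h1 : ∀ u u' v, B (u + u') v = B u v + B u' v) (h2 : ∀ (c : ℝ) u v, B (c • u) v = c * B u v)
    (h3 : ∀ u v v', B u (v + v') = B u v + B u v') (h4 : ∀ (c : ℝ) u v, B u (c • v) = c * B u v) :
    ∑ i, ∑ p, bivector Om x i p * B (frame x i) (frame x p) =
      B (e 0 x) (e 1 x) - B (e 1 x) (e 0 x) := by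
  set w := Om x ![frame x 0, frame x 1] with hw
  have hM : (Matrix.of fun i j => Om x ![frame x i, frame x j]) = !![0, w; -w, 0] := by
    ext i j
    fin_cases i <;> fin_cases j
    · simp [hOm.alternating]
    · simp [hw]
    · simp only [hw, Matrix.of_apply]
      exact hOm.swap _ _
    · simp [hOm.alternating]
  -- The skew part of a bilinear form scales by the determinant of the change of basis. Applied to
  -- `Ω` this identifies the determinant with `1/w`, the entry of the bivector; applied to `B` it
  -- gives the claim.
  have hfr : ∀ u v : TangentSpace (𝓡 2) x, ∀ C : TangentSpace (𝓡 2) x → TangentSpace (𝓡 2) x → ℝ,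
      (∀ u u' v, C (u + u') v = C u v + C u' v) → (∀ (c : ℝ) u v, C (c • u) v = c * C u v) →
      (∀ u v v', C u (v + v') = C u v + C u v') → (∀ (c : ℝ) u v, C u (c • v) = c * C u v) →
      C u v - C v u = (coframe x 0 u * coframe x 1 v - coframe x 1 u * coframe x 0 v) *
        (C (frame x 0) (frame x 1) - C (frame x 1) (frame x 0)) := by
    intro u v C h1 h2 h3 h4
    conv_lhs => rw [vec_eq_sum x u, vec_eq_sum x v]
    simp only [Fin.sum_univ_two, h1, h2, h3, h4]
    ring
  have hO := hfr (e 0 x) (e 1 x) (fun u v => Om x ![u, v]) hOm.add_left hOm.smul_left hOm.add_right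
    hOm.smul_right
  have hB := hfr (e 0 x) (e 1 x) B h1 h2 h3 h4
  have hu := he.unit x hx
  rw [hOm.swap (e 1 x), hOm.swap (frame x 1), ← hw, hu] at hO
  set c := coframe x 0 (e 0 x) * coframe x 1 (e 1 x) - coframe x 1 (e 0 x) * coframe x 0 (e 1 x)
  have hcw : c * w = 1 := by linarith
  have hw0 : w ≠ 0 := right_ne_zero_of_mul_eq_one hcw
  have hc : c = w⁻¹ := eq_inv_of_mul_eq_one_left hcw
  have hbiv : bivector Om x = !![0, w⁻¹; -w⁻¹, 0] := by
    rw [bivector, hM]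
    have : (!![0, w; -w, 0] : Matrix (Fin 2) (Fin 2) ℝ)⁻¹ = !![0, -w⁻¹; w⁻¹, 0] := by
      refine Matrix.inv_eq_right_inv ?_
      ext i j
      fin_cases i <;> fin_cases j <;> simp [hw0]
    rw [this]
    ext i j
    fin_cases i <;> fin_cases j <;> simp
  rw [hB, hc, hbiv]
  simp [Fin.sum_univ_two]
  ring

end bivector

end

/-! ### Contractions, `ρ` and the moment map in a symplectic frame. -/

section

variable {M : Type*} [TopologicalSpace M] [ChartedSpace Plane M] [IsManifold (𝓡 2) ∞ M] [T2Space M]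

variable {Om : Tensor M 2} {D : Conn M} {U V : Set M} {e : Fin 2 → VField M} {x : M} {k : ℕ}

section linear

variable {T : Tensor M k} {a b c u v w : TangentSpace (𝓡 2) x} (r : ℝ)

lemma IsTensor.add1 {T : Tensor M 1} (hT : IsTensor U T) (hx : x ∈ U) :
    T x ![a + b] = T x ![a] + T x ![b] := by
  simpa only [update_one] using hT.update_add hx ![a] 0 a b

lemma IsTensor.smul1 {T : Tensor M 1} (hT : IsTensor U T) (hx : x ∈ U) :
    T x ![r • a] = r * T x ![a] := by
  simpa only [update_one] using hT.update_smul hx ![a] 0 r a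

lemma IsTensor.add20 {T : Tensor M 2} (hT : IsTensor U T) (hx : x ∈ U) :
    T x ![a + b, u] = T x ![a, u] + T x ![b, u] := by
  simpa only [update_two_zero] using hT.update_add hx ![a, u] 0 a b

lemma IsTensor.add21 {T : Tensor M 2} (hT : IsTensor U T) (hx : x ∈ U) :
    T x ![u, a + b] = T x ![u, a] + T x ![u, b] := by
  simpa only [update_two_one] using hT.update_add hx ![u, a] 1 a b

lemma IsTensor.smul20 {T : Tensor M 2} (hT : IsTensor U T) (hx : x ∈ U) :
    T x ![r • a, u] = r * T x ![a, u] := by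
  simpa only [update_two_zero] using hT.update_smul hx ![a, u] 0 r a

lemma IsTensor.smul21 {T : Tensor M 2} (hT : IsTensor U T) (hx : x ∈ U) :
    T x ![u, r • a] = r * T x ![u, a] := by
  simpa only [update_two_one] using hT.update_smul hx ![u, a] 1 r a

lemma IsTensor.add30 {T : Tensor M 3} (hT : IsTensor U T) (hx : x ∈ U) :
    T x ![a + b, u, v] = T x ![a, u, v] + T x ![b, u, v] := by
  simpa only [update_three_zero] using hT.update_add hx ![a, u, v] 0 a b

lemma IsTensor.add31 {T : Tensor M 3} (hT : IsTensor U T) (hx : x ∈ U) :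
    T x ![u, a + b, v] = T x ![u, a, v] + T x ![u, b, v] := by
  simpa only [update_three_one] using hT.update_add hx ![u, a, v] 1 a b

lemma IsTensor.add32 {T : Tensor M 3} (hT : IsTensor U T) (hx : x ∈ U) :
    T x ![u, v, a + b] = T x ![u, v, a] + T x ![u, v, b] := by
  simpa only [update_three_two] using hT.update_add hx ![u, v, a] 2 a b

lemma IsTensor.smul30 {T : Tensor M 3} (hT : IsTensor U T) (hx : x ∈ U) :
    T x ![r • a, u, v] = r * T x ![a, u, v] := by
  simpa only [update_three_zero] using hT.update_smul hx ![a, u, v] 0 r a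

lemma IsTensor.smul31 {T : Tensor M 3} (hT : IsTensor U T) (hx : x ∈ U) :
    T x ![u, r • a, v] = r * T x ![u, a, v] := by
  simpa only [update_three_one] using hT.update_smul hx ![u, a, v] 1 r a

lemma IsTensor.smul32 {T : Tensor M 3} (hT : IsTensor U T) (hx : x ∈ U) :
    T x ![u, v, r • a] = r * T x ![u, v, a] := by
  simpa only [update_three_two] using hT.update_smul hx ![u, v, a] 2 r a

lemma update_four_zero {α : Type*} (a b c d w : α) :
    Function.update ![a, b, c, d] 0 w = ![w, b, c, d] := by
  funext i; fin_cases i <;> rfl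

lemma update_four_one {α : Type*} (a b c d w : α) :
    Function.update ![a, b, c, d] 1 w = ![a, w, c, d] := by
  funext i; fin_cases i <;> rfl

lemma update_four_two {α : Type*} (a b c d w : α) :
    Function.update ![a, b, c, d] 2 w = ![a, b, w, d] := by
  funext i; fin_cases i <;> rfl

lemma update_four_three {α : Type*} (a b c d w : α) :
    Function.update ![a, b, c, d] 3 w = ![a, b, c, w] := by
  funext i; fin_cases i <;> rfl

lemma IsTensor.add40 {T : Tensor M 4} (hT : IsTensor U T) (hx : x ∈ U) :
    T x ![a + b, u, v, w] = T x ![a, u, v, w] + T x ![b, u, v, w] := by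
  simpa only [update_four_zero] using hT.update_add hx ![a, u, v, w] 0 a b

lemma IsTensor.smul40 {T : Tensor M 4} (hT : IsTensor U T) (hx : x ∈ U) :
    T x ![r • a, u, v, w] = r * T x ![a, u, v, w] := by
  simpa only [update_four_zero] using hT.update_smul hx ![a, u, v, w] 0 r a

lemma IsTensor.add41 {T : Tensor M 4} (hT : IsTensor U T) (hx : x ∈ U) :
    T x ![u, a + b, v, w] = T x ![u, a, v, w] + T x ![u, b, v, w] := by
  simpa only [update_four_one] using hT.update_add hx ![u, a, v, w] 1 a b

lemma IsTensor.smul41 {T : Tensor M 4} (hT : IsTensor U T) (hx : x ∈ U) :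
    T x ![u, r • a, v, w] = r * T x ![u, a, v, w] := by
  simpa only [update_four_one] using hT.update_smul hx ![u, a, v, w] 1 r a

lemma IsTensor.add42 {T : Tensor M 4} (hT : IsTensor U T) (hx : x ∈ U) :
    T x ![u, v, a + b, w] = T x ![u, v, a, w] + T x ![u, v, b, w] := by
  simpa only [update_four_two] using hT.update_add hx ![u, v, a, w] 2 a b

lemma IsTensor.smul42 {T : Tensor M 4} (hT : IsTensor U T) (hx : x ∈ U) :
    T x ![u, v, r • a, w] = r * T x ![u, v, a, w] := by
  simpa only [update_four_two] using hT.update_smul hx ![u, v, a, w] 2 r a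

lemma IsTensor.add43 {T : Tensor M 4} (hT : IsTensor U T) (hx : x ∈ U) :
    T x ![u, v, w, a + b] = T x ![u, v, w, a] + T x ![u, v, w, b] := by
  simpa only [update_four_three] using hT.update_add hx ![u, v, w, a] 3 a b

lemma IsTensor.smul43 {T : Tensor M 4} (hT : IsTensor U T) (hx : x ∈ U) :
    T x ![u, v, w, r • a] = r * T x ![u, v, w, a] := by
  simpa only [update_four_three] using hT.update_smul hx ![u, v, w, a] 3 r a

end linear

section contraction

variable (hOm : IsSymplecticForm Om) (he : IsFrame Om e V)

/-- The complete contraction of two tensors at a point, computed in a symplectic frame. -/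
def contrE (e : Fin 2 → VField M) (x : M) : {k : ℕ} → ((Fin k → TangentSpace (𝓡 2) x) → ℝ) →
    ((Fin k → TangentSpace (𝓡 2) x) → ℝ) → ℝ
  | 0, a, b => a ![] * b ![]
  | _ + 1, a, b =>
    contrE e x (fun v => a (Fin.cons (e 0 x) v)) (fun v => b (Fin.cons (e 1 x) v))
    - contrE e x (fun v => a (Fin.cons (e 1 x) v)) (fun v => b (Fin.cons (e 0 x) v))

include hOm he in
-- Induction on the rank: the first slots of `a` and `b` are contracted by `bivector_sum`, the
-- others by the induction hypothesis.
lemma contract_multilinear (hx : x ∈ V) :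
    ∀ {k : ℕ} (a b : MultilinearMap ℝ (fun _ : Fin k => TangentSpace (𝓡 2) x) ℝ),
    ∑ I : Fin k → Fin 2, ∑ J : Fin k → Fin 2, (∏ r, bivector Om x (I r) (J r)) *
      a (fun r => frame x (I r)) * b (fun r => frame x (J r)) = contrE e x a b := by
  intro k
  induction k with
  | zero =>
    intro a b
    simp [contrE, Subsingleton.elim _ (![] : Fin 0 → TangentSpace (𝓡 2) x)]
  | succ k ih =>
    intro a b
    -- The contraction of all slots but the first, as a bilinear form in the two first arguments.
    let B : TangentSpace (𝓡 2) x → TangentSpace (𝓡 2) x → ℝ := fun u v =>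
      ∑ I : Fin k → Fin 2, ∑ J : Fin k → Fin 2, (∏ r, bivector Om x (I r) (J r)) *
        a.curryLeft u (fun r => frame x (I r)) * b.curryLeft v (fun r => frame x (J r))
    have hB := bivector_sum hOm he hx B
      (fun u u' v => by
        simp only [B, map_add, add_apply, mul_add, add_mul, Finset.sum_add_distrib])
      (fun c u v => by
        simp only [B, map_smul, smul_apply, smul_eq_mul, Finset.mul_sum]
        refine Finset.sum_congr rfl fun I _ => Finset.sum_congr rfl fun J _ => by ring)
      (fun u v v' => by simp only [B, map_add, add_apply, mul_add, Finset.sum_add_distrib])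
      (fun c u v => by
        simp only [B, map_smul, smul_apply, smul_eq_mul, Finset.mul_sum]
        refine Finset.sum_congr rfl fun I _ => Finset.sum_congr rfl fun J _ => by ring)
    have h1 : contrE e x a b = B (e 0 x) (e 1 x) - B (e 1 x) (e 0 x) := by
      simp only [B, ih]
      rfl
    rw [h1, ← hB]
    have hcons : ∀ F : (Fin (k + 1) → Fin 2) → ℝ, ∑ I, F I = ∑ i, ∑ I, F (Fin.cons i I) := by
      intro F
      rw [← (Fin.consEquiv (fun _ : Fin (k + 1) => Fin 2)).sum_comp, Fintype.sum_prod_type]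
      rfl
    have hfc : ∀ (i : Fin 2) (I : Fin k → Fin 2),
        (fun r => frame x ((Fin.cons i I : Fin (k + 1) → Fin 2) r)) =
        (Fin.cons (frame x i) fun r => frame x (I r) : Fin (k + 1) → TangentSpace (𝓡 2) x) := by
      intro i I
      funext r
      refine Fin.cases ?_ (fun r => ?_) r <;> simp
    rw [hcons]
    refine Finset.sum_congr rfl fun i _ => ?_
    simp only [hcons]
    rw [Finset.sum_comm]
    refine Finset.sum_congr rfl fun j _ => ?_
    simp only [B, Finset.mul_sum]
    refine Finset.sum_congr rfl fun I _ => Finset.sum_congr rfl fun J _ => ?_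
    simp only [Fin.prod_univ_succ, Fin.cons_zero, Fin.cons_succ, hfc, MultilinearMap.curryLeft_apply]
    ring

include hOm he in
lemma contract_eq {a b : Tensor M k} (ha : IsTensor U a) (hb : IsTensor U b) (hx : x ∈ V)
    (hU : x ∈ U) : contract Om a b x = contrE e x (a x) (b x) := by
  obtain ⟨f, hf⟩ := ha x hU
  obtain ⟨g, hg⟩ := hb x hU
  have hf' : a x = f := funext hf
  have hg' : b x = g := funext hg
  rw [contract, hf', hg', contract_multilinear hOm he hx]

include hOm he in
-- Each coordinate of the raised form is an instance of `bivector_sum` with one slot filled by a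
-- coordinate functional. Linearity of `a` is asked separately so that partially evaluated tensors
-- qualify.
lemma raise_vec (hx : x ∈ V) (a : TangentSpace (𝓡 2) x → ℝ) (h1 : ∀ u v, a (u + v) = a u + a v)
    (h2 : ∀ (c : ℝ) u, a (c • u) = c * a u) :
    ∑ k, (∑ p, bivector Om x k p * a (frame x p)) • frame x k =
      a (e 1 x) • e 0 x - a (e 0 x) • e 1 x := by
  have h : ∀ i, coframe x i (∑ k, (∑ p, bivector Om x k p * a (frame x p)) • frame x k) =
      coframe x i (a (e 1 x) • e 0 x - a (e 0 x) • e 1 x) := by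
    intro i
    have := bivector_sum hOm he hx (fun u v => coframe x i u * a v)
      (fun u u' v => by simp [add_mul]) (fun c u v => by simp [mul_assoc])
      (fun u v v' => by rw [h1]; ring) (fun c u v => by rw [h2]; ring)
    rw [map_sum, map_sub, map_smul, map_smul, smul_eq_mul, smul_eq_mul, mul_comm (a (e 1 x)),
      mul_comm (a (e 0 x)), ← this]
    refine Finset.sum_congr rfl fun j _ => ?_
    rw [map_smul, smul_eq_mul, Finset.sum_mul]
    exact Finset.sum_congr rfl fun p _ => by ring
  rw [vec_eq_sum x (∑ k, _), vec_eq_sum x (_ - _)]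
  simp only [h]

include hOm he in
lemma sharp_eq {a : Tensor M 1} (ha : IsTensor U a) (hx : x ∈ V) (hU : x ∈ U) :
    sharp Om a x = a x ![e 1 x] • e 0 x - a x ![e 0 x] • e 1 x :=
  raise_vec hOm he hx (fun v => a x ![v]) (fun _ _ => ha.add1 hU) (fun c _ => ha.smul1 c hU)

end contraction

section operators

variable (hOm : IsSymplecticForm Om) (hD : IsSymplecticConnection Om D U) (hU : IsOpen U)
  (he : IsFrame Om e V) (hVU : V ⊆ U)

include hD hU in
lemma isTensor_rho : IsTensor U (rho Om D) := by
  have hT := ((hD.smooth_ric hU).covD hD hU).multilinear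
  refine isTensor_of_linear ?_ ?_
  · intro x hx v i a b
    obtain rfl : i = 0 := Subsingleton.elim _ _
    simp only [rho, Function.update_self, hT.add31 hx, mul_add, Finset.sum_add_distrib]
  · intro x hx v i c a
    obtain rfl : i = 0 := Subsingleton.elim _ _
    simp only [rho, Function.update_self, hT.smul31 c hx, Finset.mul_sum]
    exact Finset.sum_congr rfl fun p _ => Finset.sum_congr rfl fun q _ => by ring

include hOm hD hU he hVU

lemma rho_frame (hx : x ∈ V) (i : Fin 2) : rho Om D x ![e i x] =
    ev hx ((frameConn hOm hD hU he hVU).rhoOf (frameConn hOm hD hU he hVU).ric i) := by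
  have hT := (hD.smooth_ric hU).covD hD hU
  have hxU := hVU hx
  have h := bivector_sum hOm he hx (fun u v => covD D (ric D) x ![v, e i x, u])
    (fun u u' v => hT.multilinear.add32 hxU) (fun c u v => hT.multilinear.smul32 c hxU)
    (fun u v v' => hT.multilinear.add30 hxU) (fun c u v => hT.multilinear.smul30 c hxU)
  rw [FrameConn.rhoOf, map_mul, map_sub, ← comp2_ric hOm hD hU he hVU,
    ← comp3_covD hOm hD hU he hVU (hD.smooth_ric hU), ← comp3_covD hOm hD hU he hVU
    (hD.smooth_ric hU), ev_comp3 hU he hVU hT, ev_comp3 hU he hVU hT, map_ofNat, ← h]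
  rfl

lemma riem_frame (hx : x ∈ V) (i j k l : Fin 2) : riem Om D x ![e i x, e j x, e k x, e l x] =
    ev hx ((frameConn hOm hD hU he hVU).riem i j k l) := by
  change Om x ![curv D x (e i x) (e j x) (e k x), e l x] = _
  rw [FrameConn.riem]
  fin_cases l
  · change _ = ev hx (-_)
    rw [map_neg, ← fco_curv hOm hD hU he hVU hx, fco_one]
    exact hOm.swap _ _
  · change _ = ev hx ((frameConn hOm hD hU he hVU).curv i j k 0)
    rw [← fco_curv hOm hD hU he hVU hx]
    rfl

lemma isTensor_riem : IsTensor U (riem Om D) := by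
  refine isTensor_of_linear ?_ ?_
  · intro x hx v i a b
    fin_cases i <;> simp [riem, hD.curv_add_mid hU hx, hD.curv_add_right hU hx, hD.curv_add hU hx,
      hOm.add_left, hOm.add_right]
  · intro x hx v i c a
    fin_cases i <;> simp [riem, hD.curv_smul_mid hU hx, hD.curv_smul_right hU hx,
      hD.curv_smul hU hx, hOm.smul_left, hOm.smul_right]

/-- The quadratic curvature terms cancel by `curv_contr`; only the double divergence of `Ric`
survives. -/
lemma moment_eq (hx : x ∈ V) : moment Om D x =
    ev hx ((frameConn hOm hD hU he hVU).divdiv (frameConn hOm hD hU he hVU).ric) := by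
  set C := frameConn hOm hD hU he hVU with hC
  have hR := hD.smooth_ric hU
  have hT1 := hR.covD hD hU
  have hT2 := hT1.covD hD hU
  have hT := hT2.multilinear
  have hxU := hVU hx
  have h1 : ∀ u v : TangentSpace (𝓡 2) x,
      ∑ j, ∑ q, bivector Om x j q * covD D (covD D (ric D)) x ![v, frame x q, u, frame x j] =
      covD D (covD D (ric D)) x ![v, e 1 x, u, e 0 x]
        - covD D (covD D (ric D)) x ![v, e 0 x, u, e 1 x] := fun u v =>
    bivector_sum hOm he hx (fun a b => covD D (covD D (ric D)) x ![v, b, u, a])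
      (fun u u' v => hT.add43 hxU) (fun c u v => hT.smul43 c hxU)
      (fun u v v' => hT.add41 hxU) (fun c u v => hT.smul41 c hxU)
  have h2 := bivector_sum hOm he hx (fun u v => covD D (covD D (ric D)) x ![v, e 1 x, u, e 0 x]
        - covD D (covD D (ric D)) x ![v, e 0 x, u, e 1 x])
      (fun u u' v => by rw [hT.add42 hxU, hT.add42 hxU]; ring)
      (fun c u v => by rw [hT.smul42 c hxU, hT.smul42 c hxU]; ring)
      (fun u v v' => by rw [hT.add40 hxU, hT.add40 hxU]; ring)
      (fun c u v => by rw [hT.smul40 c hxU, hT.smul40 c hxU]; ring)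
  have h3 : ∑ i, ∑ j, ∑ p, ∑ q, bivector Om x i p * bivector Om x j q *
      covD D (covD D (ric D)) x ![frame x p, frame x q, frame x i, frame x j] =
      ev hx (C.divdiv C.ric) := by
    have hev : ∀ i j k l, ev hx (C.cov3 (C.cov2 C.ric) i j k l) =
        covD D (covD D (ric D)) x ![e i x, e j x, e k x, e l x] := by
      intro i j k l
      have : C.cov2 C.ric = comp3 V e (covD D (ric D)) := by
        funext i j k
        rw [comp3_covD hOm hD hU he hVU hR, comp2_ric hOm hD hU he hVU]
      rw [this, hC, ← comp4_covD hOm hD hU he hVU hT1, ev_comp4 hU he hVU hT2]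
    rw [FrameConn.divdiv, map_add, map_sub, map_sub, hev, hev, hev, hev]
    simp only [← h1] at h2
    refine Eq.trans ?_ (h2.trans ?_)
    · refine Finset.sum_congr rfl fun i _ => ?_
      rw [Finset.sum_comm]
      refine Finset.sum_congr rfl fun p _ => ?_
      rw [Finset.mul_sum]
      refine Finset.sum_congr rfl fun j _ => ?_
      rw [Finset.mul_sum]
      exact Finset.sum_congr rfl fun q _ => by ring
    · rw [h1, h1]; ring
  have h4 : contract Om (ric D) (ric D) x = ev hx (FrameConn.contr2 C.ric C.ric) := by
    rw [contract_eq hOm he hR.multilinear hR.multilinear hx hxU]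
    simp only [FrameConn.contr2, map_add, map_sub, map_mul, hC, ← ric_frame hOm hD hU he hVU hx]
    have : contrE e x (ric D x) (ric D x) =
      ric D x ![e 0 x, e 0 x] * ric D x ![e 1 x, e 1 x] -
      ric D x ![e 0 x, e 1 x] * ric D x ![e 1 x, e 0 x] -
      (ric D x ![e 1 x, e 0 x] * ric D x ![e 0 x, e 1 x] -
      ric D x ![e 1 x, e 1 x] * ric D x ![e 0 x, e 0 x]) := rfl
    rw [this]; ring
  have h5 : contract Om (riem Om D) (riem Om D) x = ev hx (FrameConn.contr4 C.riem C.riem) := by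
    have hRm := isTensor_riem hOm hD hU he hVU
    rw [contract_eq hOm he hRm hRm hx hxU]
    simp only [FrameConn.contr4, FrameConn.contr3, FrameConn.contr2, map_add, map_sub, map_mul, hC,
      ← riem_frame hOm hD hU he hVU hx]
    let r : Fin 2 → Fin 2 → Fin 2 → Fin 2 → ℝ := fun i j k l =>
      riem Om D x ![e i x, e j x, e k x, e l x]
    have h2 : ∀ i j i' j', contrE e x (fun v : Fin 2 → TangentSpace (𝓡 2) x =>
        riem Om D x (Fin.cons (e i x) (Fin.cons (e j x) v : Fin 3 → TangentSpace (𝓡 2) x)))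
        (fun v : Fin 2 → TangentSpace (𝓡 2) x =>
        riem Om D x (Fin.cons (e i' x) (Fin.cons (e j' x) v : Fin 3 → TangentSpace (𝓡 2) x))) =
        r i j 0 0 * r i' j' 1 1 - r i j 0 1 * r i' j' 1 0 -
        (r i j 1 0 * r i' j' 0 1 - r i j 1 1 * r i' j' 0 0) := fun i j i' j' => rfl
    simp only [contrE] at h2 ⊢
    rw [h2, h2, h2, h2]
    ring
  rw [moment, h3, h4, h5, FrameConn.curv_contr, map_mul, map_ofNat]
  ring

end operators

end

/-! ### Hamiltonian fields, the operator `H` and Lie derivatives in a frame. -/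

section

variable {M : Type*} [TopologicalSpace M] [ChartedSpace Plane M] [IsManifold (𝓡 2) ∞ M] [T2Space M]

variable {Om : Tensor M 2} {D : Conn M} {U V : Set M} {e : Fin 2 → VField M} {x : M} {k : ℕ}

lemma isTensor_diffl (f : M → ℝ) : IsTensor Set.univ (diffl f) := by
  refine isTensor_of_linear ?_ ?_
  · intro x _ v i a b
    obtain rfl : i = 0 := Subsingleton.elim _ _
    simp [diffl]
  · intro x _ v i c a
    obtain rfl : i = 0 := Subsingleton.elim _ _
    simp [diffl]

lemma smooth_diffl {f : M → ℝ} (hU : IsOpen U) (hf : SmoothFn f U) : IsSmoothTensor U (diffl f) :=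
  isSmoothTensor_of_at (fun x _ => isTensor_diffl f x trivial) fun _ hx _ hX =>
    (SmoothFn.at hf hU hx).mvfderiv (hX 0)

variable (hOm : IsSymplecticForm Om) (hD : IsSymplecticConnection Om D U) (hU : IsOpen U)
  (he : IsFrame Om e V) (hVU : V ⊆ U)

section sharp

include hOm hU he hVU

lemma smooth_sharp {a : Tensor M 1} (ha : IsSmoothTensor U a) : SmoothVF (sharp Om a) V := by
  refine smoothVF_of_at fun x hx => ?_
  have h : ∀ i, SmoothFnAt (fun y => a y ![e i y]) x := fun i => by
    have := smoothFn_comp he hVU hU ha ![i]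
    simp only [frame_vec1] at this
    exact SmoothFn.at this he.isOpen hx
  refine SmoothVFAt.congr ((SmoothVFAt.smul (h 1) (he.at hx 0)).sub
    (SmoothVFAt.smul (h 0) (he.at hx 1))) ?_
  filter_upwards [he.isOpen.eventually_mem hx] with y hy
  exact sharp_eq hOm he ha.multilinear hy (hVU hy)

lemma compV_sharp {a : Tensor M 1} (ha : IsSmoothTensor U a) :
    compV hOm V e (sharp Om a) = FrameConn.raise (comp1 V e a) := by
  funext k
  refine ring_ext fun x hx => ?_
  rw [ev_compV hOm he hx (smooth_sharp hOm hU he hVU ha), sharp_eq hOm he ha.multilinear hx (hVU hx)]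
  fin_cases k <;> simp [fco_frame hOm he hx, ev_comp1 hU he hVU ha hx]

lemma smooth_ham {f : M → ℝ} (hf : SmoothFn f U) : SmoothVF (ham Om f) V :=
  smoothVF_of_at fun _ hx => (SmoothVF.at (smooth_sharp hOm hU he hVU (smooth_diffl hU hf))
    he.isOpen hx).neg

omit hOm in
lemma comp1_diffl {f : M → ℝ} (hf : SmoothFn f U) (i : Fin 2) :
    comp1 V e (diffl f) i = der he.isOpen (he.smooth i) (toR V f) := by
  refine ring_ext fun x hx => ?_
  rw [ev_comp1 hU he hVU (smooth_diffl hU hf), ev_der_toR _ _ hx (hf.mono hVU)]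
  rfl

end sharp

lemma compV_ham {f : M → ℝ} (hf : SmoothFn f U) :
    compV hOm V e (ham Om f) = (frameConn hOm hD hU he hVU).ham (toR V f) := by
  funext k
  have h := congrFun (compV_sharp hOm hU he hVU (smooth_diffl hU hf)) k
  have h1 : compV hOm V e (ham Om f) k = -compV hOm V e (sharp Om (diffl f)) k := by
    refine ring_ext fun x hx => ?_
    rw [map_neg, ev_compV hOm he hx (smooth_ham hOm hU he hVU hf),
      ev_compV hOm he hx (smooth_sharp hOm hU he hVU (smooth_diffl hU hf)), ham, map_neg]
  rw [h1, h, FrameConn.ham]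
  congr 2
  funext i
  exact comp1_diffl hU he hVU hf i

section lie

include hD hU

/-- The two terms in which `W` is differentiated form together the second covariant derivative of
`X`, which is linear over functions in `W`. -/
lemma lieConn_apply (hx : x ∈ U) {X W : VField M} (hX : SmoothVFAt X x) (hW : SmoothVFAt W x)
    (u : TangentSpace (𝓡 2) x) : lieConn D X x u (W x) =
      D (fun y => D X y (W y)) x u - D X x (D W x u) + curv D x (X x) u (W x) := by
  have hUx := hU.mem_nhds hx
  rw [lieConn]
  congr 1
  refine eq_of_linear (Φ := fun W => D (fun y => D X y (W y)) x u - D X x (D W x u)) ?_ ?_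
    (smoothVFAt_extVec _) hW (extVec_self _)
  · intro Y Z hY hZ
    simp only [map_add, hD.add hx hY hZ, add_apply,
      hD.add hx (hD.smoothAt hUx hY hX) (hD.smoothAt hUx hZ hX)]
    abel
  · intro f Y hf hY
    simp only [map_smul, hD.smul hx hf hY, hD.smul hx hf (hD.smoothAt hUx hY hX), map_add]
    module

end lie

lemma curv_frame_left (hx : x ∈ V) (w : TangentSpace (𝓡 2) x) (i j l : Fin 2) :
    fco hOm e l x (curv D x w (e i x) (e j x)) =
      ∑ p, fco hOm e p x w * ev hx ((frameConn hOm hD hU he hVU).curv p i j l) := by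
  conv_lhs => rw [eq_sum_fco hOm he hx w, Fin.sum_univ_two, hD.curv_add hU (hVU hx),
    hD.curv_smul hU (hVU hx), hD.curv_smul hU (hVU hx)]
  simp only [map_add, map_smul, fco_curv hOm hD hU he hVU hx, smul_eq_mul, Fin.sum_univ_two]

lemma fco_lieConn (hx : x ∈ V) {X : VField M} (hX : SmoothVF X V) (i j k : Fin 2) :
    fco hOm e k x (lieConn D X x (e i x) (e j x)) =
      ev hx ((frameConn hOm hD hU he hVU).lieConn (compV hOm V e X) i j k) := by
  have hXx := SmoothVF.at hX he.isOpen hx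
  have hs := smooth_nabla hD hU he hVU (he.smooth j) hX
  rw [lieConn_apply hD hU (hVU hx) hXx (he.at hx j), map_add, map_sub,
    curv_frame_left hOm hD hU he hVU hx, ← ev_covV hOm hD hU he hVU hx hs,
    eq_sum_fco hOm he hx (D (e j) x (e i x))]
  have h : ∀ k, compV hOm V e (fun y => D X y (e j y)) k =
    (frameConn hOm hD hU he hVU).covV (compV hOm V e X) j k := fun k =>
    compV_nabla hOm hD hU he hVU hX j k
  simp only [FrameConn.lieConn, Fin.sum_univ_two, map_add, map_sub, map_mul, map_smul, smul_eq_mul,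
    ev_G, ev_covV hOm hD hU he hVU hx hX, ev_compV hOm he hx hX]
  rw [FrameConn.covV]
  simp only [h, Fin.sum_univ_two, map_add, map_mul, ev_G, ev_covV hOm hD hU he hVU hx hX]
  ring

lemma hop_frame (hx : x ∈ V) {f : M → ℝ} (hf : SmoothFn f U) (i j k : Fin 2) :
    hop Om D f x ![e i x, e j x, e k x] =
      ev hx ((frameConn hOm hD hU he hVU).hop (toR V f) i j k) := by
  have h := fun k => fco_lieConn hOm hD hU he hVU hx (smooth_ham hOm hU he hVU hf) i j k
  rw [compV_ham hOm hD hU he hVU hf] at h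
  change Om x ![lieConn D (ham Om f) x (e i x) (e j x), e k x] = _
  rw [FrameConn.hop]
  fin_cases k
  · change _ = ev hx (-(frameConn hOm hD hU he hVU).lieConn _ i j 1)
    rw [map_neg, ← h, fco_one]
    exact hOm.swap _ _
  · change _ = ev hx ((frameConn hOm hD hU he hVU).lieConn _ i j 0)
    rw [← h]
    rfl

include hOm hD hU he hVU in
lemma isTensor_hop {f : M → ℝ} (hf : SmoothFn f U) : IsTensor V (hop Om D f) := by
  have key : ∀ x ∈ V, ∀ u : TangentSpace (𝓡 2) x, ∀ W, SmoothVFAt W x →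
      lieConn D (ham Om f) x u (W x) = D (fun y => D (ham Om f) y (W y)) x u
        - D (ham Om f) x (D W x u) + curv D x (ham Om f x) u (W x) := fun x hx u W hW =>
    lieConn_apply hD hU (hVU hx) (SmoothVF.at (smooth_ham hOm hU he hVU hf) he.isOpen hx) hW u
  have hadd1 : ∀ x ∈ V, ∀ u u' w : TangentSpace (𝓡 2) x, lieConn D (ham Om f) x (u + u') w =
      lieConn D (ham Om f) x u w + lieConn D (ham Om f) x u' w := by
    intro x hx u u' w
    simp only [lieConn, map_add, hD.curv_add_mid hU (hVU hx)]
    abel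
  have hsmul1 : ∀ x ∈ V, ∀ (c : ℝ) (u w : TangentSpace (𝓡 2) x), lieConn D (ham Om f) x (c • u) w =
      c • lieConn D (ham Om f) x u w := by
    intro x hx c u w
    simp only [lieConn, map_smul, hD.curv_smul_mid hU (hVU hx)]
    module
  have hadd2 : ∀ x ∈ V, ∀ u w w' : TangentSpace (𝓡 2) x, lieConn D (ham Om f) x u (w + w') =
      lieConn D (ham Om f) x u w + lieConn D (ham Om f) x u w' := by
    intro x hx u w w'
    have hUx := hU.mem_nhds (hVU hx)
    have hw := smoothVFAt_extVec w
    have hw' := smoothVFAt_extVec w'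
    have hX := SmoothVF.at (smooth_ham hOm hU he hVU hf) he.isOpen hx
    have h := key x hx u _ (hw.add hw')
    simp only [map_add, hD.add (hVU hx) hw hw', add_apply, extVec_self,
      hD.add (hVU hx) (hD.smoothAt hUx hw hX) (hD.smoothAt hUx hw' hX),
      hD.curv_add_right hU (hVU hx)] at h
    refine h.trans ?_
    simp only [lieConn]
    abel
  have hsmul2 : ∀ x ∈ V, ∀ (c : ℝ) (u w : TangentSpace (𝓡 2) x), lieConn D (ham Om f) x u (c • w) =
      c • lieConn D (ham Om f) x u w := by
    intro x hx c u w
    have hUx := hU.mem_nhds (hVU hx)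
    have hw := smoothVFAt_extVec w
    have hX := SmoothVF.at (smooth_ham hOm hU he hVU hf) he.isOpen hx
    have h := key x hx u _ (SmoothVFAt.smul (smoothFnAt_const c) hw)
    simp only [map_smul, hD.smul (hVU hx) (smoothFnAt_const c) hw, extVec_self,
      hD.smul (hVU hx) (smoothFnAt_const c) (hD.smoothAt hUx hw hX),
      hD.curv_smul_right hU (hVU hx), mvfderiv_const, zero_apply, zero_smul, add_zero] at h
    refine h.trans ?_
    simp only [lieConn]
    module
  refine isTensor_of_linear ?_ ?_
  · intro x hx v i a b
    fin_cases i <;> simp [hop, hOm.add_left, hOm.add_right, hadd1 x hx, hadd2 x hx]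
  · intro x hx v i c a
    fin_cases i <;> simp [hop, hOm.smul_left, hOm.smul_right, hsmul1 x hx, hsmul2 x hx]

section lieD

include hD hU

/-- Torsion-freeness turns the bracket into `∇_X - ∇X`; this trades derivatives along `X` for the
components already computed, and makes the Lie derivative visibly tensorial. -/
lemma lieD_eq {T : Tensor M k} (hT : IsSmoothTensor U T) (hx : x ∈ U) {X : VField M}
    (hX : SmoothVFAt X x) (v : Fin k → TangentSpace (𝓡 2) x) : lieD X T x v =
      covD D T x (Fin.cons (X x) v) + ∑ i, T x (Function.update v i (D X x (v i))) := by
  have h : ∀ i, T x (Function.update v i (VectorField.mlieBracket (𝓡 2) X (extVec (v i)) x)) =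
      T x (Function.update v i (D (extVec (v i)) x (X x))) -
        T x (Function.update v i (D X x (v i))) := fun i => by
    rw [hD.bracket hx hX (smoothVFAt_extVec _), extVec_self, sub_eq_add_neg,
      hT.multilinear.update_add hx, ← neg_one_smul ℝ, hT.multilinear.update_smul hx]
    ring
  simp only [lieD, covD, h, Finset.sum_sub_distrib, Fin.cons_zero, Fin.cons_succ]
  ring

end lieD

lemma lieD_frame {T : Tensor M 3} (hT : IsSmoothTensor U T) (hx : x ∈ V) {X : VField M}
    (hX : SmoothVF X V) (i j k : Fin 2) : lieD X T x ![e i x, e j x, e k x] =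
      ev hx ((frameConn hOm hD hU he hVU).lie3 (compV hOm V e X) (comp3 V e T) i j k) := by
  have hXx := SmoothVF.at hX he.isOpen hx
  have hT4 := (hT.covD hD hU).multilinear
  have hc : covD D T x ![X x, e i x, e j x, e k x] =
      fco hOm e 0 x (X x) * covD D T x ![e 0 x, e i x, e j x, e k x] +
      fco hOm e 1 x (X x) * covD D T x ![e 1 x, e i x, e j x, e k x] := by
    conv_lhs => rw [eq_sum_fco hOm he hx (X x), Fin.sum_univ_two]
    rw [hT4.add40 (hVU hx), hT4.smul40 _ (hVU hx), hT4.smul40 _ (hVU hx)]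
  have hu := hT.multilinear.update_frame hOm he hx (hVU hx) ![e i x, e j x, e k x]
  rw [lieD_eq hD hU hT (hVU hx) hXx]
  have h0 : covD D T x (Fin.cons (X x) ![e i x, e j x, e k x]) =
      covD D T x ![X x, e i x, e j x, e k x] := rfl
  rw [h0, Fin.sum_univ_three, hu 0 (D X x _), hu 1 (D X x _), hu 2 (D X x _)]
  simp only [update_three_zero, update_three_one, update_three_two, FrameConn.lie3]
  rw [hc]
  simp only [Fin.sum_univ_two, map_add, map_mul, ev_covV hOm hD hU he hVU hx hX,
    ev_comp3 hU he hVU hT, ← comp4_covD hOm hD hU he hVU hT, ev_comp4 hU he hVU (hT.covD hD hU),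
    ev_compV hOm he hx hX]
  have e0 : ![e i x, e j x, e k x] 0 = e i x := rfl
  have e1 : ![e i x, e j x, e k x] 1 = e j x := rfl
  have e2 : ![e i x, e j x, e k x] 2 = e k x := rfl
  rw [e0, e1, e2]
  ring

end

/-! ### Adding a symmetric cubic tensor to a symplectic connection. -/

section

variable {M : Type*} [TopologicalSpace M] [ChartedSpace Plane M] [IsManifold (𝓡 2) ∞ M] [T2Space M]

variable {Om : Tensor M 2} {D : Conn M} {U V : Set M} {e : Fin 2 → VField M} {x : M}

/-- A field of endomorphisms is smooth if it maps smooth vector fields to smooth vector fields. -/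
lemma contMDiffAt_hom {A : Π x : M, TangentSpace (𝓡 2) x →L[ℝ] TangentSpace (𝓡 2) x}
    (h : ∀ X, SmoothVFAt X x → SmoothVFAt (fun y => A y (X y)) x) :
    ContMDiffAt (𝓡 2) ((𝓡 2).prod 𝓘(ℝ, Plane →L[ℝ] Plane)) ∞
      (fun y => (⟨y, A y⟩ : Bundle.TotalSpace (Plane →L[ℝ] Plane)
        fun y : M => TangentSpace (𝓡 2) y →L[ℝ] TangentSpace (𝓡 2) y)) x := by
  rw [contMDiffAt_hom_bundle]
  refine ⟨contMDiffAt_id, ?_⟩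
  have hs : x ∈ (chartAt Plane x).source := mem_chart_source _ _
  have hg : ∀ j, ContMDiffAt (𝓡 2) 𝓘(ℝ, Plane) ∞ (fun y => (trivializationAt Plane
      (fun y : M => TangentSpace (𝓡 2) y) x ⟨y, A y (coordVF x j y)⟩).2) x := fun j => by
    have := (h _ (SmoothVF.at (coordVF_smooth x j) (chartAt Plane x).open_source hs)).self_of_nhds
    exact (Bundle.contMDiffAt_section x).mp this
  -- In the trivialization at `x` the endomorphism is rebuilt from its columns, the images of the
  -- coordinate fields.
  have h2 : ContMDiffAt (𝓡 2) 𝓘(ℝ, Plane →L[ℝ] Plane) ∞ (fun y => ∑ j : Fin 2,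
      ContinuousLinearMap.smulRightL ℝ Plane Plane (EuclideanSpace.proj j)
        (trivializationAt Plane (fun y : M => TangentSpace (𝓡 2) y) x
          ⟨y, A y (coordVF x j y)⟩).2) x :=
    ContMDiffAt.sum fun j _ => (ContinuousLinearMap.contMDiff _).contMDiffAt.comp x (hg j)
  refine h2.congr_of_eventuallyEq ?_
  filter_upwards [(chartAt Plane x).open_source.mem_nhds hs] with y hy
  ext1 w
  have hw : w = ∑ p, w p • (EuclideanSpace.single p (1 : ℝ) : Plane) := by
    ext i
    fin_cases i <;> simp
  conv_lhs => rw [hw]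
  have hc : ∀ j, ContinuousLinearMap.inCoordinates Plane (fun y : M => TangentSpace (𝓡 2) y) Plane
      (fun y : M => TangentSpace (𝓡 2) y) x y x y (A y) (EuclideanSpace.single j (1 : ℝ)) =
      (trivializationAt Plane (fun y : M => TangentSpace (𝓡 2) y) x ⟨y, A y (coordVF x j y)⟩).2 := by
    intro j
    rw [coordVF_eq_symmL hy, ← Bundle.Trivialization.continuousLinearMapAt_apply_of_mem (R := ℝ) _ hy]
    rfl
  rw [map_sum, sum_apply]
  refine Finset.sum_congr rfl fun j _ => ?_
  rw [map_smul, hc]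
  rfl

lemma exists_frame (hOm : IsSymplecticForm Om) (hU : IsOpen U) (hx : x ∈ U) :
    ∃ (V : Set M) (e : Fin 2 → VField M), x ∈ V ∧ V ⊆ U ∧ IsFrame Om e V :=
  ⟨(chartAt Plane x).source ∩ U, chartFrame Om x, ⟨mem_chart_source _ _, hx⟩,
    Set.inter_subset_right, isFrame_chartFrame hOm x ((chartAt Plane x).open_source.inter hU)
    Set.inter_subset_left⟩

section addCubic

variable {P : Tensor M 3}

lemma addCubic_apply (hOm : IsSymplecticForm Om) (he : IsFrame Om e V) (hP : IsTensor U P)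
    (hx : x ∈ V) (hxU : x ∈ U) (Y : VField M) (v : TangentSpace (𝓡 2) x) :
    addCubic Om D P Y x v = D Y x v + (P x ![v, Y x, e 1 x] • e 0 x - P x ![v, Y x, e 0 x] • e 1 x) := by
  have h : ∀ i, ∑ k, (∑ p, bivector Om x k p * P x ![frame x i, Y x, frame x p]) • frame x k =
      P x ![frame x i, Y x, e 1 x] • e 0 x - P x ![frame x i, Y x, e 0 x] • e 1 x := fun i =>
    raise_vec hOm he hx (fun w => P x ![frame x i, Y x, w]) (fun _ _ => hP.add32 hxU)
      (fun c _ => hP.smul32 c hxU)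
  have hv := vec_eq_sum x v
  have h0 : addCubic Om D P Y x v = D Y x v + ∑ i, coframe x i v •
      ∑ k, (∑ p, bivector Om x k p * P x ![frame x i, Y x, frame x p]) • frame x k := by
    rw [addCubic, add_apply, sum_apply]
    rfl
  rw [h0, Finset.sum_congr rfl fun i _ => by rw [h i], Fin.sum_univ_two]
  rw [Fin.sum_univ_two] at hv
  conv_rhs => rw [hv]
  simp only [hP.add30 hxU, hP.smul30 _ hxU, map_add, map_smul]
  rw [← map_smul, ← map_smul, ← map_add, ← hv]
  module

variable (hOm : IsSymplecticForm Om) (hD : IsSymplecticConnection Om D U) (hU : IsOpen U)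
  (hP : IsSmoothTensor U P) (hS : IsSymmetricTensor U P)

lemma IsSymmetricTensor.swap01 (hS : IsSymmetricTensor U P) (hx : x ∈ U)
    (u v w : TangentSpace (𝓡 2) x) : P x ![u, v, w] = P x ![v, u, w] := by
  rw [← hS x hx ![u, v, w] (Equiv.swap 0 1)]
  congr 1
  funext i
  fin_cases i <;> rfl

lemma IsSymmetricTensor.swap12 (hS : IsSymmetricTensor U P) (hx : x ∈ U)
    (u v w : TangentSpace (𝓡 2) x) : P x ![u, v, w] = P x ![u, w, v] := by
  rw [← hS x hx ![u, v, w] (Equiv.swap 1 2)]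
  congr 1
  funext i
  fin_cases i <;> rfl

lemma IsSmoothTensor.smooth3 (hP : IsSmoothTensor U P) (hU : U ∈ 𝓝 x) {X Y Z : VField M}
    (hX : SmoothVFAt X x) (hY : SmoothVFAt Y x) (hZ : SmoothVFAt Z x) :
    SmoothFnAt (fun y => P y ![X y, Y y, Z y]) x := by
  have := hP.smoothAt hU (X := ![X, Y, Z]) (by intro i; fin_cases i; exacts [hX, hY, hZ])
  refine this.congr (Filter.Eventually.of_forall fun y => ?_)
  congr 1
  funext i
  fin_cases i <;> rfl

include hOm hD hU hP in
lemma smoothAt_addCubic (hx : x ∈ U) {X Y : VField M} (hX : SmoothVFAt X x)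
    (hY : SmoothVFAt Y x) : SmoothVFAt (fun y => addCubic Om D P Y y (X y)) x := by
  obtain ⟨V, e, hxV, hVU, he⟩ := exists_frame hOm hU hx
  have hUx := hU.mem_nhds hx
  refine ((hD.smoothAt hUx hX hY).add ((SmoothVFAt.smul (hP.smooth3 hUx hX hY (he.at hxV 1))
    (he.at hxV 0)).sub (SmoothVFAt.smul (hP.smooth3 hUx hX hY (he.at hxV 0))
    (he.at hxV 1)))).congr ?_
  filter_upwards [he.isOpen.eventually_mem hxV] with y hy
  exact addCubic_apply hOm he hP.multilinear hy (hVU hy) Y (X y)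

include hOm hD hU hP hS in
-- Symmetry of `P` in the first two slots keeps the torsion zero; symmetry in the last two keeps `Ω`
-- parallel.
lemma addCubic_symplectic : IsSymplecticConnection Om (addCubic Om D P) U where
  isCov := {
    add := by
      intro σ σ' x hσ hσ' hx
      obtain ⟨V, e, hxV, hVU, he⟩ := exists_frame hOm hU hx
      ext1 v
      rw [add_apply, addCubic_apply hOm he hP.multilinear hxV hx,
        addCubic_apply hOm he hP.multilinear hxV hx, addCubic_apply hOm he hP.multilinear hxV hx,
        hD.isCov.add hσ hσ' hx]
      simp only [Pi.add_apply, add_apply, hP.multilinear.add31 hx]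
      module
    leibniz := by
      intro σ g x hσ hg hx
      obtain ⟨V, e, hxV, hVU, he⟩ := exists_frame hOm hU hx
      ext1 v
      rw [add_apply, smul_apply, addCubic_apply hOm he hP.multilinear hxV hx,
        addCubic_apply hOm he hP.multilinear hxV hx, hD.isCov.leibniz hσ hg hx]
      simp only [Pi.smul_apply', add_apply, smul_apply, hP.multilinear.smul31 _ hx]
      module }
  smooth := {
    contMDiff := by
      intro σ hσ x hx
      refine (contMDiffAt_hom fun X hX => ?_).contMDiffWithinAt
      exact smoothAt_addCubic hOm hD hU hP hx hX (SmoothVF.at hσ hU hx) }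
  torsionFree := by
    intro x hx X Y hX hY
    obtain ⟨V, e, hxV, hVU, he⟩ := exists_frame hOm hU hx
    rw [← hD.torsionFree x hx X Y hX hY, addCubic_apply hOm he hP.multilinear hxV hx,
      addCubic_apply hOm he hP.multilinear hxV hx, hS.swap01 hx (X x), hS.swap01 hx (X x)]
    module
  parallel := by
    intro x hx v
    obtain ⟨V, e, hxV, hVU, he⟩ := exists_frame hOm hU hx
    have h := hD.parallel x hx v
    have hu := he.unit x hxV
    -- Lowering the raised index of `P` with `Ω` gives `P` back.
    have hPi : ∀ u w z : TangentSpace (𝓡 2) x,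
        Om x ![P x ![u, w, e 1 x] • e 0 x - P x ![u, w, e 0 x] • e 1 x, z] = P x ![u, w, z] := by
      intro u w z
      conv_lhs => rw [eq_sum_fco hOm he hxV z, Fin.sum_univ_two]
      conv_rhs => rw [eq_sum_fco hOm he hxV z, Fin.sum_univ_two]
      have h10 : Om x ![e 1 x, e 0 x] = -1 := by rw [hOm.swap, hu]
      simp only [sub_eq_add_neg, hOm.add_right, hOm.add_left, hOm.neg_left, hOm.smul_left,
        hOm.smul_right, hOm.alternating, hu, h10, hP.multilinear.add32 hx,
        hP.multilinear.smul32 _ hx]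
      ring
    rw [covD, Fin.sum_univ_two] at h ⊢
    have hv : (fun j : Fin 2 => v j.succ) = ![v 1, v 2] := by
      funext j; fin_cases j <;> rfl
    simp only [hv, update_two_zero, update_two_one] at h ⊢
    rw [addCubic_apply hOm he hP.multilinear hxV hx, addCubic_apply hOm he hP.multilinear hxV hx,
      hOm.add_left, hOm.add_right, hPi, hOm.swap (v 1) (_ - _), hPi]
    simp only [extVec_self]
    have h3 : P x ![v 0, v (Fin.succ 0), v 2] = P x ![v 0, v (Fin.succ 1), v 1] :=
      hS.swap12 hx _ _ _
    rw [h3]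
    linarith

end addCubic

end

/-! ### Components of modified connections, and Killing one-forms. -/

section

namespace FrameConn

variable {A : Type*} [CommRing A] [Algebra ℝ A]

lemma ext_of_eq {C C' : FrameConn A} (h1 : C.d = C'.d) (h2 : C.G = C'.G) : C = C' := by
  cases C; cases C'
  simp only at h1 h2
  subst h1; subst h2
  rfl

lemma hop_smul (C : FrameConn A) (c : ℝ) (f : A) (i j k : Fin 2) :
    C.hop (c • f) i j k = c • C.hop f i j k := by
  have hc : ∀ i, C.d i (algebraMap ℝ A c) = 0 := fun i => Derivation.map_algebraMap _ _
  rw [Algebra.smul_def, Algebra.smul_def]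
  generalize algebraMap ℝ A c = a at hc
  fin_cases k <;>
  · simp only [hop, lieConn, covV, ham, Fin.zero_eta, Fin.mk_one, lower_zero, lower_one, raise_zero,
      raise_one, Fin.sum_univ_two, map_add, map_neg, Derivation.leibniz, hc, smul_eq_mul, mul_zero,
      add_zero]
    ring

end FrameConn

variable {M : Type*} [TopologicalSpace M] [ChartedSpace Plane M] [IsManifold (𝓡 2) ∞ M] [T2Space M]

variable {Om : Tensor M 2} {D : Conn M} {U V : Set M} {e : Fin 2 → VField M} {x : M}

lemma symmetrize_two (T : Tensor M 2) (x : M) (v : Fin 2 → TangentSpace (𝓡 2) x) :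
    symmetrize T x v = 1 / 2 * (T x ![v 0, v 1] + T x ![v 1, v 0]) := by
  have h : (Finset.univ : Finset (Equiv.Perm (Fin 2))) = {1, Equiv.swap 0 1} := by decide
  have e1 : (fun i => v ((1 : Equiv.Perm (Fin 2)) i)) = ![v 0, v 1] := by
    funext i; fin_cases i <;> rfl
  have e2 : (fun i => v (Equiv.swap 0 1 i)) = ![v 1, v 0] := by
    funext i; fin_cases i <;> rfl
  rw [symmetrize, h, Finset.sum_insert (by decide), Finset.sum_singleton, e1, e2]
  norm_num

lemma symmetrize_three (T : Tensor M 3) (x : M) (v : Fin 3 → TangentSpace (𝓡 2) x) :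
    symmetrize T x v = 1 / 6 * (T x ![v 0, v 1, v 2] + T x ![v 0, v 2, v 1] + T x ![v 1, v 0, v 2] +
      T x ![v 1, v 2, v 0] + T x ![v 2, v 0, v 1] + T x ![v 2, v 1, v 0]) := by
  have h : (Finset.univ : Finset (Equiv.Perm (Fin 3))) = {1, Equiv.swap 1 2, Equiv.swap 0 1,
    Equiv.swap 0 1 * Equiv.swap 1 2, Equiv.swap 1 2 * Equiv.swap 0 1, Equiv.swap 0 2} := by decide
  have e1 : (fun i => v ((1 : Equiv.Perm (Fin 3)) i)) = ![v 0, v 1, v 2] := by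
    funext i; fin_cases i <;> rfl
  have e2 : (fun i => v (Equiv.swap 1 2 i)) = ![v 0, v 2, v 1] := by
    funext i; fin_cases i <;> rfl
  have e3 : (fun i => v (Equiv.swap 0 1 i)) = ![v 1, v 0, v 2] := by
    funext i; fin_cases i <;> rfl
  have e4 : (fun i => v ((Equiv.swap 0 1 * Equiv.swap 1 2 : Equiv.Perm (Fin 3)) i)) = ![v 1, v 2, v 0] := by
    funext i; fin_cases i <;> rfl
  have e5 : (fun i => v ((Equiv.swap 1 2 * Equiv.swap 0 1 : Equiv.Perm (Fin 3)) i)) = ![v 2, v 0, v 1] := by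
    funext i; fin_cases i <;> rfl
  have e6 : (fun i => v (Equiv.swap 0 2 i)) = ![v 2, v 1, v 0] := by
    funext i; fin_cases i <;> rfl
  rw [symmetrize, h, Finset.sum_insert (by decide), Finset.sum_insert (by decide),
    Finset.sum_insert (by decide), Finset.sum_insert (by decide), Finset.sum_insert (by decide),
    Finset.sum_singleton, e1, e2, e3, e4, e5, e6]
  have : ((Nat.factorial 3 : ℕ) : ℝ)⁻¹ = 1 / 6 := by norm_num [Nat.factorial]
  rw [this]
  ring

section addCubic

variable {P : Tensor M 3} (hOm : IsSymplecticForm Om) (hD : IsSymplecticConnection Om D U)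
  (hU : IsOpen U) (he : IsFrame Om e V) (hVU : V ⊆ U) (hP : IsSmoothTensor U P)
  (hS : IsSymmetricTensor U P)

/-- The bridge from `addCubic` to `FrameConn.add`, by which the algebraic variation formulas apply
to actual connections. -/
lemma frameConn_addCubic {p : ℕ → smoothRing V}
    (hp : ∀ i j k, FrameConn.sym3 p i j k = comp3 V e P i j k) :
    frameConn hOm (addCubic_symplectic hOm hD hU hP hS) hU he hVU =
      (frameConn hOm hD hU he hVU).add p := by
  refine FrameConn.ext_of_eq rfl ?_
  funext i j k
  refine ring_ext fun x hx => ?_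
  rw [ev_G, FrameConn.add_G, map_add, ev_G, addCubic_apply hOm he hP.multilinear hx (hVU hx)]
  simp only [hp, map_add, map_sub, map_smul, fco_frame hOm he hx, smul_eq_mul]
  fin_cases k <;> simp [ev_comp3 hU he hVU hP hx]

include hU hVU hP hS he in
lemma exists_sym3 : ∃ p : ℕ → smoothRing V,
    ∀ i j k, FrameConn.sym3 p i j k = comp3 V e P i j k := by
  have h01 : ∀ i j k, comp3 V e P i j k = comp3 V e P j i k := fun i j k =>
    ring_ext fun x hx => by
      rw [ev_comp3 hU he hVU hP hx, ev_comp3 hU he hVU hP hx, hS.swap01 (hVU hx)]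
  have h12 : ∀ i j k, comp3 V e P i j k = comp3 V e P i k j := fun i j k =>
    ring_ext fun x hx => by
      rw [ev_comp3 hU he hVU hP hx, ev_comp3 hU he hVU hP hx, hS.swap12 (hVU hx)]
  -- The `n`-th entry is the component whose nondecreasing index has `n` ones; symmetry brings every
  -- index to this form.
  refine ⟨fun n => comp3 V e P (if 3 ≤ n then 1 else 0) (if 2 ≤ n then 1 else 0)
    (if 1 ≤ n then 1 else 0), fun i j k => ?_⟩
  fin_cases i <;> fin_cases j <;> fin_cases k <;> simp [FrameConn.sym3]
  · exact h12 0 0 1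
  · exact (h12 0 0 1).trans (h01 0 1 0)
  · exact h01 0 1 1
  · exact (h01 0 1 1).trans (h12 1 0 1)

end addCubic

/-! ### Killing one-forms of a connection with parallel Ricci tensor -/

section killing

variable {Z : Tensor M 1} (hOm : IsSymplecticForm Om)
  (hD : IsSymplecticConnection Om D Set.univ) (hpar : ∀ x v, covD D (ric D) x v = 0)
  (hZ : IsSmoothTensor Set.univ Z) (hK : ∀ x v, symmetrize (covD D Z) x v = 0)
  (he : IsFrame Om e V)

/-- The components of `D` in a frame. -/
abbrev baseConn : FrameConn (smoothRing V) :=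
  frameConn hOm hD isOpen_univ he (Set.subset_univ V)

/-- The function `D_0 Z_1`. -/
abbrev kg (Z : Tensor M 1) : smoothRing V := (baseConn hOm hD he).cov1 (comp1 V e Z) 0 1

include hZ hK in
lemma cov1_skew (i j : Fin 2) : (baseConn hOm hD he).cov1 (comp1 V e Z) i j =
    -(baseConn hOm hD he).cov1 (comp1 V e Z) j i := by
  refine ring_ext fun x hx => ?_
  rw [← comp2_covD hOm hD isOpen_univ he _ hZ, ← comp2_covD hOm hD isOpen_univ he _ hZ, map_neg,
    ev_comp2 isOpen_univ he (Set.subset_univ V) (hZ.covD hD isOpen_univ),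
    ev_comp2 isOpen_univ he (Set.subset_univ V) (hZ.covD hD isOpen_univ)]
  have := hK x ![e i x, e j x]
  rw [symmetrize_two] at this
  simp only [Matrix.cons_val_zero, Matrix.cons_val_one] at this
  linarith

include hpar hZ hK in
-- The Killing equation makes `D_i Z_j` skew, so it is determined by the single function `D_0 Z_1`.
lemma isKilling : (baseConn hOm hD he).IsKilling (comp1 V e Z) (kg hOm hD he Z) := by
  have hs := cov1_skew hOm hD hZ hK he
  have h00 : (baseConn hOm hD he).cov1 (comp1 V e Z) 0 0 = 0 := by
    refine ring_ext fun x hx => ?_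
    have := congrArg (ev hx) (hs 0 0)
    rw [map_neg] at this
    rw [map_zero]; linarith
  have h11 : (baseConn hOm hD he).cov1 (comp1 V e Z) 1 1 = 0 := by
    refine ring_ext fun x hx => ?_
    have := congrArg (ev hx) (hs 1 1)
    rw [map_neg] at this
    rw [map_zero]; linarith
  have h10 := hs 1 0
  obtain ⟨g, h01⟩ : ∃ g, g = (baseConn hOm hD he).cov1 (comp1 V e Z) 0 1 := ⟨_, rfl⟩
  rw [← h01] at h10
  rw [kg, ← h01]
  simp only [FrameConn.cov1, Fin.sum_univ_two] at h00 h10 h01 h11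
  have tr := (baseConn hOm hD he).tr
  refine ⟨?_, ?_, ?_, ?_, fun i j k => ?_⟩
  · linear_combination h00
  · linear_combination -h01 + comp1 V e Z 1 * tr 0
  · linear_combination h10
  · linear_combination h11 + comp1 V e Z 1 * tr 1
  · have hc : (baseConn hOm hD he).cov2 (baseConn hOm hD he).ric i j k = 0 := by
      refine ring_ext fun x hx => ?_
      rw [← comp2_ric hOm hD isOpen_univ he, ← comp3_covD hOm hD isOpen_univ he _
        (hD.smooth_ric isOpen_univ), ev_comp3 isOpen_univ he (Set.subset_univ V)
        ((hD.smooth_ric isOpen_univ).covD hD isOpen_univ), hpar, map_zero]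
    rw [FrameConn.cov2] at hc
    linear_combination hc

include hZ hK in
-- The divergence is `D_0 Z_1 - D_1 Z_0`, and the two summands coincide by skewness. This is the
-- factor in `γ = 2g`.
lemma gam_eq (hx : x ∈ V) : gam Om D Z x = 2 * ev hx (kg hOm hD he Z) := by
  have hsm := smooth_sharp hOm isOpen_univ he (Set.subset_univ V) hZ
  have h := trace_eq (D (sharp Om Z) x : TangentSpace (𝓡 2) x →ₗ[ℝ] TangentSpace (𝓡 2) x)
    (fun i => e i x) (fun i => fco hOm e i x) (fun v => eq_sum_fco hOm he hx v)
  refine h.trans ?_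
  have hc := fun i => ev_covV hOm hD isOpen_univ he (Set.subset_univ V) hx hsm i i
  have hs := congrArg (ev hx) (cov1_skew hOm hD hZ hK he 0 1)
  simp only [Fin.sum_univ_two, ContinuousLinearMap.coe_coe, ← hc,
    compV_sharp hOm isOpen_univ he (Set.subset_univ V) hZ]
  have tr := (baseConn hOm hD he).tr
  simp only [FrameConn.covV, FrameConn.cov1, Fin.sum_univ_two, FrameConn.raise_zero,
    FrameConn.raise_one, map_add, map_sub, map_mul, map_neg, tr] at hs ⊢
  linarith

include hZ in
lemma ric_sharp (hx : x ∈ V) : ric D x ![sharp Om Z x, sharp Om Z x] =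
    ev hx ((baseConn hOm hD he).szz (comp1 V e Z)) := by
  have hR := (hD.smooth_ric isOpen_univ).multilinear
  have t : x ∈ (Set.univ : Set M) := trivial
  rw [sharp_eq hOm he hZ.multilinear hx t, sub_eq_add_neg, ← neg_smul]
  simp only [hR.add20 t, hR.add21 t, hR.smul20 _ t, hR.smul21 _ t, FrameConn.szz, FrameConn.sz,
    map_sub, map_mul, ← ric_frame hOm hD isOpen_univ he (Set.subset_univ V) hx,
    ev_comp1 isOpen_univ he (Set.subset_univ V) hZ hx]
  ring

/-- The function `γ² + 4 Z^a Z^b S_{ab}`. -/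
def nuFn (Om : Tensor M 2) (D : Conn M) (Z : Tensor M 1) (x : M) : ℝ :=
  gam Om D Z x ^ 2 + 4 * ric D x ![sharp Om Z x, sharp Om Z x]

include hOm hD hZ hK in
lemma smooth_gam : SmoothFn (gam Om D Z) Set.univ := by
  refine smoothFn_of_at fun x _ => ?_
  obtain ⟨V, e, hx, -, he⟩ := exists_frame hOm isOpen_univ (Set.mem_univ x)
  refine ((smoothFnAt_const 2).mul (SmoothFn.at (smooth_fn (kg hOm hD he Z)) he.isOpen hx)).congr ?_
  filter_upwards [he.isOpen.eventually_mem hx] with y hy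
  rw [gam_eq hOm hD hZ hK he hy, fn_apply hy]

include hOm hD hZ hK in
lemma isOpen_hatM (nu : ℝ) : IsOpen (hatM Om D Z nu) := by
  have hc : Continuous (gam Om D Z) := by
    have := (smooth_gam hOm hD hZ hK).continuousOn
    exact continuousOn_univ.mp this
  exact isOpen_ne_fun (hc.pow 2) continuous_const

include hZ hK in
lemma nuFn_eq (hx : x ∈ V) : nuFn Om D Z x =
    ev hx (4 * kg hOm hD he Z ^ 2 + 4 * (baseConn hOm hD he).szz (comp1 V e Z)) := by
  rw [nuFn, gam_eq hOm hD hZ hK he hx, ric_sharp hOm hD hZ he hx]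
  simp only [map_add, map_mul, map_pow, map_ofNat]
  ring

include hOm hD hpar hZ hK in
-- By `d_nu` the differential annihilates both vectors of a frame. Constancy on a connected surface
-- follows from `eq_of_mvfderiv_eq_zero`.
lemma smooth_nuFn_and (x : M) : SmoothFnAt (nuFn Om D Z) x ∧
    mvfderiv (𝓡 2) (nuFn Om D Z) x = 0 := by
  obtain ⟨V, e, hx, -, he⟩ := exists_frame hOm isOpen_univ (Set.mem_univ x)
  set a := 4 * kg hOm hD he Z ^ 2 + 4 * (baseConn hOm hD he).szz (comp1 V e Z) with ha
  have heq : ∀ᶠ y in 𝓝 x, nuFn Om D Z y = fn a y := by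
    filter_upwards [he.isOpen.eventually_mem hx] with y hy
    rw [nuFn_eq hOm hD hZ hK he hy, fn_apply hy]
  refine ⟨(SmoothFn.at (smooth_fn a) he.isOpen hx).congr heq, ?_⟩
  rw [mvfderiv_congr heq]
  have h0 : ∀ i, mvfderiv (𝓡 2) (fn a) x (e i x) = 0 := fun i => by
    rw [← ev_der he.isOpen (he.smooth i) hx]
    have := (isKilling hOm hD hpar hZ hK he).d_nu i
    exact (congrArg (ev hx) this).trans (map_zero _)
  ext1 v
  rw [eq_sum_fco hOm he hx v, Fin.sum_univ_two, map_add, map_smul, map_smul, h0, h0]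
  simp

end killing

/-- A function with vanishing differential on a connected manifold is constant. -/
lemma eq_of_mvfderiv_eq_zero [PreconnectedSpace M] {f : M → ℝ} (hf : ∀ x, SmoothFnAt f x)
    (h0 : ∀ x, mvfderiv (𝓡 2) f x = 0) (x y : M) : f x = f y := by
  have hloc : IsLocallyConstant f := by
    rw [IsLocallyConstant.iff_eventually_eq]
    intro x
    set φ := chartAt Plane x with hφ
    obtain ⟨r, hr, hball⟩ := Metric.isOpen_iff.mp φ.open_target (φ x) (mem_chart_target Plane x)
    have hd : ∀ z ∈ φ.target, HasFDerivAt (f ∘ φ.symm) (0 : Plane →L[ℝ] ℝ) z := by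
      intro z hz
      have h1 : MDifferentiableAt (𝓡 2) 𝓘(ℝ, ℝ) f (φ.symm z) := (hf _).mdiff
      have h2 : MDifferentiableAt 𝓘(ℝ, Plane) (𝓡 2) φ.symm z :=
        mdifferentiableAt_atlas_symm (chart_mem_atlas Plane x) hz
      have h3 := (h1.hasMFDerivAt.comp z h2.hasMFDerivAt)
      have h4 : mfderiv (𝓡 2) 𝓘(ℝ, ℝ) f (φ.symm z) = 0 := h0 _
      rw [h4] at h3
      have h5 := hasMFDerivAt_iff_hasFDerivAt.mp h3
      exact h5.congr_fderiv (by ext; rfl)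
    have hc : ∀ z ∈ Metric.ball (φ x) r, (f ∘ φ.symm) z = (f ∘ φ.symm) (φ x) := by
      intro z hz
      exact (convex_ball (φ x) r).is_const_of_fderivWithin_eq_zero (𝕜 := ℝ)
        (fun w hw => (hd w (hball hw)).differentiableAt.differentiableWithinAt)
        (fun w hw => by
          rw [fderivWithin_of_isOpen Metric.isOpen_ball hw, (hd w (hball hw)).fderiv]) hz
        (Metric.mem_ball_self hr)
    have hn : φ ⁻¹' Metric.ball (φ x) r ∩ φ.source ∈ 𝓝 x :=
      Filter.inter_mem ((φ.continuousAt (mem_chart_source Plane x)).preimage_mem_nhds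
        (Metric.ball_mem_nhds _ hr)) (φ.open_source.mem_nhds (mem_chart_source Plane x))
    filter_upwards [hn] with y hy
    have := hc (φ y) hy.1
    simpa [φ.left_inv hy.2, φ.left_inv (mem_chart_source Plane x)] using this
  exact hloc.apply_eq_of_preconnectedSpace x y

end

/-! ### The connections `∇(t)`: pointwise identities. -/

section

variable {M : Type*} [TopologicalSpace M] [ChartedSpace Plane M] [IsManifold (𝓡 2) ∞ M] [T2Space M]

variable {Om : Tensor M 2} {D : Conn M} {U V : Set M} {e : Fin 2 → VField M} {x : M}

lemma IsTensor.mono {k : ℕ} {T : Tensor M k} (hT : IsTensor U T) (h : V ⊆ U) : IsTensor V T :=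
  fun x hx => hT x (h hx)

lemma IsTensor.const_mul {k : ℕ} {T : Tensor M k} (c : ℝ) (hT : IsTensor U T) :
    IsTensor U (fun x v => c * T x v) := fun x hx => by
  obtain ⟨f, hf⟩ := hT x hx
  exact ⟨c • f, fun v => congrArg (c * ·) (hf v)⟩

lemma IsSmoothTensor.const_mul {k : ℕ} {T : Tensor M k} (c : ℝ) (hT : IsSmoothTensor U T) :
    IsSmoothTensor U (fun x v => c * T x v) :=
  ⟨hT.multilinear.const_mul c, fun X hX => contMDiffOn_const.mul (hT.smooth X hX)⟩

lemma IsSymmetricTensor.const_mul {k : ℕ} {T : Tensor M k} (c : ℝ) (hT : IsSymmetricTensor U T) :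
    IsSymmetricTensor U (fun x v => c * T x v) := fun x hx v s => by
  simp only [hT x hx v s]

lemma IsTensor.add {k : ℕ} {S T : Tensor M k} (hS : IsTensor U S) (hT : IsTensor U T) :
    IsTensor U (fun x v => S x v + T x v) := fun x hx => by
  obtain ⟨f, hf⟩ := hS x hx
  obtain ⟨g, hg⟩ := hT x hx
  exact ⟨f + g, fun v => congrArg₂ (· + ·) (hf v) (hg v)⟩

lemma IsSmoothTensor.add {k : ℕ} {S T : Tensor M k} (hS : IsSmoothTensor U S)
    (hT : IsSmoothTensor U T) : IsSmoothTensor U (fun x v => S x v + T x v) :=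
  ⟨hS.multilinear.add hT.multilinear, fun X hX => (hS.smooth X hX).add (hT.smooth X hX)⟩

lemma IsSymmetricTensor.add {k : ℕ} {S T : Tensor M k} (hS : IsSymmetricTensor U S)
    (hT : IsSymmetricTensor U T) : IsSymmetricTensor U (fun x v => S x v + T x v) :=
  fun x hx v s => by simp only [hS x hx v s, hT x hx v s]

lemma IsTensor.symmetrize {k : ℕ} {T : Tensor M k} (hT : IsTensor U T) :
    IsTensor U (symmetrize T) := fun x hx => by
  obtain ⟨f, hf⟩ := hT x hx
  exact ⟨((k.factorial : ℝ))⁻¹ • ∑ s : Equiv.Perm (Fin k), f.domDomCongr s, fun v => by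
    simp [SympSurface.symmetrize, hf]⟩

lemma isTensor_zero {k : ℕ} : IsTensor U (fun _ _ => 0 : Tensor M k) := fun _ _ =>
  ⟨0, fun _ => rfl⟩

lemma IsSymplecticConnection.mono (hD : IsSymplecticConnection Om D U) (hU : IsOpen U)
    (hV : IsOpen V) (h : V ⊆ U) : IsSymplecticConnection Om D V where
  isCov := hD.isCov.mono h
  smooth := {
    contMDiff := by
      intro σ hσ x hx
      exact (contMDiffAt_hom fun X hX =>
        hD.smoothAt (hU.mem_nhds (h hx)) hX (SmoothVF.at hσ hV hx)).contMDiffWithinAt }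
  torsionFree x hx := hD.torsionFree x (h hx)
  parallel x hx := hD.parallel x (h hx)

lemma isTensor_lieD {k : ℕ} {T : Tensor M k} (hD : IsSymplecticConnection Om D U) (hU : IsOpen U)
    (hT : IsSmoothTensor U T) (hVU : V ⊆ U) (hV : IsOpen V) {X : VField M} (hX : SmoothVF X V) :
    IsTensor V (lieD X T) := fun x hx => by
  obtain ⟨f, hf⟩ := hT.multilinear x (hVU hx)
  obtain ⟨g, hg⟩ := (hT.covD hD hU).multilinear x (hVU hx)
  refine ⟨g.curryLeft (X x) + ∑ i, f.compLinearMap (Function.update (fun _ => LinearMap.id) i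
    (D X x : TangentSpace (𝓡 2) x →ₗ[ℝ] TangentSpace (𝓡 2) x)), fun v => ?_⟩
  rw [lieD_eq hD hU hT (hVU hx) (SmoothVF.at hX hV hx), add_apply,
    MultilinearMap.curryLeft_apply, hg, sum_apply]
  congr 1
  refine Finset.sum_congr rfl fun i _ => ?_
  rw [hf, MultilinearMap.compLinearMap_apply]
  congr 1
  funext j
  by_cases hj : j = i
  · subst hj; simp
  · simp [hj]

/-- A one-form `Z` with `D_{(i} Z_{j)} = 0` for a symplectic connection with parallel Ricci tensor,
where `ν` is the value of `γ² + 4 Z^a Z^b S_{ab}`. -/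
structure IsKillingData (Om : Tensor M 2) (D : Conn M) (Z : Tensor M 1) (nu : ℝ) : Prop where
  form : IsSymplecticForm Om
  conn : IsSymplecticConnection Om D Set.univ
  par : ∀ x v, covD D (ric D) x v = 0
  smooth : IsSmoothTensor Set.univ Z
  killing : ∀ x v, symmetrize (covD D Z) x v = 0
  nu_eq : ∀ x, nuFn Om D Z x = nu

namespace IsKillingData

variable {Z : Tensor M 1} {nu : ℝ} (h : IsKillingData Om D Z nu)

include h

lemma isOpen : IsOpen (hatM Om D Z nu) := isOpen_hatM h.form h.conn h.smooth h.killing nu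

lemma smooth_w : SmoothFn (fun x => (nu - gam Om D Z x ^ 2)⁻¹) (hatM Om D Z nu) := by
  refine smoothFn_of_at fun x hx => ?_
  have hg := SmoothFn.at (smooth_gam h.form h.conn h.smooth h.killing) isOpen_univ
    (Set.mem_univ x)
  exact ((smoothFnAt_const nu).sub (hg.pow 2)).inv (sub_ne_zero.mpr (Ne.symm hx))

lemma smooth_Gam : IsSmoothTensor (hatM Om D Z nu) (Gam Om D Z nu) := by
  have hZ := h.smooth.multilinear
  refine isSmoothTensor_of_at (isTensor_of_linear ?_ ?_) ?_
  · intro x _ v i a b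
    fin_cases i <;> simp [Gam, hZ.add1 (Set.mem_univ x)] <;> ring
  · intro x _ v i a b
    fin_cases i <;> simp [Gam, hZ.smul1 _ (Set.mem_univ x)] <;> ring
  · intro x hx X hX
    have hz : ∀ i, SmoothFnAt (fun y => Z y ![X i y]) x := fun i => by
      have := h.smooth.smoothAt Filter.univ_mem (X := ![X i])
        (fun j => by fin_cases j; exact hX i)
      refine this.congr (Filter.Eventually.of_forall fun y => ?_)
      congr 1
      funext j; fin_cases j; rfl
    exact (((SmoothFn.at h.smooth_w h.isOpen hx).mul (hz 0)).mul (hz 1)).mul (hz 2)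

omit h in
lemma symm_Gam : IsSymmetricTensor U (Gam Om D Z nu) := fun x _ v s => by
  have h : ∀ v : Fin 3 → TangentSpace (𝓡 2) x, Gam Om D Z nu x v =
      (nu - gam Om D Z x ^ 2)⁻¹ * ∏ i, Z x ![v i] := fun v => by
    rw [Fin.prod_univ_three, Gam]; ring
  rw [h, h, Equiv.prod_comp s (fun i => Z x ![v i])]

lemma symplectic (t : ℝ) :
    IsSymplecticConnection Om (nab Om D Z nu t) (hatM Om D Z nu) :=
  addCubic_symplectic h.form (h.conn.mono isOpen_univ h.isOpen (Set.subset_univ _)) h.isOpen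
    (h.smooth_Gam.const_mul t) (symm_Gam.const_mul t)

section local_frame

variable (he : IsFrame Om e V) (hV : V ⊆ hatM Om D Z nu) (t : ℝ)

/-- The function `(ν - γ²)⁻¹`. -/
abbrev wR (V : Set M) (Om : Tensor M 2) (D : Conn M) (Z : Tensor M 1) (nu : ℝ) : smoothRing V :=
  toR V fun x => (nu - gam Om D Z x ^ 2)⁻¹

include hV in
lemma ev_wR (hx : x ∈ V) : ev hx (wR V Om D Z nu) = (nu - gam Om D Z x ^ 2)⁻¹ :=
  ev_toR (h.smooth_w.mono hV) hx

lemma gam_ev (hx : x ∈ V) : gam Om D Z x = 2 * ev hx (kg h.form h.conn he Z) :=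
  gam_eq h.form h.conn h.smooth h.killing he hx

lemma nu_ev (hx : x ∈ V) : nu = ev hx (4 * kg h.form h.conn he Z ^ 2 +
    4 * (baseConn h.form h.conn he).szz (comp1 V e Z)) :=
  (h.nu_eq x).symm.trans (nuFn_eq h.form h.conn h.smooth h.killing he hx)

include hV he in
-- Since `ν = γ² + 4S(Z,Z)`, the denominator `ν - γ²` is `4S(Z,Z)`. The algebraic lemmas know `w`
-- only through this relation.
lemma hw : wR V Om D Z nu * (4 * (baseConn h.form h.conn he).szz (comp1 V e Z)) = 1 := by
  refine ring_ext fun x hx => ?_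
  rw [map_mul, map_one, h.ev_wR hV hx]
  have h1 := h.nu_ev he hx
  have h2 := h.gam_ev he hx
  simp only [map_add, map_mul, map_pow, map_ofNat] at h1 ⊢
  have h3 : nu - gam Om D Z x ^ 2 =
      4 * ev hx ((baseConn h.form h.conn he).szz (comp1 V e Z)) := by
    linear_combination h1 - (gam Om D Z x + 2 * ev hx (kg h.form h.conn he Z)) * h2
  rw [← h3]
  exact inv_mul_cancel₀ (sub_ne_zero.mpr (Ne.symm (hV hx)))

lemma kill : (baseConn h.form h.conn he).IsKilling (comp1 V e Z) (kg h.form h.conn he Z) :=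
  isKilling h.form h.conn h.par h.smooth h.killing he

omit h in
lemma d_const (C : FrameConn (smoothRing V)) (c : ℝ) (i : Fin 2) :
    C.d i (algebraMap ℝ _ c) = 0 := Derivation.map_algebraMap _ _

lemma sym3_gamma (hV : V ⊆ hatM Om D Z nu) (he : IsFrame Om e V) (i j k : Fin 2) :
    FrameConn.sym3 (FrameConn.gamma (comp1 V e Z) (wR V Om D Z nu) (algebraMap ℝ _ t)) i j k =
      comp3 V e (fun x v => t * Gam Om D Z nu x v) i j k := by
  refine ring_ext fun x hx => ?_
  rw [ev_comp3 h.isOpen he hV (h.smooth_Gam.const_mul t) hx]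
  have hz := fun i => ev_comp1 isOpen_univ he (Set.subset_univ V) h.smooth hx i
  have hw := h.ev_wR hV hx
  have ht : ev hx (algebraMap ℝ _ t) = t := AlgHom.commutes _ _
  fin_cases i <;> fin_cases j <;> fin_cases k <;>
  · simp only [Fin.zero_eta, Fin.mk_one, FrameConn.sym3_simps, FrameConn.gamma_simps, map_mul,
      map_pow, hz, hw, ht, Gam, Matrix.cons_val]
    ring

/-- The components of `∇(t)` in a frame. -/
lemma frameConn_nab : frameConn h.form (h.symplectic t) h.isOpen he hV =
    (baseConn h.form h.conn he).add
      (FrameConn.gamma (comp1 V e Z) (wR V Om D Z nu) (algebraMap ℝ _ t)) :=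
  (frameConn_addCubic h.form (h.conn.mono isOpen_univ h.isOpen (Set.subset_univ _)) h.isOpen he hV
    (h.smooth_Gam.const_mul t) (symm_Gam.const_mul t)
    (fun i j k => h.sym3_gamma t hV he i j k)).trans (congrArg (fun C => FrameConn.add C _) rfl)

include hV he in
lemma ric_nab_frame (hx : x ∈ V) (i j : Fin 2) : ric (nab Om D Z nu t) x ![e i x, e j x] =
    ric D x ![e i x, e j x] +
      t * gam Om D Z x * (nu - gam Om D Z x ^ 2)⁻¹ * Z x ![e i x] * Z x ![e j x] := by
  rw [ric_frame h.form (h.symplectic t) h.isOpen he hV hx, h.frameConn_nab he hV,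
    (h.kill he).ric_add_gamma (h.hw he hV) (d_const _ t),
    ric_frame h.form h.conn isOpen_univ he (Set.subset_univ V) hx, h.gam_ev he hx]
  simp only [map_add, map_mul, map_ofNat, h.ev_wR hV hx, AlgHom.commutes, Algebra.algebraMap_self,
    RingHom.id_apply, ev_comp1 isOpen_univ he (Set.subset_univ V) h.smooth hx]
  rw [h.gam_ev he hx]
  ring

include hV he in
lemma rho_nab_frame (hx : x ∈ V) (i : Fin 2) : rho Om (nab Om D Z nu t) x ![e i x] =
    1 / 2 * t * (nu - 3 * gam Om D Z x ^ 2) * (nu - gam Om D Z x ^ 2)⁻¹ * Z x ![e i x] := by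
  rw [rho_frame h.form (h.symplectic t) h.isOpen he hV hx, h.frameConn_nab he hV,
    (h.kill he).rhoOf_ric (h.hw he hV) (d_const _ t)]
  have h1 := h.nu_ev he hx
  have h2 := h.gam_ev he hx
  simp only [map_add, map_mul, map_pow, map_ofNat] at h1
  simp only [map_sub, map_mul, map_ofNat, map_pow, h.ev_wR hV hx, AlgHom.commutes,
    Algebra.algebraMap_self,
    RingHom.id_apply, ev_comp1 isOpen_univ he (Set.subset_univ V) h.smooth hx]
  have h3 : nu - 3 * gam Om D Z x ^ 2 =
      4 * (ev hx ((baseConn h.form h.conn he).szz (comp1 V e Z))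
        - 2 * ev hx (kg h.form h.conn he Z) ^ 2) := by
    linear_combination h1 - 3 * (gam Om D Z x + 2 * ev hx (kg h.form h.conn he Z)) * h2
  rw [h3]
  ring

include hV he in
lemma moment_nab_frame (hx : x ∈ V) : moment Om (nab Om D Z nu t) x =
    -(3 / 4) * t * gam Om D Z x := by
  rw [moment_eq h.form (h.symplectic t) h.isOpen he hV hx, h.frameConn_nab he hV]
  have h1 := congrArg (ev hx) ((h.kill he).divdiv_ric (h.hw he hV) (d_const _ t))
  simp only [map_mul, map_neg, map_ofNat, AlgHom.commutes, Algebra.algebraMap_self,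
    RingHom.id_apply] at h1
  rw [h.gam_ev he hx]
  linarith

lemma ric_sharp_frame (hx : x ∈ V) (k : Fin 2) : ric D x ![e k x, sharp Om Z x] =
    ev hx ((baseConn h.form h.conn he).sz (comp1 V e Z) k) := by
  have hR := (h.conn.smooth_ric isOpen_univ).multilinear
  have t : x ∈ (Set.univ : Set M) := trivial
  rw [sharp_eq h.form he h.smooth.multilinear hx t, sub_eq_add_neg, ← neg_smul]
  simp only [hR.add21 t, hR.smul21 _ t, FrameConn.sz,
    map_sub, map_mul, ← ric_frame h.form h.conn isOpen_univ he (Set.subset_univ V) hx,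
    ev_comp1 isOpen_univ he (Set.subset_univ V) h.smooth hx]
  ring

include hV he in
lemma symm_nab_frame (hx : x ∈ V) (i j k : Fin 2) :
    symmetrize (covD (nab Om D Z nu t) (ric (nab Om D Z nu t))) x ![e i x, e j x, e k x] =
      -4 * t * nu * ((nu - gam Om D Z x ^ 2) ^ 2)⁻¹ * cubicZR Om D Z x ![e i x, e j x, e k x] := by
  have hS := h.symplectic t
  have hR := hS.smooth_ric h.isOpen
  have hc : ∀ i j k, covD (nab Om D Z nu t) (ric (nab Om D Z nu t)) x ![e i x, e j x, e k x] =
      ev hx ((frameConn h.form hS h.isOpen he hV).cov2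
        (frameConn h.form hS h.isOpen he hV).ric i j k) := fun i j k => by
    rw [← ev_comp3 h.isOpen he hV (hR.covD hS h.isOpen) hx, comp3_covD h.form hS h.isOpen he hV hR,
      ← comp2_ric]
  have hk := congrArg (ev hx)
    ((h.kill he).symm_cov_ric (h.hw he hV) (d_const _ t) i j k)
  have h1 := h.nu_ev he hx
  rw [← h.frameConn_nab he hV] at hk
  rw [cubicZR, symmetrize_three, symmetrize_three]
  simp only [Matrix.cons_val, hc, h.ric_sharp_frame he hx]
  simp only [map_add, map_mul, map_neg, map_pow, map_ofNat, h.ev_wR hV hx, AlgHom.commutes,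
    Algebra.algebraMap_self, RingHom.id_apply,
    ev_comp1 isOpen_univ he (Set.subset_univ V) h.smooth hx] at hk h1
  rw [← h1] at hk
  rw [hk, inv_pow]
  ring

include hV he in
lemma hop_nab_frame (c : ℝ) (hx : x ∈ V) (i j k : Fin 2) :
    hop Om (nab Om D Z nu t) (fun y => c * gam Om D Z y) x ![e i x, e j x, e k x] = 0 := by
  have hsm : SmoothFn (fun y => c * gam Om D Z y) Set.univ :=
    contMDiffOn_const.mul (smooth_gam h.form h.conn h.smooth h.killing)
  have hg : toR V (fun y => c * gam Om D Z y) = (2 * c) • kg h.form h.conn he Z :=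
    ring_ext fun y hy => by
      rw [ev_toR (hsm.mono (Set.subset_univ _)), map_smul, h.gam_ev he hy, smul_eq_mul]
      ring
  rw [hop_frame h.form (h.symplectic t) h.isOpen he hV hx (hsm.mono (Set.subset_univ _)), hg,
    h.frameConn_nab he hV, FrameConn.hop_smul, (h.kill he).hop_g (h.hw he hV) (d_const _ t),
    smul_zero, map_zero]

include hV he in
-- Proportionality to `γ` is asked on `V` only, because the moment map of `∇(t)` is computed only on
-- `hatM`.
lemma lie_nab_frame {f : M → ℝ} {c : ℝ} (hf : SmoothFn f (hatM Om D Z nu))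
    (hfc : ∀ x ∈ V, f x = c * gam Om D Z x) (hx : x ∈ V) (i j k : Fin 2) :
    lieD (ham Om f) (Gam Om D Z nu) x ![e i x, e j x, e k x] = 0 := by
  have hS := h.conn.mono isOpen_univ h.isOpen (Set.subset_univ (hatM Om D Z nu))
  have hg : toR V f = algebraMap ℝ _ (2 * c) * kg h.form h.conn he Z := ring_ext fun y hy => by
    rw [ev_toR (hf.mono hV), map_mul, AlgHom.commutes, hfc y hy, h.gam_ev he hy]
    simp only [Algebra.algebraMap_self, RingHom.id_apply]
    ring
  have h1 := (h.kill he).lie_gamma (h.hw he hV) (d_const _ 1) (d_const _ (2 * c)) i j k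
  have h2 : FrameConn.sym3 (FrameConn.gamma (comp1 V e Z) (wR V Om D Z nu) (algebraMap ℝ _ 1)) =
      comp3 V e (Gam Om D Z nu) := by
    funext i j k
    rw [h.sym3_gamma 1 hV he]
    simp only [one_mul]
  rw [lieD_frame h.form hS h.isOpen he hV h.smooth_Gam hx (smooth_ham h.form h.isOpen he hV hf),
    compV_ham h.form hS h.isOpen he hV hf, hg, ← h2]
  exact (congrArg (ev hx) h1).trans (map_zero _)

end local_frame

section pointwise

variable (t : ℝ) (hx : x ∈ hatM Om D Z nu)

include hx

lemma ric_nab (v : Fin 2 → TangentSpace (𝓡 2) x) : ric (nab Om D Z nu t) x v = ric D x v +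
    t * gam Om D Z x * (nu - gam Om D Z x ^ 2)⁻¹ * Z x ![v 0] * Z x ![v 1] := by
  obtain ⟨V, e, hxV, hV, he⟩ := exists_frame h.form h.isOpen hx
  have hZ := h.smooth.multilinear
  have hR := (h.conn.smooth_ric isOpen_univ).multilinear
  refine tensor_ext (T := fun x v => ric D x v + t * gam Om D Z x * (nu - gam Om D Z x ^ 2)⁻¹ *
    Z x ![v 0] * Z x ![v 1]) h.form he ((h.symplectic t).smooth_ric h.isOpen).multilinear
    ((hR.mono (Set.subset_univ _)).add (isTensor_of_linear ?_ ?_)) hxV hx (fun I => ?_) v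
  · intro x _ v i a b
    fin_cases i <;> simp [hZ.add1 (Set.mem_univ x)] <;> ring
  · intro x _ v i a b
    fin_cases i <;> simp [hZ.smul1 _ (Set.mem_univ x)] <;> ring
  · have hI : I = ![I 0, I 1] := by funext r; fin_cases r <;> rfl
    rw [hI, frame_vec2]
    exact h.ric_nab_frame he hV t hxV _ _

lemma rho_nab (v : TangentSpace (𝓡 2) x) : rho Om (nab Om D Z nu t) x ![v] =
    1 / 2 * t * (nu - 3 * gam Om D Z x ^ 2) * (nu - gam Om D Z x ^ 2)⁻¹ * Z x ![v] := by
  obtain ⟨V, e, hxV, hV, he⟩ := exists_frame h.form h.isOpen hx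
  have hr := isTensor_rho (h.symplectic t) h.isOpen
  have hZ := h.smooth.multilinear
  rw [eq_sum_fco h.form he hxV v, Fin.sum_univ_two, hr.add1 hx, hr.smul1 _ hx, hr.smul1 _ hx,
    hZ.add1 trivial, hZ.smul1 _ trivial, hZ.smul1 _ trivial, h.rho_nab_frame he hV t hxV,
    h.rho_nab_frame he hV t hxV]
  ring

lemma moment_nab : moment Om (nab Om D Z nu t) x = -(3 / 4) * t * gam Om D Z x := by
  obtain ⟨V, e, hxV, hV, he⟩ := exists_frame h.form h.isOpen hx
  exact h.moment_nab_frame he hV t hxV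

lemma isTensor_cubicZR : IsTensor Set.univ (cubicZR Om D Z) := by
  have hZ := h.smooth.multilinear
  have hR := (h.conn.smooth_ric isOpen_univ).multilinear
  refine IsTensor.symmetrize (isTensor_of_linear ?_ ?_)
  · intro x _ v i a b
    fin_cases i <;> simp [hZ.add1 (Set.mem_univ x), hR.add20 (Set.mem_univ x)] <;> ring
  · intro x _ v i a b
    fin_cases i <;> simp [hZ.smul1 _ (Set.mem_univ x), hR.smul20 _ (Set.mem_univ x)] <;> ring

lemma symm_nab (v : Fin 3 → TangentSpace (𝓡 2) x) :
    symmetrize (covD (nab Om D Z nu t) (ric (nab Om D Z nu t))) x v =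
      -4 * t * nu * ((nu - gam Om D Z x ^ 2) ^ 2)⁻¹ * cubicZR Om D Z x v := by
  obtain ⟨V, e, hxV, hV, he⟩ := exists_frame h.form h.isOpen hx
  have hS := h.symplectic t
  have hc : IsTensor (hatM Om D Z nu) (cubicZR Om D Z) :=
    (h.isTensor_cubicZR hx).mono (Set.subset_univ _)
  -- The scalar factor is frozen at `x`, since the comparison takes place at this point alone.
  refine tensor_ext (T := fun y v => -4 * t * nu * ((nu - gam Om D Z x ^ 2) ^ 2)⁻¹ *
    cubicZR Om D Z y v) h.form he
    (((hS.smooth_ric h.isOpen).covD hS h.isOpen).multilinear.symmetrize) (hc.const_mul _) hxV hx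
    (fun I => ?_) v
  have hI : I = ![I 0, I 1, I 2] := by funext r; fin_cases r <;> rfl
  rw [hI, frame_vec3]
  exact h.symm_nab_frame he hV t hxV _ _ _

lemma hop_nab (c : ℝ) (v : Fin 3 → TangentSpace (𝓡 2) x) :
    hop Om (nab Om D Z nu t) (fun y => c * gam Om D Z y) x v = 0 := by
  obtain ⟨V, e, hxV, hV, he⟩ := exists_frame h.form h.isOpen hx
  have hsm : SmoothFn (fun y => c * gam Om D Z y) Set.univ :=
    contMDiffOn_const.mul (smooth_gam h.form h.conn h.smooth h.killing)
  refine tensor_ext (T := fun _ _ => 0) h.form he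
    (isTensor_hop h.form (h.symplectic t) h.isOpen he hV (hsm.mono (Set.subset_univ _)))
    isTensor_zero hxV hxV (fun I => ?_) v
  have hI : I = ![I 0, I 1, I 2] := by funext r; fin_cases r <;> rfl
  rw [hI, frame_vec3]
  exact h.hop_nab_frame he hV t c hxV _ _ _

lemma lie_nab (v : Fin 3 → TangentSpace (𝓡 2) x) :
    lieD (ham Om (moment Om (nab Om D Z nu t))) (Gam Om D Z nu) x v = 0 := by
  obtain ⟨V, e, hxV, hV, he⟩ := exists_frame h.form h.isOpen hx
  have hS := h.conn.mono isOpen_univ h.isOpen (Set.subset_univ (hatM Om D Z nu))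
  have hsm : SmoothFn (moment Om (nab Om D Z nu t)) (hatM Om D Z nu) := by
    refine smoothFn_of_at fun y hy => ?_
    refine ((smoothFnAt_const (-(3 / 4) * t)).mul
      (SmoothFn.at (smooth_gam h.form h.conn h.smooth h.killing) isOpen_univ trivial)).congr ?_
    filter_upwards [h.isOpen.eventually_mem hy] with z hz
    exact h.moment_nab t hz
  have hT := isTensor_lieD hS h.isOpen h.smooth_Gam hV he.isOpen
    (smooth_ham h.form h.isOpen he hV hsm)
  refine tensor_ext (T := fun _ _ => 0) h.form he hT isTensor_zero hxV hxV (fun I => ?_) v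
  have hI : I = ![I 0, I 1, I 2] := by funext r; fin_cases r <;> rfl
  rw [hI, frame_vec3]
  exact h.lie_nab_frame he hV hsm (fun y hy => h.moment_nab t (hV hy)) hxV _ _ _

/-- Here `dK_i = (3/2)t S_ip Z^p`, so `ρ^p dK_p = (3/4)t²(ν - 3γ²)w S(Z,Z) = (3/16)t²(ν - 3γ²)`, and
adding `K² = (9/16)t²γ²` removes `γ`. -/
lemma tau_nab : moment Om (nab Om D Z nu t) x ^ 2 +
    diffl (moment Om (nab Om D Z nu t)) x ![sharp Om (rho Om (nab Om D Z nu t)) x] =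
      3 * t ^ 2 / 16 * nu := by
  obtain ⟨V, e, hxV, hV, he⟩ := exists_frame h.form h.isOpen hx
  have hr := isTensor_rho (h.symplectic t) h.isOpen
  have hsm : SmoothFn (gam Om D Z) V :=
    (smooth_gam h.form h.conn h.smooth h.killing).mono (Set.subset_univ _)
  have hg : toR V (gam Om D Z) = algebraMap ℝ _ 2 * kg h.form h.conn he Z := ring_ext fun y hy => by
    rw [ev_toR hsm, map_mul, AlgHom.commutes, h.gam_ev he hy]; rfl
  have hd : ∀ i, mvfderiv (𝓡 2) (moment Om (nab Om D Z nu t)) x (e i x) =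
      (3 / 2) * t * ev hxV ((baseConn h.form h.conn he).sz (comp1 V e Z) i) := fun i => by
    have h1 : mvfderiv (𝓡 2) (moment Om (nab Om D Z nu t)) x =
        mvfderiv (𝓡 2) (fun y => (-(3 / 4) * t) * gam Om D Z y) x := mvfderiv_congr (by
      filter_upwards [h.isOpen.eventually_mem hx] with z hz
      exact h.moment_nab t hz)
    have h2 : SmoothFn (fun y => (-(3 / 4) * t) * gam Om D Z y) V := contMDiffOn_const.mul hsm
    have h3 : toR V (fun y => (-(3 / 4) * t) * gam Om D Z y) =
        algebraMap ℝ _ (-(3 / 2) * t) * kg h.form h.conn he Z := ring_ext fun y hy => by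
      rw [ev_toR h2, map_mul, AlgHom.commutes, h.gam_ev he hy]
      simp only [Algebra.algebraMap_self, RingHom.id_apply]
      ring
    rw [h1, ← ev_d h.form h.conn isOpen_univ he (Set.subset_univ V) hxV h2, h3, Derivation.leibniz,
      d_const, (h.kill he).d_g, smul_zero, add_zero, smul_eq_mul, map_mul, AlgHom.commutes, map_neg,
      Algebra.algebraMap_self, RingHom.id_apply]
    ring
  rw [diffl, Matrix.cons_val_zero, sharp_eq h.form he hr hxV hx, map_sub, map_smul, map_smul, hd, hd,
    h.moment_nab t hx, h.rho_nab_frame he hV t hxV, h.rho_nab_frame he hV t hxV]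
  have h1 := h.nu_ev he hxV
  have h2 := h.gam_ev he hxV
  have h4 := sub_ne_zero.mpr (Ne.symm hx)
  simp only [map_add, map_mul, map_pow, map_ofNat, FrameConn.szz, map_sub,
    ev_comp1 isOpen_univ he (Set.subset_univ V) h.smooth hxV] at h1
  have h5 : nu - gam Om D Z x ^ 2 = 4 * (ev hxV ((baseConn h.form h.conn he).sz (comp1 V e Z) 0) *
      Z x ![e 1 x] - ev hxV ((baseConn h.form h.conn he).sz (comp1 V e Z) 1) * Z x ![e 0 x]) := by
    linear_combination h1 - (gam Om D Z x + 2 * ev hxV (kg h.form h.conn he Z)) * h2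
  simp only [smul_eq_mul]
  have h6 : (nu - gam Om D Z x ^ 2)⁻¹ * (4 * (ev hxV ((baseConn h.form h.conn he).sz (comp1 V e Z) 0) *
      Z x ![e 1 x] - ev hxV ((baseConn h.form h.conn he).sz (comp1 V e Z) 1) * Z x ![e 0 x])) = 1 := by
    rw [← h5]; exact inv_mul_cancel₀ h4
  linear_combination (3 / 16) * t ^ 2 * (nu - 3 * gam Om D Z x ^ 2) * h6

end pointwise

end IsKillingData

end

/-! ### First variation of the moment map. -/

section

namespace FrameConn

variable {A : Type*} [CommRing A] [Algebra ℝ A] (C : FrameConn A)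

/-- Polynomial dependence of the moment map on the connection. -/
lemma divdiv_add_smul (p : ℕ → A) : ∃ a₂ a₃ : A, ∀ s : A, (∀ i, C.d i s = 0) →
    2 * (C.add fun n => s * p n).divdiv (C.add fun n => s * p n).ric =
      2 * C.divdiv C.ric - s * C.momentVar p + s ^ 2 * a₂ + s ^ 3 * a₃ := by
  -- `Ric` is quadratic in `s`, passing to `ρ` adds one degree and the divergence does not depend on
  -- the connection. The witnesses are the divergences of the coefficients of `s²` and `s³` in `ρ`.
  refine ⟨-C.div (raise fun i => C.rhoOf (quad p) i + twist p (C.divOf (sym3 p)) i),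
    -C.div (raise (twist p (quad p))), fun s hs => ?_⟩
  have h2 (i : Fin 2) : C.d i (2 : A) = 0 := by exact_mod_cast (C.d i).map_natCast 2
  have hB : ∀ i j, C.divOf (sym3 fun n => s * p n) i j = s * C.divOf (sym3 p) i j := fun i j => by
    fin_cases i <;> fin_cases j <;>
    · simp only [Fin.zero_eta, Fin.mk_one, divOf, cov3, Fin.sum_univ_two, sym3_simps,
        Derivation.leibniz, hs, smul_eq_mul, mul_zero, add_zero]
      ring
  have hq : ∀ i j, quad (fun n => s * p n) i j = s ^ 2 * quad p i j := fun i j => by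
    fin_cases i <;> fin_cases j <;>
    · simp only [Fin.zero_eta, Fin.mk_one, quad, Fin.sum_univ_two, sym3_simps, raise_zero,
        raise_one]
      ring
  have hr : (C.add fun n => s * p n).ric =
      fun i j => C.ric i j + s * C.divOf (sym3 p) i j + s ^ 2 * quad p i j := by
    funext i j; rw [ric_add, hB, hq]
  have hrho : (C.add fun n => s * p n).rhoOf (C.add fun n => s * p n).ric = fun i =>
      C.rhoOf C.ric i + s * (C.rhoOf (C.divOf (sym3 p)) i + twist p C.ric i)
      + s ^ 2 * (C.rhoOf (quad p) i + twist p (C.divOf (sym3 p)) i)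
      + s ^ 3 * twist p (quad p) i := by
    rw [hr]
    funext i
    rw [rhoOf_add]
    generalize C.divOf (sym3 p) = B
    generalize quad p = Q
    fin_cases i <;>
    · simp only [Fin.zero_eta, Fin.mk_one, rhoOf, cov2, twist, Fin.sum_univ_two, sym3_simps,
        raise_zero, raise_one, Derivation.leibniz, Derivation.leibniz_pow, map_add, hs, smul_eq_mul,
        mul_zero, smul_zero, add_zero]
      ring
  rw [two_mul_divdiv _ _ (ric_symm _), div_add, hrho, two_mul_divdiv _ _ C.ric_symm, momentVar]
  generalize C.rhoOf (C.divOf (sym3 p)) = T₁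
  generalize twist p C.ric = S₁
  generalize C.rhoOf (quad p) = T₂
  generalize twist p (C.divOf (sym3 p)) = S₂
  generalize twist p (quad p) = T₃
  generalize C.rhoOf C.ric = T₀
  simp only [div, covV, Fin.sum_univ_two, raise_zero, raise_one, Derivation.leibniz,
    Derivation.leibniz_pow, map_add, map_neg, hs, smul_eq_mul, mul_zero, smul_zero, add_zero]
  ring

lemma momentVar_add (p q : ℕ → A) :
    C.momentVar (fun n => p n + q n) = C.momentVar p + C.momentVar q := by
  have hB : C.divOf (sym3 fun n => p n + q n) =
      fun i j => C.divOf (sym3 p) i j + C.divOf (sym3 q) i j := by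
    funext i j
    fin_cases i <;> fin_cases j <;>
    · simp only [Fin.zero_eta, Fin.mk_one, divOf, cov3, Fin.sum_univ_two, sym3_simps, map_add]
      ring
  rw [momentVar, momentVar, momentVar, hB]
  generalize C.divOf (sym3 p) = B
  generalize C.divOf (sym3 q) = B'
  simp only [div, covV, rhoOf, cov2, twist, Fin.sum_univ_two, sym3_simps,
    raise_zero, raise_one, map_add, map_neg, map_sub, Derivation.leibniz, smul_eq_mul]
  ring

/-- The flux depends locally on the cubic tensor. -/
lemma flux_mem {I : Ideal A} (hI : ∀ i, ∀ a ∈ I, C.d i a ∈ I) (f : A) {p : ℕ → A}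
    (hp : ∀ i j k, sym3 p i j k ∈ I) (k : Fin 2) : C.flux f p k ∈ I := by
  -- Membership is computed in the quotient by `I`, where all components of `p` and their
  -- derivatives vanish. The ideal used later consists of the functions vanishing off a compact set.
  have h0 : ∀ i j k, Ideal.Quotient.mk I (sym3 p i j k) = 0 := fun i j k =>
    Ideal.Quotient.eq_zero_iff_mem.mpr (hp i j k)
  have h1 : ∀ l i j k, Ideal.Quotient.mk I (C.d l (sym3 p i j k)) = 0 := fun l i j k =>
    Ideal.Quotient.eq_zero_iff_mem.mpr (hI l _ (hp i j k))
  have hB : ∀ i j, C.divOf (sym3 p) i j ∈ I := fun i j => by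
    rw [← Ideal.Quotient.eq_zero_iff_mem]
    fin_cases i <;> fin_cases j <;> simp [divOf, cov3, h0, h1]
  have hB0 : ∀ i j, Ideal.Quotient.mk I (C.divOf (sym3 p) i j) = 0 := fun i j =>
    Ideal.Quotient.eq_zero_iff_mem.mpr (hB i j)
  have hB1 : ∀ k i j, Ideal.Quotient.mk I (C.d k (C.divOf (sym3 p) i j)) = 0 := fun k i j =>
    Ideal.Quotient.eq_zero_iff_mem.mpr (hI k _ (hB i j))
  rw [← Ideal.Quotient.eq_zero_iff_mem]
  fin_cases k <;>
    simp [flux, rhoOf, cov2, twist, contr2, h0, hB0, hB1]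

end FrameConn

variable {M : Type*} [TopologicalSpace M] [ChartedSpace Plane M] [IsManifold (𝓡 2) ∞ M] [T2Space M]

variable {Om : Tensor M 2} {D : Conn M} {U V : Set M} {e : Fin 2 → VField M} {x : M}

/-- The first variation of the moment map, as the interpolated linear coefficient of a cubic
polynomial. -/
def varMoment (Om : Tensor M 2) (D : Conn M) (P : Tensor M 3) (x : M) : ℝ :=
  letI K := fun s : ℝ => moment Om (addCubic Om D (fun y v => s * P y v)) x
  -- For `a₀ + a₁s + a₂s² + a₃s³` the two differences are `2a₁ + 2a₃` and `4a₁ + 16a₃`, so the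
  -- combination is exactly `a₁`. This form makes smoothness of the variation immediate.
  (8 * (K 1 - K (-1)) - (K 2 - K (-2))) / 12

section moment

variable {P : Tensor M 3} (hOm : IsSymplecticForm Om) (hD : IsSymplecticConnection Om D U)
  (hU : IsOpen U) (he : IsFrame Om e V) (hVU : V ⊆ U) (hP : IsSmoothTensor U P)
  (hS : IsSymmetricTensor U P)

include hOm hD hU in
lemma smooth_moment : SmoothFn (moment Om D) U := by
  refine smoothFn_of_at fun x hx => ?_
  obtain ⟨V, e, hxV, hV, he⟩ := exists_frame hOm hU hx
  refine (SmoothFn.at (smooth_fn ((frameConn hOm hD hU he hV).divdiv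
    (frameConn hOm hD hU he hV).ric)) he.isOpen hxV).congr ?_
  filter_upwards [he.isOpen.eventually_mem hxV] with y hy
  rw [moment_eq hOm hD hU he hV hy, fn_apply hy]

include hP hS in
lemma exists_poly_frame (hx : x ∈ V) {p : ℕ → smoothRing V}
    (hp : ∀ i j k, FrameConn.sym3 p i j k = comp3 V e P i j k) : ∃ b c : ℝ, ∀ s : ℝ,
    moment Om (addCubic Om D (fun y v => s * P y v)) x = moment Om D x
      - s * (1 / 2 * ev hx ((frameConn hOm hD hU he hVU).momentVar p)) + s ^ 2 * b + s ^ 3 * c := by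
  obtain ⟨a₂, a₃, h⟩ := (frameConn hOm hD hU he hVU).divdiv_add_smul p
  refine ⟨1 / 2 * ev hx a₂, 1 / 2 * ev hx a₃, fun s => ?_⟩
  have hs := congrArg (ev hx) (h (algebraMap ℝ _ s) fun i => Derivation.map_algebraMap _ _)
  have hq : ∀ i j k, FrameConn.sym3 (fun n => algebraMap ℝ _ s * p n) i j k =
      comp3 V e (fun y v => s * P y v) i j k := fun i j k => ring_ext fun y hy => by
    rw [ev_comp3 hU he hVU (hP.const_mul s) hy, FrameConn.sym3, map_mul, AlgHom.commutes,
      ← ev_comp3 hU he hVU hP hy, ← hp]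
    rfl
  rw [moment_eq hOm (addCubic_symplectic hOm hD hU (hP.const_mul s) (hS.const_mul s)) hU he hVU hx,
    frameConn_addCubic hOm hD hU he hVU (hP.const_mul s) (hS.const_mul s) hq,
    moment_eq hOm hD hU he hVU hx]
  simp only [map_add, map_sub, map_mul, map_pow, map_ofNat, AlgHom.commutes,
    Algebra.algebraMap_self, RingHom.id_apply] at hs
  linarith

include hP hS in
lemma varMoment_frame (hx : x ∈ V) {p : ℕ → smoothRing V}
    (hp : ∀ i j k, FrameConn.sym3 p i j k = comp3 V e P i j k) : varMoment Om D P x =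
      -(1 / 2) * ev hx ((frameConn hOm hD hU he hVU).momentVar p) := by
  obtain ⟨b, c, h⟩ := exists_poly_frame hOm hD hU he hVU hP hS hx hp
  simp only [varMoment, h]
  ring

include hOm hD hU hP hS

lemma exists_poly (hx : x ∈ U) : ∃ b c : ℝ, ∀ s : ℝ,
    moment Om (addCubic Om D (fun y v => s * P y v)) x = moment Om D x
      + s * varMoment Om D P x + s ^ 2 * b + s ^ 3 * c := by
  obtain ⟨V, e, hxV, hV, he⟩ := exists_frame hOm hU hx
  obtain ⟨p, hp⟩ := exists_sym3 hU he hV hP hS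
  obtain ⟨b, c, h⟩ := exists_poly_frame hOm hD hU he hV hP hS hxV hp
  refine ⟨b, c, fun s => ?_⟩
  rw [h, varMoment_frame hOm hD hU he hV hP hS hxV hp]
  ring

lemma smooth_varMoment : SmoothFn (varMoment Om D P) U := by
  have h : ∀ s : ℝ, SmoothFn (moment Om (addCubic Om D (fun y v => s * P y v))) U := fun s =>
    smooth_moment hOm (addCubic_symplectic hOm hD hU (hP.const_mul s) (hS.const_mul s)) hU
  exact ((contMDiffOn_const.mul ((h 1).sub (h (-1)))).sub ((h 2).sub (h (-2)))).mul
    (contMDiffOn_const (c := (12 : ℝ)⁻¹))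

lemma varMoment_add {Q : Tensor M 3} (hQ : IsSmoothTensor U Q) (hT : IsSymmetricTensor U Q)
    (hx : x ∈ U) : varMoment Om D (fun y v => P y v + Q y v) x =
      varMoment Om D P x + varMoment Om D Q x := by
  obtain ⟨V, e, hxV, hV, he⟩ := exists_frame hOm hU hx
  obtain ⟨p, hp⟩ := exists_sym3 hU he hV hP hS
  obtain ⟨q, hq⟩ := exists_sym3 hU he hV hQ hT
  have hpq : ∀ i j k, FrameConn.sym3 (fun n => p n + q n) i j k =
      comp3 V e (fun y v => P y v + Q y v) i j k := fun i j k => ring_ext fun y hy => by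
    rw [ev_comp3 hU he hV (hP.add hQ) hy, ← ev_comp3 hU he hV hP hy, ← ev_comp3 hU he hV hQ hy,
      ← hp, ← hq, FrameConn.sym3, map_add]
    rfl
  rw [varMoment_frame hOm hD hU he hV hP hS hxV hp, varMoment_frame hOm hD hU he hV hQ hT hxV hq,
    varMoment_frame hOm hD hU he hV (hP.add hQ) (hS.add hT) hxV hpq, FrameConn.momentVar_add,
    map_add]
  ring

lemma varMoment_congr {Q : Tensor M 3} (hQ : IsSmoothTensor U Q) (hT : IsSymmetricTensor U Q)
    (hx : x ∈ U) (h : ∀ᶠ y in 𝓝 x, P y = Q y) : varMoment Om D P x = varMoment Om D Q x := by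
  obtain ⟨W, hW, hWo, hxW⟩ := eventually_nhds_iff.mp h
  -- On a frame domain inside the set where `P = Q` both tensors have the same components.
  obtain ⟨V, e, hxV, hV, he⟩ := exists_frame hOm (hU.inter hWo) (⟨hx, hxW⟩ : x ∈ U ∩ W)
  have hVU : V ⊆ U := hV.trans Set.inter_subset_left
  obtain ⟨p, hp⟩ := exists_sym3 hU he hVU hP hS
  have hq : ∀ i j k, FrameConn.sym3 p i j k = comp3 V e Q i j k := fun i j k =>
    ring_ext fun y hy => by
      rw [hp, ev_comp3 hU he hVU hP hy, ev_comp3 hU he hVU hQ hy, hW y (hV hy).2]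
  rw [varMoment_frame hOm hD hU he hVU hP hS hxV hp, varMoment_frame hOm hD hU he hVU hQ hT hxV hq]

omit hOm hD hU hP hS in
lemma varMoment_zero : varMoment Om D (fun _ _ => 0) x = 0 := by
  simp [varMoment]

end moment

/-- The Green identity integrand. -/
def green (Om : Tensor M 2) (D : Conn M) (f : M → ℝ) (P : Tensor M 3) (x : M) : ℝ :=
  f x * varMoment Om D P x - contract Om (hop Om D f) P x

section green

variable {P : Tensor M 3} {f : M → ℝ} (hOm : IsSymplecticForm Om)
  (hD : IsSymplecticConnection Om D U) (hU : IsOpen U) (he : IsFrame Om e V) (hVU : V ⊆ U)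
  (hf : SmoothFn f U) (hP : IsSmoothTensor U P) (hS : IsSymmetricTensor U P)

include hVU hf hP in
lemma contract_hop_frame (hx : x ∈ V) : contract Om (hop Om D f) P x =
    ev hx (FrameConn.contr3 ((frameConn hOm hD hU he hVU).hop (toR V f)) (comp3 V e P)) := by
  rw [contract_eq hOm he (isTensor_hop hOm hD hU he hVU hf) (hP.multilinear.mono hVU) hx hx]
  simp only [FrameConn.contr3, FrameConn.contr2, map_add, map_sub, map_mul, ev_comp3 hU he hVU hP,
    ← hop_frame hOm hD hU he hVU hx hf]
  have hc : ∀ i j k, (Fin.cons (e i x) (Fin.cons (e j x) (Fin.cons (e k x) ![])) :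
      Fin 3 → TangentSpace (𝓡 2) x) = ![e i x, e j x, e k x] := fun _ _ _ => rfl
  simp only [contrE, hc]
  ring

include hVU hf hP hS in
-- The algebraic Green identity `div_flux`, with `δK = -(1/2) momentVar`.
lemma green_frame (hx : x ∈ V) {p : ℕ → smoothRing V}
    (hp : ∀ i j k, FrameConn.sym3 p i j k = comp3 V e P i j k) : green Om D f P x =
      1 / 2 * ev hx ((frameConn hOm hD hU he hVU).div
        ((frameConn hOm hD hU he hVU).flux (toR V f) p)) := by
  have h : FrameConn.sym3 p = comp3 V e P := by funext i j k; exact hp i j k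
  rw [green, FrameConn.div_flux, varMoment_frame hOm hD hU he hVU hP hS hx hp, h,
    contract_hop_frame hOm hD hU he hVU hf hP hx]
  simp only [map_sub, map_mul, map_neg, map_ofNat, ev_toR (hf.mono hVU) hx]
  ring

end green

end

section

variable {M : Type*} [TopologicalSpace M] [ChartedSpace Plane M] [IsManifold (𝓡 2) ∞ M] [T2Space M]

variable {Om : Tensor M 2} {D : Conn M} {U V : Set M} {e : Fin 2 → VField M} {x : M}

/-! ### The area measure in a chart -/

lemma hasMFDerivAt_transition {c c' : OpenPartialHomeomorph M Plane} (hc : c ∈ atlas Plane M)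
    (hc' : c' ∈ atlas Plane M) {y : Plane} (hy : y ∈ c'.target) (hy' : c'.symm y ∈ c.source) :
    HasFDerivAt (fun z => c (c'.symm z)) (fderiv ℝ (fun z => c (c'.symm z)) y) y ∧
    ∀ v : Plane, (mfderiv 𝓘(ℝ, Plane) (𝓡 2) c'.symm y v : Plane) =
      mfderiv 𝓘(ℝ, Plane) (𝓡 2) c.symm (c (c'.symm y)) (fderiv ℝ (fun z => c (c'.symm z)) y v) := by
  have : IsManifold (𝓡 2) 1 M := IsManifold.of_le (n := ∞) (by simp)
  have h1 : MDifferentiableAt 𝓘(ℝ, Plane) (𝓡 2) c'.symm y := mdifferentiableAt_atlas_symm hc' hy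
  have h2 : MDifferentiableAt (𝓡 2) 𝓘(ℝ, Plane) c (c'.symm y) := mdifferentiableAt_atlas hc hy'
  have h3 : MDifferentiableAt 𝓘(ℝ, Plane) (𝓡 2) c.symm (c (c'.symm y)) :=
    mdifferentiableAt_atlas_symm hc (c.map_source hy')
  have hT : HasFDerivAt (fun z => c (c'.symm z)) (fderiv ℝ (fun z => c (c'.symm z)) y) y :=
    (mdifferentiableAt_iff_differentiableAt.mp (h2.comp y h1)).hasFDerivAt
  refine ⟨hT, fun v => ?_⟩
  have hev : c'.symm =ᶠ[𝓝 y] (c.symm ∘ fun z => c (c'.symm z)) := by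
    filter_upwards [(c'.continuousAt_symm hy).preimage_mem_nhds (c.open_source.mem_nhds hy')]
      with z hz
    exact (c.left_inv hz).symm
  have h4 := (h3.hasMFDerivAt.comp y hT.hasMFDerivAt).congr_of_eventuallyEq hev
  have h5 := hasMFDerivAt_unique h1.hasMFDerivAt h4
  exact congrArg (fun L : Plane →L[ℝ] Plane => L v) h5

lemma det_plane (T : Plane →L[ℝ] Plane) : T.det =
    T (EuclideanSpace.single 0 1) 0 * T (EuclideanSpace.single 1 1) 1
      - T (EuclideanSpace.single 1 1) 0 * T (EuclideanSpace.single 0 1) 1 := by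
  rw [ContinuousLinearMap.det, ← LinearMap.det_toMatrix (EuclideanSpace.basisFun (Fin 2) ℝ).toBasis,
    Matrix.det_fin_two]
  simp [LinearMap.toMatrix_apply]

/-- The density of the area form in a chart. -/
def chartDens (Om : Tensor M 2) (c : OpenPartialHomeomorph M Plane) (y : Plane) : ℝ :=
  Om (c.symm y) ![mfderiv 𝓘(ℝ, Plane) (𝓡 2) c.symm y (EuclideanSpace.single 0 (1 : ℝ) : Plane),
    mfderiv 𝓘(ℝ, Plane) (𝓡 2) c.symm y (EuclideanSpace.single 1 (1 : ℝ) : Plane)]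

/-- An area form transforms by the Jacobian determinant of the transition map; this makes the chart
measures compatible. -/
lemma chartDens_transition (hOm : IsSymplecticForm Om) {c c' : OpenPartialHomeomorph M Plane}
    (hc : c ∈ atlas Plane M) (hc' : c' ∈ atlas Plane M) {y : Plane} (hy : y ∈ c'.target)
    (hy' : c'.symm y ∈ c.source) : chartDens Om c' y =
      (fderiv ℝ (fun z => c (c'.symm z)) y).det * chartDens Om c (c (c'.symm y)) := by
  have h := (hasMFDerivAt_transition hc hc' hy hy').2
  set T := fderiv ℝ (fun z => c (c'.symm z)) y
  have hp : c'.symm y = c.symm (c (c'.symm y)) := (c.left_inv hy').symm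
  -- The two points are only propositionally equal. Their tangent spaces are compared through the
  -- common model `Plane`.
  have key : ∀ (p q : M) (_ : p = q) (a b a' b' : Plane), a = a' → b = b' →
      Om p ![(a : TangentSpace (𝓡 2) p), (b : TangentSpace (𝓡 2) p)] =
      Om q ![(a' : TangentSpace (𝓡 2) q), (b' : TangentSpace (𝓡 2) q)] := by
    rintro p _ rfl a b _ _ rfl rfl; rfl
  have hT : ∀ v : Plane, v = v 0 • EuclideanSpace.single 0 (1 : ℝ) +
      v 1 • EuclideanSpace.single 1 (1 : ℝ) := fun v => by
    ext i; fin_cases i <;> simp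
  rw [chartDens, chartDens, key _ _ hp _ _ _ _ (h _) (h _)]
  set L := mfderiv 𝓘(ℝ, Plane) (𝓡 2) c.symm (c (c'.symm y))
  have hL : ∀ v : Plane, L v = v 0 • L (EuclideanSpace.single 0 (1 : ℝ) : Plane) +
      v 1 • L (EuclideanSpace.single 1 (1 : ℝ) : Plane) := fun v => by
    conv_lhs => rw [hT v]
    exact (L.map_add _ _).trans (congrArg₂ (· + ·) (L.map_smul _ _) (L.map_smul _ _))
  rw [hL (T _), hL (T (EuclideanSpace.single 1 (1 : ℝ))), det_plane]
  simp only [hOm.add_left, hOm.add_right, hOm.smul_left, hOm.smul_right, hOm.alternating]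
  rw [hOm.swap (L (EuclideanSpace.single 1 (1 : ℝ) : Plane))]
  ring

lemma chartDens_chartAt {y : M} (hy : y ∈ (chartAt Plane x).source) :
    chartDens Om (chartAt Plane x) (chartAt Plane x y) = dens Om x y := by
  have key : ∀ (p q : M) (_ : p = q) (a b a' b' : Plane), a = a' → b = b' →
      Om p ![(a : TangentSpace (𝓡 2) p), (b : TangentSpace (𝓡 2) p)] =
      Om q ![(a' : TangentSpace (𝓡 2) q), (b' : TangentSpace (𝓡 2) q)] := by
    rintro p _ rfl a b _ _ rfl rfl; rfl
  exact key _ _ ((chartAt Plane x).left_inv hy) _ _ _ _ (coordVF_apply hy 0).symm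
    (coordVF_apply hy 1).symm

section measure

variable [MeasurableSpace M] [BorelSpace M]

/-- The area measure of a chart. -/
def chartMeasure (Om : Tensor M 2) (c : OpenPartialHomeomorph M Plane) : Measure M :=
  Measure.map c.symm ((volume.withDensity fun y => ENNReal.ofReal |chartDens Om c y|).restrict
    c.target)

/-- The inverse chart is continuous on its target only, so measurability is proved on the subtype
and pushed forward. -/
lemma measurableSet_target_inter (c : OpenPartialHomeomorph M Plane) {A : Set M}
    (hA : MeasurableSet A) : MeasurableSet (c.target ∩ c.symm ⁻¹' A) := by
  have h1 : Measurable (c.target.domRestrict c.symm) :=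
    (continuousOn_iff_continuous_domRestrict.mp c.continuousOn_symm).measurable
  have h2 := MeasurableSet.subtype_image c.open_target.measurableSet (h1 hA)
  convert h2 using 1
  ext y
  simp [and_comm]

lemma chartMeasure_apply (c : OpenPartialHomeomorph M Plane) {A : Set M} (hA : MeasurableSet A) :
    chartMeasure Om c A =
      ∫⁻ y in c.target ∩ c.symm ⁻¹' A, ENNReal.ofReal |chartDens Om c y| := by
  rw [chartMeasure, Measure.map_apply_of_aemeasurable
    (c.continuousOn_symm.aemeasurable c.open_target.measurableSet) hA,
    Measure.restrict_apply' c.open_target.measurableSet, Set.inter_comm,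
    withDensity_apply _ (measurableSet_target_inter c hA)]

/-- Change of variables under the transition map. It is an inequality because the part of `A`
outside the source of `c'` is lost. -/
lemma chartMeasure_le (hOm : IsSymplecticForm Om) {c c' : OpenPartialHomeomorph M Plane}
    (hc : c ∈ atlas Plane M) (hc' : c' ∈ atlas Plane M) {A : Set M} (hA : MeasurableSet A) :
    chartMeasure Om c' (A ∩ c.source) ≤ chartMeasure Om c A := by
  have hAc := hA.inter c.open_source.measurableSet
  rw [chartMeasure_apply c' hAc, chartMeasure_apply c hA]
  set S := c'.target ∩ c'.symm ⁻¹' (A ∩ c.source)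
  have hS : MeasurableSet S := measurableSet_target_inter c' hAc
  have h1 : ∀ y ∈ S, HasFDerivWithinAt (fun z => c (c'.symm z))
      (fderiv ℝ (fun z => c (c'.symm z)) y) S y := fun y hy =>
    (hasMFDerivAt_transition hc hc' hy.1 hy.2.2).1.hasFDerivWithinAt
  have hinj : Set.InjOn (fun z => c (c'.symm z)) S := fun y hy z hz h =>
    c'.symm.injOn hy.1 hz.1 (c.injOn hy.2.2 hz.2.2 h)
  have h2 : ∫⁻ y in S, ENNReal.ofReal |chartDens Om c' y| =
      ∫⁻ y in S, ENNReal.ofReal |(fderiv ℝ (fun z => c (c'.symm z)) y).det| *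
        ENNReal.ofReal |chartDens Om c (c (c'.symm y))| := by
    refine setLIntegral_congr_fun hS fun y hy => ?_
    rw [chartDens_transition hOm hc hc' hy.1 hy.2.2, abs_mul, ENNReal.ofReal_mul (abs_nonneg _)]
  rw [h2, ← lintegral_image_eq_lintegral_abs_det_fderiv_mul volume hS h1 hinj
    (fun z => ENNReal.ofReal |chartDens Om c z|)]
  refine lintegral_mono_set ?_
  rintro _ ⟨y, hy, rfl⟩
  refine ⟨c.map_source hy.2.2, ?_⟩
  simp only [Set.mem_preimage, c.left_inv hy.2.2]
  exact hy.2.1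

/-- A supremum of measures is not evaluated set by set. It is bounded by a single measure dominating
every chart measure, namely that of `c` plus `area` restricted to the complement of the chart. -/
lemma area_apply (hOm : IsSymplecticForm Om) {c : OpenPartialHomeomorph M Plane}
    (hc : c ∈ atlas Plane M) {A : Set M} (hA : MeasurableSet A) (hAc : A ⊆ c.source) :
    area Om A = chartMeasure Om c A := by
  have hs := c.open_source.measurableSet
  refine le_antisymm ?_ ?_
  · have h : area Om ≤ chartMeasure Om c + (area Om).restrict c.sourceᶜ := by
      refine iSup₂_le fun c' hc' => Measure.le_iff.mpr fun B hB => ?_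
      change chartMeasure Om c' B ≤ _
      rw [Measure.add_apply, Measure.restrict_apply hB, ← measure_inter_add_sdiff B hs]
      refine add_le_add (chartMeasure_le hOm hc hc' hB) ?_
      exact (le_iSup₂_of_le (f := fun c _ => chartMeasure Om c) c' hc' le_rfl : _ ≤ area Om) _
    refine (h A).trans ?_
    rw [Measure.add_apply, Measure.restrict_apply hA, Set.disjoint_iff_inter_eq_empty.mp
      (Set.disjoint_compl_right_iff_subset.mpr hAc)]
    simp
  · exact (le_iSup₂_of_le (f := fun c _ => chartMeasure Om c) c hc le_rfl : _ ≤ area Om) _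

lemma continuousOn_chartDens (hOm : IsSymplecticForm Om) (x : M) :
    ContinuousOn (chartDens Om (chartAt Plane x)) (chartAt Plane x).target := by
  have h1 : ContinuousOn (fun y => dens Om x ((chartAt Plane x).symm y)) (chartAt Plane x).target :=
    (smooth_dens hOm x).continuousOn.comp (chartAt Plane x).continuousOn_symm
      (fun y hy => (chartAt Plane x).map_target hy)
  refine h1.congr fun y hy => ?_
  have h := chartDens_chartAt (Om := Om) ((chartAt Plane x).map_target hy)
  rwa [(chartAt Plane x).right_inv hy] at h

lemma isLocallyFiniteMeasure_area (hOm : IsSymplecticForm Om) :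
    IsLocallyFiniteMeasure (area Om) where
  finiteAtNhds x := by
    set c := chartAt Plane x with hcdef
    have hxs := mem_chart_source Plane x
    obtain ⟨r, hr, hb⟩ := Metric.nhds_basis_closedBall.mem_iff.mp
      (c.open_target.mem_nhds (mem_chart_target Plane x))
    have hN : IsOpen (c.source ∩ c ⁻¹' Metric.ball (c x) r) :=
      c.continuousOn.isOpen_inter_preimage c.open_source Metric.isOpen_ball
    refine ⟨_, hN.mem_nhds ⟨hxs, Metric.mem_ball_self hr⟩, ?_⟩
    rw [area_apply hOm (chart_mem_atlas Plane x) hN.measurableSet Set.inter_subset_left,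
      chartMeasure_apply _ hN.measurableSet]
    have hsub : c.target ∩ c.symm ⁻¹' (c.source ∩ c ⁻¹' Metric.ball (c x) r) ⊆
        Metric.closedBall (c x) r := by
      rintro y ⟨hy, hy2⟩
      have := hy2.2
      rw [Set.mem_preimage, c.right_inv hy] at this
      exact Metric.ball_subset_closedBall this
    refine (lintegral_mono_set hsub).trans_lt ?_
    have hint : IntegrableOn (fun y => |chartDens Om c y|) (Metric.closedBall (c x) r) :=
      ((continuousOn_chartDens hOm x).mono hb).abs.integrableOn_compact (isCompact_closedBall _ _)
    exact hint.lintegral_lt_top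

lemma setIntegral_chart (hOm : IsSymplecticForm Om) {K : Set M} (hV : IsOpen V)
    (hVx : V ⊆ (chartAt Plane x).source) (hK : MeasurableSet K) (hKV : K ⊆ V) {F : M → ℝ}
    (hF : ContinuousOn F V) : ∫ z in K, F z ∂(area Om) =
      ∫ y in (chartAt Plane x).target ∩ (chartAt Plane x).symm ⁻¹' K,
        |dens Om x ((chartAt Plane x).symm y)| * F ((chartAt Plane x).symm y) := by
  set c := chartAt Plane x with hcdef
  have hKc := hKV.trans hVx
  have h1 : (area Om).restrict K = (chartMeasure Om c).restrict K := by
    refine Measure.ext fun A hA => ?_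
    rw [Measure.restrict_apply hA, Measure.restrict_apply hA,
      area_apply hOm (chart_mem_atlas Plane x) (hA.inter hK) (Set.inter_subset_right.trans hKc)]
  -- `F` is controlled on `V` only; extension by zero gives a function measurable on all of `M`.
  have h2 : ∫ z in K, F z ∂(area Om) = ∫ z in K, V.indicator F z ∂(area Om) :=
    setIntegral_congr_fun hK fun z hz => (Set.indicator_of_mem (hKV hz) F).symm
  have hFm : ∀ μ : Measure M, AEStronglyMeasurable (V.indicator F) μ := fun μ =>
    (aestronglyMeasurable_indicator_iff hV.measurableSet).mpr
      (hF.aestronglyMeasurable hV.measurableSet)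
  have hT := measurableSet_target_inter c hK
  rw [h2, h1, chartMeasure, setIntegral_map hK (hFm _)
    (c.continuousOn_symm.aemeasurable c.open_target.measurableSet),
    Measure.restrict_restrict' c.open_target.measurableSet, Set.inter_comm]
  have hd : ∀ y ∈ c.target, chartDens Om c y = dens Om x (c.symm y) := fun y hy => by
    have h := chartDens_chartAt (Om := Om) (c.map_target hy)
    rwa [c.right_inv hy] at h
  rw [setIntegral_withDensity_eq_setIntegral_toReal_smul₀ _ _ _ hT]
  · refine setIntegral_congr_fun hT fun y hy => ?_
    simp only [smul_eq_mul, ENNReal.toReal_ofReal (abs_nonneg _), hd y hy.1,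
      Set.indicator_of_mem (hKV hy.2)]
  · exact (((continuousOn_chartDens hOm x).mono Set.inter_subset_left).aemeasurable hT).norm.ennreal_ofReal
  · exact Filter.Eventually.of_forall fun y => ENNReal.ofReal_lt_top

end measure

/-! ### The divergence theorem -/

lemma hasFDerivAt_chart {g : M → ℝ} {z : Plane} (hz : z ∈ (chartAt Plane x).target)
    (hg : SmoothFnAt g ((chartAt Plane x).symm z)) :
    DifferentiableAt ℝ (fun z => g ((chartAt Plane x).symm z)) z ∧ ∀ i,
    fderiv ℝ (fun z => g ((chartAt Plane x).symm z)) z (EuclideanSpace.single i 1) =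
      mvfderiv (𝓡 2) g ((chartAt Plane x).symm z) (coordVF x i ((chartAt Plane x).symm z)) := by
  have : IsManifold (𝓡 2) 1 M := IsManifold.of_le (n := ∞) (by simp)
  have h1 : MDifferentiableAt 𝓘(ℝ, Plane) (𝓡 2) (chartAt Plane x).symm z :=
    mdifferentiableAt_atlas_symm (chart_mem_atlas Plane x) hz
  have h2 := hasMFDerivAt_iff_hasFDerivAt.mp ((hg.mdiff).hasMFDerivAt.comp z h1.hasMFDerivAt)
  obtain ⟨L, hL, hLv⟩ : ∃ L : Plane →L[ℝ] ℝ,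
      HasFDerivAt (fun z => g ((chartAt Plane x).symm z)) L z ∧ ∀ v : Plane, L v =
        mvfderiv (𝓡 2) g ((chartAt Plane x).symm z)
          (mfderiv 𝓘(ℝ, Plane) (𝓡 2) (chartAt Plane x).symm z v) := ⟨_, h2, fun _ => rfl⟩
  refine ⟨hL.differentiableAt, fun i => ?_⟩
  have h3 := coordVF_apply ((chartAt Plane x).map_target hz) i
  rw [(chartAt Plane x).right_inv hz] at h3
  rw [h3, hL.fderiv, hLv]

/-- Integration by parts against the constant function `1`. -/
lemma integral_fderiv_eq_zero {a : Plane → ℝ} (ha : ContDiff ℝ 1 a) (hc : HasCompactSupport a)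
    (v : Plane) : Integrable (fun y => fderiv ℝ a y v) ∧ ∫ y, fderiv ℝ a y v = 0 := by
  have h1 : Integrable (fun y => fderiv ℝ a y v) :=
    ((ha.continuous_fderiv one_ne_zero).clm_apply continuous_const).integrable_of_hasCompactSupport
      (hc.fderiv_apply ℝ v)
  refine ⟨h1, ?_⟩
  have h := integral_mul_fderiv_eq_neg_fderiv_mul_of_integrable (μ := volume) (𝕜 := ℝ)
    (f := fun _ : Plane => (1 : ℝ)) (g := a) (v := v) (by simp) (by simpa using h1)
    (by simpa using ha.continuous.integrable_of_hasCompactSupport hc)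
    (fun _ _ => differentiableAt_const _) (fun x _ => ha.differentiable one_ne_zero x)
  simpa using h

/-- Vanishing of `g` on `V` off the compact set `K` lets its coordinate expression be extended by
zero to a `C¹` function of compact support on the plane. -/
lemma integral_coordVF_eq_zero {g : M → ℝ} {K : Set M} (hV : IsOpen V)
    (hVx : V ⊆ (chartAt Plane x).source) (hK : IsCompact K) (hKV : K ⊆ V) (hg : SmoothFn g V)
    (h0 : ∀ y ∈ V, y ∉ K → g y = 0) (i : Fin 2) :
    letI F := fun y => mvfderiv (𝓡 2) g ((chartAt Plane x).symm y)
        (coordVF x i ((chartAt Plane x).symm y))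
    letI K' := (chartAt Plane x).target ∩ (chartAt Plane x).symm ⁻¹' K
    IntegrableOn F K' ∧ ∫ y in K', F y = 0 := by
  set c := chartAt Plane x with hcdef
  set W := c.target ∩ c.symm ⁻¹' V with hWdef
  have hW : IsOpen W := c.isOpen_inter_preimage_symm hV
  set K' := c.target ∩ c.symm ⁻¹' K with hKdef
  have hK' : IsCompact K' := by
    have : K' = c '' K := (c.image_eq_target_inter_inv_preimage (hKV.trans hVx)).symm
    rw [this]
    exact hK.image_of_continuousOn (c.continuousOn.mono (hKV.trans hVx))
  have hKW : K' ⊆ W := fun y hy => ⟨hy.1, hKV hy.2⟩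
  set a : Plane → ℝ := W.indicator fun y => g (c.symm y) with hadef
  have ha0 : ∀ y ∉ K', a y = 0 := fun y hy => by
    by_cases hyW : y ∈ W
    · rw [hadef, Set.indicator_of_mem hyW]
      exact h0 _ hyW.2 fun h => hy ⟨hyW.1, h⟩
    · exact Set.indicator_of_notMem hyW _
  have ha1 : ∀ y ∈ W, a =ᶠ[𝓝 y] fun y => g (c.symm y) := fun y hy => by
    filter_upwards [hW.mem_nhds hy] with z hz
    exact Set.indicator_of_mem hz _
  have ha2 : ∀ y ∉ K', a =ᶠ[𝓝 y] fun _ => 0 := fun y hy => by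
    filter_upwards [hK'.isClosed.isOpen_compl.mem_nhds hy] with z hz
    exact ha0 z hz
  have hsm : ContDiff ℝ 1 a := by
    rw [contDiff_iff_contDiffAt]
    intro y
    by_cases hy : y ∈ K'
    · have hyW := hKW hy
      refine ContDiffAt.congr_of_eventuallyEq ?_ (ha1 y hyW)
      have h1 : ContMDiffAt 𝓘(ℝ, Plane) (𝓡 2) ∞ c.symm y :=
        (contMDiffOn_chart_symm (n := ∞) (x := x)).contMDiffAt (c.open_target.mem_nhds hyW.1)
      have h2 : ContMDiffAt (𝓡 2) 𝓘(ℝ, ℝ) ∞ g (c.symm y) :=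
        hg.contMDiffAt (hV.mem_nhds hyW.2)
      exact (h2.comp y h1).contDiffAt.of_le (by simp)
    · exact contDiffAt_const.congr_of_eventuallyEq (ha2 y hy)
  have hcs : HasCompactSupport a := HasCompactSupport.intro hK' ha0
  obtain ⟨h1, h2⟩ := integral_fderiv_eq_zero hsm hcs (EuclideanSpace.single i 1)
  have h3 : ∀ y ∈ K', fderiv ℝ a y (EuclideanSpace.single i 1) =
      mvfderiv (𝓡 2) g (c.symm y) (coordVF x i (c.symm y)) := fun y hy => by
    rw [(ha1 y (hKW hy)).fderiv_eq]
    exact (hasFDerivAt_chart hy.1 (SmoothFn.at hg hV (hKV hy.2))).2 i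
  refine ⟨h1.integrableOn.congr_fun h3 hK'.measurableSet, ?_⟩
  rw [← setIntegral_congr_fun hK'.measurableSet h3,
    setIntegral_eq_integral_of_forall_compl_eq_zero, h2]
  intro y hy
  rw [(ha2 y hy).fderiv_eq]
  simp

section frame

variable (hOm : IsSymplecticForm Om) (hD : IsSymplecticConnection Om D U) (hU : IsOpen U)
  (hV : IsOpen V) (hVx : V ⊆ (chartAt Plane x).source) (hVU : V ⊆ U)

/-- The coordinate formula for the divergence with density `ω`. As `e₁ = ω⁻¹∂₁`, the second
coordinate component of the field is `ω⁻¹ X 1`, and the density cancels in the second term. -/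
lemma dens_mul_div (X : Fin 2 → smoothRing V) {y : M} (hy : y ∈ V) :
    dens Om x y * ev hy ((frameConn hOm hD hU (isFrame_chartFrame hOm x hV hVx) hVU).div X) =
      mvfderiv (𝓡 2) (fn (toR V (dens Om x) * X 0)) y (coordVF x 0 y) +
      mvfderiv (𝓡 2) (fn (X 1)) y (coordVF x 1 y) := by
  set C := frameConn hOm hD hU (isFrame_chartFrame hOm x hV hVx) hVU with hC
  have hw : SmoothFn (dens Om x) V := (smooth_dens hOm x).mono hVx
  have hwi : SmoothFn (fun y => (dens Om x y)⁻¹) V := smoothFn_of_at fun y hy =>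
    (SmoothFn.at hw hV hy).inv (dens_ne_zero hOm (hVx hy))
  have hd : ∀ i (f : smoothRing V) {y : M} (hy : y ∈ V),
      ev hy (C.d i f) = mvfderiv (𝓡 2) (fn f) y (chartFrame Om x i y) := fun i f y hy =>
    ev_der hV ((isFrame_chartFrame hOm x hV hVx).smooth i) hy f
  have hd0 : ∀ (f : smoothRing V) {y : M} (hy : y ∈ V),
      ev hy (C.d 0 f) = mvfderiv (𝓡 2) (fn f) y (coordVF x 0 y) := fun f y hy => hd 0 f hy
  have hd1 : ∀ (f : smoothRing V) {y : M} (hy : y ∈ V),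
      ev hy (C.d 1 f) = (dens Om x y)⁻¹ * mvfderiv (𝓡 2) (fn f) y (coordVF x 1 y) := fun f y hy =>
    (hd 1 f hy).trans (by simp [chartFrame])
  let u : Fin 2 → M → ℝ := fun i y => (chartAt Plane x y) i
  have hu : ∀ i, SmoothFn (u i) V := fun i => by
    have h1 : ContMDiffOn (𝓡 2) 𝓘(ℝ, Plane) ∞ (chartAt Plane x) V :=
      (contMDiffOn_chart (n := ∞) (x := x)).mono hVx
    exact ((EuclideanSpace.proj i : Plane →L[ℝ] ℝ).contMDiff).comp_contMDiffOn h1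
  have hdu : ∀ i j {y : M} (_ : y ∈ V), mvfderiv (𝓡 2) (fn (toR V (u i))) y (coordVF x j y) =
      if j = i then 1 else 0 := fun i j y hy => by
    have hcy := (chartAt Plane x).map_source (hVx hy)
    have hs : (chartAt Plane x).symm (chartAt Plane x y) = y := (chartAt Plane x).left_inv (hVx hy)
    have h1 : mvfderiv (𝓡 2) (fn (toR V (u i))) y = mvfderiv (𝓡 2) (u i) y := mvfderiv_congr (by
      filter_upwards [hV.mem_nhds hy] with z hz
      exact fn_toR (hu i) hz)
    have h2 := (hasFDerivAt_chart (x := x) (g := u i) hcy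
      (by rw [hs]; exact SmoothFn.at (hu i) hV hy)).2 j
    rw [hs] at h2
    rw [h1, ← h2]
    have h3 : (fun z => u i ((chartAt Plane x).symm z)) =ᶠ[𝓝 (chartAt Plane x y)]
        (EuclideanSpace.proj i : Plane →L[ℝ] ℝ) := by
      filter_upwards [(chartAt Plane x).open_target.mem_nhds hcy] with z hz
      simp only [u, (chartAt Plane x).right_inv hz]
      rfl
    rw [h3.fderiv_eq, ContinuousLinearMap.fderiv]
    fin_cases i <;> fin_cases j <;> simp
  have d00 : C.d 0 (toR V (u 0)) = 1 := ring_ext fun y hy => by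
    rw [hd0, hdu 0 0 hy, map_one]; rfl
  have d01 : C.d 0 (toR V (u 1)) = 0 := ring_ext fun y hy => by
    rw [hd0, hdu 1 0 hy, map_zero]; rfl
  have d10 : C.d 1 (toR V (u 0)) = 0 := ring_ext fun y hy => by
    rw [hd1, hdu 0 1 hy, map_zero]; simp
  have d11 : C.d 1 (toR V (u 1)) = toR V (fun y => (dens Om x y)⁻¹) := ring_ext fun y hy => by
    rw [hd1, hdu 1 1 hy, ev_toR hwi]; simp
  -- The commutation rule is tested on the two coordinate functions. This yields `G 0 1 0 = G 1 0 0`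
  -- and the logarithmic derivative of the density along `∂₀`.
  have c0 := C.comm (toR V (u 0))
  have c1 := C.comm (toR V (u 1))
  rw [d00, d10, Derivation.map_one_eq_zero, map_zero] at c0
  rw [d01, d11, map_zero] at c1
  have hwwi : toR V (dens Om x) * toR V (fun y => (dens Om x y)⁻¹) = 1 := ring_ext fun y hy => by
    rw [map_mul, ev_toR hw, ev_toR hwi, map_one, mul_inv_cancel₀ (dens_ne_zero hOm (hVx hy))]
  have hdw := congrArg (C.d 0) hwwi
  rw [Derivation.leibniz, Derivation.map_one_eq_zero, smul_eq_mul, smul_eq_mul] at hdw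
  have t0 := C.tr 0
  have t1 := C.tr 1
  have key : toR V (dens Om x) * C.div X = C.d 0 (toR V (dens Om x) * X 0) +
      toR V (dens Om x) * C.d 1 (X 1) := by
    simp only [FrameConn.div, FrameConn.covV, Fin.sum_univ_two, Derivation.leibniz, smul_eq_mul]
    generalize toR V (dens Om x) = w at *
    generalize toR V (fun y => (dens Om x y)⁻¹) = wi at *
    have t2 : w * (C.G 0 0 0 + C.G 1 0 1) = C.d 0 w := by
      linear_combination -w * hdw - w ^ 2 * c1 + w ^ 2 * wi * t0
        - (w * (C.G 0 0 0 + C.G 1 0 1) - C.d 0 w) * hwwi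
    linear_combination X 0 * t2 + w * X 1 * c0 + w * X 1 * t1
  have := congrArg (ev hy) key
  rw [map_mul, ev_toR hw, map_add, hd0, map_mul, ev_toR hw, hd1] at this
  rw [this, mul_inv_cancel_left₀ (dens_ne_zero hOm (hVx hy))]

variable [MeasurableSpace M] [BorelSpace M]

include hVx in
/-- The divergence theorem for a vector field with compact support in a chart. -/
lemma integral_div_eq_zero (σ : ℝ) (hσ : ∀ y ∈ V, |dens Om x y| = σ * dens Om x y)
    {K : Set M} (hK : IsCompact K) (hKV : K ⊆ V) (X : Fin 2 → smoothRing V)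
    (hX : ∀ y (hy : y ∈ V), y ∉ K → ∀ k, ev hy (X k) = 0) :
    ∫ y in K, fn ((frameConn hOm hD hU (isFrame_chartFrame hOm x hV hVx) hVU).div X) y
      ∂(area Om) = 0 := by
  set C := frameConn hOm hD hU (isFrame_chartFrame hOm x hV hVx) hVU with hC
  rw [setIntegral_chart hOm hV hVx hK.measurableSet hKV (smooth_fn _).continuousOn]
  obtain ⟨i0, z0⟩ := integral_coordVF_eq_zero hV hVx hK hKV
    (smooth_fn (toR V (dens Om x) * X 0)) (fun y hy hyK => by
      rw [fn_apply hy, map_mul, hX y hy hyK, mul_zero]) 0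
  obtain ⟨i1, z1⟩ := integral_coordVF_eq_zero hV hVx hK hKV (smooth_fn (X 1))
    (fun y hy hyK => by rw [fn_apply hy, hX y hy hyK]) 1
  have hT := measurableSet_target_inter (chartAt Plane x) hK.measurableSet
  have h : ∀ z ∈ (chartAt Plane x).target ∩ (chartAt Plane x).symm ⁻¹' K,
      |dens Om x ((chartAt Plane x).symm z)| * fn (C.div X) ((chartAt Plane x).symm z) =
      σ * (mvfderiv (𝓡 2) (fn (toR V (dens Om x) * X 0)) ((chartAt Plane x).symm z)
        (coordVF x 0 ((chartAt Plane x).symm z)) +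
      mvfderiv (𝓡 2) (fn (X 1)) ((chartAt Plane x).symm z)
        (coordVF x 1 ((chartAt Plane x).symm z))) := fun z hz => by
    rw [← dens_mul_div hOm hD hU hV hVx hVU X (hKV hz.2), hσ _ (hKV hz.2), fn_apply (hKV hz.2)]
    ring
  rw [setIntegral_congr_fun hT h, integral_const_mul, integral_add i0 i1, z0, z1]
  simp

end frame

end

section

variable {M : Type*} [TopologicalSpace M] [ChartedSpace Plane M] [IsManifold (𝓡 2) ∞ M] [T2Space M]

variable {Om : Tensor M 2} {D : Conn M} {U V : Set M} {e : Fin 2 → VField M} {x : M}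

/-! ### The Green identity -/

lemma IsSmoothTensor.fn_mul {k : ℕ} {T : Tensor M k} {χ : M → ℝ} (hχ : SmoothFn χ U)
    (hT : IsSmoothTensor U T) : IsSmoothTensor U (fun x v => χ x * T x v) :=
  ⟨fun x hx => (hT.multilinear.const_mul (χ x)) x hx, fun X hX => hχ.mul (hT.smooth X hX)⟩

lemma IsSymmetricTensor.fn_mul {k : ℕ} {T : Tensor M k} (χ : M → ℝ) (hT : IsSymmetricTensor U T) :
    IsSymmetricTensor U (fun x v => χ x * T x v) := fun x hx v s => by
  simp only [hT x hx v s]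

lemma isSmoothTensor_zero {k : ℕ} : IsSmoothTensor U (fun _ _ => 0 : Tensor M k) :=
  ⟨isTensor_zero, fun _ _ => contMDiffOn_const⟩

lemma isSymmetricTensor_zero {k : ℕ} : IsSymmetricTensor U (fun _ _ => 0 : Tensor M k) :=
  fun _ _ _ _ => rfl

section green

variable {P Q : Tensor M 3} {f : M → ℝ} (hOm : IsSymplecticForm Om)
  (hD : IsSymplecticConnection Om D U) (hU : IsOpen U)
  (hf : SmoothFn f U) (hP : IsSmoothTensor U P) (hS : IsSymmetricTensor U P)

include hOm hD hU hf hP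

lemma smooth_contract_hop : SmoothFn (contract Om (hop Om D f) P) U := by
  refine smoothFn_of_at fun x hx => ?_
  obtain ⟨V, e, hxV, hV, he⟩ := exists_frame hOm hU hx
  refine (SmoothFn.at (smooth_fn (FrameConn.contr3 ((frameConn hOm hD hU he hV).hop (toR V f))
    (comp3 V e P))) he.isOpen hxV).congr ?_
  filter_upwards [he.isOpen.eventually_mem hxV] with y hy
  rw [contract_hop_frame hOm hD hU he hV hf hP hy, fn_apply hy]

/-- `H(f)` vanishes where `f` vanishes locally. -/
lemma contract_hop_eq_zero (hx : x ∈ U) (h0 : ∀ᶠ y in 𝓝 x, f y = 0) :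
    contract Om (hop Om D f) P x = 0 := by
  obtain ⟨W, hW, hWo, hxW⟩ := eventually_nhds_iff.mp h0
  obtain ⟨V, e, hxV, hV, he⟩ := exists_frame hOm (hU.inter hWo) (⟨hx, hxW⟩ : x ∈ U ∩ W)
  have hVU : V ⊆ U := hV.trans Set.inter_subset_left
  have hz : toR V f = 0 := ring_ext fun y hy => by
    rw [ev_toR (hf.mono hVU) hy, hW y (hV hy).2, map_zero]
  have hh : ∀ i j k, (frameConn hOm hD hU he hVU).hop 0 i j k = 0 := fun i j k => by
    have := (frameConn hOm hD hU he hVU).hop_smul 0 0 i j k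
    rwa [zero_smul, zero_smul] at this
  rw [contract_hop_frame hOm hD hU he hVU hf hP hxV, hz]
  simp only [FrameConn.contr3, FrameConn.contr2, hh, zero_mul, sub_zero,
    add_zero, map_zero]

include hS

lemma smooth_green : SmoothFn (green Om D f P) U :=
  (hf.mul (smooth_varMoment hOm hD hU hP hS)).sub (smooth_contract_hop hOm hD hU hf hP)

omit hf in
lemma green_eq_zero (hx : x ∈ U) (h0 : ∀ᶠ y in 𝓝 x, ∀ v, P y v = 0) : green Om D f P x = 0 := by
  have h1 : varMoment Om D P x = 0 := by
    rw [varMoment_congr hOm hD hU hP hS isSmoothTensor_zero isSymmetricTensor_zero hx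
      (Q := fun _ _ => 0), varMoment_zero]
    filter_upwards [h0] with y hy
    funext v; exact hy v
  rw [green, h1, contract]
  simp [h0.self_of_nhds]

omit hf in
lemma green_add (hQ : IsSmoothTensor U Q) (hT : IsSymmetricTensor U Q) (hx : x ∈ U) :
    green Om D f (fun y v => P y v + Q y v) x = green Om D f P x + green Om D f Q x := by
  rw [green, varMoment_add hOm hD hU hP hS hQ hT hx]
  simp only [green, contract, mul_add, Finset.sum_add_distrib]
  ring

variable [MeasurableSpace M] [BorelSpace M]

lemma integral_green_chart (hV : IsOpen V) (hVx : V ⊆ (chartAt Plane x).source) (hVU : V ⊆ U)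
    (σ : ℝ) (hσ : ∀ y ∈ V, |dens Om x y| = σ * dens Om x y)
    {K : Set M} (hK : IsCompact K) (hKV : K ⊆ V) (hPK : ∀ y ∈ V, y ∉ K → ∀ v, P y v = 0) :
    ∫ y in K, green Om D f P y ∂(area Om) = 0 := by
  have he := isFrame_chartFrame hOm x hV hVx
  obtain ⟨p, hp⟩ := exists_sym3 hU he hVU hP hS
  let I : Ideal (smoothRing V) := {
    carrier := {a | ∀ y (hy : y ∈ V), y ∉ K → ev hy a = 0}
    add_mem' := fun {a b} ha hb y hy hyK => by rw [map_add, ha y hy hyK, hb y hy hyK, add_zero]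
    zero_mem' := fun y hy hyK => map_zero _
    smul_mem' := fun c a ha y hy hyK => by rw [smul_eq_mul, map_mul, ha y hy hyK, mul_zero] }
  have hI : ∀ i, ∀ a ∈ I, (frameConn hOm hD hU he hVU).d i a ∈ I := fun i a ha y hy hyK => by
    refine (ev_der hV (he.smooth i) hy a).trans ?_
    rw [mvfderiv_congr (g := fun _ => (0 : ℝ)), mvfderiv_const, zero_apply]
    filter_upwards [hV.mem_nhds hy, hK.isClosed.isOpen_compl.mem_nhds hyK] with z hz hzK
    rw [fn_apply hz, ha z hz hzK]
  have hpI : ∀ i j k, FrameConn.sym3 p i j k ∈ I := fun i j k y hy hyK => by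
    rw [hp, ev_comp3 hU he hVU hP hy, hPK y hy hyK]
  have hX := FrameConn.flux_mem (frameConn hOm hD hU he hVU) hI (toR V f) hpI
  have h := integral_div_eq_zero hOm hD hU hV hVx hVU σ hσ hK hKV _
    (fun y hy hyK k => hX k y hy hyK)
  have h1 : ∀ y ∈ K, green Om D f P y = 1 / 2 * fn ((frameConn hOm hD hU he hVU).div
      ((frameConn hOm hD hU he hVU).flux (toR V f) p)) y := fun y hy => by
    rw [green_frame hOm hD hU he hVU hf hP hS (hKV hy) hp, fn_apply (hKV hy)]
  rw [setIntegral_congr_fun hK.measurableSet h1, integral_const_mul, h, mul_zero]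

/-- The first variation of the moment map is the formal adjoint of `H`. -/
theorem integral_green [SecondCountableTopology M] {C : Set M} (hC : IsCompact C) (hCU : C ⊆ U)
    (hPC : ∀ y, y ∉ C → ∀ v, P y v = 0) : ∫ y in C, green Om D f P y ∂(area Om) = 0 := by
  have : LocallyCompactSpace M := Manifold.locallyCompact_of_finiteDimensional (𝓡 2)
  have : IsLocallyFiniteMeasure (area Om) := isLocallyFiniteMeasure_area hOm
  -- A chart need not be positively oriented and its source need not be connected, so the domain is
  -- cut down to the set where the density has the sign it has at `x`.
  let W : M → Set M := fun x => ((chartAt Plane x).source ∩ U) ∩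
    (fun y => dens Om x y * dens Om x x) ⁻¹' Set.Ioi 0
  have hWo : ∀ x, IsOpen (W x) := fun x => by
    refine ContinuousOn.isOpen_inter_preimage ?_ ((chartAt Plane x).open_source.inter hU) isOpen_Ioi
    exact ((smooth_dens hOm x).continuousOn.mono Set.inter_subset_left).mul continuousOn_const
  have hW0 : ∀ x ∈ U, x ∈ W x := fun x hx => ⟨⟨mem_chart_source _ _, hx⟩,
    mul_self_pos.mpr (dens_ne_zero hOm (mem_chart_source _ _))⟩
  have hWσ : ∀ x, ∀ y ∈ W x, |dens Om x y| = (|dens Om x x| / dens Om x x) * dens Om x y := by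
    intro x y hy
    have h : 0 < dens Om x y * dens Om x x := hy.2
    rcases mul_pos_iff.mp h with ⟨h1, h2⟩ | ⟨h1, h2⟩
    · rw [abs_of_pos h1, abs_of_pos h2, div_self h2.ne', one_mul]
    · rw [abs_of_neg h1, abs_of_neg h2, neg_div, div_self h2.ne]; ring
  obtain ⟨χ, hχ⟩ := SmoothPartitionOfUnity.exists_isSubordinate (𝓡 2) hC.isClosed W hWo
    (fun x hx => Set.mem_iUnion.mpr ⟨x, hW0 x (hCU hx)⟩)
  have hχs : ∀ i, SmoothFn (χ i) U := fun i => (χ i).contMDiff.contMDiffOn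
  have hfin := χ.locallyFinite.finite_nonempty_inter_compact hC
  set s := hfin.toFinset with hs
  have hsum : ∀ y ∈ C, ∑ i ∈ s, χ i y = 1 := fun y hy => by
    rw [← χ.sum_eq_one hy]
    refine (finsum_eq_sum_of_support_subset _ fun i hi => ?_).symm
    rw [hs, Set.Finite.coe_toFinset]
    exact ⟨y, hi, hy⟩
  -- The partition of unity is applied to `P`, on which the Green integrand depends linearly; each
  -- piece is supported in one chart.
  have hone : ∀ i, ∫ y in C, green Om D f (fun y v => χ i y * P y v) y ∂(area Om) = 0 := by
    intro i
    have hPi := hP.fn_mul (hχs i)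
    have hSi := hS.fn_mul (χ i)
    have hK : IsCompact (C ∩ tsupport (χ i)) := hC.inter_right (isClosed_tsupport _)
    rw [setIntegral_eq_of_subset_of_forall_sdiff_eq_zero (s := C ∩ tsupport (χ i)) hC.measurableSet
      Set.inter_subset_left]
    · refine integral_green_chart hOm hD hU hf hPi hSi (hWo i)
        (Set.inter_subset_left.trans Set.inter_subset_left)
        (Set.inter_subset_left.trans Set.inter_subset_right) _ (hWσ i) hK
        (Set.inter_subset_right.trans (hχ i)) ?_
      intro y _ hyK v
      by_cases hyC : y ∈ C
      · rw [image_eq_zero_of_notMem_tsupport fun h => hyK ⟨hyC, h⟩, zero_mul]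
      · rw [hPC y hyC, mul_zero]
    · intro y hy
      refine green_eq_zero hOm hD hU hPi hSi (hCU hy.1) ?_
      filter_upwards [(isClosed_tsupport (χ i)).isOpen_compl.mem_nhds
        fun h => hy.2 ⟨hy.1, h⟩] with z hz v
      rw [image_eq_zero_of_notMem_tsupport hz, zero_mul]
  have hall : ∀ t : Finset M,
      ∫ y in C, green Om D f (fun y v => (∑ i ∈ t, χ i y) * P y v) y ∂(area Om) = 0 := by
    classical
    intro t
    induction t using Finset.induction_on with
    | empty =>
      rw [setIntegral_congr_fun (g := fun _ => (0 : ℝ)) hC.measurableSet, integral_zero]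
      intro y hy
      refine green_eq_zero hOm hD hU (hP.fn_mul ?_) (hS.fn_mul _) (hCU hy)
        (Filter.Eventually.of_forall fun z v => by simp)
      exact contMDiffOn_const.congr fun y _ => Finset.sum_empty
    | insert i t hi ih =>
      have hts : SmoothFn (fun y => ∑ i ∈ t, χ i y) U := smoothFn_of_at fun y hy =>
        SmoothFnAt.sum _ fun i _ => SmoothFn.at (hχs i) hU hy
      have h1 : ∀ y ∈ C, green Om D f (fun y v => (∑ i ∈ insert i t, χ i y) * P y v) y =
          green Om D f (fun y v => χ i y * P y v) y +
          green Om D f (fun y v => (∑ i ∈ t, χ i y) * P y v) y := fun y hy => by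
        rw [← green_add hOm hD hU (hP.fn_mul (hχs i)) (hS.fn_mul _) (hP.fn_mul hts) (hS.fn_mul _)
          (hCU hy)]
        congr 1
        funext y v
        rw [Finset.sum_insert hi, add_mul]
      rw [setIntegral_congr_fun hC.measurableSet h1, integral_add, hone, ih, add_zero]
      · exact ((smooth_green hOm hD hU hf (hP.fn_mul (hχs i)) (hS.fn_mul _)).continuousOn.mono
          hCU).integrableOn_compact hC
      · exact ((smooth_green hOm hD hU hf (hP.fn_mul hts) (hS.fn_mul _)).continuousOn.mono
          hCU).integrableOn_compact hC
  have heq : (fun y v => (∑ i ∈ s, χ i y) * P y v) = P := by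
    funext y v
    by_cases hy : y ∈ C
    · rw [hsum y hy, one_mul]
    · rw [hPC y hy, mul_zero]
  have := hall s
  rwa [heq] at this

end green

section critical

variable [MeasurableSpace M] [BorelSpace M] [SecondCountableTopology M]

/-- A connection is critical if its moment map is annihilated by `H`. -/
theorem isCritical_of_hop_eq_zero (hOm : IsSymplecticForm Om) (hD : IsSymplecticConnection Om D U)
    (hU : IsOpen U) {f : M → ℝ} (hf : SmoothFn f U) (hm : ∀ x ∈ U, moment Om D x = f x)
    (hH : ∀ x ∈ U, ∀ v, hop Om D f x v = 0) : IsCritical Om D U := by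
  intro P C hP hS hC hCU hPC
  have : IsLocallyFiniteMeasure (area Om) := isLocallyFiniteMeasure_area hOm
  let K : ℝ → M → ℝ := fun s => moment Om (addCubic Om D (fun y v => s * P y v))
  have hK : ∀ s, SmoothFn (K s) U := fun s =>
    smooth_moment hOm (addCubic_symplectic hOm hD hU (hP.const_mul s) (hS.const_mul s)) hU
  let K0 : M → ℝ := moment Om D
  let K1 : M → ℝ := varMoment Om D P
  -- The coefficients of the cubic polynomial are recovered from its values at `0`, `1`, `-1` and
  -- the linear coefficient, and are thus seen to be continuous.
  let K2 : M → ℝ := fun x => (K 1 x + K (-1) x) * (1 / 2) - K0 x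
  let K3 : M → ℝ := fun x => K 1 x - K0 x - K1 x - K2 x
  have h0 : SmoothFn K0 U := smooth_moment hOm hD hU
  have h1 : SmoothFn K1 U := smooth_varMoment hOm hD hU hP hS
  have h2 : SmoothFn K2 U := (((hK 1).add (hK (-1))).mul contMDiffOn_const).sub h0
  have h3 : SmoothFn K3 U := (((hK 1).sub h0).sub h1).sub h2
  have c0 := h0.continuousOn.mono hCU
  have c1 := h1.continuousOn.mono hCU
  have c2 := h2.continuousOn.mono hCU
  have c3 := h3.continuousOn.mono hCU
  -- Coefficients of the square of a cubic polynomial. The integral of `K²` over `C` is then a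
  -- polynomial in `s` of degree at most six, and its derivative at `0` is the integral of the entry
  -- with index `1`.
  let c : Fin 7 → M → ℝ := ![fun x => K0 x ^ 2, fun x => 2 * (K0 x * K1 x),
    fun x => K1 x ^ 2 + 2 * (K0 x * K2 x), fun x => 2 * (K0 x * K3 x) + 2 * (K1 x * K2 x),
    fun x => K2 x ^ 2 + 2 * (K1 x * K3 x), fun x => 2 * (K2 x * K3 x), fun x => K3 x ^ 2]
  have hc : ∀ j, ContinuousOn (c j) C := fun j => by
    fin_cases j <;> simp only [c] <;> simp <;> fun_prop
  have hpoly : ∀ s, ∀ x ∈ C, K s x ^ 2 = ∑ j : Fin 7, s ^ (j : ℕ) * c j x := fun s x hx => by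
    obtain ⟨a, b, hab⟩ := exists_poly hOm hD hU hP hS (hCU hx)
    have e1 := hab 1
    have e2 := hab (-1)
    have es := hab s
    change K 1 x = K0 x + 1 * K1 x + 1 ^ 2 * a + 1 ^ 3 * b at e1
    change K (-1) x = K0 x + (-1) * K1 x + (-1) ^ 2 * a + (-1) ^ 3 * b at e2
    change K s x = K0 x + s * K1 x + s ^ 2 * a + s ^ 3 * b at es
    have ea : a = K2 x := by simp only [K2]; linarith
    have eb : b = K3 x := by
      have : K3 x = K 1 x - K0 x - K1 x - K2 x := rfl
      rw [this, ← ea]; linarith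
    rw [es, ea, eb, Fin.sum_univ_seven]
    simp only [c]
    simp
    ring
  have hE : ∀ s, ∫ x in C, (moment Om (addCubic Om D (fun y v => s * P y v)) x) ^ 2 ∂(area Om) =
      ∑ j : Fin 7, s ^ (j : ℕ) * ∫ x in C, c j x ∂(area Om) := fun s => by
    rw [setIntegral_congr_fun hC.measurableSet (hpoly s), integral_finsetSum]
    · simp only [integral_const_mul]
    · exact fun j _ => ((hc j).integrableOn_compact hC).const_mul _
  -- The linear coefficient is `2K δK`. As `H(K) = 0`, this is twice the Green integrand with `f =
  -- K`.
  have hA1 : ∫ x in C, c 1 x ∂(area Om) = 0 := by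
    have h := integral_green hOm hD hU hf hP hS hC hCU hPC
    have h' : ∀ x ∈ C, c 1 x = 2 * green Om D f P x := fun x hx => by
      have : contract Om (hop Om D f) P x = 0 := by
        simp [contract, hH x (hCU hx)]
      rw [green, this, sub_zero, ← hm x (hCU hx)]
      rfl
    rw [setIntegral_congr_fun hC.measurableSet h', integral_const_mul, h, mul_zero]
  simp only [hE]
  have hder : HasDerivAt (fun s : ℝ => ∑ j : Fin 7, s ^ (j : ℕ) * ∫ x in C, c j x ∂(area Om))
      (∑ j : Fin 7, (((j : ℕ) : ℝ) * (0 : ℝ) ^ ((j : ℕ) - 1)) * ∫ x in C, c j x ∂(area Om)) 0 :=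
    HasDerivAt.fun_sum fun j _ => (hasDerivAt_pow (j : ℕ) (0 : ℝ)).mul_const _
  convert hder using 1
  rw [Fin.sum_univ_seven, hA1]
  simp

/-- The first variation of the moment map is the value of the formal adjoint of `H`. -/
theorem isAdjointValue_varMoment (hOm : IsSymplecticForm Om) (hD : IsSymplecticConnection Om D U)
    (hU : IsOpen U) {a : Tensor M 3} (ha : IsSmoothTensor U a) (hs : IsSymmetricTensor U a)
    {h : M → ℝ} (hh : ∀ x ∈ U, h x = varMoment Om D a x) : IsAdjointValue Om D U a h := by
  have : LocallyCompactSpace M := Manifold.locallyCompact_of_finiteDimensional (𝓡 2)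
  have : IsLocallyFiniteMeasure (area Om) := isLocallyFiniteMeasure_area hOm
  have hsm : SmoothFn h U := (smooth_varMoment hOm hD hU ha hs).congr hh
  refine ⟨hsm, fun f hf hfc hfU => ?_⟩
  have hfs : SmoothFn f U := hf.contMDiffOn
  obtain ⟨L, hL, hfL, hLU⟩ := exists_compact_between hfc hU hfU
  -- Here `f` has compact support but `a` need not. Cutting `a` off by a function equal to `1` near
  -- the support of `f` changes nothing there and makes `integral_green` applicable.
  obtain ⟨χ, h1, h0, -⟩ := exists_contMDiffMap_one_nhds_of_subset_interior (n := ⊤) (𝓡 2)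
    (isClosed_tsupport f) hfL
  have hχ : SmoothFn χ U := χ.contMDiff.contMDiffOn
  have hg := integral_green hOm hD hU hfs (ha.fn_mul hχ) (hs.fn_mul χ) hL hLU
    (fun y hy v => by rw [h0 y hy, zero_mul])
  have hft : ∀ y ∉ tsupport f, ∀ᶠ z in 𝓝 y, f z = 0 := fun y hy => by
    filter_upwards [(isClosed_tsupport f).isOpen_compl.mem_nhds hy] with z hz
    exact image_eq_zero_of_notMem_tsupport hz
  have hz : ∀ y ∈ U, y ∉ tsupport f → contract Om (hop Om D f) a y = 0 := fun y hy hyf =>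
    contract_hop_eq_zero hOm hD hU hfs ha hy (hft y hyf)
  have heq : ∀ y ∈ L, green Om D f (fun y v => χ y * a y v) y =
      f y * h y - contract Om (hop Om D f) a y := fun y hy => by
    have hyU := hLU hy
    by_cases hyf : y ∈ tsupport f
    · have hev : ∀ᶠ z in 𝓝 y, χ z = 1 := Filter.Eventually.filter_mono (nhds_le_nhdsSet hyf) h1
      rw [green, hh y hyU, varMoment_congr hOm hD hU (ha.fn_mul hχ) (hs.fn_mul χ) ha hs hyU]
      · congr 1
        simp only [contract, hev.self_of_nhds, one_mul]
      · filter_upwards [hev] with z hz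
        funext v
        rw [hz, one_mul]
    · rw [green, contract_hop_eq_zero hOm hD hU hfs (ha.fn_mul hχ) hyU (hft y hyf), hz y hyU hyf,
        (hft y hyf).self_of_nhds]
      ring
  have i1 : IntegrableOn (fun y => f y * h y) L (area Om) :=
    ((hfs.mul hsm).continuousOn.mono hLU).integrableOn_compact hL
  have i2 : IntegrableOn (contract Om (hop Om D f) a) L (area Om) :=
    ((smooth_contract_hop hOm hD hU hfs ha).continuousOn.mono hLU).integrableOn_compact hL
  rw [setIntegral_congr_fun hL.measurableSet heq, integral_sub i1 i2] at hg
  have hnot : ∀ y ∈ U \ L, y ∉ tsupport f := fun y hy h => hy.2 (interior_subset (hfL h))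
  rw [setIntegral_eq_of_subset_of_forall_sdiff_eq_zero hU.measurableSet hLU
      (fun y hy => hz y hy.1 (hnot y hy)),
    setIntegral_eq_of_subset_of_forall_sdiff_eq_zero hU.measurableSet hLU
      (fun y hy => by rw [image_eq_zero_of_notMem_tsupport (hnot y hy), zero_mul])]
  linarith

end critical

end

/-! ### Preferred, critical and Jacobi statements for `∇(t)`. -/

section

variable {M : Type*} [TopologicalSpace M] [ChartedSpace Plane M] [IsManifold (𝓡 2) ∞ M] [T2Space M]

variable {Om : Tensor M 2} {D : Conn M} {U V : Set M} {e : Fin 2 → VField M} {x : M}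

lemma exists_killingData [PreconnectedSpace M] {Z : Tensor M 1} (hOm : IsSymplecticForm Om)
    (hD : IsSymplecticConnection Om D Set.univ) (hpar : ∀ x v, covD D (ric D) x v = 0)
    (hZ : IsSmoothTensor Set.univ Z) (hK : ∀ x v, symmetrize (covD D Z) x v = 0) :
    ∃ nu, IsKillingData Om D Z nu := by
  have h := smooth_nuFn_and hOm hD hpar hZ hK
  rcases isEmpty_or_nonempty M with hM | ⟨⟨p⟩⟩
  -- A preconnected space may be empty; any constant then serves.
  · exact ⟨0, hOm, hD, hpar, hZ, hK, fun x => (hM.false x).elim⟩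
  · exact ⟨nuFn Om D Z p, hOm, hD, hpar, hZ, hK,
      fun x => eq_of_mvfderiv_eq_zero (fun y => (h y).1) (fun y => (h y).2) x p⟩

/-- Gives `∇(t) + sΓ = ∇(t + s)`, so that varying `∇(t)` along `Γ` stays inside the family. -/
lemma addCubic_addCubic (P Q : Tensor M 3) :
    addCubic Om (addCubic Om D P) Q = addCubic Om D (fun x v => P x v + Q x v) := by
  funext Y x
  have h : ∀ i k, ∑ p, bivector Om x k p *
      (P x ![frame x i, Y x, frame x p] + Q x ![frame x i, Y x, frame x p]) =
      (∑ p, bivector Om x k p * P x ![frame x i, Y x, frame x p]) +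
      ∑ p, bivector Om x k p * Q x ![frame x i, Y x, frame x p] := fun i k => by
    rw [← Finset.sum_add_distrib]
    exact Finset.sum_congr rfl fun p _ => mul_add _ _ _
  have hs : ∀ (L : TangentSpace (𝓡 2) x →L[ℝ] ℝ) (a b : TangentSpace (𝓡 2) x),
      L.smulRight (a + b) = L.smulRight a + L.smulRight b := fun L a b => by
    ext1 v
    exact smul_add (L v) a b
  simp only [addCubic, h, add_smul, Finset.sum_add_distrib, hs, add_assoc]

namespace IsKillingData

variable {Z : Tensor M 1} {nu : ℝ} (h : IsKillingData Om D Z nu) (t : ℝ)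

include h

lemma not_isPreferred (ht : t ≠ 0) (hne : ∃ x ∈ hatM Om D Z nu, ∃ v,
    4 * nu * ((nu - gam Om D Z x ^ 2) ^ 2)⁻¹ * cubicZR Om D Z x v ≠ 0) :
    ¬ IsPreferred (nab Om D Z nu t) (hatM Om D Z nu) := by
  rintro hp
  obtain ⟨x, hx, v, hv⟩ := hne
  have h1 := h.symm_nab t hx v
  rw [hp x hx v] at h1
  have h2 : t * (4 * nu * ((nu - gam Om D Z x ^ 2) ^ 2)⁻¹ * cubicZR Om D Z x v) = 0 := by
    linear_combination h1
  exact (mul_ne_zero ht hv) h2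

/-- Along `Γ` the moment map is `-(3/4)(t + s)γ`, affine in `s`. -/
lemma varMoment_nab (hx : x ∈ hatM Om D Z nu) :
    varMoment Om (nab Om D Z nu t) (Gam Om D Z nu) x = -(3 / 4) * gam Om D Z x := by
  have hs : ∀ s : ℝ, moment Om (addCubic Om (nab Om D Z nu t) (fun y v => s * Gam Om D Z nu y v)) x =
      -(3 / 4) * (t + s) * gam Om D Z x := fun s => by
    rw [← h.moment_nab (t + s) hx, nab, nab, addCubic_addCubic]
    simp only [add_mul]
  simp only [varMoment, hs]
  ring

variable [MeasurableSpace M] [BorelSpace M] [SecondCountableTopology M]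

lemma isCritical : IsCritical Om (nab Om D Z nu t) (hatM Om D Z nu) :=
  isCritical_of_hop_eq_zero h.form (h.symplectic t) h.isOpen
    (f := fun x => -(3 / 4) * t * gam Om D Z x)
    ((contMDiffOn_const.mul (smooth_gam h.form h.conn h.smooth h.killing)).mono (Set.subset_univ _))
    (fun _ hx => h.moment_nab t hx) (fun _ hx v => h.hop_nab t hx _ v)

/-- `H*(Γ)` is the first variation of `K` along `Γ`, a constant multiple of `γ`, which `H`
annihilates; the Hamiltonian field of `K` preserves `Γ`. -/
lemma isJacobi : IsJacobi Om (nab Om D Z nu t) (hatM Om D Z nu) (Gam Om D Z nu) :=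
  ⟨fun x => -(3 / 4) * gam Om D Z x, isAdjointValue_varMoment h.form (h.symplectic t) h.isOpen
    h.smooth_Gam symm_Gam (fun _ hx => (h.varMoment_nab t hx).symm),
    fun x hx v => by rw [h.hop_nab t hx, h.lie_nab t hx, add_zero]⟩

end IsKillingData

end

section

/-! ### Smooth maps into normed spaces -/

section maps

variable {M : Type*} [TopologicalSpace M] [ChartedSpace Plane M] [IsManifold (𝓡 2) ∞ M]
variable {E F G : Type*} [NormedAddCommGroup E] [NormedSpace ℝ E] [NormedAddCommGroup F]
  [NormedSpace ℝ F] [NormedAddCommGroup G] [NormedSpace ℝ G] {x : M}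

/-- `f` is smooth near `x`. -/
def SmoothMapAt (f : M → E) (x : M) : Prop :=
  ∀ᶠ y in 𝓝 x, ContMDiffAt (𝓡 2) 𝓘(ℝ, E) ∞ f y

lemma SmoothMapAt.mdiff {f : M → E} (h : SmoothMapAt f x) :
    MDifferentiableAt (𝓡 2) 𝓘(ℝ, E) f x :=
  h.self_of_nhds.mdifferentiableAt (by simp)

lemma smoothMapAt_const (c : E) : SmoothMapAt (fun _ : M => c) x :=
  Filter.Eventually.of_forall fun _ => contMDiffAt_const

lemma SmoothMapAt.sub {f g : M → E} (hf : SmoothMapAt f x) (hg : SmoothMapAt g x) :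
    SmoothMapAt (fun y => f y - g y) x := by
  filter_upwards [hf, hg] with y h1 h2 using h1.sub h2

lemma SmoothMapAt.bilin (B : E →L[ℝ] F →L[ℝ] G) {f : M → E} {g : M → F} (hf : SmoothMapAt f x)
    (hg : SmoothMapAt g x) : SmoothMapAt (fun y => B (f y) (g y)) x := by
  filter_upwards [hf, hg] with y h1 h2
  exact B.isBoundedBilinearMap.contDiff.contMDiff.contMDiffAt.comp y (h1.prodMk_space h2)

lemma SmoothMapAt.exists_open {f : M → E} (h : SmoothMapAt f x) :
    ∃ V, IsOpen V ∧ x ∈ V ∧ ContMDiffOn (𝓡 2) 𝓘(ℝ, E) ∞ f V := by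
  obtain ⟨V, hV, hVo, hx⟩ := eventually_nhds_iff.mp h
  exact ⟨V, hVo, hx, fun y hy => (hV y hy).contMDiffWithinAt⟩

lemma SmoothMapAt.of_open {f : M → E} {V : Set M} (hf : ContMDiffOn (𝓡 2) 𝓘(ℝ, E) ∞ f V)
    (hV : IsOpen V) (hx : x ∈ V) : SmoothMapAt f x := by
  filter_upwards [hV.mem_nhds hx] with y hy using hf.contMDiffAt (hV.mem_nhds hy)

lemma SmoothMapAt.mvfderiv {f : M → E} {X : VField M} (hf : SmoothMapAt f x)
    (hX : SmoothVFAt X x) : SmoothMapAt (fun y => mvfderiv (𝓡 2) f y (X y)) x := by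
  obtain ⟨V, hV, hxV, h1⟩ := hf.exists_open
  obtain ⟨W, hW, hxW, h2⟩ := hX.exists_open
  exact SmoothMapAt.of_open (smooth_mvfderiv (hV.inter hW) (h1.mono Set.inter_subset_left)
    (h2.mono Set.inter_subset_right)) (hV.inter hW) ⟨hxV, hxW⟩

lemma SmoothMapAt.commutator {f : M → E} {X Y : VField M} (hf : SmoothMapAt f x)
    (hX : SmoothVFAt X x) (hY : SmoothVFAt Y x) :
    _root_.mvfderiv (𝓡 2) f x (VectorField.mlieBracket (𝓡 2) X Y x) =
      _root_.mvfderiv (𝓡 2) (fun y => _root_.mvfderiv (𝓡 2) f y (Y y)) x (X x)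
        - _root_.mvfderiv (𝓡 2) (fun y => _root_.mvfderiv (𝓡 2) f y (X y)) x (Y x) := by
  obtain ⟨U, hU, hxU, h0⟩ := hf.exists_open
  obtain ⟨V, hV, hxV, h1⟩ := hX.exists_open
  obtain ⟨W, hW, hxW, h2⟩ := hY.exists_open
  exact mvfderiv_mlieBracket (V := U ∩ V ∩ W) ((hU.inter hV).inter hW)
    (h0.mono fun _ h => h.1.1) (h1.mono fun _ h => h.1.2) (h2.mono fun _ h => h.2)
    ⟨⟨hxU, hxV⟩, hxW⟩

lemma hasMFDerivAt_prodMk_space {f : M → E} {g : M → F} {f' : TangentSpace (𝓡 2) x →L[ℝ] E}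
    {g' : TangentSpace (𝓡 2) x →L[ℝ] F} (hf : HasMFDerivAt (𝓡 2) 𝓘(ℝ, E) f x f')
    (hg : HasMFDerivAt (𝓡 2) 𝓘(ℝ, F) g x g') :
    HasMFDerivAt (𝓡 2) 𝓘(ℝ, E × F) (fun y => (f y, g y)) x (f'.prod g') :=
  ⟨hf.1.prodMk hg.1, hf.2.prodMk hg.2⟩

lemma mvfderiv_bilin (B : E →L[ℝ] F →L[ℝ] G) {f : M → E} {g : M → F}
    (hf : MDifferentiableAt (𝓡 2) 𝓘(ℝ, E) f x) (hg : MDifferentiableAt (𝓡 2) 𝓘(ℝ, F) g x)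
    (v : TangentSpace (𝓡 2) x) :
    mvfderiv (𝓡 2) (fun y => B (f y) (g y)) x v =
      B (mvfderiv (𝓡 2) f x v) (g x) + B (f x) (mvfderiv (𝓡 2) g x v) := by
  have h1 := (hasMFDerivAt_prodMk_space hf.hasMFDerivAt hg.hasMFDerivAt)
  have h := (HasMFDerivAt.comp (I' := 𝓘(ℝ, E × F)) (I'' := 𝓘(ℝ, G)) x
    (B.isBoundedBilinearMap.hasFDerivAt (f x, g x)).hasMFDerivAt h1).mfderiv
  have h2 := congrArg (fun L : TangentSpace (𝓡 2) x →L[ℝ] G => L v) h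
  refine h2.trans ?_
  exact add_comm _ _

lemma mdifferentiableAt_bilin (B : E →L[ℝ] F →L[ℝ] G) {f : M → E} {g : M → F}
    (hf : MDifferentiableAt (𝓡 2) 𝓘(ℝ, E) f x) (hg : MDifferentiableAt (𝓡 2) 𝓘(ℝ, F) g x) :
    MDifferentiableAt (𝓡 2) 𝓘(ℝ, G) (fun y => B (f y) (g y)) x :=
  B.isBoundedBilinearMap.differentiableAt (f x, g x)
    |>.mdifferentiableAt.comp x (hf.prodMk_space hg)

lemma mvfderiv_sub_apply {f g : M → E}
    (hf : MDifferentiableAt (𝓡 2) 𝓘(ℝ, E) f x) (hg : MDifferentiableAt (𝓡 2) 𝓘(ℝ, E) g x)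
    (v : TangentSpace (𝓡 2) x) :
    mvfderiv (𝓡 2) (fun y => f y - g y) x v = mvfderiv (𝓡 2) f x v - mvfderiv (𝓡 2) g x v :=
  congrArg (fun L => L v) (hf.hasMFDerivAt.sub hg.hasMFDerivAt).mfderiv

lemma mvfderiv_add_apply {f g : M → E}
    (hf : MDifferentiableAt (𝓡 2) 𝓘(ℝ, E) f x) (hg : MDifferentiableAt (𝓡 2) 𝓘(ℝ, E) g x)
    (v : TangentSpace (𝓡 2) x) :
    mvfderiv (𝓡 2) (fun y => f y + g y) x v = mvfderiv (𝓡 2) f x v + mvfderiv (𝓡 2) g x v :=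
  congrArg (fun L => L v) (hf.hasMFDerivAt.add hg.hasMFDerivAt).mfderiv

lemma mvfderiv_const_apply (c : E) (v : TangentSpace (𝓡 2) x) :
    mvfderiv (𝓡 2) (fun _ : M => c) x v = 0 := by
  have h := (hasMFDerivAt_const (I := 𝓡 2) (I' := 𝓘(ℝ, E)) c x).mfderiv
  exact congrArg (fun L : TangentSpace (𝓡 2) x →L[ℝ] E => L v) h

end maps

/-! ### Tangent vectors of the sphere as vectors of the ambient space -/

section sphere

instance fact_finrank_space : Fact (Module.finrank ℝ Space = 2 + 1) :=
  ⟨finrank_euclideanSpace_fin⟩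

lemma smooth_coe (x : S2) : SmoothMapAt (Subtype.val : S2 → Space) x :=
  Filter.Eventually.of_forall fun _ => contMDiff_coe_sphere.contMDiffAt

lemma incl_add (x : S2) (u v : TangentSpace (𝓡 2) x) : incl x (u + v) = incl x u + incl x v :=
  map_add (mvfderiv (𝓡 2) (Subtype.val : S2 → Space) x) u v

lemma incl_sub (x : S2) (u v : TangentSpace (𝓡 2) x) : incl x (u - v) = incl x u - incl x v :=
  map_sub (mvfderiv (𝓡 2) (Subtype.val : S2 → Space) x) u v

lemma incl_smul (x : S2) (c : ℝ) (v : TangentSpace (𝓡 2) x) : incl x (c • v) = c • incl x v :=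
  map_smul (mvfderiv (𝓡 2) (Subtype.val : S2 → Space) x) c v

lemma incl_injective (x : S2) : Function.Injective (incl x) :=
  injective_mvfderiv_subtypeVal_sphere x

lemma inner_self_coe (x : S2) : inner ℝ (x : Space) x = 1 := by
  rw [real_inner_self_eq_norm_sq, norm_eq_of_mem_sphere, one_pow]

lemma mem_range_incl (x : S2) {w : Space} : (∃ v, incl x v = w) ↔ inner ℝ (x : Space) w = 0 := by
  have h := range_mvfderiv_subtypeVal (n := 2) x
  rw [← Submodule.mem_orthogonal_singleton_iff_inner_right, ← h]
  rfl

lemma inner_incl (x : S2) (v : TangentSpace (𝓡 2) x) : inner ℝ (x : Space) (incl x v) = 0 :=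
  (mem_range_incl x).mp ⟨v, rfl⟩

/-- The radial projection onto the sphere. -/
def rad (w : Space) : S2 :=
  if h : w = 0 then ⟨e3, by simp [e3]⟩ else ⟨‖w‖⁻¹ • w, by simp [norm_smul, h]⟩

lemma rad_coe (x : S2) : rad x = x := by
  have h0 : (x : Space) ≠ 0 := ne_zero_of_mem_unit_sphere x
  rw [rad, dif_neg h0]
  ext1
  simp [norm_eq_of_mem_sphere]

lemma coe_rad {w : Space} (h : w ≠ 0) : (rad w : Space) = ‖w‖⁻¹ • w := by
  rw [rad, dif_neg h]

lemma contMDiffAt_rad {w : Space} (hw : w ≠ 0) :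
    ContMDiffAt 𝓘(ℝ, Space) (𝓡 2) ∞ rad w := by
  have hp : 0 < ‖w‖ := norm_pos_iff.mpr hw
  -- Restriction of the codomain to the sphere is applied to a map smooth everywhere. The map `φ` is
  -- the identity near `w` and never zero: the bump lives in the ball of radius `‖w‖/2`, where `z -
  -- w` is too short to cancel `w`.
  let χ : ContDiffBump w := ⟨‖w‖ / 4, ‖w‖ / 2, by positivity, by linarith⟩
  let φ : Space → Space := fun z => w + χ z • (z - w)
  have hφ : ∀ z, φ z ≠ 0 := fun z h0 => by
    have h1 : ‖χ z • (z - w)‖ = ‖w‖ := by rw [eq_neg_of_add_eq_zero_right h0, norm_neg]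
    rw [norm_smul, Real.norm_of_nonneg χ.nonneg] at h1
    by_cases hz : z ∈ Metric.ball w χ.rOut
    · have h2 : ‖z - w‖ < ‖w‖ / 2 := by simpa [dist_eq_norm] using hz
      have h3 := mul_le_mul_of_nonneg_right (χ.le_one (x := z)) (norm_nonneg (z - w))
      linarith
    · have : χ z = 0 := by
        rw [← Function.notMem_support, χ.support_eq]
        exact hz
      rw [this, zero_mul] at h1
      exact hp.ne h1
  have hφs : ContDiff ℝ ∞ φ :=
    contDiff_const.add (χ.contDiff.smul (contDiff_id.sub contDiff_const))
  have h1 : ContMDiff 𝓘(ℝ, Space) 𝓘(ℝ, Space) ∞ (fun z => ‖φ z‖⁻¹ • φ z) :=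
    (((hφs.norm ℝ hφ).inv fun z => norm_ne_zero_iff.mpr (hφ z)).smul hφs).contMDiff
  refine ((h1.codRestrict_sphere (n := 2)
    fun z => by simp [norm_smul, hφ z]) w).congr_of_eventuallyEq ?_
  filter_upwards [χ.eventuallyEq_one, isOpen_ne.mem_nhds hw] with z hz h0
  ext1
  have : φ z = z := by
    change w + χ z • (z - w) = z
    rw [hz, Pi.one_apply, one_smul, add_sub_cancel]
  rw [Set.val_codRestrict_apply, this]
  exact coe_rad h0

/-- The orthogonal projection to a tangent plane of the sphere. -/
def tproj (x : S2) : Space →L[ℝ] TangentSpace (𝓡 2) x :=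
  ((mfderiv 𝓘(ℝ, Space) (𝓡 2) rad (x : Space) : Space →L[ℝ] Plane)).comp
    (ContinuousLinearMap.id ℝ Space - (innerSL ℝ (x : Space)).smulRight (x : Space))

/-- The radial projection is a left inverse of the inclusion of the sphere, so its differential
inverts `incl`. -/
lemma mfderiv_rad_incl (x : S2) (v : TangentSpace (𝓡 2) x) :
    (mfderiv 𝓘(ℝ, Space) (𝓡 2) rad (x : Space) : Space →L[ℝ] Plane) (incl x v) = (v : Plane) := by
  have h1 : MDifferentiableAt 𝓘(ℝ, Space) (𝓡 2) rad (x : Space) :=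
    (contMDiffAt_rad (ne_zero_of_mem_unit_sphere x)).mdifferentiableAt (by simp)
  have h2 := (h1.hasMFDerivAt.comp x (smooth_coe x).mdiff.hasMFDerivAt).mfderiv
  have h3 : rad ∘ (Subtype.val : S2 → Space) = id := funext rad_coe
  rw [h3, mfderiv_id] at h2
  exact (congrArg (fun L : Plane →L[ℝ] Plane => L v) h2).symm

lemma incl_tproj (x : S2) (w : Space) :
    incl x (tproj x w) = w - inner ℝ (x : Space) w • (x : Space) := by
  obtain ⟨v, hv⟩ := (mem_range_incl x (w := w - inner ℝ (x : Space) w • (x : Space))).mpr (by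
    rw [inner_sub_right, inner_smul_right, inner_self_coe, mul_one, sub_self])
  have : tproj x w = (mfderiv 𝓘(ℝ, Space) (𝓡 2) rad (x : Space) : Space →L[ℝ] Plane)
      (w - inner ℝ (x : Space) w • (x : Space)) := rfl
  rw [this, ← hv]
  exact congrArg _ (mfderiv_rad_incl x v)

lemma SmoothVFAt.incl {X : VField S2} {x : S2} (hX : SmoothVFAt X x) :
    SmoothMapAt (fun y => incl y (X y)) x :=
  (smooth_coe x).mvfderiv hX

lemma SmoothMapAt.tproj {F : S2 → Space} {x : S2} (hF : SmoothMapAt F x) :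
    SmoothVFAt (fun y => tproj y (F y)) x := by
  have hG : SmoothMapAt (fun y : S2 => F y - inner ℝ (y : Space) (F y) • (y : Space)) x :=
    hF.sub (((smooth_coe x).bilin (innerSL ℝ) hF).bilin (ContinuousLinearMap.lsmul ℝ ℝ)
      (smooth_coe x))
  filter_upwards [hG] with y hy
  have h0 : IsOpen {w : Space | w ≠ 0} := isOpen_ne
  have hr : ContMDiffOn 𝓘(ℝ, Space) (𝓡 2) ∞ rad {w | w ≠ 0} := fun w hw =>
    (contMDiffAt_rad hw).contMDiffWithinAt
  have h1 := hr.contMDiffOn_tangentMapWithin (m := ∞) (by simp) h0.uniqueMDiffOn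
  have hyn : (y : Space) ≠ 0 := ne_zero_of_mem_unit_sphere y
  have h2 : ContMDiffAt (𝓡 2) 𝓘(ℝ, Space).tangent ∞ (fun z : S2 =>
      (⟨(z : Space), F z - inner ℝ (z : Space) (F z) • (z : Space)⟩ :
        TangentBundle 𝓘(ℝ, Space) Space)) y :=
    ((contMDiff_tangentBundleModelSpaceHomeomorph_symm (I := 𝓘(ℝ, Space)) (n := ∞)).contMDiffAt).comp
      y ((smooth_coe y).self_of_nhds.prodMk_space hy)
  have h3 := ((h1 _ (by exact hyn)).contMDiffAt ((h0.preimage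
    (FiberBundle.continuous_proj Space (TangentSpace 𝓘(ℝ, Space)))).mem_nhds (by exact hyn))).comp
      y h2
  refine h3.congr_of_eventuallyEq (Filter.Eventually.of_forall fun z => ?_)
  have hz : ((z : Space)) ∈ {w : Space | w ≠ 0} := ne_zero_of_mem_unit_sphere z
  -- The tangent map of `rad` lands over `rad z`, which is equal to `z` but not by definition.
  have key : ∀ (p : S2) (v : Plane), p = z →
    (⟨z, v⟩ : TangentBundle (𝓡 2) S2) = ⟨p, v⟩ := by
    rintro p v rfl
    rfl
  simp only [Function.comp_apply, tangentMapWithin]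
  rw [mfderivWithin_of_mem_nhds (h0.mem_nhds hz)]
  exact key _ _ (rad_coe z)

end sphere

end

section

/-! ### The Levi-Civita connection of the round sphere -/

section sphere

variable {x : S2}

lemma incl_neg (x : S2) (v : TangentSpace (𝓡 2) x) : incl x (-v) = -incl x v :=
  map_neg (mvfderiv (𝓡 2) (Subtype.val : S2 → Space) x) v

/-- The Levi-Civita connection of the round sphere. -/
def roundConn : Conn S2 := fun Y x =>
  (tproj x).comp (mvfderiv (𝓡 2) (fun y => incl y (Y y)) x)

lemma incl_roundConn (Y : VField S2) (x : S2) (v : TangentSpace (𝓡 2) x) :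
    incl x (roundConn Y x v) = mvfderiv (𝓡 2) (fun y => incl y (Y y)) x v -
      inner ℝ (x : Space) (mvfderiv (𝓡 2) (fun y => incl y (Y y)) x v) • (x : Space) :=
  incl_tproj _ _

lemma mdifferentiableAt_incl {Y : VField S2} (hY : MDifferentiableAt (𝓡 2)
    ((𝓡 2).prod 𝓘(ℝ, Plane)) (fun y => (⟨y, Y y⟩ : TangentBundle (𝓡 2) S2)) x) :
    MDifferentiableAt (𝓡 2) 𝓘(ℝ, Space) (fun y => incl y (Y y)) x := by
  have h1 : ContMDiff (𝓡 2).tangent 𝓘(ℝ, Space).tangent 1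
      (tangentMap (𝓡 2) 𝓘(ℝ, Space) (Subtype.val : S2 → Space)) :=
    (contMDiff_coe_sphere (m := 2)).contMDiff_tangentMap (by norm_num)
  have h2 := (contMDiff_snd_tangentBundle_modelSpace Space 𝓘(ℝ, Space) (n := 1)).comp h1
  exact ((h2 _).mdifferentiableAt (by simp)).comp x hY

/-- The second fundamental form of the sphere, from differentiating `⟨x, Y⟩ = 0`. -/
lemma inner_mvfderiv_incl {Y : VField S2} (hY : MDifferentiableAt (𝓡 2)
    ((𝓡 2).prod 𝓘(ℝ, Plane)) (fun y => (⟨y, Y y⟩ : TangentBundle (𝓡 2) S2)) x)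
    (v : TangentSpace (𝓡 2) x) :
    inner ℝ (x : Space) (mvfderiv (𝓡 2) (fun y => incl y (Y y)) x v) =
      -inner ℝ (incl x v) (incl x (Y x)) := by
  have h := mvfderiv_bilin (innerSL ℝ) (smooth_coe x).mdiff (mdifferentiableAt_incl hY) v
  have h0 : (fun y : S2 => innerSL ℝ (y : Space) (incl y (Y y))) = fun _ => (0 : ℝ) :=
    funext fun y => inner_incl y (Y y)
  rw [h0, mvfderiv_const_apply] at h
  exact eq_neg_of_add_eq_zero_right h.symm

lemma roundConn_isCov : IsCovariantDerivativeOn Plane roundConn (Set.univ : Set S2) where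
  add := by
    intro Y Y' x hY hY' _
    ext1 v
    apply incl_injective x
    have h : (fun y => incl y ((Y + Y') y)) = fun y => incl y (Y y) + incl y (Y' y) :=
      funext fun y => incl_add _ _ _
    rw [add_apply, incl_add, incl_roundConn, incl_roundConn, incl_roundConn, h,
      mvfderiv_add_apply (mdifferentiableAt_incl hY) (mdifferentiableAt_incl hY'), inner_add_right]
    module
  leibniz := by
    intro Y g x hY hg _
    ext1 v
    apply incl_injective x
    have h : (fun y => incl y ((g • Y) y)) =
        fun y => ContinuousLinearMap.lsmul ℝ ℝ (g y) (incl y (Y y)) :=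
      funext fun y => incl_smul _ _ _
    have h1 : (g x • roundConn Y x + (mvfderiv (𝓡 2) g x).smulRight (Y x)) v =
      g x • roundConn Y x v + mvfderiv (𝓡 2) g x v • Y x := rfl
    rw [h1, incl_add, incl_smul, incl_smul, incl_roundConn, incl_roundConn, h,
      mvfderiv_bilin _ hg (mdifferentiableAt_incl hY)]
    simp only [ContinuousLinearMap.lsmul_apply, inner_add_right, inner_smul_right, inner_incl]
    module

lemma smoothAt_roundConn {X Y : VField S2} (hX : SmoothVFAt X x) (hY : SmoothVFAt Y x) :
    SmoothVFAt (fun y => roundConn Y y (X y)) x :=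
  SmoothMapAt.tproj (hY.incl.mvfderiv hX)

lemma incl_mlieBracket {X Y : VField S2} (hX : SmoothVFAt X x) (hY : SmoothVFAt Y x) :
    incl x (VectorField.mlieBracket (𝓡 2) X Y x) =
      mvfderiv (𝓡 2) (fun y => incl y (Y y)) x (X x) -
        mvfderiv (𝓡 2) (fun y => incl y (X y)) x (Y x) :=
  (smooth_coe x).commutator hX hY

lemma roundConn_torsionFree {X Y : VField S2} (hX : SmoothVFAt X x) (hY : SmoothVFAt Y x) :
    roundConn Y x (X x) - roundConn X x (Y x) = VectorField.mlieBracket (𝓡 2) X Y x := by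
  apply incl_injective x
  rw [incl_mlieBracket hX hY, incl_sub, incl_roundConn, incl_roundConn,
    inner_mvfderiv_incl hX.mdiff, inner_mvfderiv_incl hY.mdiff,
    real_inner_comm]
  abel

lemma inner_eq (u v : Space) : inner ℝ u v = u 0 * v 0 + u 1 * v 1 + u 2 * v 2 := by
  simp [PiLp.inner_apply, Fin.sum_univ_three, mul_comm]

lemma det3_eq (u v w : Space) : det3 u v w = u 0 * (v 1 * w 2 - v 2 * w 1) +
    u 1 * (v 2 * w 0 - v 0 * w 2) + u 2 * (v 0 * w 1 - v 1 * w 0) := by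
  have h := Matrix.det_fin_three (Matrix.of ![u.ofLp, v.ofLp, w.ofLp])
  refine (show det3 u v w = _ from h).trans ?_
  simp only [Matrix.of_apply, Matrix.cons_val_zero, Matrix.cons_val_one, Matrix.cons_val]
  ring

/-- The cross product. -/
def cross : Space →L[ℝ] Space →L[ℝ] Space :=
  (LinearMap.mk₂ ℝ (fun v w : Space =>
    (!₂[v 1 * w 2 - v 2 * w 1, v 2 * w 0 - v 0 * w 2, v 0 * w 1 - v 1 * w 0] : Space))
    (fun a b c => by ext i; fin_cases i <;> simp <;> ring)
    (fun a b c => by ext i; fin_cases i <;> simp <;> ring)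
    (fun a b c => by ext i; fin_cases i <;> simp <;> ring)
    (fun a b c => by ext i; fin_cases i <;> simp <;> ring)).toContinuousBilinearMap

lemma cross_apply (v w : Space) :
    cross v w = !₂[v 1 * w 2 - v 2 * w 1, v 2 * w 0 - v 0 * w 2, v 0 * w 1 - v 1 * w 0] := rfl

lemma det3_eq_inner (u v w : Space) : det3 u v w = innerSL ℝ u (cross v w) := by
  rw [innerSL_apply_apply, inner_eq, det3_eq, cross_apply]
  simp

lemma det3_add_mid (u a b w : Space) : det3 u (a + b) w = det3 u a w + det3 u b w := by
  simp only [det3_eq_inner, map_add, add_apply]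

lemma det3_smul_mid (u w : Space) (c : ℝ) (a : Space) : det3 u (c • a) w = c * det3 u a w := by
  simp [det3_eq_inner]

lemma det3_add_right (u v a b : Space) : det3 u v (a + b) = det3 u v a + det3 u v b := by
  simp only [det3_eq_inner, map_add]

lemma det3_smul_right (u v : Space) (c : ℝ) (a : Space) : det3 u v (c • a) = c * det3 u v a := by
  simp [det3_eq_inner]

lemma det3_self_mid (u w : Space) : det3 u u w = 0 := by rw [det3_eq]; ring

lemma det3_self_right (u v : Space) : det3 u v v = 0 := by rw [det3_eq]; ring

lemma det3_self_outer (u v : Space) : det3 u v u = 0 := by rw [det3_eq]; ring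

/-- Three vectors in the plane orthogonal to `p` are dependent. The identity used is Cramer's:
`det(a,b,c) p` is a combination of `a`, `b`, `c`-determinants paired with `⟨p,a⟩`, `⟨p,b⟩`, `⟨p,c⟩`
after taking the product with `p`. -/
lemma det3_tangent {p a b c : Space} (hp : inner ℝ p p = 1) (ha : inner ℝ p a = 0)
    (hb : inner ℝ p b = 0) (hc : inner ℝ p c = 0) : det3 a b c = 0 := by
  rw [inner_eq] at hp ha hb hc
  rw [det3_eq]
  linear_combination (-(det3 a b c)) * hp + det3 p b c * ha + det3 p c a * hb + det3 p a b * hc +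
    (p 0 ^ 2 + p 1 ^ 2 + p 2 ^ 2 - 1) * det3_eq a b c
    - (p 0 * a 0 + p 1 * a 1 + p 2 * a 2) * det3_eq p b c
    - (p 0 * b 0 + p 1 * b 1 + p 2 * b 2) * det3_eq p c a
    - (p 0 * c 0 + p 1 * c 1 + p 2 * c 2) * det3_eq p a b

lemma mvfderiv_det3 {M : Type*} [TopologicalSpace M] [ChartedSpace Plane M]
    [IsManifold (𝓡 2) ∞ M] {x : M} {F G H : M → Space}
    (hF : MDifferentiableAt (𝓡 2) 𝓘(ℝ, Space) F x) (hG : MDifferentiableAt (𝓡 2) 𝓘(ℝ, Space) G x)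
    (hH : MDifferentiableAt (𝓡 2) 𝓘(ℝ, Space) H x) (v : TangentSpace (𝓡 2) x) :
    mvfderiv (𝓡 2) (fun y => det3 (F y) (G y) (H y)) x v =
      det3 (mvfderiv (𝓡 2) F x v) (G x) (H x) + det3 (F x) (mvfderiv (𝓡 2) G x v) (H x) +
        det3 (F x) (G x) (mvfderiv (𝓡 2) H x v) := by
  simp only [det3_eq_inner]
  rw [mvfderiv_bilin _ hF (mdifferentiableAt_bilin _ hG hH), mvfderiv_bilin _ hG hH, map_add,
    add_assoc]

lemma SmoothMapAt.det3 {F G H : S2 → Space} (hF : SmoothMapAt F x) (hG : SmoothMapAt G x)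
    (hH : SmoothMapAt H x) : SmoothFnAt (fun y => det3 (F y) (G y) (H y)) x := by
  simp only [det3_eq_inner]
  exact hF.bilin _ (hG.bilin _ hH)

lemma isSymplecticForm_roundArea : IsSymplecticForm roundArea where
  smooth := by
    refine isSmoothTensor_of_at (isTensor_of_linear ?_ ?_) ?_
    · intro x _ v i a b
      fin_cases i <;> simp [roundArea, incl_add, det3_add_mid, det3_add_right]
    · intro x _ v i c a
      fin_cases i <;> simp [roundArea, incl_smul, det3_smul_mid, det3_smul_right]
    · exact fun x _ X hX => (smooth_coe x).det3 (hX 0).incl (hX 1).incl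
  alternating := fun x v => det3_self_right _ _
  nondegenerate := by
    intro x v hv
    -- Rotating `v` by a right angle in the tangent plane gives `Ω(v, x × v) = |v|²`.
    refine ⟨tproj x (cross x (incl x v)), ?_⟩
    have h0 : incl x v ≠ 0 := fun h => hv (incl_injective x (h.trans
      (map_zero (mvfderiv (𝓡 2) (Subtype.val : S2 → Space) x)).symm))
    have h1 : roundArea x ![v, tproj x (cross x (incl x v))] =
        det3 x (incl x v) (incl x (tproj x (cross x (incl x v)))) := rfl
    have h2 : inner ℝ (x : Space) (cross x (incl x v)) = 0 := by
      rw [← innerSL_apply_apply ℝ, ← det3_eq_inner, det3_self_mid]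
    have h3 := inner_self_coe x
    have h4 := inner_incl x v
    rw [h1, incl_tproj, h2, zero_smul, sub_zero]
    rw [← inner_self_ne_zero (𝕜 := ℝ)] at h0
    convert h0 using 1
    rw [inner_eq] at h3 h4 ⊢
    rw [det3_eq, cross_apply]
    simp only [Matrix.cons_val_zero, Matrix.cons_val_one, Matrix.cons_val]
    linear_combination (incl x v 0 ^ 2 + incl x v 1 ^ 2 + incl x v 2 ^ 2) * h3 -
      (x.1 0 * incl x v 0 + x.1 1 * incl x v 1 + x.1 2 * incl x v 2) * h4

lemma isSmoothTensor_rotForm : IsSmoothTensor Set.univ rotForm := by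
  refine isSmoothTensor_of_at (isTensor_of_linear ?_ ?_) ?_
  · intro x _ v i a b
    fin_cases i
    simp [rotForm, incl_add, det3_add_right]
  · intro x _ v i c a
    fin_cases i
    simp [rotForm, incl_smul, det3_smul_right]
  · exact fun x _ X hX => (smoothMapAt_const e3).det3 (smooth_coe x) (hX 0).incl

/-- In the derivative of `det(x, u, v)` the term differentiating `x` vanishes by `det3_tangent`, and
the normal parts of the derivatives of `u`, `v` are multiples of `x`, hence invisible. -/
lemma covD_roundArea (x : S2) (v : Fin 3 → TangentSpace (𝓡 2) x) :
    covD roundConn roundArea x v = 0 := by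
  have hs := fun i : Fin 2 => (smoothVFAt_extVec (v i.succ))
  have h1 := mvfderiv_det3 (smooth_coe x).mdiff (hs 0).incl.mdiff (hs 1).incl.mdiff (v 0)
  have h2 : mvfderiv (𝓡 2) (Subtype.val : S2 → Space) x (v 0) = incl x (v 0) := rfl
  rw [h2, det3_tangent (inner_self_coe x) (inner_incl x _) (inner_incl x _) (inner_incl x _)] at h1
  have h3 : mvfderiv (𝓡 2) (fun y => roundArea y (fun i => extVec (v i.succ) y)) x (v 0) = _ := h1
  rw [covD, h3, Fin.sum_univ_two]
  simp [roundArea, incl_roundConn, sub_eq_add_neg, ← neg_smul, det3_add_mid, det3_add_right,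
    det3_smul_mid, det3_smul_right, det3_self_mid, det3_self_outer]

lemma covD_roundMetric (x : S2) (v : Fin 3 → TangentSpace (𝓡 2) x) :
    covD roundConn roundMetric x v = 0 := by
  have hs := fun i : Fin 2 => (smoothVFAt_extVec (v i.succ))
  have h1 := mvfderiv_bilin (innerSL ℝ) (hs 0).incl.mdiff (hs 1).incl.mdiff (v 0)
  have h3 : mvfderiv (𝓡 2) (fun y => roundMetric y (fun i => extVec (v i.succ) y)) x (v 0) = _ := h1
  have h4 := inner_incl x (v 1)
  have h5 := inner_incl x (v 2)
  rw [real_inner_comm] at h4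
  rw [covD, h3, Fin.sum_univ_two]
  simp [roundMetric, incl_roundConn, inner_sub_left, inner_sub_right, inner_smul_left,
    inner_smul_right, h4, h5]
  exact sub_self _

lemma isSymplecticConnection_roundConn :
    IsSymplecticConnection roundArea roundConn Set.univ where
  isCov := roundConn_isCov
  smooth := ⟨fun {Y} hY x _ => (contMDiffAt_hom fun X hX =>
    smoothAt_roundConn hX (SmoothVF.at (by exact hY) isOpen_univ trivial)).contMDiffWithinAt⟩
  torsionFree := by
    intro x _ X Y hX hY
    -- The fields are merely differentiable at `x`, whereas the bracket formula was proved for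
    -- smooth germs. Torsion is a tensor, so the fields may be replaced by smooth extensions of
    -- their values.
    have h1 := roundConn_isCov.torsion_apply hX hY
    rw [roundConn_isCov.torsion_apply_eq_extend] at h1
    have h2 := roundConn_torsionFree (smoothVFAt_extVec (X x)) (smoothVFAt_extVec (Y x))
    rw [extVec_self, extVec_self] at h2
    exact sub_eq_zero.mp (h1.symm.trans (sub_eq_zero.mpr h2))
  parallel := fun x _ v => covD_roundArea x v

/-- The Gauss equation. The flat second derivatives cancel against the bracket term, leaving the
contribution of the second fundamental form, which is the metric. -/
lemma curv_roundConn (u v w : TangentSpace (𝓡 2) x) : curv roundConn x u v w =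
    roundMetric x ![v, w] • u - roundMetric x ![u, w] • v := by
  have hu := smoothVFAt_extVec u
  have hv := smoothVFAt_extVec v
  have hw := smoothVFAt_extVec w
  have key : ∀ a b : TangentSpace (𝓡 2) x,
      incl x (roundConn (fun y => roundConn (extVec w) y (extVec b y)) x a) =
        mvfderiv (𝓡 2) (fun y => mvfderiv (𝓡 2) (fun z => incl z (extVec w z)) y (extVec b y)) x a
        - inner ℝ (x : Space) (mvfderiv (𝓡 2) (fun y =>
          mvfderiv (𝓡 2) (fun z => incl z (extVec w z)) y (extVec b y)) x a) • (x : Space)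
        + inner ℝ (incl x b) (incl x w) • incl x a := by
    intro a b
    have hb := smoothVFAt_extVec b
    have hF := hw.incl.mvfderiv hb
    have hI : SmoothMapAt (fun y : S2 => innerSL ℝ (y : Space)
        (mvfderiv (𝓡 2) (fun z => incl z (extVec w z)) y (extVec b y))) x :=
      (smooth_coe x).bilin _ hF
    have h0 : mvfderiv (𝓡 2) (fun y => incl y (roundConn (extVec w) y (extVec b y))) x a = _ :=
      congrArg (fun f : S2 → Space => mvfderiv (𝓡 2) f x a)
        (funext fun y => incl_roundConn (extVec w) y (extVec b y))
    have h1 := mvfderiv_sub_apply hF.mdiff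
      (hI.bilin (ContinuousLinearMap.lsmul ℝ ℝ) (smooth_coe x)).mdiff a
    have h2 := mvfderiv_bilin (ContinuousLinearMap.lsmul ℝ ℝ) hI.mdiff (smooth_coe x).mdiff a
    have h3 := inner_mvfderiv_incl hw.mdiff b
    rw [h2] at h1
    have h4 : mvfderiv (𝓡 2) (Subtype.val : S2 → Space) x a = incl x a := rfl
    rw [incl_roundConn, h0]
    rw [extVec_self] at h3
    simp only [ContinuousLinearMap.lsmul_apply, innerSL_apply_apply, h4, extVec_self, h3] at h1
    rw [show mvfderiv (𝓡 2) (fun y : S2 => _) x a = _ from h1]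
    simp only [inner_sub_right, inner_add_right, inner_smul_right, inner_self_coe, inner_incl]
    module
  have hc := hw.incl.commutator hu hv
  rw [extVec_self, extVec_self] at hc
  apply incl_injective x
  rw [curv, incl_sub, incl_sub, key, key, incl_roundConn, hc]
  simp only [incl_sub, incl_smul, inner_sub_right, roundMetric, Matrix.cons_val_zero,
    Matrix.cons_val_one]
  module

/-- Consequently the Ricci tensor is parallel, being the metric. -/
lemma ric_roundConn : ric roundConn = roundMetric := by
  funext x v
  have h0 : roundMetric x v = roundMetric x ![v 0, v 1] := rfl
  have h1 : ∀ p, coframe x p (curv roundConn x (frame x p) (v 0) (v 1)) =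
      roundMetric x ![v 0, v 1] * coframe x p (frame x p) -
        coframe x p (v 0) * roundMetric x ![frame x p, v 1] := fun p => by
    rw [curv_roundConn, map_sub, map_smul, map_smul, smul_eq_mul, smul_eq_mul, mul_comm (roundMetric _ ![frame x p, v 1])]
  have h2 : roundMetric x ![v 0, v 1] = ∑ p, coframe x p (v 0) * roundMetric x ![frame x p, v 1] := by
    conv_lhs => rw [vec_eq_sum x (v 0)]
    simp [roundMetric, Fin.sum_univ_two, incl_add, incl_smul, inner_add_left, inner_smul_left]
  have h3 : ∀ p, coframe x p (frame x p) = 1 := fun p => by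
    change (EuclideanSpace.single p (1 : ℝ) : Plane) p = 1
    simp
  rw [ric, Finset.sum_congr rfl fun p _ => h1 p, Finset.sum_sub_distrib, ← h2, h0]
  simp only [h3]
  simp
  ring

/-- The result is skew in `u, v`, which is the Killing equation. -/
lemma covD_rotForm (x : S2) (u v : TangentSpace (𝓡 2) x) :
    covD roundConn rotForm x ![u, v] = det3 e3 (incl x u) (incl x v) := by
  have hs := smoothVFAt_extVec v
  have h1 := mvfderiv_det3 (mdifferentiableAt_const (c := e3)) (smooth_coe x).mdiff hs.incl.mdiff u
  have h2 : mvfderiv (𝓡 2) (Subtype.val : S2 → Space) x u = incl x u := rfl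
  have h4 : ∀ a b : Space, det3 0 a b = 0 := fun a b => by simp [det3_eq]
  rw [mvfderiv_const_apply, h2, h4, zero_add] at h1
  have h3 : mvfderiv (𝓡 2) (fun y => rotForm y (fun i : Fin 1 => extVec (![u, v] i.succ) y)) x u = _ := h1
  rw [covD, Fin.sum_univ_one]
  simp only [Matrix.cons_val_zero] 
  rw [h3]
  simp [rotForm, incl_roundConn, sub_eq_add_neg, ← neg_smul, det3_add_right,
    det3_smul_right, det3_self_right]

lemma symmetrize_covD_rotForm (x : S2) (v : Fin 2 → TangentSpace (𝓡 2) x) :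
    symmetrize (covD roundConn rotForm) x v = 0 := by
  rw [symmetrize_two, covD_rotForm, covD_rotForm, det3_eq, det3_eq]
  ring

end sphere

end

section

/-! ### The family of connections on the round sphere -/

lemma sharp_unique {M : Type*} [TopologicalSpace M] [ChartedSpace Plane M] [IsManifold (𝓡 2) ∞ M]
    [T2Space M] {Om : Tensor M 2} (hOm : IsSymplecticForm Om) {a : Tensor M 1}
    (ha : IsTensor Set.univ a) {x : M} {Y : TangentSpace (𝓡 2) x}
    (h : ∀ w, Om x ![Y, w] = a x ![w]) : sharp Om a x = Y := by
  obtain ⟨V, e, hx, -, he⟩ := exists_frame hOm isOpen_univ (Set.mem_univ x)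
  rw [sharp_eq hOm he ha hx trivial, ← h, ← h]
  conv_rhs => rw [eq_sum_fco hOm he hx Y]
  rw [Fin.sum_univ_two, fco_zero, fco_one, hOm.swap (e 0 x) Y, neg_smul, sub_eq_add_neg]

/-- Raising with the area form rotates the dual vector of `Z` by a right angle: the rotation field
becomes minus the gradient of the height. -/
lemma sharp_rotForm (x : S2) : sharp roundArea rotForm x = -tproj x e3 := by
  refine sharp_unique isSymplecticForm_roundArea isSmoothTensor_rotForm.multilinear fun w => ?_
  change det3 x (incl x (-tproj x e3)) (incl x w) = det3 e3 x (incl x w)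
  rw [incl_neg, incl_tproj, neg_sub, sub_eq_add_neg, det3_add_mid, det3_smul_mid, det3_self_mid,
    mul_zero, zero_add, det3_eq, det3_eq]
  simp only [PiLp.neg_apply]
  ring

lemma inner_e3 (w : Space) : inner ℝ w e3 = w 2 := by
  rw [inner_eq]
  simp [e3]

/-- The covariant derivative of `Z^♯` is the height times the identity, whose trace is twice the
height. -/
lemma gam_rotForm (x : S2) : gam roundArea roundConn rotForm x = 2 * x.1 2 := by
  have h0 : sharp roundArea rotForm = fun y => -tproj y e3 := funext sharp_rotForm
  have hin : (fun y : S2 => incl y (-tproj y e3)) =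
      fun y : S2 => ContinuousLinearMap.lsmul ℝ ℝ (innerSL ℝ (y : Space) e3) (y : Space) - e3 :=
    funext fun y => by rw [incl_neg, incl_tproj, neg_sub]; rfl
  have hI := (smooth_coe x).bilin (innerSL ℝ) (smoothMapAt_const e3)
  have key : ∀ v : TangentSpace (𝓡 2) x, roundConn (fun y => -tproj y e3) x v = x.1 2 • v := by
    intro v
    apply incl_injective x
    have h4 : mvfderiv (𝓡 2) (Subtype.val : S2 → Space) x v = incl x v := rfl
    rw [incl_roundConn, hin, mvfderiv_sub_apply (hI.bilin _ (smooth_coe x)).mdiff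
      mdifferentiableAt_const, mvfderiv_bilin _ hI.mdiff (smooth_coe x).mdiff, mvfderiv_const_apply,
      incl_smul, h4]
    have h5 : innerSL ℝ (x : Space) e3 = x.1 2 := inner_e3 x
    simp only [ContinuousLinearMap.lsmul_apply, h5, inner_sub_right,
      inner_add_right, inner_smul_right, inner_self_coe, inner_incl, inner_zero_right]
    module
  have h3 : ∀ p, coframe x p (frame x p) = 1 := fun p => by
    change (EuclideanSpace.single p (1 : ℝ) : Plane) p = 1
    simp
  rw [gam, divergence, h0]
  simp [key, h3]

lemma coe_sq (x : S2) : x.1 0 ^ 2 + x.1 1 ^ 2 + x.1 2 ^ 2 = 1 := by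
  have h := inner_self_coe x
  rw [inner_eq] at h
  linear_combination h

/-- With height `h` the value is `4h² + 4(1 - h²)`, since the gradient of the height has squared
length `1 - h²`. -/
lemma nuFn_rotForm (x : S2) : nuFn roundArea roundConn rotForm x = 4 := by
  have h : ric roundConn x ![sharp roundArea rotForm x, sharp roundArea rotForm x] =
      1 - x.1 2 ^ 2 := by
    rw [ric_roundConn, sharp_rotForm]
    change inner ℝ (incl x (-tproj x e3)) (incl x (-tproj x e3)) = _
    rw [incl_neg, inner_neg_neg, incl_tproj, inner_e3]
    have h := coe_sq x
    simp only [inner_sub_left, inner_sub_right, inner_smul_left, inner_smul_right, inner_e3,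
      inner_self_coe, real_inner_comm (x : Space) e3]
    simp [e3]
    ring
  rw [nuFn, h, gam_rotForm]
  ring

lemma isKillingData_round : IsKillingData roundArea roundConn rotForm 4 where
  form := isSymplecticForm_roundArea
  conn := isSymplecticConnection_roundConn
  par := fun x v => by rw [ric_roundConn, covD_roundMetric]
  smooth := isSmoothTensor_rotForm
  killing := symmetrize_covD_rotForm
  nu_eq := nuFn_rotForm

lemma mem_poles (x : S2) : x ∈ poles ↔ x.1 2 ^ 2 = 1 := by
  have h := coe_sq x
  have e0 : e3 0 = 0 := by simp [e3]
  have e1 : e3 1 = 0 := by simp [e3]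
  have e2 : e3 2 = 1 := by simp [e3]
  constructor
  · rintro (hx | hx) <;> simp [hx, e2]
  · intro hx
    have h0 : x.1 0 = 0 := by nlinarith
    have h1 : x.1 1 = 0 := by nlinarith
    rcases sq_eq_one_iff.mp hx with h2 | h2
    · left
      ext i
      fin_cases i
      exacts [h0.trans e0.symm, h1.trans e1.symm, h2.trans e2.symm]
    · right
      ext i
      fin_cases i <;> simp [h0, h1, h2, e0, e1, e2]

lemma hatM_round : hatM roundArea roundConn rotForm 4 = polesᶜ := by
  ext x
  rw [hatM, Set.mem_ofPred_eq, gam_rotForm, Set.mem_compl_iff, mem_poles, not_iff_not]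
  constructor <;> intro h <;> linarith

lemma cubicZR_diag {M : Type*} [TopologicalSpace M] [ChartedSpace Plane M] [IsManifold (𝓡 2) ∞ M]
    [T2Space M] (Om : Tensor M 2) (D : Conn M) (Z : Tensor M 1) (x : M)
    (v : TangentSpace (𝓡 2) x) :
    cubicZR Om D Z x ![v, v, v] = Z x ![v] ^ 2 * ric D x ![v, sharp Om Z x] := by
  rw [cubicZR, symmetrize_three]
  simp only [Matrix.cons_val_zero, Matrix.cons_val_one, Matrix.cons_val]
  ring

lemma exists_coe_eq {a b c : ℝ} (h : a ^ 2 + b ^ 2 + c ^ 2 = 1) :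
    ∃ x : S2, (x : Space) = !₂[a, b, c] := by
  refine ⟨⟨!₂[a, b, c], ?_⟩, rfl⟩
  have h1 : ‖(!₂[a, b, c] : Space)‖ ^ 2 = 1 := by
    rw [← real_inner_self_eq_norm_sq, inner_eq]
    simp only [Matrix.cons_val_zero, Matrix.cons_val_one, Matrix.cons_val]
    linear_combination h
  rw [mem_sphere_zero_iff_norm]
  exact (pow_eq_one_iff_of_nonneg (norm_nonneg _) two_ne_zero).mp h1

lemma not_isPreferred_round {t : ℝ} (ht : t ≠ 0) :
    ¬ IsPreferred (nab roundArea roundConn rotForm 4 t) polesᶜ := by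
  rw [← hatM_round]
  obtain ⟨x, hx⟩ := exists_coe_eq (a := 1) (b := 0) (c := 0) (by norm_num)
  -- At an equatorial point `Z` sees the component of `v` along the equator and `S(·, Z^♯)` the
  -- vertical one; `v` has both, so the cubic form is nonzero on `(v, v, v)`.
  obtain ⟨v, hv⟩ := (mem_range_incl x (w := !₂[0, 1, 1])).mpr (by rw [hx, inner_eq]; simp)
  have hx2 : x.1 2 = 0 := by rw [hx]; rfl
  refine isKillingData_round.not_isPreferred t ht ⟨x, ?_, ![v, v, v], ?_⟩
  · rw [hatM_round, Set.mem_compl_iff, mem_poles, hx2]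
    norm_num
  · have h1 : rotForm x ![v] = 1 := by
      change det3 e3 x (incl x v) = 1
      rw [hv, hx, det3_eq]
      simp [e3]
    have h2 : ric roundConn x ![v, sharp roundArea rotForm x] = -1 := by
      rw [ric_roundConn, sharp_rotForm]
      change inner ℝ (incl x v) (incl x (-tproj x e3)) = -1
      rw [incl_neg, incl_tproj, hv, inner_e3, hx2, inner_eq]
      simp [e3]
    rw [cubicZR_diag, h1, h2, gam_rotForm, hx2]
    norm_num

lemma exists_moment_ne_zero_round {t : ℝ} (ht : t ≠ 0) :
    ∃ x ∈ polesᶜ, moment roundArea (nab roundArea roundConn rotForm 4 t) x ≠ 0 := by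
  -- A rational point off the equator, where `K` vanishes, and off the poles.
  obtain ⟨x, hx⟩ := exists_coe_eq (a := 3 / 5) (b := 0) (c := 4 / 5) (by norm_num)
  have hx2 : x.1 2 = 4 / 5 := by rw [hx]; rfl
  have hp : x ∈ polesᶜ := by
    rw [Set.mem_compl_iff, mem_poles, hx2]
    norm_num
  refine ⟨x, hp, ?_⟩
  rw [← hatM_round] at hp
  rw [isKillingData_round.moment_nab t hp, gam_rotForm, hx2]
  exact mul_ne_zero (mul_ne_zero (by norm_num) ht) (by norm_num)

lemma rotForm_apply (x : S2) (v : Fin 1 → TangentSpace (𝓡 2) x) :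
    rotForm x v = x.1 0 * incl x (v 0) 1 - x.1 1 * incl x (v 0) 0 := by
  rw [rotForm, det3_eq]
  simp [e3]

lemma rotForm_sq_le (x : S2) (v : Fin 1 → TangentSpace (𝓡 2) x) :
    rotForm x v ^ 2 ≤ (1 - x.1 2 ^ 2) * ‖incl x (v 0)‖ ^ 2 := by
  have h := coe_sq x
  rw [rotForm_apply, ← real_inner_self_eq_norm_sq, inner_eq]
  have h1 : 1 - x.1 2 ^ 2 = x.1 0 ^ 2 + x.1 1 ^ 2 := by linear_combination -h
  rw [h1]
  nlinarith [sq_nonneg (x.1 0 * incl x (v 0) 0 + x.1 1 * incl x (v 0) 1),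
    mul_nonneg (add_nonneg (sq_nonneg (x.1 0)) (sq_nonneg (x.1 1))) (sq_nonneg (incl x (v 0) 2))]

/-- The denominator is `4(1 - h²)` with `h` the height, and `|Z|² ≤ 1 - h²`: two factors `Z` absorb
it and the third tends to zero at the poles. -/
lemma abs_Gam_le (x : S2) (v : Fin 3 → TangentSpace (𝓡 2) x) :
    |Gam roundArea roundConn rotForm 4 x v| ≤
      1 / 4 * (|rotForm x ![v 0]| * (‖incl x (v 1)‖ * ‖incl x (v 2)‖)) := by
  have hs : 0 ≤ 1 - x.1 2 ^ 2 := by nlinarith [coe_sq x, sq_nonneg (x.1 0), sq_nonneg (x.1 1)]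
  have h1 : |rotForm x ![v 1] * rotForm x ![v 2]| ≤
      (1 - x.1 2 ^ 2) * (‖incl x (v 1)‖ * ‖incl x (v 2)‖) := by
    refine abs_le_of_sq_le_sq ?_ (by positivity)
    have := mul_le_mul (rotForm_sq_le x ![v 1]) (rotForm_sq_le x ![v 2]) (sq_nonneg _)
      (by positivity)
    calc _ = rotForm x ![v 1] ^ 2 * rotForm x ![v 2] ^ 2 := by ring
      _ ≤ _ := this
      _ = _ := by simp only [Matrix.cons_val_zero]; ring
  have h2 : Gam roundArea roundConn rotForm 4 x v = 1 / 4 * ((1 - x.1 2 ^ 2)⁻¹ *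
      (rotForm x ![v 0] * (rotForm x ![v 1] * rotForm x ![v 2]))) := by
    have : (4 : ℝ) - (2 * x.1 2) ^ 2 = 4 * (1 - x.1 2 ^ 2) := by ring
    rw [Gam, gam_rotForm, this, mul_inv]
    ring
  rw [h2, abs_mul, abs_mul, abs_mul, abs_inv, abs_of_nonneg hs, abs_of_pos (by norm_num)]
  -- At a pole the inverse of zero is zero, so the formula for `Γ` takes the value `0` there. This
  -- is already the continuous extension.
  rcases hs.eq_or_lt with h0 | h0
  · rw [← h0, inv_zero, zero_mul, mul_zero]
    positivity
  · refine mul_le_mul_of_nonneg_left ?_ (by norm_num)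
    rw [inv_mul_le_iff₀ h0]
    calc _ ≤ |rotForm x ![v 0]| * ((1 - x.1 2 ^ 2) * (‖incl x (v 1)‖ * ‖incl x (v 2)‖)) :=
          mul_le_mul_of_nonneg_left h1 (abs_nonneg _)
      _ = _ := by ring

lemma isContinuousTensor_Gam_round (t : ℝ) :
    IsContinuousTensor (fun x v => t * Gam roundArea roundConn rotForm 4 x v) where
  multilinear := by
    refine isTensor_of_linear ?_ ?_
    · intro x _ v i a b
      fin_cases i <;> simp [Gam, rotForm, incl_add, det3_add_right] <;> ring
    · intro x _ v i c a
      fin_cases i <;> simp [Gam, rotForm, incl_smul, det3_smul_right] <;> ring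
  continuous := by
    intro X hX
    refine continuous_const.mul (continuous_iff_continuousAt.mpr fun x => ?_)
    by_cases hx : x ∈ poles
    · have h0 : rotForm x ![X 0 x] = 0 := by
        have h1 := rotForm_sq_le x ![X 0 x]
        rw [(mem_poles x).mp hx, sub_self, zero_mul] at h1
        exact pow_eq_zero_iff two_ne_zero |>.mp (le_antisymm h1 (sq_nonneg _))
      have hc : ContinuousAt (fun y : S2 => 1 / 4 * (|rotForm y ![X 0 y]| *
          (‖incl y (X 1 y)‖ * ‖incl y (X 2 y)‖))) x := by
        have hi : ∀ i, ContinuousAt (fun y => incl y (X i y)) x := fun i =>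
          ((hX i).at x).incl.mdiff.continuousAt
        have hZ : ContinuousAt (fun y => rotForm y ![X 0 y]) x :=
          ((smoothMapAt_const e3).det3 (smooth_coe x) ((hX 0).at x).incl).mdiff.continuousAt
        exact continuousAt_const.mul (hZ.abs.mul ((hi 1).norm.mul (hi 2).norm))
      have hv : Gam roundArea roundConn rotForm 4 x (fun i => X i x) = 0 := by
        simp [Gam, h0]
      rw [ContinuousAt, hv]
      rw [ContinuousAt, h0, abs_zero, zero_mul, mul_zero] at hc
      exact squeeze_zero_norm (fun y => abs_Gam_le y _) hc
    · have h1 : x ∈ hatM roundArea roundConn rotForm 4 := by rwa [hatM_round]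
      exact ((isKillingData_round.smooth_Gam.smooth X hX).contMDiffAt
        (isKillingData_round.isOpen.mem_nhds h1)).continuousAt

/-- The relation is asked for `s ≠ 0` only, because an extension of `Γ` is arbitrary at the pole;
continuity of `g` supplies `g 0 = 0`. -/
lemma hasDerivAt_eq_of_eq_mul {g k : ℝ → ℝ} {d : ℝ} (hg : HasDerivAt g d 0)
    (hk : ContinuousAt k 0) (h : ∀ s, s ≠ 0 → g s = s * k s) : d = k 0 := by
  have hk' : Filter.Tendsto k (𝓝[≠] 0) (𝓝 (k 0)) := hk.tendsto.mono_left nhdsWithin_le_nhds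
  have he : ∀ᶠ s in 𝓝[≠] (0 : ℝ), s ≠ 0 := self_mem_nhdsWithin
  have h0 : g 0 = 0 := by
    have h1 : Filter.Tendsto g (𝓝[≠] 0) (𝓝 (0 * k 0)) :=
      ((Filter.tendsto_id.mono_left nhdsWithin_le_nhds).mul hk').congr'
        (he.mono fun s hs => (h s hs).symm)
    rw [zero_mul] at h1
    exact tendsto_nhds_unique (hg.continuousAt.tendsto.mono_left nhdsWithin_le_nhds) h1
  refine tendsto_nhds_unique (hasDerivAt_iff_tendsto_slope.mp hg) (hk'.congr' (he.mono fun s hs => ?_))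
  rw [slope_def_field, h0, h s hs, sub_zero, sub_zero, mul_div_cancel_left₀ _ hs]

/-- On the tangential part of the first basis vector, `Γ` is a cubic over a quadratic form in the
horizontal coordinates. -/
lemma Gam_round_diag (x : S2) (v : TangentSpace (𝓡 2) x) (hv : incl x v = !₂[1, 0, 0] - x.1 0 • x.1) :
    Gam roundArea roundConn rotForm 4 x (fun _ => v) =
      -(4 * (x.1 0 ^ 2 + x.1 1 ^ 2))⁻¹ * x.1 1 ^ 3 := by
  have h : (4 : ℝ) - (2 * x.1 2) ^ 2 = 4 * (x.1 0 ^ 2 + x.1 1 ^ 2) := by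
    linear_combination -4 * coe_sq x
  rw [Gam, gam_rotForm, h, rotForm_apply]
  simp only [Matrix.cons_val_zero, hv]
  simp
  ring

lemma not_tensorDifferentiableAt_round {t : ℝ} (ht : t ≠ 0) {T : Tensor S2 3}
    (hT : ∀ x ∈ polesᶜ, ∀ v, T x v = t * Gam roundArea roundConn rotForm 4 x v) {p : S2}
    (hp : p ∈ poles) : ¬ TensorDifferentiableAt T p := by
  intro hd
  have hp2 := (mem_poles p).mp hp
  have hsq := coe_sq p
  have hp0 : p.1 0 = 0 := by nlinarith
  have hp1 : p.1 1 = 0 := by nlinarith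
  have hpn : (p : Space) ≠ 0 := ne_zero_of_mem_unit_sphere p
  have hX : IsSmoothVField (fun y : S2 => tproj y !₂[1, 0, 0]) := fun y =>
    (smoothMapAt_const (x := y) !₂[1, 0, 0]).tproj.self_of_nhds
  have h1 := hd (fun _ => fun y => tproj y !₂[1, 0, 0]) fun _ => hX
  set f : S2 → ℝ := fun y => T y (fun _ => tproj y !₂[1, 0, 0]) with hf
  have h2 : MDifferentiableAt 𝓘(ℝ, Space) 𝓘(ℝ, ℝ) (f ∘ rad) (p : Space) := by
    refine MDifferentiableAt.comp (I' := 𝓡 2) (p : Space) ?_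
      ((contMDiffAt_rad hpn).mdifferentiableAt (by simp))
    rwa [rad_coe]
  have h3 := h2.differentiableAt.hasFDerivAt
  set L := fderiv ℝ (f ∘ rad) (p : Space)
  -- The directional derivative at the pole is computed along the projection to the sphere of the
  -- line `p + s(a, b, 0)`. It is homogeneous of degree one in `(a, b)`.
  have key : ∀ a b : ℝ, 0 < a ^ 2 + b ^ 2 → L !₂[a, b, 0] = -(t * b ^ 3 / (4 * (a ^ 2 + b ^ 2))) := by
    intro a b hab
    let w : ℝ → Space := fun s => (p : Space) + s • !₂[a, b, 0]
    have hw0 : w 0 = p := by simp [w]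
    have hw : HasDerivAt w !₂[a, b, 0] 0 := by
      have h := ((hasDerivAt_id (0 : ℝ)).smul_const (!₂[a, b, 0] : Space)).const_add (p : Space)
      rwa [one_smul] at h
    have hc0 : ∀ s, w s 0 = s * a := fun s => by simp [w, hp0]
    have hc1 : ∀ s, w s 1 = s * b := fun s => by simp [w, hp1]
    have hc2 : ∀ s, w s 2 = p.1 2 := fun s => by simp [w]
    have hn : ∀ s, ‖w s‖ ^ 2 = s ^ 2 * (a ^ 2 + b ^ 2) + 1 := fun s => by
      rw [← real_inner_self_eq_norm_sq, inner_eq, hc0, hc1, hc2]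
      linear_combination hp2
    have hn0 : ∀ s, ‖w s‖ ≠ 0 := fun s h => by
      have := hn s
      rw [h] at this
      nlinarith [mul_nonneg (sq_nonneg s) hab.le]
    have h4 : HasDerivAt (fun s => f (rad (w s))) (L !₂[a, b, 0]) 0 := by
      rw [← hw0] at h3
      exact h3.comp_hasDerivAt 0 hw
    have h5 := hasDerivAt_eq_of_eq_mul (k := fun s => -(t * b ^ 3 / (4 * (a ^ 2 + b ^ 2))) * ‖w s‖⁻¹) h4
      (continuousAt_const.mul (hw.continuousAt.norm.inv₀ (hn0 0))) fun s hs => by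
        have hy : ∀ i, (rad (w s)).1 i = ‖w s‖⁻¹ * w s i := fun i => by
          rw [coe_rad (norm_ne_zero_iff.mp (hn0 s))]
          rfl
        have hr : rad (w s) ∈ polesᶜ := by
          rw [Set.mem_compl_iff, mem_poles, hy, hc2, mul_pow, hp2, mul_one, inv_pow, hn, inv_eq_one]
          have := mul_pos (pow_pos (abs_pos.mpr hs) 2) hab
          rw [sq_abs] at this
          linarith
        have hm := hab.ne'
        rw [hf]
        simp only
        rw [hT _ hr, Gam_round_diag _ _ ?_, hy, hy, hc0, hc1]
        · have hq : (‖w s‖⁻¹ * (s * a)) ^ 2 + (‖w s‖⁻¹ * (s * b)) ^ 2 =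
              (s / ‖w s‖) ^ 2 * (a ^ 2 + b ^ 2) := by ring
          rw [hq]
          have := hn0 s
          field_simp
        · rw [incl_tproj, inner_eq]
          simp
    rw [h5, hw0, norm_eq_of_mem_sphere, inv_one, mul_one]
  -- The values `0`, `-t/4` and `-t/8` in the directions `(1,0)`, `(0,1)` and `(1,1)` contradict
  -- additivity of `L` unless `t = 0`.
  have e1 := key 1 0 (by norm_num)
  have e2 := key 0 1 (by norm_num)
  have e3 := key 1 1 (by norm_num)
  have e4 : (!₂[1, 1, 0] : Space) = !₂[1, 0, 0] + !₂[0, 1, 0] := by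
    ext i
    fin_cases i <;> simp
  rw [e4, map_add, e1, e2] at e3
  apply ht
  linarith

end

end SympSurface

end

theorem mainTheorem9 :
    -- the general result
    (∀ (M : Type*) [TopologicalSpace M] [T2Space M] [SecondCountableTopology M]
        [PreconnectedSpace M] [ChartedSpace Plane M] [IsManifold (𝓡 2) ∞ M]
        [MeasurableSpace M] [BorelSpace M]
        (Om : Tensor M 2) (D : Conn M) (Z : Tensor M 1),
      IsSymplecticForm Om →
      IsSymplecticConnection Om D Set.univ →
      (∀ x v, covD D (ric D) x v = 0) →
      IsSmoothTensor Set.univ Z →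
      (∀ x v, symmetrize (covD D Z) x v = 0) →
      ∃ nu : ℝ,
        (∀ x, gam Om D Z x ^ 2 + 4 * ric D x ![sharp Om Z x, sharp Om Z x] = nu) ∧
        IsOpen (hatM Om D Z nu) ∧
        IsSmoothTensor (hatM Om D Z nu) (Gam Om D Z nu) ∧
        ∀ t : ℝ,
          IsSymplecticConnection Om (nab Om D Z nu t) (hatM Om D Z nu) ∧
          (∀ x ∈ hatM Om D Z nu,
            (∀ u v, ric (nab Om D Z nu t) x ![u, v] = ric D x ![u, v] +
              t * gam Om D Z x * (nu - gam Om D Z x ^ 2)⁻¹ * Z x ![u] * Z x ![v]) ∧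
            (∀ v, -deltaStar (nab Om D Z nu t) (ric (nab Om D Z nu t)) x v =
                symmetrize (covD (nab Om D Z nu t) (ric (nab Om D Z nu t))) x v ∧
              symmetrize (covD (nab Om D Z nu t) (ric (nab Om D Z nu t))) x v =
                -4 * t * nu * ((nu - gam Om D Z x ^ 2) ^ 2)⁻¹ * cubicZR Om D Z x v) ∧
            (∀ v, rho Om (nab Om D Z nu t) x ![v] =
              1 / 2 * t * (nu - 3 * gam Om D Z x ^ 2) * (nu - gam Om D Z x ^ 2)⁻¹ * Z x ![v]) ∧
            moment Om (nab Om D Z nu t) x = -(3 / 4) * t * gam Om D Z x ∧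
            moment Om (nab Om D Z nu t) x ^ 2 +
                diffl (moment Om (nab Om D Z nu t)) x ![sharp Om (rho Om (nab Om D Z nu t)) x] =
              3 * t ^ 2 / 16 * nu ∧
            (∀ v, hop Om (nab Om D Z nu t) (gam Om D Z) x v = 0)) ∧
          IsCritical Om (nab Om D Z nu t) (hatM Om D Z nu) ∧
          (t ≠ 0 →
            (∃ x ∈ hatM Om D Z nu, ∃ v,
              4 * nu * ((nu - gam Om D Z x ^ 2) ^ 2)⁻¹ * cubicZR Om D Z x v ≠ 0) →
            ¬ IsPreferred (nab Om D Z nu t) (hatM Om D Z nu)) ∧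
          IsJacobi Om (nab Om D Z nu t) (hatM Om D Z nu) (Gam Om D Z nu)) ∧
    -- the round sphere
    IsSymplecticForm roundArea ∧
    IsSmoothTensor Set.univ rotForm ∧
    ∃ D : Conn S2,
      IsSymplecticConnection roundArea D Set.univ ∧
      (∀ x v, covD D roundMetric x v = 0) ∧
      (∀ x v, covD D (ric D) x v = 0) ∧
      (∀ x v, symmetrize (covD D rotForm) x v = 0) ∧
      (∀ x, gam roundArea D rotForm x ^ 2 +
        4 * ric D x ![sharp roundArea rotForm x, sharp roundArea rotForm x] = 4) ∧
      hatM roundArea D rotForm 4 = polesᶜ ∧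
      ∀ t : ℝ, t ≠ 0 →
        IsSymplecticConnection roundArea (nab roundArea D rotForm 4 t) polesᶜ ∧
        IsCritical roundArea (nab roundArea D rotForm 4 t) polesᶜ ∧
        ¬ IsPreferred (nab roundArea D rotForm 4 t) polesᶜ ∧
        (∃ x ∈ polesᶜ, moment roundArea (nab roundArea D rotForm 4 t) x ≠ 0) ∧
        (∃ T : Tensor S2 3, IsContinuousTensor T ∧
          ∀ x ∈ polesᶜ, ∀ v, T x v = t * Gam roundArea D rotForm 4 x v) ∧
        (∀ T : Tensor S2 3, IsTensor Set.univ T →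
          (∀ x ∈ polesᶜ, ∀ v, T x v = t * Gam roundArea D rotForm 4 x v) →
          ∀ p ∈ poles, ¬ TensorDifferentiableAt T p) := by
  constructor
  · intro M _ _ _ _ _ _ _ _ Om D Z hOm hD hpar hZ hK
    obtain ⟨nu, h⟩ := exists_killingData hOm hD hpar hZ hK
    refine ⟨nu, h.nu_eq, h.isOpen, h.smooth_Gam, fun t => ⟨h.symplectic t, fun x hx => ⟨?_, ?_, ?_,
      h.moment_nab t hx, h.tau_nab t hx, ?_⟩, h.isCritical t, h.not_isPreferred t, h.isJacobi t⟩⟩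
    · exact fun u v => h.ric_nab t hx ![u, v]
    · exact fun v => ⟨neg_neg _, h.symm_nab t hx v⟩
    · exact fun v => h.rho_nab t hx v
    · intro v
      simpa only [one_mul] using h.hop_nab t hx 1 v
  · refine ⟨isSymplecticForm_roundArea, isSmoothTensor_rotForm, roundConn,
      isSymplecticConnection_roundConn, covD_roundMetric, isKillingData_round.par,
      symmetrize_covD_rotForm, nuFn_rotForm, hatM_round, fun t ht => ⟨?_, ?_,
        not_isPreferred_round ht, exists_moment_ne_zero_round ht,
        ⟨_, isContinuousTensor_Gam_round t, fun _ _ _ => rfl⟩,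
        fun T _ hT p hp => not_tensorDifferentiableAt_round ht hT hp⟩⟩
    · rw [← hatM_round]
      exact isKillingData_round.symplectic t
    · rw [← hatM_round]
      exact isKillingData_round.isCritical t
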